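/- **Setting.** Let $R=\mathbb Z[X,Y,Z^{\pm1}]/(X^2=Y^2=1)$ and $\lambda((a,b),(c,d))=X^{ac}Y^{bd}Z^{ad-bc}$. Let $B^n$ be the set of crossingless matchings of $2n$ points on a line and $B_m^n$ the set of planar isotopy classes of flat tangles with $2m$ bottom and $2n$ top endpoints; $1_n\in B_n^n$ is the identity tangle. *Grading category.* The objects of $\mathcal G$ are the crossingless matchings of all sizes; for $a\in B^m$, $b\in B^n$ put $\mathrm{Hom}_{\mathcal G}(a,b)=B_m^n\times\mathbb Z^2$. For matchings $a,b,c$ and composable tangles $t,s$, the closed diagram $a\,t\,\bar b\,b\,s\,\bar c$ is turned into $a\,t\,s\,\bar c$ by performing a saddle at each arc of $b$, in order of decreasing right endpoint, all saddles framed by upward arrows; let $s_{abc}(t,s)\in\mathbb Z^2$ be its degree, a saddle merging two circles having degree $(-1,0)$ and a saddle splitting a circle having degree $(0,-1)$. Composition is $(s,q)\circ(t,p)=(s\circ t,\;p+q+s_{abc}(t,s))$ and $\mathrm{Id}_a=(1_n,(n,0))$ for $a\in B^n$. For composable $f=(t_1,p_1):a\to b$, $g=(t_2,p_2):b\to c$,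 $h=(t_3,p_3):c\to d$ put $$\alpha(f,g,h)=\alpha_1\cdot\lambda\bigl(s_{bcd}(t_2,t_3),p_1\bigr),$$ where $\alpha_1\in R^\times$ is the scalar such that, in the diagram $a\,t_1\,\bar b\,b\,t_2\,\bar c\,c\,t_3\,\bar d$, performing first the saddles of $b$ and then those of $c$ equals $\alpha_1$ times performing first those of $c$ and then those of $b$, in the calculus of chronological cobordisms: exchanging two merges gives $X$, two splits $Y$; a split followed by a merge which remains a merge and a split when exchanged equals $Z$ times the merge followed by the split; if both orders are a merge and then a split, the factor is $Y$ when the tails of the two arrows lie on the same circle, and $X$ otherwise; if both orders are a split of one circle and then a merge, the factor is $1$ when the right end of the arc of the first saddle, after that saddle, lies on the same circle as the tail of the arrow of the second saddle, and $XY$ otherwise. Put $\zeta(f)=\alpha(\mathrm{Id}_a,\mathrm{Id}_a,f)\,\alpha(f,\mathrm{Id}_b,\mathrm{Id}_b)$ for $f:a\to b$. *The unified arc algebra.* $H^n=\bigoplus_{a,b\in B^n}\mathcal F(a\bar b)$, where $\mathcal F(a\bar b)$ is the free $R$-module on the labellings of the circles of $a\bar b$ by $v_+$, $v_-$, read as tensors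 with the circles ordered from right to left by their rightmost points; $\deg v_+=(1,0)$, $\deg v_-=(0,-1)$, and a labelling of total degree $p$ has $\mathcal G$-degree $(1_n,p):a\to b$. The product $\mu:\mathcal F(a\bar b)\otimes\mathcal F(b\bar c)\to\mathcal F(a\bar c)$ is induced by the above saddles at the arcs of $b$ (the product $\mathcal F(a\bar b)\otimes\mathcal F(b'\bar c)\to H^n$ is $0$ for $b\ne b'$), where a merge acts by $v_+v_+\mapsto v_+$, $v_+v_-\mapsto v_-$, $v_-v_+\mapsto XZ\,v_-$, $v_-v_-\mapsto0$ (lower circle first) and a split by $v_+\mapsto v_-\otimes v_++YZ\,v_+\otimes v_-$, $v_-\mapsto v_-\otimes v_-$ (left circle first), and tensor factors are exchanged by $v\otimes w\mapsto\lambda(|v|,|w|)\,w\otimes v$. Let $e_a\in\mathcal F(a\bar a)$ be the labelling with all circles $v_+$, and $1=\sum_{a\in B^n}e_a$. The unit of $H^n$ in degree $\mathrm{Id}_X$ is $1_X=e_X$ for $X\in B^n$, and $1_X=0$ for matchings of another size. *Center.* The $\mathcal G$-graded center $Z^{\mathcal G}(H^n)$ is the set of all sums $z$ of elements of degrees $\mathrm{Id}_a$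 such that $\mu(x,z)=\zeta(|x|)\mu(z,x)$ for all homogeneous $x\in H^n$; and $Z^{\mathcal G}_*(H^n)=\{z\in Z^{\mathcal G}(H^n):\mu(z,z')=1\text{ for some }z'\in Z^{\mathcal G}(H^n)\}$. *Complexes.* A $\mathcal G$-graded $(H^n,H^n)$-bimodule is an $R$-module $M=\bigoplus_{g}M_g$, $g$ running through the morphisms of $\mathcal G$, with $R$-bilinear left and right actions of $H^n$ that add degrees by composition, vanish on elements of non-composable degrees, and satisfy, for homogeneous elements, $(xy)m=\alpha(|x|,|y|,|m|)\,x(ym)$, $(mx)y=\alpha(|m|,|x|,|y|)\,m(xy)$, $(xm)y=\alpha(|x|,|m|,|y|)\,x(my)$, $1_Xm=\alpha(\mathrm{Id}_X,\mathrm{Id}_X,|m|)^{-1}m$ and $m1_Y=\alpha(|m|,\mathrm{Id}_Y,\mathrm{Id}_Y)\,m$ for $|m|:X\to Y$. Bounded complexes of such bimodules have grading-preserving differentials $\partial$ of homological degree $-1$; $\mathcal K$ is the category of these complexes with grading-preserving chain maps of bimodules up to chain homotopy. $M\otimes_{H^n}N$ is the quotient of $M\otimes_RN$ by the tensors of elements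 of non-composable degrees and by the elements $mx\otimes p-\alpha(|m|,|x|,|p|)\,m\otimes xp$, with $x(m\otimes p)=\alpha(|x|,|m|,|p|)^{-1}\,xm\otimes p$, $(m\otimes p)x=\alpha(|m|,|p|,|x|)\,m\otimes px$ and $\partial(m\otimes p)=\partial m\otimes p+(-1)^{k}m\otimes\partial p$ for $m$ of homological degree $k$. A complex $M$ is *invertible* if there is a bounded complex $N$ with $N\otimes_{H^n}M\simeq H^n$ and $M\otimes_{H^n}N\simeq H^n$ in $\mathcal K$, where $H^n$ is placed in homological degree $0$. **Statement.** Let $n\ge1$. 1. The map $r\mapsto r\cdot1$ is an isomorphism of $R$ onto $Z^{\mathcal G}(H^n)$, as $R$-modules and compatible with the multiplications; under it, $R^\times$ corresponds to $Z^{\mathcal G}_*(H^n)$. 2. If $M$ is an invertible complex of $\mathcal G$-graded $(H^n,H^n)$-bimodules, then the automorphisms of $M$ in $\mathcal K$ are exactly the classes of $u\cdot\mathrm{Id}_M$ with $u\in R^\times$. 3. If $M$ and $N$ are invertible complexes of $\mathcal G$-graded $(H^n,H^n)$-bimodules (in particular, complexes of geometric bimodules) and $f,g:M\to N$ are isomorphisms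 in $\mathcal K$, then $g=u\cdot f$ in $\mathcal K$ for some $u\in R^\times$. -/

import Mathlib

open scoped TensorProduct

universe u

noncomputable section

namespace UnifiedArc

/-! ### The ground ring `R = ℤ[X, Y, Z^{±1}] / (X² = Y² = 1)` -/

/-- `ℤ[X, Y] / (X² - 1, Y² - 1)`. -/
abbrev BaseRing : Type :=
  MvPolynomial (Fin 2) ℤ ⧸
    Ideal.span {(MvPolynomial.X 0 ^ 2 - 1 : MvPolynomial (Fin 2) ℤ), MvPolynomial.X 1 ^ 2 - 1}

/-- The ring `R = ℤ[X, Y, Z^{±1}] / (X² - 1, Y² - 1)`. -/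
def R : Type := LaurentPolynomial BaseRing

instance : CommRing R := inferInstanceAs (CommRing (LaurentPolynomial BaseRing))

/-- The class of a variable of `ℤ[X, Y]` in `R`. -/
def R.var (k : Fin 2) : R :=
  (LaurentPolynomial.C (Ideal.Quotient.mk _ (MvPolynomial.X k)) : LaurentPolynomial BaseRing)

theorem R.var_mul_self (k : Fin 2) : R.var k * R.var k = 1 := by
  have h : (Ideal.Quotient.mk
      (Ideal.span {(MvPolynomial.X 0 ^ 2 - 1 : MvPolynomial (Fin 2) ℤ), MvPolynomial.X 1 ^ 2 - 1})
      (MvPolynomial.X k) * Ideal.Quotient.mk _ (MvPolynomial.X k) : BaseRing) = 1 := by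
    rw [← map_mul, ← map_one (Ideal.Quotient.mk _), Ideal.Quotient.eq, ← sq]
    apply Ideal.subset_span
    fin_cases k <;> simp
  have h' : (LaurentPolynomial.C (Ideal.Quotient.mk _ (MvPolynomial.X k)) *
      LaurentPolynomial.C (Ideal.Quotient.mk _ (MvPolynomial.X k)) :
      LaurentPolynomial BaseRing) = 1 := by
    rw [← map_mul, h, map_one]
  exact h'

/-- The unit `X` of `R`. -/
def uX : Rˣ := ⟨R.var 0, R.var 0, R.var_mul_self 0, R.var_mul_self 0⟩

/-- The unit `Y` of `R`. -/
def uY : Rˣ := ⟨R.var 1, R.var 1, R.var_mul_self 1, R.var_mul_self 1⟩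

/-- The unit `Z` of `R`. -/
def uZ : Rˣ where
  val := (LaurentPolynomial.T 1 : LaurentPolynomial BaseRing)
  inv := (LaurentPolynomial.T (-1) : LaurentPolynomial BaseRing)
  val_inv := by
    have h : (LaurentPolynomial.T 1 * LaurentPolynomial.T (-1) : LaurentPolynomial BaseRing) = 1 := by
      rw [← LaurentPolynomial.T_add]; simp
    exact h
  inv_val := by
    have h : (LaurentPolynomial.T (-1) * LaurentPolynomial.T 1 : LaurentPolynomial BaseRing) = 1 := by
      rw [← LaurentPolynomial.T_add]; simp
    exact h

/-- `λ((a,b),(c,d)) = X^{ac} Y^{bd} Z^{ad-bc}`. -/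
def lam (p q : ℤ × ℤ) : Rˣ :=
  uX ^ (p.1 * q.1) * uY ^ (p.2 * q.2) * uZ ^ (p.1 * q.2 - p.2 * q.1)

/-! ### Crossingless matchings and flat tangles -/

/-- Crossingless matchings of `2n` points on a line. -/
@[ext]
structure CrossMatch (n : ℕ) where
  mate : Fin (2 * n) → Fin (2 * n)
  mate_mate : ∀ i, mate (mate i) = i
  mate_ne : ∀ i, mate i ≠ i
  noncrossing : ∀ i j, i < j → j < mate i → i < mate j ∧ mate j < mate i

instance (n : ℕ) : Finite (CrossMatch n) :=
  Finite.of_injective CrossMatch.mate fun _ _ h => CrossMatch.ext h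

instance (n : ℕ) : Fintype (CrossMatch n) := Fintype.ofFinite _

/-- The matching as a function on `ℕ`, the identity outside of `{0, …, 2n-1}`. -/
def CrossMatch.mateN {n : ℕ} (a : CrossMatch n) (i : ℕ) : ℕ :=
  if h : i < 2 * n then (a.mate ⟨i, h⟩ : ℕ) else i

/-- The arcs of a matching, each given by its left endpoint, ordered from right to left
(that is, by decreasing right endpoint; an outer arc comes before the arcs inside it). -/
def CrossMatch.arcs {n : ℕ} (b : CrossMatch n) : List (Fin (2 * n)) :=
  ((List.finRange (2 * n)).reverse.filter fun j => b.mate j < j).map b.mate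

/-- Endpoints of a flat tangle: `(false, i)` is the `i`-th point on the bottom line and
`(true, i)` is the `i`-th point on the top line. -/
abbrev Pt : Type := Bool × ℕ

/-- Diagrams of flat tangles with `2m` points at the bottom and `2n` points at the top in general
position with respect to the height function, read from bottom to top: `cup w i` adds on top of `w`
a local minimum that creates the new strands number `i`, `i+1`, and `cap w i` adds a local maximum
that joins the strands number `i`, `i+1` (numbering from `0`, from left to right). -/
inductive Word : ℕ → ℕ → Type
  | nil (n : ℕ) : Word n n
  | cup {m n : ℕ} (w : Word m n) (i : ℕ) (h : i ≤ 2 * n) : Word m (n + 1)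
  | cap {m n : ℕ} (w : Word m (n + 1)) (i : ℕ) (h : i ≤ 2 * n) : Word m n

/-- Planar isotopy (fixing the endpoints) of diagrams: the congruence generated by straightening a
strand and by exchanging the heights of two distant critical points. Closed circles are never
removed and never cross a strand. -/
inductive Isotopic : ∀ {m n : ℕ}, Word m n → Word m n → Prop
  | refl {m n : ℕ} (w : Word m n) : Isotopic w w
  | symm {m n : ℕ} {v w : Word m n} : Isotopic v w → Isotopic w v
  | trans {m n : ℕ} {u v w : Word m n} : Isotopic u v → Isotopic v w → Isotopic u w
  | congr_cup {m n : ℕ} {v w : Word m n} (i : ℕ) (h : i ≤ 2 * n) :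
      Isotopic v w → Isotopic (v.cup i h) (w.cup i h)
  | congr_cap {m n : ℕ} {v w : Word m (n + 1)} (i : ℕ) (h : i ≤ 2 * n) :
      Isotopic v w → Isotopic (v.cap i h) (w.cap i h)
  | zigzag_right {m n : ℕ} (w : Word m n) (i : ℕ) (h : i ≤ 2 * n) (h' : i + 1 ≤ 2 * n) :
      Isotopic ((w.cup i h).cap (i + 1) h') w
  | zigzag_left {m n : ℕ} (w : Word m n) (i : ℕ) (h : i + 1 ≤ 2 * n) (h' : i ≤ 2 * n) :
      Isotopic ((w.cup (i + 1) h).cap i h') w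
  | cup_cup {m n : ℕ} (w : Word m n) (i j : ℕ) (hij : i ≤ j) (h₁ : i ≤ 2 * n)
      (h₂ : j + 2 ≤ 2 * (n + 1)) (h₃ : j ≤ 2 * n) (h₄ : i ≤ 2 * (n + 1)) :
      Isotopic ((w.cup i h₁).cup (j + 2) h₂) ((w.cup j h₃).cup i h₄)
  | cap_cap {m n : ℕ} (w : Word m (n + 2)) (i j : ℕ) (hij : i ≤ j) (h₁ : j + 2 ≤ 2 * (n + 1))
      (h₂ : i ≤ 2 * n) (h₃ : i ≤ 2 * (n + 1)) (h₄ : j ≤ 2 * n) :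
      Isotopic ((w.cap (j + 2) h₁).cap i h₂) ((w.cap i h₃).cap j h₄)
  | cup_cap_right {m n : ℕ} (w : Word m (n + 1)) (i j : ℕ) (hij : i ≤ j) (h₁ : i ≤ 2 * (n + 1))
      (h₂ : j + 2 ≤ 2 * (n + 1)) (h₃ : j ≤ 2 * n) (h₄ : i ≤ 2 * n) :
      Isotopic ((w.cup i h₁).cap (j + 2) h₂) ((w.cap j h₃).cup i h₄)
  | cup_cap_left {m n : ℕ} (w : Word m (n + 1)) (i j : ℕ) (hji : j ≤ i)
      (h₁ : i + 2 ≤ 2 * (n + 1)) (h₂ : j ≤ 2 * (n + 1)) (h₃ : j ≤ 2 * n) (h₄ : i ≤ 2 * n) :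
      Isotopic ((w.cup (i + 2) h₁).cap j h₂) ((w.cap j h₃).cup i h₄)

instance Word.setoid (m n : ℕ) : Setoid (Word m n) :=
  ⟨Isotopic, Isotopic.refl, Isotopic.symm, Isotopic.trans⟩

/-- `B_m^n`: isotopy classes of flat tangles from `2m` points to `2n` points. -/
def Tangle (m n : ℕ) : Type := Quotient (Word.setoid m n)

/-- Stacking: the second diagram on top of the first one. -/
def Word.comp {m n : ℕ} (w : Word m n) : ∀ {p : ℕ}, Word n p → Word m p
  | _, .nil _ => w
  | _, .cup v i h => (w.comp v).cup i h
  | _, .cap v i h => (w.comp v).cap i h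

theorem Word.comp_congr_left {m n p : ℕ} {w w' : Word m n} (h : Isotopic w w') (v : Word n p) :
    Isotopic (w.comp v) (w'.comp v) := by
  induction v with
  | nil => exact h
  | cup v i hi ih => exact .congr_cup i hi ih
  | cap v i hi ih => exact .congr_cap i hi ih

theorem Word.comp_congr_right {m n p : ℕ} (w : Word m n) {v v' : Word n p} (h : Isotopic v v') :
    Isotopic (w.comp v) (w.comp v') := by
  induction h with
  | refl v => exact .refl _
  | symm _ ih => exact .symm ih
  | trans _ _ ih₁ ih₂ => exact .trans ih₁ ih₂
  | congr_cup i h _ ih => exact .congr_cup i h ih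
  | congr_cap i h _ ih => exact .congr_cap i h ih
  | zigzag_right v i h h' => exact .zigzag_right _ i h h'
  | zigzag_left v i h h' => exact .zigzag_left _ i h h'
  | cup_cup v i j hij h₁ h₂ h₃ h₄ => exact .cup_cup _ i j hij h₁ h₂ h₃ h₄
  | cap_cap v i j hij h₁ h₂ h₃ h₄ => exact .cap_cap _ i j hij h₁ h₂ h₃ h₄
  | cup_cap_right v i j hij h₁ h₂ h₃ h₄ => exact .cup_cap_right _ i j hij h₁ h₂ h₃ h₄
  | cup_cap_left v i j hij h₁ h₂ h₃ h₄ => exact .cup_cap_left _ i j hij h₁ h₂ h₃ h₄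

/-- The tangle `1_n` of `2n` vertical strands. -/
def Tangle.one (n : ℕ) : Tangle n n := Quotient.mk _ (.nil n)

/-- Stacking `t` below `s`. -/
def Tangle.comp {m n p : ℕ} (t : Tangle m n) (s : Tangle n p) : Tangle m p :=
  Quotient.map₂ (fun w v => w.comp v)
    (fun _ w' h v _ h' =>
      (Isotopic.trans (Word.comp_congr_left h v) (Word.comp_congr_right w' h') : Isotopic _ _))
    t s

/-- `p` is one of the two points created by a cup inserted at `i`. -/
def IsNew (i : ℕ) (p : Pt) : Prop := p.1 = true ∧ (p.2 = i ∨ p.2 = i + 1)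

/-- The position of an old point before the insertion of a cup at `i`. -/
def beforeCup (i : ℕ) (p : Pt) : Pt := (p.1, if p.1 = true ∧ i ≤ p.2 then p.2 - 2 else p.2)

/-- The position of a point before the insertion of a cap at `i`. -/
def beforeCap (i : ℕ) (p : Pt) : Pt := (p.1, if p.1 = true ∧ i ≤ p.2 then p.2 + 2 else p.2)

/-- How a cup at `i` changes the relation of lying on the same component. -/
def cupRel (i : ℕ) (r : Pt → Pt → Prop) (p q : Pt) : Prop :=
  (IsNew i p ∧ IsNew i q) ∨ (¬IsNew i p ∧ ¬IsNew i q ∧ r (beforeCup i p) (beforeCup i q))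

/-- How a cap at `i` changes the relation of lying on the same component. -/
def capRel (i : ℕ) (r : Pt → Pt → Prop) (p q : Pt) : Prop :=
  r (beforeCap i p) (beforeCap i q) ∨
  (r (beforeCap i p) (true, i) ∧ r (true, i + 1) (beforeCap i q)) ∨
  (r (beforeCap i p) (true, i + 1) ∧ r (true, i) (beforeCap i q))

theorem exists_eq_of_equivalence {r : Pt → Pt → Prop} (h : Equivalence r) :
    ∃ (α : Type) (f : Pt → α), r = fun p q => f p = f q :=
  ⟨Quotient ⟨r, h⟩, Quotient.mk _, by ext p q; exact (Quotient.eq (r := ⟨r, h⟩)).symm⟩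

theorem cupRel_equivalence (i : ℕ) {r : Pt → Pt → Prop} (h : Equivalence r) :
    Equivalence (cupRel i r) := by
  obtain ⟨α, f, rfl⟩ := exists_eq_of_equivalence h
  constructor <;> intros <;> simp only [cupRel] at * <;> grind

theorem capRel_equivalence (i : ℕ) {r : Pt → Pt → Prop} (h : Equivalence r) :
    Equivalence (capRel i r) := by
  obtain ⟨α, f, rfl⟩ := exists_eq_of_equivalence h
  constructor <;> intros <;> simp only [capRel] at * <;> grind

theorem capRel_cupRel_right (i : ℕ) {r : Pt → Pt → Prop} (h : Equivalence r) :
    capRel (i + 1) (cupRel i r) = r := by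
  obtain ⟨α, f, rfl⟩ := exists_eq_of_equivalence h
  have e (p : Pt) : IsNew i (beforeCap (i + 1) p) ↔ p = (true, i) := by
    obtain ⟨x, k⟩ := p; cases x <;> simp [IsNew, beforeCap]; grind
  have e' (p : Pt) (hp : p ≠ (true, i)) : beforeCup i (beforeCap (i + 1) p) = p := by
    obtain ⟨x, k⟩ := p; cases x <;> simp [beforeCup, beforeCap] at hp ⊢; grind
  have e1 : IsNew i (true, i + 1) := by simp [IsNew]
  have e2 : ¬ IsNew i (true, i + 2) := by simp [IsNew]
  have e3 : beforeCup i (true, i + 2) = (true, i) := by simp [beforeCup]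
  ext p q
  have := e' p; have := e' q
  simp only [capRel, cupRel, e, add_assoc, Nat.reduceAdd, e1, e2, e3]
  grind

theorem capRel_cupRel_left (i : ℕ) {r : Pt → Pt → Prop} (h : Equivalence r) :
    capRel i (cupRel (i + 1) r) = r := by
  obtain ⟨α, f, rfl⟩ := exists_eq_of_equivalence h
  have e (p : Pt) : IsNew (i + 1) (beforeCap i p) ↔ p = (true, i) := by
    obtain ⟨x, k⟩ := p; cases x <;> simp [IsNew, beforeCap]; grind
  have e' (p : Pt) (hp : p ≠ (true, i)) : beforeCup (i + 1) (beforeCap i p) = p := by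
    obtain ⟨x, k⟩ := p; cases x <;> simp [beforeCup, beforeCap] at hp ⊢; grind
  have e1 : IsNew (i + 1) (true, i + 1) := by simp [IsNew]
  have e2 : ¬ IsNew (i + 1) (true, i) := by simp [IsNew]; omega
  have e3 : beforeCup (i + 1) (true, i) = (true, i) := by simp [beforeCup]
  ext p q
  have := e' p; have := e' q
  simp only [capRel, cupRel, e, e1, e2, e3]
  grind

theorem cupRel_cupRel {i j : ℕ} (hij : i ≤ j) (r : Pt → Pt → Prop) :
    cupRel (j + 2) (cupRel i r) = cupRel i (cupRel j r) := by
  have e (p : Pt) : IsNew i p → ¬ IsNew (j + 2) p := by simp only [IsNew]; omega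
  have e1 (p : Pt) (hp : ¬ IsNew (j + 2) p) : IsNew i (beforeCup (j + 2) p) ↔ IsNew i p := by
    simp only [IsNew, beforeCup] at *; grind
  have e2 (p : Pt) (hp : ¬ IsNew i p) : IsNew j (beforeCup i p) ↔ IsNew (j + 2) p := by
    simp only [IsNew, beforeCup] at *; grind
  have e3 (p : Pt) (hp : ¬ IsNew i p) (hq : ¬ IsNew (j + 2) p) :
      beforeCup i (beforeCup (j + 2) p) = beforeCup j (beforeCup i p) := by
    simp only [IsNew, beforeCup] at *; grind
  ext p q
  have := e p; have := e q; have := e1 p; have := e1 q; have := e2 p; have := e2 q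
  have := e3 p; have := e3 q
  simp only [cupRel]
  grind

theorem capRel_capRel {i j : ℕ} (hij : i ≤ j) {r : Pt → Pt → Prop} (h : Equivalence r) :
    capRel i (capRel (j + 2) r) = capRel j (capRel i r) := by
  obtain ⟨α, f, rfl⟩ := exists_eq_of_equivalence h
  have e (p : Pt) : beforeCap (j + 2) (beforeCap i p) = beforeCap i (beforeCap j p) := by
    simp only [beforeCap]; grind
  have e3 : beforeCap (j + 2) (true, i) = (true, i) := by simp [beforeCap]; omega
  have e4 : beforeCap (j + 2) (true, i + 1) = (true, i + 1) := by simp [beforeCap]; omega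
  have e5 : beforeCap i (true, j) = (true, j + 2) := by simp [beforeCap, hij]
  have e6 : beforeCap i (true, j + 1) = (true, j + 3) := by simp [beforeCap]; omega
  ext p q
  simp only [capRel, e, e3, e4, e5, e6]
  grind

theorem capRel_cupRel_of_le {i j : ℕ} (hij : i ≤ j) {r : Pt → Pt → Prop} :
    capRel (j + 2) (cupRel i r) = cupRel i (capRel j r) := by
  have e (p : Pt) : IsNew i (beforeCap (j + 2) p) ↔ IsNew i p := by
    simp only [IsNew, beforeCap] at *; grind
  have e1 (p : Pt) (hp : ¬ IsNew i p) :
      beforeCup i (beforeCap (j + 2) p) = beforeCap j (beforeCup i p) := by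
    simp only [IsNew, beforeCup, beforeCap] at *; grind
  have e2 : ¬ IsNew i (true, j + 2) := by simp [IsNew]; omega
  have e3 : ¬ IsNew i (true, j + 3) := by simp [IsNew]; omega
  have e4 : beforeCup i (true, j + 2) = (true, j) := by simp [beforeCup]; omega
  have e5 : beforeCup i (true, j + 3) = (true, j + 1) := by simp [beforeCup]; omega
  ext p q
  have := e1 p; have := e1 q
  simp only [capRel, cupRel, e, add_assoc, Nat.reduceAdd, e2, e3, e4, e5]
  grind

theorem capRel_cupRel_of_ge {i j : ℕ} (hij : i ≤ j) {r : Pt → Pt → Prop} :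
    capRel i (cupRel (j + 2) r) = cupRel j (capRel i r) := by
  have e (p : Pt) : IsNew (j + 2) (beforeCap i p) ↔ IsNew j p := by
    simp only [IsNew, beforeCap] at *; grind
  have e1 (p : Pt) (hp : ¬ IsNew j p) :
      beforeCup (j + 2) (beforeCap i p) = beforeCap i (beforeCup j p) := by
    simp only [IsNew, beforeCup, beforeCap] at *; grind
  have e2 : ¬ IsNew (j + 2) (true, i) := by simp [IsNew]; omega
  have e3 : ¬ IsNew (j + 2) (true, i + 1) := by simp [IsNew]; omega
  have e4 : beforeCup (j + 2) (true, i) = (true, i) := by simp [beforeCup]; omega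
  have e5 : beforeCup (j + 2) (true, i + 1) = (true, i + 1) := by simp [beforeCup]; omega
  ext p q
  have := e1 p; have := e1 q
  simp only [capRel, cupRel, e, e2, e3, e4, e5]
  grind

/-- `w.Joined p q` says that the endpoints `p` and `q` lie on the same component of the tangle.
(For convenience there are further vertical strands to the right of the diagram, which never
interact with it.) -/
def Word.Joined : ∀ {m n : ℕ}, Word m n → Pt → Pt → Prop
  | _, _, .nil _ => fun p q => p.2 = q.2
  | _, _, .cup w i _ => cupRel i w.Joined
  | _, _, .cap w i _ => capRel i w.Joined

theorem Word.joined_equivalence {m n : ℕ} (w : Word m n) : Equivalence w.Joined := by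
  induction w with
  | nil =>
    simp only [Word.Joined]
    exact ⟨fun _ => rfl, fun h => h.symm, fun h h' => h.trans h'⟩
  | cup w i h ih =>
    simp only [Word.Joined]; exact cupRel_equivalence i ih
  | cap w i h ih =>
    simp only [Word.Joined]; exact capRel_equivalence i ih

theorem Isotopic.joined_eq {m n : ℕ} {v w : Word m n} (h : Isotopic v w) :
    v.Joined = w.Joined := by
  induction h with
  | refl v => rfl
  | symm _ ih => exact ih.symm
  | trans _ _ ih₁ ih₂ => exact ih₁.trans ih₂
  | congr_cup i h _ ih => simp only [Word.Joined, ih]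
  | congr_cap i h _ ih => simp only [Word.Joined, ih]
  | zigzag_right v i h h' =>
    simp only [Word.Joined]; exact capRel_cupRel_right i v.joined_equivalence
  | zigzag_left v i h h' =>
    simp only [Word.Joined]; exact capRel_cupRel_left i v.joined_equivalence
  | cup_cup v i j hij h₁ h₂ h₃ h₄ =>
    simp only [Word.Joined]; exact cupRel_cupRel hij _
  | cap_cap v i j hij h₁ h₂ h₃ h₄ =>
    simp only [Word.Joined]; exact capRel_capRel hij v.joined_equivalence
  | cup_cap_right v i j hij h₁ h₂ h₃ h₄ =>
    simp only [Word.Joined]; exact capRel_cupRel_of_le hij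
  | cup_cap_left v i j hij h₁ h₂ h₃ h₄ =>
    simp only [Word.Joined]; exact capRel_cupRel_of_ge hij

/-- Two endpoints lie on the same component of the flat tangle. -/
def Tangle.Joined {m n : ℕ} (t : Tangle m n) : Pt → Pt → Prop :=
  Quotient.lift Word.Joined (fun _ _ h => Isotopic.joined_eq h) t

/-! ### The grading category -/

/-- Objects: crossingless matchings of any size. -/
abbrev Obj : Type := Σ n : ℕ, CrossMatch n

/-- Morphisms: flat tangles together with a bidegree. -/
abbrev Hom (a b : Obj) : Type := Tangle a.1 b.1 × (ℤ × ℤ)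

/-- A planar diagram in horizontal strips. Strip number `k` is bounded by line `k - 1` from below and
by line `k` from above; its content is a flat tangle, of which we record which endpoints lie on the
same component. Below strip `0` there are the arcs `base`; on line `k` there are the arcs
`line k`, once reflected downwards (closing strip `k` from above) and once upwards (closing
strip `k + 1` from below). -/
structure Diagram where
  base : ℕ → ℕ
  strip : ℕ → Pt → Pt → Prop
  line : ℕ → ℕ → ℕ

/-- Endpoint `p` of the tangle in strip `k`. -/
abbrev Node : Type := ℕ × Pt

/-- A saddle: the line it lies on, and the left endpoint of the arc along which it is performed. -/
abbrev Saddle : Type := ℕ × ℕ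

/-- The elementary connections in the diagram after the saddles in `S` have been performed; a saddle
replaces the two mirror images of an arc by two vertical strands. -/
inductive Diagram.Adj (D : Diagram) (S : Set Saddle) : Node → Node → Prop
  | strand (k : ℕ) (p q : Pt) : D.strip k p q → D.Adj S (k, p) (k, q)
  | base (i : ℕ) : D.Adj S (0, false, i) (0, false, D.base i)
  | cap (k i : ℕ) : (k, min i (D.line k i)) ∉ S → D.Adj S (k, true, i) (k, true, D.line k i)
  | cup (k i : ℕ) : (k, min i (D.line k i)) ∉ S →
      D.Adj S (k + 1, false, i) (k + 1, false, D.line k i)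
  | vert (k i : ℕ) : (k, min i (D.line k i)) ∈ S → D.Adj S (k, true, i) (k + 1, false, i)

/-- Two nodes lie on the same circle after the saddles in `S`. -/
def Diagram.Conn (D : Diagram) (S : Set Saddle) : Node → Node → Prop :=
  Relation.EqvGen (D.Adj S)

/-- The saddle `x`, performed after the saddles in `S`, joins two circles (otherwise it splits a
circle). -/
def Diagram.IsMerge (D : Diagram) (S : Set Saddle) (x : Saddle) : Prop :=
  ¬ D.Conn S (x.1, true, x.2) (x.1 + 1, false, x.2)

open Classical in
/-- The degree of a saddle: `(-1, 0)` for a merge and `(0, -1)` for a split. -/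
def Diagram.saddleDeg (D : Diagram) (S : Set Saddle) (x : Saddle) : ℤ × ℤ :=
  if D.IsMerge S x then (-1, 0) else (0, -1)

/-- The degree of a sequence of saddles. -/
def Diagram.deg (D : Diagram) : Set Saddle → List Saddle → ℤ × ℤ
  | _, [] => 0
  | S, x :: xs => D.saddleDeg S x + D.deg (insert x S) xs

open Classical in
/-- The unit `u` such that performing `x` and then `y` is `u` times performing `y` and then `x`,
all saddles being framed by upward arrows.
* two merges: `X`; two splits: `Y`;
* a split and a merge on disjoint or singly connected parts: `Z^{±1}`;
* two merges becoming a merge followed by a split of the same two circles (both orders): `X` or `Y`,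
  depending on whether the two arrows point in opposite or in the same direction with
  respect to the two circles;
* one circle split and merged again (both orders): `1` or `XY`, depending on the arrows. -/
def Diagram.swap (D : Diagram) (S : Set Saddle) (x y : Saddle) : Rˣ :=
  if D.IsMerge S x then
    if D.IsMerge (insert x S) y then uX
    else if ¬ D.IsMerge S y then uZ⁻¹
    else if D.Conn S (x.1, true, x.2) (y.1, true, y.2) then uY else uX
  else
    if ¬ D.IsMerge (insert x S) y then uY
    else if D.IsMerge S y then uZ
    else if D.Conn (insert x S) (x.1, true, D.line x.1 x.2) (y.1, true, y.2) then 1 else uX * uY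

/-- The unit for moving the saddle `x` past the saddles in a list. -/
def Diagram.pass (D : Diagram) : Set Saddle → Saddle → List Saddle → Rˣ
  | _, _, [] => 1
  | S, x, y :: ys => D.swap S x y * D.pass (insert y S) x ys

/-- The unit `u` such that performing the saddles `xs` and then `ys` is `u` times performing `ys` and
then `xs`. -/
def Diagram.passAll (D : Diagram) : Set Saddle → List Saddle → List Saddle → Rˣ
  | _, [], _ => 1
  | S, x :: xs, ys => D.passAll (insert x S) xs ys * D.pass S x ys

/-- The saddles contracting all arcs of `b` on line `k`, from right to left. -/
def saddles {n : ℕ} (k : ℕ) (b : CrossMatch n) : List Saddle :=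
  b.arcs.map fun i => (k, (i : ℕ))

/-- The closed diagram `a t b̄ b s c̄`. -/
def diag₂ {k l m : ℕ} (a : CrossMatch k) (b : CrossMatch l) (c : CrossMatch m)
    (t : Tangle k l) (s : Tangle l m) : Diagram where
  base := a.mateN
  strip
    | 0 => t.Joined
    | 1 => s.Joined
    | _ => fun _ _ => False
  line
    | 0 => b.mateN
    | 1 => c.mateN
    | _ => id

/-- The closed diagram `a t₁ b̄ b t₂ c̄ c t₃ d̄`. -/
def diag₃ {k l m p : ℕ} (a : CrossMatch k) (b : CrossMatch l) (c : CrossMatch m) (d : CrossMatch p)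
    (t₁ : Tangle k l) (t₂ : Tangle l m) (t₃ : Tangle m p) : Diagram where
  base := a.mateN
  strip
    | 0 => t₁.Joined
    | 1 => t₂.Joined
    | 2 => t₃.Joined
    | _ => fun _ _ => False
  line
    | 0 => b.mateN
    | 1 => c.mateN
    | 2 => d.mateN
    | _ => id

/-- The degree of the canonical cobordism from `a t b̄ b s c̄` to `a t s c̄`. -/
def cobDeg {k l m : ℕ} (a : CrossMatch k) (b : CrossMatch l) (c : CrossMatch m)
    (t : Tangle k l) (s : Tangle l m) : ℤ × ℤ :=
  (diag₂ a b c t s).deg ∅ (saddles 0 b)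

/-- The identity morphism `(1_n, (n, 0))`. -/
def Hom.id (a : Obj) : Hom a a := (Tangle.one a.1, ((a.1 : ℤ), 0))

/-- Composition in diagrammatic order: `f.comp g` is `g ∘ f`. -/
def Hom.comp {a b c : Obj} (f : Hom a b) (g : Hom b c) : Hom a c :=
  (f.1.comp g.1, f.2 + g.2 + cobDeg a.2 b.2 c.2 f.1 g.1)

/-- The associator `α(f, g, h)` of three composable morphisms `a → b → c → d`. -/
def assoc {a b c d : Obj} (f : Hom a b) (g : Hom b c) (h : Hom c d) : Rˣ :=
  (diag₃ a.2 b.2 c.2 d.2 f.1 g.1 h.1).passAll ∅ (saddles 0 b.2) (saddles 1 c.2) *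
    lam (cobDeg b.2 c.2 d.2 g.1 h.1) f.2

/-- The typical left unitor `α(Id, Id, f)⁻¹`. -/
def leftUnitor {a b : Obj} (f : Hom a b) : Rˣ := (assoc (Hom.id a) (Hom.id a) f)⁻¹

/-- The typical right unitor `α(f, Id, Id)`. -/
def rightUnitor {a b : Obj} (f : Hom a b) : Rˣ := assoc f (Hom.id b) (Hom.id b)

/-- `ζ(f) = α(Id, Id, f) α(f, Id, Id)`. -/
def zeta {a b : Obj} (f : Hom a b) : Rˣ :=
  assoc (Hom.id a) (Hom.id a) f * assoc f (Hom.id b) (Hom.id b)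

/-- All morphisms of the grading category. -/
abbrev Grade : Type := Σ a b : Obj, Hom a b

/-- A morphism of the grading category as an element of `Grade`. -/
abbrev Hom.grade {a b : Obj} (f : Hom a b) : Grade := ⟨a, b, f⟩

/-! ### The unified arc algebra -/

/-- The degree of a label: `(1, 0)` for `v₊` (that is, `true`) and `(0, -1)` for `v₋` (`false`). -/
def labelDeg (x : Bool) : ℤ × ℤ := if x then (1, 0) else (0, -1)

/-- Labellings of the circles of the diagram `a b̄` by `v₊`, `v₋`, as functions on the vertices. They
stand for the tensor product of the labels, where the circles are ordered from right to left by
their rightmost vertices. -/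
def Labeling {n : ℕ} (a b : CrossMatch n) : Type :=
  {ε : Fin (2 * n) → Bool // ∀ i, ε (a.mate i) = ε i ∧ ε (b.mate i) = ε i}

instance {n : ℕ} (a b : CrossMatch n) : Finite (Labeling a b) := Subtype.finite

instance {n : ℕ} (a b : CrossMatch n) : Fintype (Labeling a b) := Fintype.ofFinite _

/-- Two vertices lie on the same circle of `a b̄`. -/
def SameCircle {n : ℕ} (a b : CrossMatch n) : Fin (2 * n) → Fin (2 * n) → Prop :=
  Relation.EqvGen fun i j => j = a.mate i ∨ j = b.mate i

open Classical in
/-- The degree of a labelling: the sum over all circles (represented by their rightmost vertices) of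
the degrees of the labels. -/
def Labeling.deg {n : ℕ} {a b : CrossMatch n} (ε : Labeling a b) : ℤ × ℤ :=
  ∑ i ∈ Finset.univ.filter (fun i => ∀ j, SameCircle a b i j → j ≤ i), labelDeg (ε.1 i)

/-- The basis of `H^n = ⨁_{a, b} F(a b̄)`. -/
abbrev ArcBasis (n : ℕ) : Type := Σ a b : CrossMatch n, Labeling a b

/-- The `R`-module `H^n`. -/
abbrev Arc (n : ℕ) : Type := ArcBasis n →₀ R

/-- The degree `(1_n, p)` of a basis element. -/
def ArcBasis.grade {n : ℕ} (x : ArcBasis n) : Grade :=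
  ⟨⟨n, x.1⟩, ⟨n, x.2.1⟩, (Tangle.one n, x.2.2.deg)⟩

/-- The homogeneous component of `H^n` of degree `g`. -/
def arcGr {n : ℕ} (g : Grade) : Submodule R (Arc n) :=
  Finsupp.supported R R {x | x.grade = g}

/-- The vertices of the diagram `a b̄ b c̄`: `(false, i)` is the `i`-th vertex of the lower
part `a b̄`, and `(true, i)` that of the upper part `b c̄`. -/
abbrev Vert (n : ℕ) : Type := Bool × Fin (2 * n)

/-- A vertex as a node of the diagram. -/
def Vert.node {n : ℕ} (v : Vert n) : Node := (if v.1 then 1 else 0, false, (v.2 : ℕ))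

/-- The position of a vertex: first the lower part, then the upper part, each from right to left. -/
def Vert.pos {n : ℕ} (v : Vert n) : ℕ := (if v.1 then 2 * n else 0) + (2 * n - 1 - v.2)

namespace Contraction

/-! In this section `D` is the diagram `a b̄ b c̄`, `S` is the set of the arcs of `b` which have been
contracted, and `ε` is a labelling of the circles, which stands for the tensor product of the labels,
with the circles ordered by the positions of their first vertices. -/

variable {n : ℕ} (D : Diagram) (S : Set Saddle)

/-- Two vertices lie on the same circle. -/
def Same (v w : Vert n) : Prop := D.Conn S v.node w.node

/-- `w` is the first vertex of its circle, and this circle comes before the circle of `v`. -/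
def FirstBefore (w v : Vert n) : Prop :=
  (∀ u, Same D S w u → w.pos ≤ u.pos) ∧ ∀ u, Same D S v u → w.pos < u.pos

open Classical in
/-- The scalar for moving the circle of `v` to the front. -/
def front (ε : Vert n → Bool) (v : Vert n) : Rˣ :=
  ∏ u ∈ Finset.univ.filter (fun u => FirstBefore D S u v), lam (labelDeg (ε u)) (labelDeg (ε v))

open Classical in
/-- The scalar for moving the circle of `v` to the first and that of `w` to the second position: first
`w` is moved to the front, then `v` is moved past `w` and past the other circles before `v`. -/
def front₂ (ε : Vert n → Bool) (v w : Vert n) : Rˣ :=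
  front D S ε w * lam (labelDeg (ε w)) (labelDeg (ε v)) *
    ∏ u ∈ Finset.univ.filter (fun u => FirstBefore D S u v ∧ ¬ Same D S u w),
      lam (labelDeg (ε u)) (labelDeg (ε v))

open Classical in
/-- The labelling with `p` on the circle of `v`, `q` on the circle of `w`, and `ε` elsewhere. -/
def put (ε : Vert n → Bool) (v w : Vert n) (p q : Bool) : Vert n → Bool := fun u =>
  if Same D S u v then p else if Same D S u w then q else ε u

open Classical in
/-- The map of the saddle along the arc from `i` (left) to `j` (right), framed by the upward arrow.

A merge of the lower circle `l` and the upper circle `u` is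
`v₊ v₊ ↦ v₊`, `v₊ v₋ ↦ v₋`, `v₋ v₊ ↦ XZ v₋`, `v₋ v₋ ↦ 0`, with the lower circle as the first factor.

A split is `v₊ ↦ v₋ ⊗ v₊ + YZ v₊ ⊗ v₋`, `v₋ ↦ v₋ ⊗ v₋`, with the left circle as the first factor. -/
def saddleBasis (i j : Fin (2 * n)) (ε : Vert n → Bool) : (Vert n → Bool) →₀ R :=
  let S' : Set Saddle := insert (0, (i : ℕ)) S
  let l : Vert n := (false, i)
  if D.IsMerge S (0, (i : ℕ)) then
    let u : Vert n := (true, i)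
    if ε l = false ∧ ε u = false then 0
    else
      let ε' := put D S' ε l l (ε l && ε u) (ε l && ε u)
      Finsupp.single ε' ((front₂ D S ε l u * (if ε l then 1 else uX * uZ) *
        (front D S' ε' l)⁻¹ : Rˣ) : R)
  else
    let r : Vert n := (false, j)
    let term (p q : Bool) (c : Rˣ) : (Vert n → Bool) →₀ R :=
      Finsupp.single (put D S' ε l r p q)
        ((front D S ε l * c * (front₂ D S' (put D S' ε l r p q) l r)⁻¹ : Rˣ) : R)
    if ε l then term false true 1 + term true false (uY * uZ) else term false false 1

/-- Contract the arcs of a list, one after the other. -/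
def contract (b : CrossMatch n) :
    Set Saddle → List (Fin (2 * n)) → ((Vert n → Bool) →₀ R) →ₗ[R] ((Vert n → Bool) →₀ R)
  | _, [] => LinearMap.id
  | S, i :: is =>
      contract b (insert (0, (i : ℕ)) S) is ∘ₗ
        Finsupp.linearCombination R (saddleBasis D S i (b.mate i))

end Contraction

open Classical in
/-- The product of basis elements of `F(a b̄)` and `F(b' c̄)`: it is zero unless `b = b'`, and otherwise
it is given by contracting the arcs of `b`. -/
def mulBasis {n : ℕ} (x y : ArcBasis n) : Arc n :=
  if x.2.1 = y.1 then
    let t := Contraction.contract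
      (diag₂ x.1 x.2.1 y.2.1 (Tangle.one n) (Tangle.one n)) x.2.1 ∅ x.2.1.arcs
      (Finsupp.single (fun v => if v.1 then y.2.2.1 v.2 else x.2.2.1 v.2) 1)
    ∑ z : Labeling x.1 y.2.1, Finsupp.single ⟨x.1, y.2.1, z⟩ (t fun v => z.1 v.2)
  else 0

/-- The multiplication of `H^n`. -/
def mul {n : ℕ} : Arc n →ₗ[R] Arc n →ₗ[R] Arc n :=
  Finsupp.linearCombination R fun x => Finsupp.linearCombination R fun y => mulBasis x y

/-- The element `e_a` of `F(a ā)`, all circles labelled `v₊`. -/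
def idem {n : ℕ} (a : CrossMatch n) : Arc n :=
  Finsupp.single ⟨a, a, ⟨fun _ => true, fun _ => ⟨rfl, rfl⟩⟩⟩ 1

open Classical in
/-- The unit of `H^n` in degree `Id_a`, for every object `a` of the grading category (it is zero if `a`
is not a matching of `2n` points). -/
def unit (n : ℕ) (a : Obj) : Arc n :=
  if h : a.1 = n then idem (h ▸ a.2) else 0

/-- The unit `1 = ∑ e_a` of `H^n`. -/
def one (n : ℕ) : Arc n := ∑ a : CrossMatch n, idem a

/-- The graded center of `H^n`. -/
def center (n : ℕ) : Submodule R (Arc n) where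
  carrier := {z | z ∈ ⨆ a : Obj, arcGr (Hom.id a).grade ∧
    ∀ (a b : Obj) (f : Hom a b), ∀ x ∈ arcGr (n := n) f.grade,
      mul x z = (zeta f : R) • mul z x}
  zero_mem' := ⟨Submodule.zero_mem _, fun a b f x _ => by simp⟩
  add_mem' := fun hz hw => ⟨Submodule.add_mem _ hz.1 hw.1, fun a b f x hx => by
    simp only [map_add, LinearMap.add_apply, smul_add, hz.2 a b f x hx, hw.2 a b f x hx]⟩
  smul_mem' := fun r z hz => ⟨Submodule.smul_mem _ r hz.1, fun a b f x hx => by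
    simp only [map_smul, LinearMap.smul_apply, hz.2 a b f x hx, smul_comm r]⟩

/-- The invertible elements of the graded center. -/
def centerUnits (n : ℕ) : Set (Arc n) :=
  {z | z ∈ center n ∧ ∃ w ∈ center n, mul z w = one n}

/-! ### Complexes of graded bimodules -/

/-- The data of a complex of graded `(H^n, H^n)`-bimodules: a module with homogeneous components
`gr k g` (`k` is the homological degree and `g` a morphism of the grading category), a left and
a right action of `H^n`, and a differential. The axioms are collected in `IsComplex`. -/
structure PreComplex (n : ℕ) where
  carrier : Type u
  [addCommGroup : AddCommGroup carrier]
  [module : Module R carrier]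
  gr : ℤ → Grade → Submodule R carrier
  lact : Arc n →ₗ[R] carrier →ₗ[R] carrier
  ract : carrier →ₗ[R] Arc n →ₗ[R] carrier
  d : carrier →ₗ[R] carrier

attribute [instance] PreComplex.addCommGroup PreComplex.module

universe v w

variable {n : ℕ}

open Classical in
/-- `M` is a bounded complex of graded `(H^n, H^n)`-bimodules with grading-preserving differential. -/
structure IsComplex (M : PreComplex.{u} n) : Prop where
  internal : DirectSum.IsInternal fun k : ℤ × Grade => M.gr k.1 k.2
  bounded : ∃ K : ℤ, ∀ k g, M.gr k g ≠ ⊥ → |k| ≤ K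
  lact_mem : ∀ {k : ℤ} {a b c : Obj} {f : Hom a b} {g : Hom b c} {x m},
    x ∈ arcGr f.grade → m ∈ M.gr k g.grade → M.lact x m ∈ M.gr k (f.comp g).grade
  ract_mem : ∀ {k : ℤ} {a b c : Obj} {f : Hom a b} {g : Hom b c} {m x},
    m ∈ M.gr k f.grade → x ∈ arcGr g.grade → M.ract m x ∈ M.gr k (f.comp g).grade
  lact_eq_zero : ∀ {k : ℤ} {a b b' c : Obj} {f : Hom a b} {g : Hom b' c} {x m},
    b ≠ b' → x ∈ arcGr f.grade → m ∈ M.gr k g.grade → M.lact x m = 0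
  ract_eq_zero : ∀ {k : ℤ} {a b b' c : Obj} {f : Hom a b} {g : Hom b' c} {m x},
    b ≠ b' → m ∈ M.gr k f.grade → x ∈ arcGr g.grade → M.ract m x = 0
  lact_lact : ∀ {k : ℤ} {a b c d : Obj} {f : Hom a b} {g : Hom b c} {h : Hom c d} {x y m},
    x ∈ arcGr f.grade → y ∈ arcGr g.grade → m ∈ M.gr k h.grade →
      M.lact (mul x y) m = (assoc f g h : R) • M.lact x (M.lact y m)
  ract_ract : ∀ {k : ℤ} {a b c d : Obj} {f : Hom a b} {g : Hom b c} {h : Hom c d} {m x y},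
    m ∈ M.gr k f.grade → x ∈ arcGr g.grade → y ∈ arcGr h.grade →
      M.ract (M.ract m x) y = (assoc f g h : R) • M.ract m (mul x y)
  ract_lact : ∀ {k : ℤ} {a b c d : Obj} {f : Hom a b} {g : Hom b c} {h : Hom c d} {x m y},
    x ∈ arcGr f.grade → m ∈ M.gr k g.grade → y ∈ arcGr h.grade →
      M.ract (M.lact x m) y = (assoc f g h : R) • M.lact x (M.ract m y)
  unit_lact : ∀ {k : ℤ} {a b : Obj} {f : Hom a b} {m},
    m ∈ M.gr k f.grade → M.lact (unit n a) m = (leftUnitor f : R) • m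
  ract_unit : ∀ {k : ℤ} {a b : Obj} {f : Hom a b} {m},
    m ∈ M.gr k f.grade → M.ract m (unit n b) = (rightUnitor f : R) • m
  d_mem : ∀ {k : ℤ} {g : Grade} {m}, m ∈ M.gr k g → M.d m ∈ M.gr (k - 1) g
  d_lact : ∀ x m, M.d (M.lact x m) = M.lact x (M.d m)
  d_ract : ∀ m x, M.d (M.ract m x) = M.ract (M.d m) x
  d_d : ∀ m, M.d (M.d m) = 0

/-- `f` is a homomorphism of bimodules of homological degree `r` which preserves the grading by the
grading category. -/
structure IsHom {M : PreComplex.{u} n} {N : PreComplex.{v} n} (r : ℤ)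
    (f : M.carrier →ₗ[R] N.carrier) : Prop where
  map_mem : ∀ {k : ℤ} {g : Grade} {m}, m ∈ M.gr k g → f m ∈ N.gr (k + r) g
  map_lact : ∀ x m, f (M.lact x m) = N.lact x (f m)
  map_ract : ∀ m x, f (M.ract m x) = N.ract (f m) x

/-- Grading-preserving chain maps. -/
structure IsChainMap {M : PreComplex.{u} n} {N : PreComplex.{v} n}
    (f : M.carrier →ₗ[R] N.carrier) : Prop extends IsHom 0 f where
  map_d : ∀ m, f (M.d m) = N.d (f m)

/-- Chain homotopy. -/
def Homotopic {M : PreComplex.{u} n} {N : PreComplex.{v} n}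
    (f g : M.carrier →ₗ[R] N.carrier) : Prop :=
  ∃ h : M.carrier →ₗ[R] N.carrier, IsHom 1 h ∧ ∀ m, f m - g m = N.d (h m) + h (M.d m)

/-- `f` is a chain map whose class is an isomorphism in the homotopy category. -/
def IsHomotopyIso {M : PreComplex.{u} n} {N : PreComplex.{v} n}
    (f : M.carrier →ₗ[R] N.carrier) : Prop :=
  IsChainMap f ∧ ∃ g : N.carrier →ₗ[R] M.carrier, IsChainMap g ∧
    Homotopic (M := M) (N := M) (g ∘ₗ f) LinearMap.id ∧
    Homotopic (M := N) (N := N) (f ∘ₗ g) LinearMap.id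

/-- `M ≃ N` in the homotopy category. -/
def HomotopyEquivalent (M : PreComplex.{u} n) (N : PreComplex.{v} n) : Prop :=
  ∃ f : M.carrier →ₗ[R] N.carrier, IsHomotopyIso f

open Classical in
/-- `H^n` as a complex concentrated in degree `0`. -/
def arcComplex (n : ℕ) : PreComplex.{0} n where
  carrier := Arc n
  gr := fun k g => if k = 0 then arcGr g else ⊥
  lact := mul
  ract := mul
  d := 0

/-- The relations which define `M ⊗_{H^n} N` as a quotient of `M ⊗_R N`: tensors with non-composable
degrees vanish, and `m x ⊗ n = α(|m|, |x|, |n|) m ⊗ x n`. -/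
def tensorRelations (M : PreComplex.{u} n) (N : PreComplex.{v} n) :
    Submodule R (M.carrier ⊗[R] N.carrier) :=
  Submodule.span R
    ({t | ∃ (k l : ℤ) (a b b' c : Obj) (f : Hom a b) (g : Hom b' c), ∃ m ∈ M.gr k f.grade,
        ∃ p ∈ N.gr l g.grade, b ≠ b' ∧ t = m ⊗ₜ[R] p} ∪
     {t | ∃ (k l : ℤ) (a b c d : Obj) (f : Hom a b) (g : Hom b c) (h : Hom c d),
        ∃ m ∈ M.gr k f.grade, ∃ x ∈ arcGr g.grade, ∃ p ∈ N.gr l h.grade,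
          t = M.ract m x ⊗ₜ[R] p - (assoc f g h : R) • (m ⊗ₜ[R] N.lact x p)})

/-- The complex `T` is the tensor product `M ⊗_{H^n} N`, with `θ m p` as the class of `m ⊗ p`. -/
structure IsTensorVia (M : PreComplex.{u} n) (N : PreComplex.{v} n) (T : PreComplex.{w} n)
    (θ : M.carrier →ₗ[R] N.carrier →ₗ[R] T.carrier) : Prop where
  surjective : Function.Surjective (TensorProduct.lift θ)
  ker_eq : LinearMap.ker (TensorProduct.lift θ) = tensorRelations M N
  mem : ∀ {k l : ℤ} {a b c : Obj} {f : Hom a b} {g : Hom b c} {m p},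
    m ∈ M.gr k f.grade → p ∈ N.gr l g.grade → θ m p ∈ T.gr (k + l) (f.comp g).grade
  lact : ∀ {k l : ℤ} {a b c d : Obj} {f : Hom a b} {g : Hom b c} {h : Hom c d} {x m p},
    x ∈ arcGr f.grade → m ∈ M.gr k g.grade → p ∈ N.gr l h.grade →
      T.lact x (θ m p) = (((assoc f g h)⁻¹ : Rˣ) : R) • θ (M.lact x m) p
  ract : ∀ {k l : ℤ} {a b c d : Obj} {f : Hom a b} {g : Hom b c} {h : Hom c d} {m p x},
    m ∈ M.gr k f.grade → p ∈ N.gr l g.grade → x ∈ arcGr h.grade →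
      T.ract (θ m p) x = (assoc f g h : R) • θ m (N.ract p x)
  d : ∀ {k l : ℤ} {g h : Grade} {m p}, m ∈ M.gr k g → p ∈ N.gr l h →
    T.d (θ m p) = θ (M.d m) p + ((k.negOnePow : ℤˣ) : ℤ) • θ m (N.d p)

/-- The complex `T` is a tensor product `M ⊗_{H^n} N`. -/
def IsTensor (M : PreComplex.{u} n) (N : PreComplex.{v} n) (T : PreComplex.{w} n) : Prop :=
  IsComplex T ∧ ∃ θ, IsTensorVia M N T θ

/-- `M` is invertible: there is a complex `N` with `N ⊗ M ≃ H^n` and `M ⊗ N ≃ H^n`. -/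
def IsInvertibleComplex (M : PreComplex.{u} n) : Prop :=
  ∃ N T T' : PreComplex.{u} n, IsComplex N ∧ IsTensor N M T ∧ IsTensor M N T' ∧
    HomotopyEquivalent T (arcComplex n) ∧ HomotopyEquivalent T' (arcComplex n)

end UnifiedArc

end

open UnifiedArc

/-! The center. An element of degree `Id_a` is a combination of labellings of the circles of `a ā`
of total degree `(n, 0)`. A label `v₋` would make the second coordinate negative, so only multiples
of `e_a` occur (`Labeling.eq_plus`). Left multiplication by `e_a` is the identity on elements of
source `a`, and right multiplication by `e_b` is the scalar `α(f, Id, Id)` on elements of degree `f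
: a → b` (`idem_mul_single`, `single_mul_idem`). Indeed one half of the diagram is trivial, every
saddle merges in a circle labelled `v₊`, and only the units from reordering tensor factors remain.
Since `α(Id, Id, f) = 1`, the element `1` is central with exactly the twist `ζ`. A central `∑ r_a
e_a` has all `r_a` equal, because `F(a b̄)` contains the nonzero labelling by `v₊` for every pair
`a, b` (`eq_smul_one_of_mem_center`). The same comparison shows that grading-preserving bimodule
endomorphisms of `H^n` are scalars (`exists_eq_smul_of_isHom`).

Invertible complexes. Let `N` be inverse to `M` and let `f` be a chain endomorphism of `M`. On `M ⊗
N ≃ H^n` the map `f ⊗ id` is homotopic to a scalar `r`, so `(f - r) ⊗ id` is null-homotopic.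
Tensoring once more with `M` and using `N ⊗ M ≃ H^n`, one finds that `f - r` itself is
null-homotopic (`TensorPair.homotopic_zero`). The scalar is determined by the homotopy class
(`eq_of_homotopic_smul`), so the automorphisms are the units of `R`. Two isomorphisms `f, g : M → N`
are then compared through the automorphism `f⁻¹ g` of `M`.

The cocycle identity. Rebracketing these tensor products needs the associator to be a 3-cocycle
(`assoc_pentagon`), and much of the work goes into this. In a stack of four tangles there are three
inner lines of saddles. Reversing the order of the three lines in two ways gives the cocycle
identity, and this reduces saddle by saddle to a hexagon identity for three saddles on different
lines (`Diagram.IsPlanar.hexagon`).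

The hexagon. With the strands oriented by the parity of their endpoints, the circles of a diagram
are the cycles of a permutation of a finite set of nodes, and a saddle multiplies this permutation
by the transposition of its two ends (`Diagram.IsPlanar.step_insert`). All exchange units therefore
depend only on the first return map to the six ends of the three saddles, a permutation of six
letters, and on the colours of the regions that contain the arrows. Planarity enters through the
checkerboard colouring: two arrows in regions of different colours never join the same two circles
(`Diagram.IsPlanar.not_joinSame`). Under this constraint the identity is checked for all 720
permutations and all colours (`allPerms_leaf`). -/

namespace UnifiedArc

/-! ### Finite verification of the hexagon identity -/

/-- The image of `i` under the permutation of `{0, …, 5}` with the octal digits of `T` as values. -/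
def digit (T i : ℕ) : ℕ := (T >>> (3 * i)) % 8

/-- `i` and `j` lie on the same cycle of the permutation encoded by `T`. -/
def cyc (T i j : ℕ) : Bool :=
  let a := digit T i
  let b := digit T a
  let c := digit T b
  let d := digit T c
  let e := digit T d
  Nat.beq i j || (Nat.beq a j || (Nat.beq b j || (Nat.beq c j || (Nat.beq d j || Nat.beq e j))))

/-- The code of a permutation of `{0, …, 5}`, composed with the transposition of `2k` and `2k+1`
for those `k` for which the corresponding flag is set. -/
def code (a b c d e f : ℕ) (x y z : Bool) : ℕ :=
  (bif x then b + 8 * a else a + 8 * b) + 64 * (bif y then d + 8 * c else c + 8 * d) +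
    4096 * (bif z then f + 8 * e else e + 8 * f)

/-- In the state `T`, the arrows `2x → 2x+1` and `2y → 2y+1` join the same two circles. -/
def both (T x y : ℕ) : Bool :=
  bif cyc T (2 * x) (2 * x + 1) then false else
    (cyc T (2 * x) (2 * y) && cyc T (2 * x + 1) (2 * y + 1)) ||
      (cyc T (2 * x) (2 * y + 1) && cyc T (2 * x + 1) (2 * y))

/-- Exponents of `X`, `Y`, `Z` (the latter shifted by `1`) in the commutation unit of two saddles. -/
def swapExp (m₁ m₂ m₃ s t : Bool) : ℕ × ℕ × ℕ :=
  bif m₁ then bif m₂ then (1, 0, 1) else bif !m₃ then (0, 0, 0) else bif s then (0, 1, 1) else (1, 0, 1)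
  else bif !m₂ then (0, 1, 1) else bif m₃ then (0, 0, 2) else bif t then (0, 0, 1) else (1, 1, 1)

/-- The commutation exponents of the saddles `x` and `y`; `T` is the state, `Tx` is the state after the
first saddle, and `cx` is the colour of the saddle `x`. -/
def swapOf (T Tx : ℕ) (cx : Bool) (x y : ℕ) : ℕ × ℕ × ℕ :=
  swapExp (!cyc T (2 * x) (2 * x + 1)) (!cyc Tx (2 * y) (2 * y + 1)) (!cyc T (2 * y) (2 * y + 1))
    (cyc T (2 * x) (2 * y)) (cyc Tx (bif cx then 2 * x else 2 * x + 1) (2 * y))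

/-- `X` and `Y` have square one, so their exponents count modulo 2. The exponent of `Z` is compared
exactly; each side has three factors, so the shifts by one cancel. -/
def expEq (u v w u' v' w' : ℕ × ℕ × ℕ) : Bool :=
  Nat.beq ((u.1 + v.1 + w.1) % 2) ((u'.1 + v'.1 + w'.1) % 2) &&
  (Nat.beq ((u.2.1 + v.2.1 + w.2.1) % 2) ((u'.2.1 + v'.2.1 + w'.2.1) % 2) &&
  Nat.beq (u.2.2 + v.2.2 + w.2.2) (u'.2.2 + v'.2.2 + w'.2.2))

def flags : List Bool := [false, true]

def six : List ℕ := [0, 1, 2, 3, 4, 5]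

/-- No two arrows in regions of different colours join the same two circles. -/
def planarOk (T : Bool → Bool → Bool → ℕ) (cx cy cz : Bool) : Bool :=
  flags.all fun x => flags.all fun y => flags.all fun z =>
    ((x ^^ cx) == (y ^^ cy) || !both (T x y z) 0 1) &&
    (((x ^^ cx) == (z ^^ cz) || !both (T x y z) 0 2) &&
    ((y ^^ cy) == (z ^^ cz) || !both (T x y z) 1 2))

/-- The two ways of turning the order `x y z` of three saddles into `z y x` by adjacent exchanges.
The saddle `z` is never the first of an exchanged pair, so its colour does not enter. -/
def hexOk (T : Bool → Bool → Bool → ℕ) (cx cy : Bool) : Bool :=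
  let o := false
  let i := true
  expEq
    (swapOf (T o o o) (T i o o) cx 0 1)
    (swapOf (T o i o) (T i i o) cx 0 2)
    (swapOf (T o o o) (T o i o) cy 1 2)
    (swapOf (T i o o) (T i i o) cy 1 2)
    (swapOf (T o o o) (T i o o) cx 0 2)
    (swapOf (T o o i) (T i o i) cx 0 1)

def leaf (a b c d e f : ℕ) : Bool :=
  flags.all fun cx => flags.all fun cy => flags.all fun cz =>
    bif planarOk (code a b c d e f) cx cy cz then hexOk (code a b c d e f) cx cy else true

/-- Discarding repeated values level by level leaves the 720 permutations out of all tuples. -/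
def allPerms (φ : ℕ → ℕ → ℕ → ℕ → ℕ → ℕ → Bool) : Bool :=
  six.all fun a => six.all fun b => bif Nat.beq b a then true else
  six.all fun c => bif Nat.beq c a || Nat.beq c b then true else
  six.all fun d => bif Nat.beq d a || (Nat.beq d b || Nat.beq d c) then true else
  six.all fun e => bif Nat.beq e a || (Nat.beq e b || (Nat.beq e c || Nat.beq e d)) then true else
  six.all fun f =>
    bif Nat.beq f a || (Nat.beq f b || (Nat.beq f c || (Nat.beq f d || Nat.beq f e))) then true else
    φ a b c d e f

theorem allPerms_leaf : allPerms leaf = true := by decide +kernel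

end UnifiedArc

/-! ### First return maps of permutations and reduction to six letters -/

namespace UnifiedArc

open Equiv Equiv.Perm

/-- `P` is the first return map of `π` to the points `pt i`. -/
def IsReturn {α : Type*} (π : Perm α) {N : ℕ} (pt : Fin N → α) (P : Perm (Fin N)) : Prop :=
  ∀ i, ∃ k : ℕ, (π ^ (k + 1)) (pt i) = pt (P i) ∧ ∀ l < k, (π ^ (l + 1)) (pt i) ∉ Set.range pt

/-- A power of `π` is the identity, so every point comes back. If two points had the same image,
then going backwards from it, the one with the longer return time would already have met the other
on its way, unless they are equal. -/
theorem exists_isReturn {α : Type*} [Finite α] (π : Perm α) {N : ℕ} {pt : Fin N → α}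
    (hpt : Function.Injective pt) : ∃ P, IsReturn π pt P := by
  classical
  have hex (i : Fin N) : ∃ k : ℕ, (π ^ (k + 1)) (pt i) ∈ Set.range pt := by
    refine ⟨orderOf π - 1, i, ?_⟩
    rw [Nat.sub_add_cancel (orderOf_pos π), pow_orderOf_eq_one]; rfl
  choose Q hQ using fun i => Nat.find_spec (hex i)
  have hmin (i : Fin N) (l : ℕ) (hl : l < Nat.find (hex i)) :
      (π ^ (l + 1)) (pt i) ∉ Set.range pt := Nat.find_min (hex i) hl
  have key (i j : Fin N) (hij : Q i = Q j) (hle : Nat.find (hex i) ≤ Nat.find (hex j)) : i = j := by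
    have h1 : (π ^ (Nat.find (hex i) + 1)) (pt i) = (π ^ (Nat.find (hex j) + 1)) (pt j) := by
      rw [← hQ, ← hQ, hij]
    obtain ⟨d, hd⟩ := Nat.exists_eq_add_of_le hle
    rw [hd, show Nat.find (hex i) + d + 1 = (Nat.find (hex i) + 1) + d by ring, pow_add _ (Nat.find (hex i) + 1) d,
      Perm.mul_apply] at h1
    have h2 := (π ^ (Nat.find (hex i) + 1)).injective h1
    cases d with
    | zero => exact hpt h2
    | succ d => exact absurd ⟨i, h2⟩ (hmin j d (by omega))
  have hinj : Function.Injective Q := fun i j hij => by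
    rcases le_total (Nat.find (hex i)) (Nat.find (hex j)) with h | h
    · exact key i j hij h
    · exact (key j i hij.symm h).symm
  exact ⟨Equiv.ofBijective Q (Finite.injective_iff_bijective.mp hinj),
    fun i => ⟨Nat.find (hex i), (hQ i).symm, hmin i⟩⟩

/-- Between two visits to the marked points `π * s` moves exactly as `π`, because `s` fixes
everything else. Passing to the first return map thus commutes with multiplication by permutations
of the marked points. -/
theorem IsReturn.mul {α : Type*} {π : Perm α} {N : ℕ} {pt : Fin N → α} {P : Perm (Fin N)}
    (h : IsReturn π pt P) {s : Perm α} {s' : Perm (Fin N)} (hs : ∀ i, s (pt i) = pt (s' i))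
    (hs' : ∀ a ∉ Set.range pt, s a = a) : IsReturn (π * s) pt (P * s') := by
  intro i
  obtain ⟨k, hk, hl⟩ := h (s' i)
  have key (l : ℕ) (hlk : l ≤ k) : ((π * s) ^ (l + 1)) (pt i) = (π ^ (l + 1)) (pt (s' i)) := by
    induction l with
    | zero => simp [hs]
    | succ l ih =>
      rw [pow_succ', Perm.mul_apply, ih (by omega), Perm.mul_apply, hs' _ (hl l (by omega)),
        ← Perm.mul_apply, ← pow_succ']
  exact ⟨k, (key k le_rfl).trans hk, fun l hlk => by rw [key l hlk.le]; exact hl l hlk⟩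

/-- In a finite set a cycle is traversed by nonnegative powers. Cutting such a path at each visit to
a marked point turns it into a path of the return map. -/
theorem IsReturn.sameCycle_iff {α : Type*} [Finite α] {π : Perm α} {N : ℕ} {pt : Fin N → α}
    (hpt : Function.Injective pt) {P : Perm (Fin N)} (h : IsReturn π pt P) (i j : Fin N) :
    SameCycle π (pt i) (pt j) ↔ SameCycle P i j := by
  constructor
  · intro hij
    obtain ⟨n, hn⟩ := hij.exists_nat_pow_eq
    induction n using Nat.strong_induction_on generalizing i with
    | _ n ih =>
      cases n with
      | zero => rw [hpt hn]
      | succ n =>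
        obtain ⟨k, hk, hl⟩ := h i
        have hkn : k ≤ n := by
          by_contra hc
          exact hl n (by omega) ⟨j, hn.symm⟩
        obtain ⟨d, rfl⟩ := Nat.exists_eq_add_of_le hkn
        rw [show k + d + 1 = d + (k + 1) by ring, pow_add, Perm.mul_apply, hk] at hn
        have := ih d (by omega) (P i) ⟨d, by simpa using hn⟩ hn
        exact (sameCycle_apply_left).mp this
  · rintro hij
    obtain ⟨n, rfl⟩ := hij.exists_nat_pow_eq
    clear hij
    induction n with
    | zero => rfl
    | succ n ih =>
      refine ih.trans ?_
      obtain ⟨k, hk, -⟩ := h ((P ^ n) i)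
      rw [pow_succ', Perm.mul_apply, ← hk]
      exact ⟨(k + 1 : ℕ), by rw [zpow_natCast]⟩

/-- A cycle on six letters has at most six elements, so the exponents `0, …, 5` suffice. -/
theorem cyc_iff (T : ℕ) (P : Perm (Fin 6)) (hT : ∀ i : Fin 6, digit T i = P i) (i j : Fin 6) :
    cyc T i j = true ↔ SameCycle P i j := by
  have h2 : cyc T i j = true ↔ ∃ k < 6, (P ^ k) i = j := by
    simp only [cyc, hT, Bool.or_eq_true, Nat.beq_eq, Fin.val_inj]
    constructor
    · rintro (h | h | h | h | h | h)
      exacts [⟨0, by simp, h⟩, ⟨1, by simp, h⟩, ⟨2, by simp, h⟩, ⟨3, by simp, h⟩, ⟨4, by simp, h⟩,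
        ⟨5, by simp, h⟩]
    · rintro ⟨k, hk, h⟩
      interval_cases k
      exacts [.inl h, .inr (.inl h), .inr (.inr (.inl h)), .inr (.inr (.inr (.inl h))),
        .inr (.inr (.inr (.inr (.inl h)))), .inr (.inr (.inr (.inr (.inr h))))]
  rw [h2]
  constructor
  · rintro ⟨k, -, h⟩
    exact ⟨k, by simpa using h⟩
  · intro h
    by_cases hi : i ∈ P.support
    · obtain ⟨k, hk, h⟩ := h.exists_pow_eq_of_mem_support hi
      exact ⟨k, hk.trans_le ((Finset.card_le_univ _).trans_eq (by simp)), h⟩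
    · rw [notMem_support] at hi
      exact ⟨0, by simp, ((h.eq_of_left hi) : i = j)⟩

/-- The product of those of the transpositions of `pt 0, pt 1`, of `pt 2, pt 3` and of `pt 4, pt 5`
whose flags are set. -/
def flips {α : Type*} [DecidableEq α] (pt : Fin 6 → α) (x y z : Bool) : Perm α :=
  (bif x then swap (pt 0) (pt 1) else 1) * (bif y then swap (pt 2) (pt 3) else 1) *
    (bif z then swap (pt 4) (pt 5) else 1)

theorem flips_apply {α : Type*} [DecidableEq α] {pt : Fin 6 → α} (hpt : Function.Injective pt)
    (x y z : Bool) (i : Fin 6) : flips pt x y z (pt i) = pt (flips id x y z i) := by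
  have (a b c : Fin 6) : swap (pt a) (pt b) (pt c) = pt (swap a b c) := by
    rw [← hpt.swap_apply]
  cases x <;> cases y <;> cases z <;> simp [flips, this]

theorem flips_apply_of_notMem {α : Type*} [DecidableEq α] {pt : Fin 6 → α}
    (x y z : Bool) {a : α} (ha : a ∉ Set.range pt) : flips pt x y z a = a := by
  have (i j : Fin 6) : swap (pt i) (pt j) a = a :=
    swap_apply_of_ne_of_ne (fun h => ha ⟨i, h.symm⟩) (fun h => ha ⟨j, h.symm⟩)
  cases x <;> cases y <;> cases z <;> simp [flips, this]

/-- Exchanging the digits in the places `2k` and `2k + 1` is composition on the right with their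
transposition. -/
theorem digit_code (P : Perm (Fin 6)) (x y z : Bool) (i : Fin 6) :
    digit (code (P 0) (P 1) (P 2) (P 3) (P 4) (P 5) x y z) i = (P * flips id x y z) i := by
  have h (k : Fin 6) := (P k).isLt
  have h0 := h 0; have h1 := h 1; have h2 := h 2; have h3 := h 3; have h4 := h 4; have h5 := h 5
  have hf : (flips id x y z : Perm (Fin 6)) = flips (fun i => i) x y z := rfl
  fin_cases i <;> cases x <;> cases y <;> cases z <;>
    simp [digit, code, flips, Nat.shiftRight_eq_div_pow, swap_apply_def] <;> omega

theorem allPerms_apply {φ : ℕ → ℕ → ℕ → ℕ → ℕ → ℕ → Bool} (h : allPerms φ = true)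
    (P : Perm (Fin 6)) : φ (P 0) (P 1) (P 2) (P 3) (P 4) (P 5) = true := by
  have mem (k : Fin 6) : (P k : ℕ) ∈ six := by
    have := (P k).isLt
    simp only [six, List.mem_cons, List.not_mem_nil]; omega
  have ne (k l : Fin 6) (hkl : k ≠ l) : Nat.beq (P k) (P l) = false := by
    rw [Bool.eq_false_iff, ne_eq, Nat.beq_eq, Fin.val_inj]
    exact fun e => hkl (P.injective e)
  have h := List.all_eq_true.mp h _ (mem 0)
  have h := List.all_eq_true.mp h _ (mem 1)
  rw [ne 1 0 (by decide)] at h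
  have h := List.all_eq_true.mp h _ (mem 2)
  rw [ne 2 0 (by decide), ne 2 1 (by decide)] at h
  have h := List.all_eq_true.mp h _ (mem 3)
  rw [ne 3 0 (by decide), ne 3 1 (by decide), ne 3 2 (by decide)] at h
  have h := List.all_eq_true.mp h _ (mem 4)
  rw [ne 4 0 (by decide), ne 4 1 (by decide), ne 4 2 (by decide), ne 4 3 (by decide)] at h
  have h := List.all_eq_true.mp h _ (mem 5)
  rw [ne 5 0 (by decide), ne 5 1 (by decide), ne 5 2 (by decide), ne 5 3 (by decide),
    ne 5 4 (by decide)] at h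
  exact h

/-- The unit `X^a Y^b Z^(c-1)`. -/
noncomputable def expUnit (e : ℕ × ℕ × ℕ) : Rˣ := uX ^ e.1 * uY ^ e.2.1 * uZ ^ ((e.2.2 : ℤ) - 1)

theorem uX_mul_self : uX * uX = 1 := Units.ext (R.var_mul_self 0)

theorem uY_mul_self : uY * uY = 1 := Units.ext (R.var_mul_self 1)

theorem pow_eq_pow_of_mod_two {G : Type*} [Monoid G] {u : G} (hu : u * u = 1) {a b : ℕ}
    (h : a % 2 = b % 2) : u ^ a = u ^ b := by
  rw [← Nat.div_add_mod a 2, ← Nat.div_add_mod b 2, h, pow_add, pow_add, pow_mul, pow_mul, sq, hu,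
    one_pow, one_pow]

theorem expUnit_mul_of_expEq {u v w u' v' w' : ℕ × ℕ × ℕ} (h : expEq u v w u' v' w' = true) :
    expUnit u * expUnit v * expUnit w = expUnit u' * expUnit v' * expUnit w' := by
  have key (u v w : ℕ × ℕ × ℕ) : expUnit u * expUnit v * expUnit w =
      uX ^ (u.1 + v.1 + w.1) * uY ^ (u.2.1 + v.2.1 + w.2.1) *
        uZ ^ (((u.2.2 + v.2.2 + w.2.2 : ℕ) : ℤ) - 3) := by
    have : (((u.2.2 + v.2.2 + w.2.2 : ℕ) : ℤ) - 3) =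
      ((u.2.2 : ℤ) - 1) + ((v.2.2 : ℤ) - 1) + ((w.2.2 : ℤ) - 1) := by push_cast; ring
    rw [this, zpow_add, zpow_add, pow_add, pow_add, pow_add, pow_add]
    simp only [expUnit]
    ac_rfl
  simp only [expEq, Bool.and_eq_true, Nat.beq_eq] at h
  rw [key, key, pow_eq_pow_of_mod_two uX_mul_self h.1, pow_eq_pow_of_mod_two uY_mul_self h.2.1, h.2.2]

open Classical in
/-- The commutation unit of two saddles in terms of their types and of the relations between the
circles at their ends. -/
noncomputable def swapUnit (m₁ m₂ m₃ s t : Prop) : Rˣ :=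
  if m₁ then if m₂ then uX else if ¬m₃ then uZ⁻¹ else if s then uY else uX
  else if ¬m₂ then uY else if m₃ then uZ else if t then 1 else uX * uY

open Classical in
theorem swapUnit_eq (m₁ m₂ m₃ s t : Prop) :
    swapUnit m₁ m₂ m₃ s t =
      expUnit (swapExp (decide m₁) (decide m₂) (decide m₃) (decide s) (decide t)) := by
  by_cases m₁ <;> by_cases m₂ <;> by_cases m₃ <;> by_cases s <;> by_cases t <;>
    simp [swapUnit, swapExp, expUnit, *]

/-- In a state in which the circles are given by `r`, the arrows `i → i'` and `j → j'` join the same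
two circles. -/
def JoinSame {N : ℕ} (r : Fin N → Fin N → Prop) (i i' j j' : Fin N) : Prop :=
  ¬ r i i' ∧ ((r i j ∧ r i' j') ∨ (r i j' ∧ r i' j))

/-- The flips are supported on the six points, so in all eight states the relations among these
points can be read off from the first return map of `π` alone. Its code is one of the entries
covered by `allPerms_leaf`, and `hJ` says that the planarity test `planarOk` succeeds for it. -/
theorem hexagon_of_sameCycle {α : Type*} [Finite α] [DecidableEq α] (π : Perm α) {pt : Fin 6 → α}
    (hpt : Function.Injective pt) (cx cy cz : Bool) (r : Bool → Bool → Bool → Fin 6 → Fin 6 → Prop)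
    (hr : ∀ x y z i j, r x y z i j ↔ SameCycle (π * flips pt x y z) (pt i) (pt j))
    (hJ : ∀ x y z, ((x ^^ cx) ≠ (y ^^ cy) → ¬ JoinSame (r x y z) 0 1 2 3) ∧
      ((x ^^ cx) ≠ (z ^^ cz) → ¬ JoinSame (r x y z) 0 1 4 5) ∧
      ((y ^^ cy) ≠ (z ^^ cz) → ¬ JoinSame (r x y z) 2 3 4 5)) :
    let o := false
    let i := true
    let ex : Fin 6 := bif cx then 0 else 1
    let ey : Fin 6 := bif cy then 2 else 3
    swapUnit (¬ r o o o 0 1) (¬ r i o o 2 3) (¬ r o o o 2 3) (r o o o 0 2) (r i o o ex 2) *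
    swapUnit (¬ r o i o 0 1) (¬ r i i o 4 5) (¬ r o i o 4 5) (r o i o 0 4) (r i i o ex 4) *
    swapUnit (¬ r o o o 2 3) (¬ r o i o 4 5) (¬ r o o o 4 5) (r o o o 2 4) (r o i o ey 4) =
    swapUnit (¬ r i o o 2 3) (¬ r i i o 4 5) (¬ r i o o 4 5) (r i o o 2 4) (r i i o ey 4) *
    swapUnit (¬ r o o o 0 1) (¬ r i o o 4 5) (¬ r o o o 4 5) (r o o o 0 4) (r i o o ex 4) *
    swapUnit (¬ r o o i 0 1) (¬ r i o i 2 3) (¬ r o o i 2 3) (r o o i 0 2) (r i o i ex 2) := by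
  classical
  intro o i ex ey
  obtain ⟨P, hP⟩ := exists_isReturn π hpt
  let T := code (P 0) (P 1) (P 2) (P 3) (P 4) (P 5)
  have hT (x y z : Bool) (i j : Fin 6) : cyc (T x y z) i j = decide (r x y z i j) := by
    rw [Bool.eq_iff_iff, decide_eq_true_iff, hr, cyc_iff _ _ (digit_code P x y z),
      (hP.mul (flips_apply hpt x y z) fun a => flips_apply_of_notMem x y z).sameCycle_iff hpt]
  have hboth (x y z : Bool) (k l : ℕ) (hk : k < 3) (hl : l < 3) : both (T x y z) k l = true ↔
      JoinSame (r x y z) ⟨2 * k, by omega⟩ ⟨2 * k + 1, by omega⟩ ⟨2 * l, by omega⟩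
        ⟨2 * l + 1, by omega⟩ := by
    have h1 := hT x y z ⟨2 * k, by omega⟩ ⟨2 * k + 1, by omega⟩
    have h2 := hT x y z ⟨2 * k, by omega⟩ ⟨2 * l, by omega⟩
    have h3 := hT x y z ⟨2 * k + 1, by omega⟩ ⟨2 * l + 1, by omega⟩
    have h4 := hT x y z ⟨2 * k, by omega⟩ ⟨2 * l + 1, by omega⟩
    have h5 := hT x y z ⟨2 * k + 1, by omega⟩ ⟨2 * l, by omega⟩
    simp only at h1 h2 h3 h4 h5
    rw [both, JoinSame, h1, h2, h3, h4, h5]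
    by_cases h : r x y z ⟨2 * k, by omega⟩ ⟨2 * k + 1, by omega⟩ <;> simp [h]
  have hleaf := allPerms_apply allPerms_leaf P
  have mem (b : Bool) : b ∈ flags := by cases b <;> simp [flags]
  have hl := List.all_eq_true.mp (List.all_eq_true.mp (List.all_eq_true.mp hleaf cx (mem _))
    cy (mem _)) cz (mem _)
  have hok : planarOk T cx cy cz = true := by
    simp only [planarOk, List.all_eq_true]
    intro x _ y _ z _
    obtain ⟨h1, h2, h3⟩ := hJ x y z
    have b1 := hboth x y z 0 1 (by simp) (by simp)
    have b2 := hboth x y z 0 2 (by simp) (by simp)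
    have b3 := hboth x y z 1 2 (by simp) (by simp)
    simp only [Bool.and_eq_true, Bool.or_eq_true, beq_iff_eq, Bool.not_eq_true',
      ← Bool.not_eq_true, b1, b2, b3]
    exact ⟨or_iff_not_imp_left.mpr h1, or_iff_not_imp_left.mpr h2, or_iff_not_imp_left.mpr h3⟩
  change (bif planarOk T cx cy cz then hexOk T cx cy else true) = true at hl
  rw [hok] at hl
  have hu (x y z x' y' z' : Bool) (k l : ℕ) (c : Bool) (hk : k < 3) (hl : l < 3) :
      expUnit (swapOf (T x y z) (T x' y' z') c k l) =
      swapUnit (¬ r x y z ⟨2 * k, by omega⟩ ⟨2 * k + 1, by omega⟩)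
        (¬ r x' y' z' ⟨2 * l, by omega⟩ ⟨2 * l + 1, by omega⟩)
        (¬ r x y z ⟨2 * l, by omega⟩ ⟨2 * l + 1, by omega⟩)
        (r x y z ⟨2 * k, by omega⟩ ⟨2 * l, by omega⟩)
        (r x' y' z' (bif c then ⟨2 * k, by omega⟩ else ⟨2 * k + 1, by omega⟩) ⟨2 * l, by omega⟩) := by
    rw [swapUnit_eq, swapOf]
    simp only [decide_not, ← hT]
    cases c <;> rfl
  have := expUnit_mul_of_expEq hl
  rw [hu _ _ _ _ _ _ 0 1 cx (by simp) (by simp), hu _ _ _ _ _ _ 0 2 cx (by simp) (by simp),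
    hu _ _ _ _ _ _ 1 2 cy (by simp) (by simp), hu _ _ _ _ _ _ 1 2 cy (by simp) (by simp),
    hu _ _ _ _ _ _ 0 2 cx (by simp) (by simp), hu _ _ _ _ _ _ 0 1 cx (by simp) (by simp)] at this
  exact this

end UnifiedArc

namespace UnifiedArc

/-! ### Flat tangles as planar matchings of their endpoints -/

/-- With every strand oriented upwards at its endpoints of even number, `p` is a point at which its
strand leaves the tangle. -/
def ptIn (p : Pt) : Bool := decide (p.2 % 2 = 0) == p.1

def InRange (m n : ℕ) (p : Pt) : Prop := p.2 < 2 * (if p.1 then n else m)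

/-- That one of the two gaps next to the point number `i` which has an even number. -/
def evenGap (i : ℕ) : ℕ := if i % 2 = 0 then i else i + 1

/-- The number of points of `χ` to the left of the gap number `g`, modulo `2`. -/
def gapCount (χ : ℕ → ZMod 2) (g : ℕ) : ZMod 2 := ∑ i ∈ Finset.range g, χ i

/-- The value of `gapCount` at the even gap next to `p`. -/
def level (χ : Pt → ZMod 2) (p : Pt) : ZMod 2 := gapCount (fun i => χ (p.1, i)) (evenGap p.2)

theorem ZMod.two_add_self (x : ZMod 2) : x + x = 0 := by revert x; decide

/-- Two neighbouring points of equal value contribute `0` modulo 2 to every gap to the right of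
both. -/
theorem gapCount_insert (χ χ' : ℕ → ZMod 2) (i : ℕ) (h₁ : ∀ j < i, χ j = χ' j)
    (h₂ : ∀ j, i ≤ j → χ j = χ' (j + 2)) (h₃ : χ' i = χ' (i + 1)) (g : ℕ) :
    (g ≤ i → gapCount χ' g = gapCount χ g) ∧ (i ≤ g → gapCount χ' (g + 2) = gapCount χ g) := by
  have h (g : ℕ) (hg : g ≤ i) : gapCount χ' g = gapCount χ g :=
    Finset.sum_congr rfl fun j hj => (h₁ j (by have := Finset.mem_range.mp hj; omega)).symm
  refine ⟨h g, fun hg => ?_⟩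
  induction g, hg using Nat.le_induction with
  | base =>
    rw [← h i le_rfl]
    simp only [gapCount, Finset.sum_range_succ, h₃, add_assoc, ZMod.two_add_self, add_zero]
  | succ g hg ih =>
    simp only [gapCount] at ih ⊢
    rw [show g + 1 + 2 = (g + 2) + 1 by ring, Finset.sum_range_succ, ih, Finset.sum_range_succ, h₂ g hg]

/-- Positions move by two, so even gaps remain even, and the inserted pair does not change any
count. -/
theorem level_insert {χ χ' : Pt → ZMod 2} {i : ℕ} (h : ∀ p, χ p = χ' (beforeCap i p))
    (h' : χ' (true, i) = χ' (true, i + 1)) (p : Pt) : level χ' (beforeCap i p) = level χ p := by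
  obtain ⟨b, j⟩ := p
  cases b with
  | false =>
    have h0 : ∀ k, χ (false, k) = χ' (false, k) := fun k => by simpa [beforeCap] using h (false, k)
    simp [level, beforeCap, gapCount, h0]
  | true =>
    have key := gapCount_insert (fun k => χ (true, k)) (fun k => χ' (true, k)) i
      (fun k hk => by simpa [beforeCap, Nat.not_le.mpr hk] using h (true, k))
      (fun k hk => by simpa [beforeCap, hk] using h (true, k)) h' (evenGap j)
    by_cases hj : i ≤ j
    · have h1 : evenGap (j + 2) = evenGap j + 2 := by simp only [evenGap]; grind
      have h2 : i ≤ evenGap j := by simp only [evenGap]; grind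
      simp only [level, beforeCap, hj, and_self, if_true, h1]
      exact key.2 h2
    · have h2 : evenGap j ≤ i := by simp only [evenGap]; grind
      simp only [level, beforeCap, hj, and_false, if_false]
      exact key.1 h2

/-- For odd `i` the two points share the even gap between them. For even `i` their even gaps `i` and
`i + 2` enclose both points, which cancel. -/
theorem level_pair {χ : Pt → ZMod 2} {i : ℕ} (h : χ (true, i) = χ (true, i + 1)) :
    level χ (true, i + 1) = level χ (true, i) := by
  simp only [level, evenGap]
  by_cases hi : i % 2 = 0
  · rw [if_neg (by omega), if_pos hi]
    simp only [gapCount, Finset.sum_range_succ, h]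
    rw [add_assoc, ZMod.two_add_self, add_zero]
  · rw [if_pos (by omega), if_neg hi]

/-- `τ` is a planar oriented perfect matching of the endpoints of a tangle with `2m` points at the
bottom and `2n` points at the top. -/
structure IsPlanar (m n : ℕ) (τ : Pt → Pt) : Prop where
  invol : ∀ p, τ (τ p) = p
  ptIn : ∀ p, ptIn (τ p) = !ptIn p
  range : ∀ p, InRange m n p → InRange m n (τ p)
  -- This is how planarity is recorded. For a union `χ` of strands, the count to the left of a gap
  -- is the colour of the region at this gap in the checkerboard colouring of the complement. In the
  -- orientation of `ptIn` the even gap always lies to the left of the strand, so its colour is the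
  -- same at both ends.
  level : ∀ χ : Pt → ZMod 2, (∀ p, χ (τ p) = χ p) → ∀ p, level χ (τ p) = level χ p

theorem IsPlanar.ne {m n : ℕ} {τ : Pt → Pt} (h : IsPlanar m n τ) (p : Pt) : τ p ≠ p := fun e => by
  have := h.ptIn p
  rw [e] at this
  cases hp : UnifiedArc.ptIn p <;> simp [hp] at this

/-- The other endpoint of the strand at `p`. -/
def Word.partner : ∀ {m n : ℕ}, Word m n → Pt → Pt
  | _, _, .nil _ => fun p => (!p.1, p.2)
  | _, _, .cup w i _ => fun p =>
    if p = (true, i) then (true, i + 1) else if p = (true, i + 1) then (true, i) else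
      beforeCap i (w.partner (beforeCup i p))
  | _, _, .cap w i _ => fun p =>
    beforeCup i (if w.partner (beforeCap i p) = (true, i) then w.partner (true, i + 1) else
      if w.partner (beforeCap i p) = (true, i + 1) then w.partner (true, i) else
        w.partner (beforeCap i p))

theorem beforeCup_beforeCap (i : ℕ) (p : Pt) : beforeCup i (beforeCap i p) = p := by
  obtain ⟨b, j⟩ := p
  simp only [beforeCup, beforeCap]; grind

theorem beforeCap_beforeCup {i : ℕ} {p : Pt} (h₁ : p ≠ (true, i)) (h₂ : p ≠ (true, i + 1)) :
    beforeCap i (beforeCup i p) = p := by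
  obtain ⟨b, j⟩ := p
  cases b <;> simp [beforeCup, beforeCap] at *; grind

theorem beforeCap_ne (i : ℕ) (p : Pt) : beforeCap i p ≠ (true, i) ∧ beforeCap i p ≠ (true, i + 1) := by
  obtain ⟨b, j⟩ := p
  cases b <;> simp [beforeCap]; grind

theorem isNew_iff (i : ℕ) (p : Pt) : IsNew i p ↔ p = (true, i) ∨ p = (true, i + 1) := by
  obtain ⟨b, j⟩ := p
  cases b <;> simp [IsNew]

theorem ptIn_beforeCap (i : ℕ) (p : Pt) : ptIn (beforeCap i p) = ptIn p := by
  obtain ⟨b, j⟩ := p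
  simp only [ptIn, beforeCap]
  split <;> simp

theorem ptIn_succ (i : ℕ) : ptIn (true, i + 1) = !ptIn (true, i) := by
  simp only [ptIn]
  rcases Nat.mod_two_eq_zero_or_one i with h | h <;> simp [h, Nat.add_mod]

theorem inRange_beforeCap {m n i : ℕ} {p : Pt} (h : InRange m n p) :
    InRange m (n + 1) (beforeCap i p) := by
  obtain ⟨b, j⟩ := p
  cases b <;> simp [InRange, beforeCap] at *
  · exact h
  · grind

theorem inRange_beforeCup {m n i : ℕ} {p : Pt} (h : InRange m (n + 1) p) (hi : i ≤ 2 * n)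
    (h₁ : p ≠ (true, i)) (h₂ : p ≠ (true, i + 1)) : InRange m n (beforeCup i p) := by
  obtain ⟨b, j⟩ := p
  cases b <;> simp [InRange, beforeCup] at *
  · exact h
  · grind

/-- By induction on the diagram. A cup adds an adjacent pair, which changes no level. For a cap, an
invariant function on the new endpoints is extended to the old ones by a common value at the two
capped points, and the levels before the cap are used. -/
theorem Word.isPlanar {m n : ℕ} (w : Word m n) : IsPlanar m n w.partner := by
  induction w with
  | nil =>
    refine ⟨fun p => by simp [partner], fun p => ?_, fun p hp => ?_, fun χ hχ p => ?_⟩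
    · obtain ⟨b, j⟩ := p
      cases b <;> simp [partner, ptIn]
    · obtain ⟨b, j⟩ := p
      cases b <;> simpa [partner, InRange] using hp
    · have : ∀ i, χ (!p.1, i) = χ (p.1, i) := fun i => by simpa [partner] using hχ (p.1, i)
      simp [level, partner, this]
  | @cup n w i hi ih =>
    have e1 : (Word.cup w i hi).partner (true, i) = (true, i + 1) := by simp [partner]
    have e2 : (Word.cup w i hi).partner (true, i + 1) = (true, i) := by simp [partner]
    have e3 (q : Pt) : (Word.cup w i hi).partner (beforeCap i q) = beforeCap i (w.partner q) := by
      simp [partner, beforeCap_ne, beforeCup_beforeCap]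
    have cases_pt (p : Pt) : p = (true, i) ∨ p = (true, i + 1) ∨ ∃ q, p = beforeCap i q := by
      by_cases h1 : p = (true, i)
      · exact .inl h1
      by_cases h2 : p = (true, i + 1)
      · exact .inr (.inl h2)
      exact .inr (.inr ⟨_, (beforeCap_beforeCup h1 h2).symm⟩)
    refine ⟨fun p => ?_, fun p => ?_, fun p hp => ?_, fun χ hχ p => ?_⟩
    · rcases cases_pt p with rfl | rfl | ⟨q, rfl⟩
      · rw [e1, e2]
      · rw [e2, e1]
      · rw [e3, e3, ih.invol]
    · rcases cases_pt p with rfl | rfl | ⟨q, rfl⟩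
      · rw [e1, ptIn_succ]
      · rw [e2, ptIn_succ, Bool.not_not]
      · rw [e3, ptIn_beforeCap, ptIn_beforeCap, ih.ptIn]
    · rcases cases_pt p with rfl | rfl | ⟨q, rfl⟩
      · rw [e1]; simp [InRange]; omega
      · rw [e2]; simp [InRange]; omega
      · rw [e3]
        refine inRange_beforeCap (ih.range _ ?_)
        have := inRange_beforeCup hp hi (beforeCap_ne i q).1 (beforeCap_ne i q).2
        rwa [beforeCup_beforeCap] at this
    · have h' : χ (true, i) = χ (true, i + 1) := by rw [← e1, hχ]
      rcases cases_pt p with rfl | rfl | ⟨q, rfl⟩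
      · rw [e1, level_pair h']
      · rw [e2, level_pair h']
      · rw [e3, level_insert (fun _ => rfl) h', level_insert (fun _ => rfl) h',
          ih.level _ fun p => by rw [← e3, hχ]]
  | @cap n w i hi ih =>
    by_cases hc : w.partner (true, i) = (true, i + 1)
    · have hc' : w.partner (true, i + 1) = (true, i) := by rw [← hc, ih.invol]
      have n1 (p : Pt) : w.partner (beforeCap i p) ≠ (true, i) := fun e =>
        (beforeCap_ne i p).2 (by rw [← hc, ← e, ih.invol])
      have n2 (p : Pt) : w.partner (beforeCap i p) ≠ (true, i + 1) := fun e =>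
        (beforeCap_ne i p).1 (by rw [← hc', ← e, ih.invol])
      have e3 (p : Pt) : beforeCap i ((Word.cap w i hi).partner p) = w.partner (beforeCap i p) := by
        simp only [partner, if_neg (n1 p), if_neg (n2 p)]
        exact beforeCap_beforeCup (n1 p) (n2 p)
      have inj (p q : Pt) (h : beforeCap i p = beforeCap i q) : p = q := by
        rw [← beforeCup_beforeCap i p, h, beforeCup_beforeCap]
      refine ⟨fun p => inj _ _ ?_, fun p => ?_, fun p hp => ?_, fun χ hχ p => ?_⟩
      · rw [e3, e3, ih.invol]
      · rw [← ptIn_beforeCap i, e3, ih.ptIn, ptIn_beforeCap]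
      · rw [← beforeCup_beforeCap i ((Word.cap w i hi).partner p), e3]
        exact inRange_beforeCup (ih.range _ (inRange_beforeCap hp)) hi (n1 p) (n2 p)
      · let χ₀ : Pt → ZMod 2 := fun q =>
          if q = (true, i) ∨ q = (true, i + 1) then 0 else χ (beforeCup i q)
        have h0 (p : Pt) : χ p = χ₀ (beforeCap i p) := by
          simp [χ₀, beforeCap_ne, beforeCup_beforeCap]
        have h0' : χ₀ (true, i) = χ₀ (true, i + 1) := by simp [χ₀]
        have hχ₀ (q : Pt) : χ₀ (w.partner q) = χ₀ q := by
          by_cases h1 : q = (true, i)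
          · rw [h1, hc, h0']
          by_cases h2 : q = (true, i + 1)
          · rw [h2, hc', h0']
          rw [← beforeCap_beforeCup h1 h2, ← e3, ← h0, ← h0, hχ]
        rw [← level_insert h0 h0', ← level_insert h0 h0', e3, ih.level χ₀ hχ₀]
    · have hc' : w.partner (true, i + 1) ≠ (true, i) := fun e => hc (by rw [← e, ih.invol])
      have a1 := ih.ne (true, i)
      have a2 := ih.ne (true, i + 1)
      have inj (p q : Pt) (h : beforeCap i p = beforeCap i q) : p = q := by
        rw [← beforeCup_beforeCap i p, h, beforeCup_beforeCap]
      have e1 (p : Pt) (h : w.partner (beforeCap i p) = (true, i)) :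
          beforeCap i ((Word.cap w i hi).partner p) = w.partner (true, i + 1) := by
        simp only [partner, if_pos h]
        exact beforeCap_beforeCup hc' a2
      have e2 (p : Pt) (h : w.partner (beforeCap i p) = (true, i + 1)) :
          beforeCap i ((Word.cap w i hi).partner p) = w.partner (true, i) := by
        simp only [partner, if_pos h]
        rw [if_neg (by rw [h]; simp)]
        exact beforeCap_beforeCup a1 hc
      have e3 (p : Pt) (h1 : w.partner (beforeCap i p) ≠ (true, i))
          (h2 : w.partner (beforeCap i p) ≠ (true, i + 1)) :
          beforeCap i ((Word.cap w i hi).partner p) = w.partner (beforeCap i p) := by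
        simp only [partner, if_neg h1, if_neg h2]
        exact beforeCap_beforeCup h1 h2
      refine ⟨fun p => inj _ _ ?_, fun p => ?_, fun p hp => ?_, fun χ hχ p => ?_⟩
      · by_cases h1 : w.partner (beforeCap i p) = (true, i)
        · rw [e2 _ (by rw [e1 p h1, ih.invol]), ← h1, ih.invol]
        by_cases h2 : w.partner (beforeCap i p) = (true, i + 1)
        · rw [e1 _ (by rw [e2 p h2, ih.invol]), ← h2, ih.invol]
        have h3 := e3 p h1 h2
        have h4 := beforeCap_ne i p
        rw [e3 _ (by rw [h3, ih.invol]; exact h4.1) (by rw [h3, ih.invol]; exact h4.2), h3, ih.invol]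
      · rw [← ptIn_beforeCap i, ← ptIn_beforeCap i p, ← Bool.not_not (ptIn (beforeCap i p)),
          ← ih.ptIn (beforeCap i p)]
        by_cases h1 : w.partner (beforeCap i p) = (true, i)
        · rw [e1 p h1, h1, ih.ptIn, ptIn_succ, Bool.not_not]
        by_cases h2 : w.partner (beforeCap i p) = (true, i + 1)
        · rw [e2 p h2, h2, ih.ptIn, ptIn_succ, Bool.not_not]
        rw [e3 p h1 h2, ih.ptIn, Bool.not_not]
      · rw [← beforeCup_beforeCap i ((Word.cap w i hi).partner p)]
        refine inRange_beforeCup ?_ hi (beforeCap_ne i _).1 (beforeCap_ne i _).2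
        by_cases h1 : w.partner (beforeCap i p) = (true, i)
        · rw [e1 p h1]; exact ih.range _ (by simp [InRange]; omega)
        by_cases h2 : w.partner (beforeCap i p) = (true, i + 1)
        · rw [e2 p h2]; exact ih.range _ (by simp [InRange]; omega)
        rw [e3 p h1 h2]; exact ih.range _ (inRange_beforeCap hp)
      · let χ₀ : Pt → ZMod 2 := fun q =>
          if q = (true, i) ∨ q = (true, i + 1) then χ (beforeCup i (w.partner (true, i)))
          else χ (beforeCup i q)
        have h0 (p : Pt) : χ p = χ₀ (beforeCap i p) := by
          simp [χ₀, beforeCap_ne, beforeCup_beforeCap]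
        have h0' : χ₀ (true, i) = χ₀ (true, i + 1) := by simp [χ₀]
        have h01 : χ₀ (w.partner (true, i)) = χ₀ (true, i) := by simp [χ₀]
        have h02 : χ₀ (w.partner (true, i + 1)) = χ₀ (true, i + 1) := by
          have : (Word.cap w i hi).partner (beforeCup i (w.partner (true, i))) =
              beforeCup i (w.partner (true, i + 1)) := inj _ _ (by
            rw [e1 _ (by rw [beforeCap_beforeCup a1 hc, ih.invol]), beforeCap_beforeCup hc' a2])
          have h3 := hχ (beforeCup i (w.partner (true, i)))
          rw [this] at h3
          simp [χ₀, a2, hc', h3]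
        have hχ₀ (q : Pt) : χ₀ (w.partner q) = χ₀ q := by
          by_cases h1 : q = (true, i)
          · rw [h1, h01]
          by_cases h2 : q = (true, i + 1)
          · rw [h2, h02]
          rw [← beforeCap_beforeCup h1 h2]
          set p := beforeCup i q
          by_cases h3 : w.partner (beforeCap i p) = (true, i)
          · rw [h3, ← h0, ← hχ, h0, e1 p h3, h02, h0']
          by_cases h4 : w.partner (beforeCap i p) = (true, i + 1)
          · rw [h4, ← h0, ← hχ, h0, e2 p h4, h01, h0']
          rw [← e3 p h3 h4, ← h0, ← h0, hχ]
        rw [← level_insert h0 h0', ← level_insert h0 h0', ← ih.level χ₀ hχ₀ (beforeCap i p)]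
        by_cases h3 : w.partner (beforeCap i p) = (true, i)
        · rw [h3, e1 p h3, ih.level χ₀ hχ₀, level_pair h0']
        by_cases h4 : w.partner (beforeCap i p) = (true, i + 1)
        · rw [h4, e2 p h4, ih.level χ₀ hχ₀, level_pair h0']
        rw [e3 p h3 h4]

theorem Word.joined_iff {m n : ℕ} (w : Word m n) (p q : Pt) :
    w.Joined p q ↔ q = p ∨ q = w.partner p := by
  induction w generalizing p q with
  | nil =>
    obtain ⟨b, i⟩ := p
    obtain ⟨c, j⟩ := q
    cases b <;> cases c <;> simp [Joined, partner, eq_comm]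
  | @cup n w i hi ih =>
    simp only [Joined, cupRel, isNew_iff, ih, partner]
    have hp := @beforeCap_beforeCup i p
    have hq := @beforeCap_beforeCup i q
    have h1 := beforeCap_ne i (w.partner (beforeCup i p))
    have h2 := beforeCup_beforeCap i (w.partner (beforeCup i p))
    have h3 : ((true, i) : Pt) ≠ (true, i + 1) := by simp
    grind
  | @cap n w i hi ih =>
    have hpl := w.isPlanar
    simp only [Joined, capRel, ih, partner]
    have hp := beforeCap_ne i p
    have hq := beforeCap_ne i q
    have hp' := beforeCup_beforeCap i p
    have hq' := beforeCup_beforeCap i q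
    have i1 := hpl.invol (beforeCap i p)
    have i2 := hpl.invol (beforeCap i q)
    have i3 := hpl.invol (true, i)
    have i4 := hpl.invol (true, i + 1)
    have h3 : ((true, i) : Pt) ≠ (true, i + 1) := by simp
    have b1 := @beforeCap_beforeCup i (w.partner (beforeCap i p))
    have b2 := @beforeCap_beforeCup i (w.partner (true, i))
    have b3 := @beforeCap_beforeCup i (w.partner (true, i + 1))
    have n1 := hpl.ne (true, i)
    have n2 := hpl.ne (true, i + 1)
    grind

theorem Tangle.exists_isPlanar {m n : ℕ} (t : Tangle m n) :
    ∃ τ, IsPlanar m n τ ∧ ∀ p q, t.Joined p q ↔ q = p ∨ q = τ p := by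
  induction t using Quotient.inductionOn with
  | _ w => exact ⟨w.partner, w.isPlanar, w.joined_iff⟩

end UnifiedArc

/-! ### The number of merges, and counts of points under arcs -/

namespace UnifiedArc

open Equiv Equiv.Perm

/-- The number of merges among two saddles does not depend on their order. -/
def countLeaf (a b c d e f : ℕ) : Bool :=
  let T := fun x y => code a b c d e f x y false
  Nat.beq ((!cyc (T false false) 0 1).toNat + (!cyc (T true false) 2 3).toNat)
    ((!cyc (T false false) 2 3).toNat + (!cyc (T false true) 0 1).toNat)

theorem allPerms_countLeaf : allPerms countLeaf = true := by decide +kernel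

theorem sameCycle_sumCongr_inl {α β : Type*} (π : Perm α) (κ : Perm β) (a b : α) :
    SameCycle (Perm.sumCongr π κ) (.inl a) (.inl b) ↔ SameCycle π a b := by
  have (n : ℤ) : ((Perm.sumCongr π κ) ^ n) (.inl a) = Sum.inl ((π ^ n) a) := by
    have h := map_zpow (Perm.sumCongrHom α β) (π, κ) n
    simp only [Perm.sumCongrHom_apply, Prod.pow_mk] at h
    rw [← h, Perm.sumCongr_apply, Sum.map_inl]
  simp only [SameCycle, this, Sum.inl.injEq]

-- Once more the statement depends only on a first return map. Two extra fixed points fill the four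
-- ends up to six points, so that the encoding of permutations of six letters can be reused.
open Classical in
theorem count_merges_of_sameCycle {α : Type*} [Finite α] [DecidableEq α] (π : Perm α) {a a' b b' : α}
    (h : [a, a', b, b'].Nodup) :
    ((if SameCycle π a a' then 0 else 1) + (if SameCycle (π * swap a a') b b' then 0 else 1) : ℕ) =
    (if SameCycle π b b' then 0 else 1) + (if SameCycle (π * swap b b') a a' then 0 else 1) := by
  let pt : Fin 6 → α ⊕ Fin 2 := ![.inl a, .inl a', .inl b, .inl b', .inr 0, .inr 1]
  have hpt : Function.Injective pt := by
    rw [← List.nodup_ofFn]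
    simp only [List.nodup_cons, List.mem_cons, List.not_mem_nil, or_false, not_or] at h
    simp [pt, List.ofFn_succ, h]
  obtain ⟨P, hP⟩ := exists_isReturn (Perm.sumCongr π 1) hpt
  have hT (x y : Bool) (i j : Fin 6) :
      cyc (code (P 0) (P 1) (P 2) (P 3) (P 4) (P 5) x y false) i j =
        decide (SameCycle (Perm.sumCongr π 1 * flips pt x y false) (pt i) (pt j)) := by
    rw [Bool.eq_iff_iff, decide_eq_true_iff, cyc_iff _ _ (digit_code P x y false),
      (hP.mul (flips_apply hpt x y false) fun a => flips_apply_of_notMem x y false).sameCycle_iff hpt]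
  have hl := allPerms_apply allPerms_countLeaf P
  have hs (c c' : α) : (Perm.sumCongr π (1 : Perm (Fin 2))) * swap (.inl c) (.inl c') =
      Perm.sumCongr (π * swap c c') 1 := by
    rw [← Perm.sumCongr_swap_one, Perm.sumCongr_mul, one_mul]
  simp only [countLeaf, Nat.beq_eq] at hl
  have h1 := hT false false 0 1
  have h2 := hT true false 2 3
  have h3 := hT false false 2 3
  have h4 := hT false true 0 1
  simp only [Fin.isValue, Fin.val_zero, Fin.val_one, Fin.val_two,
    show ((3 : Fin 6) : ℕ) = 3 from rfl] at h1 h2 h3 h4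
  rw [h1, h2, h3, h4] at hl
  simp only [flips, cond_true, cond_false, one_mul, mul_one, pt, Matrix.cons_val_zero,
    Matrix.cons_val_one, Matrix.cons_val, hs, sameCycle_sumCongr_inl] at hl
  have hb (p : Prop) [Decidable p] : (!decide p).toNat = if p then 0 else 1 := by
    by_cases p <;> simp [*]
  simpa only [hb] using hl

/-! ### Crossingless matchings as functions on `ℕ` -/

/-- `L` is a crossingless matching of `{0, …, 2N-1}`, extended by the identity. -/
structure IsArcs (N : ℕ) (L : ℕ → ℕ) : Prop where
  invol : ∀ i, L (L i) = i
  lt : ∀ i, i < 2 * N → L i < 2 * N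
  ne : ∀ i, i < 2 * N → L i ≠ i
  fix : ∀ i, 2 * N ≤ i → L i = i
  nc : ∀ i j, i < j → j < L i → i < L j ∧ L j < L i

theorem CrossMatch.mateN_of_lt {n : ℕ} (a : CrossMatch n) {i : ℕ} (h : i < 2 * n) :
    a.mateN i = a.mate ⟨i, h⟩ := by simp [mateN, h]

theorem CrossMatch.mateN_coe {n : ℕ} (a : CrossMatch n) (i : Fin (2 * n)) :
    a.mateN i = a.mate i := by simp [mateN]

theorem CrossMatch.isArcs {n : ℕ} (a : CrossMatch n) : IsArcs n a.mateN := by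
  have hfix (i : ℕ) (h : 2 * n ≤ i) : a.mateN i = i := by simp [mateN, Nat.not_lt.mpr h]
  refine ⟨fun i => ?_, fun i h => ?_, fun i h => ?_, hfix, fun i j hij hj => ?_⟩
  · by_cases h : i < 2 * n
    · rw [a.mateN_of_lt h, a.mateN_coe, a.mate_mate]
    · rw [hfix i (by omega), hfix i (by omega)]
  · rw [a.mateN_of_lt h]; exact Fin.isLt _
  · rw [a.mateN_of_lt h]
    exact fun e => a.mate_ne ⟨i, h⟩ (Fin.ext e)
  · have hi : i < 2 * n := by
      by_contra hc
      rw [hfix i (by omega)] at hj; omega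
    rw [a.mateN_of_lt hi] at hj ⊢
    have hj' : j < 2 * n := by omega
    rw [a.mateN_of_lt hj']
    exact a.noncrossing ⟨i, hi⟩ ⟨j, hj'⟩ hij hj

namespace IsArcs
variable {N : ℕ} {L : ℕ → ℕ}

theorem sum_eq_zero (h : IsArcs N L) (s : Finset ℕ) (χ : ℕ → ZMod 2) (hs : ∀ j ∈ s, L j ∈ s)
    (hN : ∀ j ∈ s, j < 2 * N) (hχ : ∀ j ∈ s, χ (L j) = χ j) : ∑ j ∈ s, χ j = 0 :=
  Finset.sum_involution (fun j _ => L j) (fun j hj => by rw [hχ j hj, ZMod.two_add_self])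
    (fun j hj _ => h.ne j (hN j hj)) (fun j hj => hs j hj) (fun j _ => h.invol j)

/-- The points strictly below an arc are matched among themselves, so the values of `χ` at them
cancel in pairs. -/
theorem gapCount_inner (h : IsArcs N L) {χ : ℕ → ZMod 2} {i : ℕ} (hi : i < L i)
    (hχ : ∀ j, i < j → j < L i → χ (L j) = χ j) : gapCount χ (i + 1) = gapCount χ (L i) := by
  have hN : i < 2 * N := by
    by_contra hc
    rw [h.fix i (by omega)] at hi; omega
  have hN' := h.lt i hN
  have key : ∑ j ∈ Finset.Ico (i + 1) (L i), χ j = 0 := by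
    refine h.sum_eq_zero _ χ (fun j hj => ?_) (fun j hj => ?_) (fun j hj => ?_) <;>
      rw [Finset.mem_Ico] at hj
    · have := h.nc i j (by omega) (by omega)
      rw [Finset.mem_Ico]; omega
    · omega
    · exact hχ j (by omega) (by omega)
  have := Finset.sum_range_add_sum_Ico χ (show i + 1 ≤ L i by omega)
  rw [key, add_zero] at this
  exact this

/-- Taking `χ = 1` in `gapCount_inner` shows that an even number of points lies below an arc. -/
theorem parity (h : IsArcs N L) {i : ℕ} (hi : i < 2 * N) : (L i) % 2 ≠ i % 2 := by
  have key (i : ℕ) (hi : i < L i) : (L i) % 2 ≠ i % 2 := by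
    have := h.gapCount_inner (χ := fun _ => 1) hi fun _ _ _ => rfl
    simp only [gapCount, Finset.sum_const, Finset.card_range, nsmul_eq_mul, mul_one] at this
    have := (ZMod.natCast_eq_natCast_iff' _ _ 2).mp this
    omega
  rcases lt_trichotomy i (L i) with hl | he | hl
  · exact key i hl
  · exact absurd he.symm (h.ne i hi)
  · have := key (L i) (by rwa [h.invol])
    rw [h.invol] at this
    exact this.symm

/-- By `parity` the even gaps at the two ends are both outside the arc or both below it. In the
first case the ends themselves contribute twice the same value. -/
theorem gapCount_evenGap (h : IsArcs N L) {χ : ℕ → ZMod 2} {i : ℕ} (hi : i < L i)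
    (hχ : ∀ j, i ≤ j → j < L i → χ (L j) = χ j) :
    gapCount χ (evenGap (L i)) = gapCount χ (evenGap i) := by
  have hN : i < 2 * N := by
    by_contra hc
    rw [h.fix i (by omega)] at hi; omega
  have hin := h.gapCount_inner hi fun j h1 h2 => hχ j h1.le h2
  have hp := h.parity hN
  have he := hχ i le_rfl hi
  by_cases hev : i % 2 = 0
  · rw [evenGap, evenGap, if_neg (by omega), if_pos hev]
    simp only [gapCount] at hin ⊢
    rw [Finset.sum_range_succ, ← hin, Finset.sum_range_succ, he, add_assoc, ZMod.two_add_self,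
      add_zero]
  · rw [evenGap, evenGap, if_pos (by omega), if_neg hev, hin]

/-- Two rows of points which agree along the arcs `j` with `con j` and which both are unions of arcs
elsewhere have the same count at each gap that is not below an arc of the second kind. -/
theorem gapCount_congr (h : IsArcs N L) {χ χ' : ℕ → ZMod 2} {con : ℕ → Prop} {g : ℕ}
    (hg : g ≤ 2 * N) (hL : ∀ j, con (L j) ↔ con j) (hcon : ∀ j, con j → χ j = χ' j)
    (hχ : ∀ j, ¬ con j → χ (L j) = χ j) (hχ' : ∀ j, ¬ con j → χ' (L j) = χ' j)
    (henc : ∀ p, p < g → g ≤ L p → con p) : gapCount χ g = gapCount χ' g := by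
  classical
  -- The uncontracted points to the left of `g` are closed under `L`, because an arc across the gap
  -- is contracted by `henc`.
  have key : ∑ j ∈ (Finset.range g).filter (fun j => ¬ con j), (χ j + χ' j) = 0 := by
    refine h.sum_eq_zero _ _ (fun j hj => ?_) (fun j hj => ?_) (fun j hj => ?_) <;>
      rw [Finset.mem_filter, Finset.mem_range] at hj
    · rw [Finset.mem_filter, Finset.mem_range, hL]
      exact ⟨by by_contra hc; exact hj.2 (henc j hj.1 (by omega)), hj.2⟩
    · omega
    · rw [hχ j hj.2, hχ' j hj.2]
  have key2 : ∑ j ∈ Finset.range g, (χ j + χ' j) = 0 := by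
    rw [← key, Finset.sum_filter]
    refine Finset.sum_congr rfl fun j _ => ?_
    by_cases hj : con j
    · simp [hj, hcon j hj, ZMod.two_add_self]
    · simp [hj]
  rw [Finset.sum_add_distrib] at key2
  have : gapCount χ g = - gapCount χ' g := eq_neg_of_add_eq_zero_left key2
  rw [this, ZMod.neg_eq_self_mod_two]

end IsArcs

/-! ### Planar diagrams -/

/-- `D` consists of `K` strips, filled with planar matchings, which are separated by
crossingless matchings. -/
structure Diagram.IsPlanar (D : Diagram) (K : ℕ) (sz : ℕ → ℕ) (τ : ℕ → Pt → Pt) : Prop where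
  base : IsArcs (sz 0) D.base
  line : ∀ k < K, IsArcs (sz (k + 1)) (D.line k)
  planar : ∀ k < K, UnifiedArc.IsPlanar (sz k) (sz (k + 1)) (τ k)
  strip : ∀ k < K, ∀ p q, D.strip k p q ↔ q = p ∨ q = τ k p

/-- The arc at the vertex `i` of the line `k` has been contracted. -/
def Diagram.Con (D : Diagram) (S : Set Saddle) (k i : ℕ) : Prop := (k, min i (D.line k i)) ∈ S

open Classical in
/-- The other end of the elementary connection at a node which is not a strand. -/
noncomputable def Diagram.turn (D : Diagram) (S : Set Saddle) : Node → Node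
  | (0, false, i) => (0, false, D.base i)
  | (k + 1, false, i) => if D.Con S k i then (k, true, i) else (k + 1, false, D.line k i)
  | (k, true, i) => if D.Con S k i then (k + 1, false, i) else (k, true, D.line k i)

theorem Diagram.conn_turn (D : Diagram) (S : Set Saddle) (u : Node) :
    D.Conn S u (D.turn S u) := by
  obtain ⟨k, b, i⟩ := u
  cases b with
  | true =>
    by_cases h : D.Con S k i
    · simp only [turn, h, if_true]; exact .rel _ _ (.vert k i h)
    · simp only [turn, h, if_false]; exact .rel _ _ (.cap k i h)
  | false =>
    cases k with
    | zero => exact .rel _ _ (.base i)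
    | succ k =>
      by_cases h : D.Con S k i
      · simp only [turn, h, if_true]; exact .symm _ _ (.rel _ _ (.vert k i h))
      · simp only [turn, h, if_false]; exact .rel _ _ (.cup k i h)

/-- The nodes of the diagram. -/
def IsNode (K : ℕ) (sz : ℕ → ℕ) (u : Node) : Prop := u.1 < K ∧ InRange (sz u.1) (sz (u.1 + 1)) u.2

/-- All arcs contracted by the saddles in `S` separate two strips. -/
def IsInner (K : ℕ) (S : Set Saddle) : Prop := ∀ s ∈ S, s.1 + 1 < K

namespace Diagram.IsPlanar
variable {D : Diagram} {K : ℕ} {sz : ℕ → ℕ} {τ : ℕ → Pt → Pt}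

theorem con_line (hD : D.IsPlanar K sz τ) (S : Set Saddle) {k : ℕ} (hk : k < K) (i : ℕ) :
    D.Con S k (D.line k i) ↔ D.Con S k i := by
  rw [Con, Con, (hD.line k hk).invol, min_comm]

theorem turn_turn (hD : D.IsPlanar K sz τ) (S : Set Saddle) {u : Node} (hu : u.1 < K) :
    D.turn S (D.turn S u) = u := by
  obtain ⟨k, b, i⟩ := u
  have h1 := fun j => (hD.line k hu).invol j
  cases b with
  | true =>
    by_cases h : D.Con S k i
    · simp [turn, h]
    · simp [turn, h, hD.con_line S hu, h1]
  | false =>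
    cases k with
    | zero => simp [turn, hD.base.invol]
    | succ k =>
      have hk : k < K := by simp only at hu; omega
      by_cases h : D.Con S k i
      · simp [turn, h]
      · simp [turn, h, hD.con_line S hk, (hD.line k hk).invol]

theorem isNode_turn (hD : D.IsPlanar K sz τ) {S : Set Saddle} (hS : IsInner K S) {u : Node}
    (hu : IsNode K sz u) : IsNode K sz (D.turn S u) := by
  obtain ⟨k, b, i⟩ := u
  obtain ⟨hk, hr⟩ := hu
  simp only [InRange] at hk hr
  cases b with
  | true =>
    by_cases h : D.Con S k i
    · simp only [turn, h, if_true]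
      exact ⟨hS _ h, by simpa [InRange] using hr⟩
    · simp only [turn, h, if_false]
      exact ⟨hk, by simpa [InRange] using (hD.line k hk).lt i (by simpa using hr)⟩
  | false =>
    cases k with
    | zero =>
      exact ⟨hk, by simpa [InRange, turn] using hD.base.lt i (by simpa using hr)⟩
    | succ k =>
      by_cases h : D.Con S k i
      · simp only [turn, h, if_true]
        exact ⟨show k < K by omega, by simpa [InRange] using hr⟩
      · simp only [turn, h, if_false]
        exact ⟨hk, by simpa [InRange] using (hD.line k (by omega)).lt i (by simpa using hr)⟩

/-- An arc joins points of different parity on the same side, and a vertical strand joins points of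
the same parity on opposite sides. Either way, exactly one of the two ends is an in-node, which
makes the orientation consistent along circles. -/
theorem ptIn_turn (hD : D.IsPlanar K sz τ) (S : Set Saddle) {u : Node} (hu : IsNode K sz u) :
    ptIn (D.turn S u).2 = !ptIn u.2 := by
  have key {N : ℕ} {L : ℕ → ℕ} (h : IsArcs N L) (b : Bool) {i : ℕ} (hi : i < 2 * N) :
      ptIn (b, L i) = !ptIn (b, i) := by
    have := h.parity hi
    rcases Nat.mod_two_eq_zero_or_one i with h1 | h1 <;>
      rcases Nat.mod_two_eq_zero_or_one (L i) with h2 | h2 <;> cases b <;> simp_all [ptIn]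
  have key' (b : Bool) (i : ℕ) : ptIn (!b, i) = !ptIn (b, i) := by
    cases b <;> simp [ptIn]
  obtain ⟨k, b, i⟩ := u
  obtain ⟨hk, hr⟩ := hu
  simp only [InRange] at hk hr
  cases b with
  | true =>
    by_cases h : D.Con S k i
    · simp only [turn, h, if_true]; exact key' true i
    · simp only [turn, h, if_false]; exact key (hD.line k hk) _ (by simpa using hr)
  | false =>
    cases k with
    | zero => exact key hD.base _ (by simpa using hr)
    | succ k =>
      by_cases h : D.Con S k i
      · simp only [turn, h, if_true]; exact key' false i
      · simp only [turn, h, if_false]; exact key (hD.line k (by omega)) _ (by simpa using hr)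

end Diagram.IsPlanar

/-- The nodes at which a strand, with the orientation of `ptIn`, leaves its strip. -/
abbrev InNode (K : ℕ) (sz : ℕ → ℕ) : Type := {u : Node // IsNode K sz u ∧ ptIn u.2 = true}

instance (K : ℕ) (sz : ℕ → ℕ) : Finite (InNode K sz) := by
  let M := ∑ k ∈ Finset.range (K + 1), 2 * sz k
  have hM (k : ℕ) (hk : k ≤ K) : 2 * sz k ≤ M :=
    Finset.single_le_sum (f := fun k => 2 * sz k) (fun _ _ => Nat.zero_le _)
      (Finset.mem_range.mpr (by omega))
  refine Finite.of_injective (β := Fin K × Bool × Fin M)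
    (fun u => (⟨u.1.1, u.2.1.1⟩, u.1.2.1, ⟨u.1.2.2, ?_⟩)) ?_
  · obtain ⟨⟨k, b, i⟩, ⟨hk, hr⟩, -⟩ := u
    have h1 := hM k (by simp only at hk; omega)
    have h2 := hM (k + 1) hk
    simp only [InRange] at hr
    simp only
    split at hr <;> omega
  · rintro ⟨⟨k, b, i⟩, hu⟩ ⟨⟨k', b', i'⟩, hu'⟩ h
    simp only [Prod.mk.injEq, Fin.mk.injEq] at h
    obtain ⟨rfl, rfl, rfl⟩ := h
    rfl

namespace Diagram.IsPlanar
variable {D : Diagram} {K : ℕ} {sz : ℕ → ℕ} {τ : ℕ → Pt → Pt}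

theorem isNode_partner (hD : D.IsPlanar K sz τ) {u : Node} (hu : IsNode K sz u) :
    IsNode K sz (u.1, τ u.1 u.2) := ⟨hu.1, (hD.planar _ hu.1).range _ hu.2⟩

/-- The permutation of the nodes along the oriented circles. -/
noncomputable def step (hD : D.IsPlanar K sz τ) (S : Set Saddle) (hS : IsInner K S) : Perm (InNode K sz) where
  toFun u := ⟨((D.turn S u.1).1, τ (D.turn S u.1).1 (D.turn S u.1).2),
    hD.isNode_partner (hD.isNode_turn hS u.2.1), by
      rw [(hD.planar _ (hD.isNode_turn hS u.2.1).1).ptIn, hD.ptIn_turn S u.2.1, u.2.2]; rfl⟩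
  invFun u := ⟨D.turn S (u.1.1, τ u.1.1 u.1.2), hD.isNode_turn hS (hD.isNode_partner u.2.1), by
      rw [hD.ptIn_turn S (hD.isNode_partner u.2.1), (hD.planar _ u.2.1.1).ptIn, u.2.2]; rfl⟩
  left_inv u := Subtype.ext (by
    simp only [(hD.planar _ (hD.isNode_turn hS u.2.1).1).invol]
    exact hD.turn_turn S u.2.1.1)
  right_inv u := Subtype.ext (by
    simp only [hD.turn_turn S (hD.isNode_partner u.2.1).1, (hD.planar _ u.2.1.1).invol])

theorem conn_partner (hD : D.IsPlanar K sz τ) (S : Set Saddle) {u : Node} (hu : u.1 < K) :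
    D.Conn S u (u.1, τ u.1 u.2) :=
  .rel _ _ (.strand u.1 u.2 _ ((hD.strip _ hu _ _).mpr (.inr rfl)))

theorem adj_cases (hD : D.IsPlanar K sz τ) {S : Set Saddle} {u v : Node} (h : D.Adj S u v) :
    v = u ∨ v = D.turn S u ∨ (u.1 < K ∧ v = (u.1, τ u.1 u.2)) ∨ (K ≤ u.1 ∧ u.1 = v.1) := by
  cases h with
  | strand k p q h =>
    by_cases hk : k < K
    · rcases (hD.strip k hk p q).mp h with rfl | rfl
      · exact .inl rfl
      · exact .inr (.inr (.inl ⟨hk, rfl⟩))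
    · exact .inr (.inr (.inr ⟨Nat.not_lt.mp hk, rfl⟩))
  | base i => exact .inr (.inl rfl)
  | cap k i h => exact .inr (.inl (by rw [turn, if_neg (show ¬ D.Con S k i from h)]))
  | cup k i h => exact .inr (.inl (by rw [turn, if_neg (show ¬ D.Con S k i from h)]))
  | vert k i h => exact .inr (.inl (by rw [turn, if_pos (show D.Con S k i from h)]))

/-- Nodes on the same circle have the same value under a function which is invariant under the two
kinds of elementary connections. -/
theorem eq_of_conn (hD : D.IsPlanar K sz τ) {S : Set Saddle} (hS : IsInner K S) {β : Type*}
    (f : Node → β) (h₁ : ∀ u, IsNode K sz u → f (D.turn S u) = f u)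
    (h₂ : ∀ u, IsNode K sz u → f (u.1, τ u.1 u.2) = f u) {u v : Node} (h : D.Conn S u v)
    (hu : IsNode K sz u) : IsNode K sz v ∧ f v = f u := by
  classical
  -- The value `none` outside the nodes of the diagram shows at the same time that connections do
  -- not leave this set.
  let F : Node → Option β := fun u => if IsNode K sz u then some (f u) else none
  have hF : ∀ u v, D.Adj S u v → F u = F v := by
    intro u v huv
    have hout {u : Node} (h : K ≤ u.1) : F u = none := if_neg fun h' => absurd h'.1 (by omega)
    rcases hD.adj_cases huv with rfl | rfl | ⟨hk, rfl⟩ | ⟨h1, h2⟩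
    · rfl
    · by_cases hu : u.1 < K
      · by_cases hu' : IsNode K sz u
        · simp only [F, if_pos hu', if_pos (hD.isNode_turn hS hu'), h₁ u hu']
        · have : ¬ IsNode K sz (D.turn S u) := fun h => hu' (by
            have := hD.isNode_turn hS h
            rwa [hD.turn_turn S hu] at this)
          simp only [F, if_neg hu', if_neg this]
      · rw [hout (by omega)]
        obtain ⟨k, b, i⟩ := u
        have hk : K ≤ k := Nat.not_lt.mp hu
        have hc : ¬ D.Con S k i := fun h => by have := hS _ h; simp only at this; omega
        cases b with
        | true => rw [turn, if_neg hc, hout hk]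
        | false =>
          cases k with
          | zero => exact (hout hk).symm
          | succ k =>
            have hc : ¬ D.Con S k i := fun h => by have := hS _ h; simp only at this; omega
            rw [turn, if_neg hc, hout hk]
    · by_cases hu' : IsNode K sz u
      · simp only [F, if_pos hu', if_pos (hD.isNode_partner hu'), h₂ u hu']
      · have : ¬ IsNode K sz (u.1, τ u.1 u.2) := fun h => hu' (by
          have := hD.isNode_partner h
          simpa [(hD.planar _ hk).invol] using this)
        simp only [F, if_neg hu', if_neg this]
    · rw [hout h1, hout (h2 ▸ h1)]
  have key : F u = F v := by
    clear hu
    induction h with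
    | rel u v h => exact hF u v h
    | refl => rfl
    | symm _ _ _ ih => exact ih.symm
    | trans _ _ _ _ _ ih₁ ih₂ => exact ih₁.trans ih₂
  have hFu : F u = some (f u) := if_pos hu
  by_cases hv : IsNode K sz v
  · have hFv : F v = some (f v) := if_pos hv
    rw [hFu, hFv, Option.some.injEq] at key
    exact ⟨hv, key.symm⟩
  · have hFv : F v = none := if_neg hv
    rw [hFu, hFv] at key
    exact absurd key (by simp)

/-- The node where the circle through `u` arrives at the next turn. -/
noncomputable def entry (hD : D.IsPlanar K sz τ) (S : Set Saddle) (hS : IsInner K S) (u : Node)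
    (hu : IsNode K sz u) : InNode K sz :=
  if h : ptIn u.2 = true then ⟨u, hu, h⟩ else
    ⟨D.turn S u, hD.isNode_turn hS hu, by rw [hD.ptIn_turn S hu]; simpa using h⟩

theorem entry_of_ptIn (hD : D.IsPlanar K sz τ) (S : Set Saddle) (hS : IsInner K S) {u : Node}
    (hu : IsNode K sz u) (h : ptIn u.2 = true) : (hD.entry S hS u hu).1 = u := by
  unfold entry; rw [dif_pos h]

theorem entry_of_not_ptIn (hD : D.IsPlanar K sz τ) (S : Set Saddle) (hS : IsInner K S) {u : Node}
    (hu : IsNode K sz u) (h : ptIn u.2 = false) : (hD.entry S hS u hu).1 = D.turn S u := by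
  unfold entry; rw [dif_neg (by simp [h])]

theorem step_val (hD : D.IsPlanar K sz τ) (S : Set Saddle) (hS : IsInner K S) (u : InNode K sz) :
    (hD.step S hS u).1 = ((D.turn S u.1).1, τ (D.turn S u.1).1 (D.turn S u.1).2) := rfl

/-- A circle alternates between strands and turns, and the parity orientation is consistent along
it. Hence the circle meets the in-nodes in one cycle of the permutation "turn, then follow the
strand". -/
theorem conn_iff (hD : D.IsPlanar K sz τ) {S : Set Saddle} (hS : IsInner K S) (u v : InNode K sz) :
    D.Conn S u.1 v.1 ↔ SameCycle (hD.step S hS) u v := by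
  classical
  constructor
  · intro h
    -- To each node is assigned the cycle of the in-node at its next turn; both kinds of elementary
    -- connections preserve it.
    let f : Node → Option (Quotient (SameCycle.setoid (hD.step S hS))) := fun u =>
      if hu : IsNode K sz u then some (Quotient.mk _ (hD.entry S hS u hu)) else none
    have h1 (u : Node) (hu : IsNode K sz u) : f (D.turn S u) = f u := by
      have hu' := hD.isNode_turn hS hu
      have hp' := hD.ptIn_turn S hu
      have e : hD.entry S hS _ hu' = hD.entry S hS u hu := Subtype.ext (by
        cases hp : ptIn u.2 <;> rw [hp] at hp'
        · rw [hD.entry_of_ptIn S hS _ hp', hD.entry_of_not_ptIn S hS _ hp]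
        · rw [hD.entry_of_not_ptIn S hS _ hp', hD.entry_of_ptIn S hS _ hp, hD.turn_turn S hu.1])
      simp only [f, dif_pos hu, dif_pos hu', e]
    have h2 (u : Node) (hu : IsNode K sz u) : f (u.1, τ u.1 u.2) = f u := by
      have hu' := hD.isNode_partner hu
      have key (u : Node) (hu : IsNode K sz u) (hp : ptIn u.2 = true) :
          hD.step S hS (hD.entry S hS _ (hD.isNode_partner hu)) = hD.entry S hS u hu := by
        have hq : ptIn (τ u.1 u.2) = false := by rw [(hD.planar _ hu.1).ptIn, hp]; rfl
        refine Subtype.ext ?_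
        rw [hD.entry_of_ptIn S hS _ hp, hD.step_val, hD.entry_of_not_ptIn S hS _ hq,
          hD.turn_turn S (u := (u.1, τ u.1 u.2)) hu.1]
        simp only [(hD.planar _ hu.1).invol]
      simp only [f, dif_pos hu, dif_pos hu', Option.some.injEq]
      refine Quotient.sound (show SameCycle _ _ _ from ?_)
      by_cases hp : ptIn u.2 = true
      · rw [← key u hu hp]
        exact sameCycle_apply_right.mpr (SameCycle.refl _ _)
      · have hp' : ptIn (τ u.1 u.2) = true := by rw [(hD.planar _ hu.1).ptIn]; simpa using hp
        have := key _ hu' hp'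
        simp only [(hD.planar _ hu.1).invol] at this
        rw [← this]
        exact sameCycle_apply_left.mpr (SameCycle.refl _ _)
    have := (hD.eq_of_conn hS f h1 h2 h u.2.1).2
    simp only [f, dif_pos u.2.1, dif_pos v.2.1, Option.some.injEq] at this
    have := (Quotient.exact this : SameCycle _ _ _)
    have e (w : InNode K sz) : hD.entry S hS w.1 w.2.1 = w :=
      Subtype.ext (hD.entry_of_ptIn S hS _ w.2.2)
    rw [e, e] at this
    exact this.symm
  · intro h
    obtain ⟨n, rfl⟩ := h.exists_nat_pow_eq
    clear h
    induction n with
    | zero => exact .refl _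
    | succ n ih =>
      refine ih.trans _ _ _ ?_
      rw [pow_succ', Perm.mul_apply]
      set w := (hD.step S hS ^ n) u
      exact (D.conn_turn S w.1).trans _ _ _
        (hD.conn_partner S (hD.isNode_turn hS w.2.1).1)

end Diagram.IsPlanar

end UnifiedArc

/-! ### The checkerboard colouring and the arrows of saddles -/

namespace UnifiedArc

open Equiv Equiv.Perm

/-- A contracted arc is not below an arc which has not been contracted. -/
def Diagram.Nested (D : Diagram) (S : Set Saddle) : Prop :=
  ∀ k i j, i < j → j < D.line k i → D.Con S k j → D.Con S k i

/-- `x` may be contracted next, or has been contracted last on its line. -/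
def Diagram.Ready (D : Diagram) (S : Set Saddle) (x : Saddle) : Prop :=
  (∀ p, p < x.2 → x.2 < D.line x.1 p → D.Con S x.1 p) ∧
    ∀ p, x.2 < p → p < D.line x.1 x.2 → ¬ D.Con S x.1 p

/-- `x` is given by the left endpoint of an arc which separates two strips. -/
def Diagram.IsSaddle (D : Diagram) (K : ℕ) (x : Saddle) : Prop :=
  x.1 + 1 < K ∧ x.2 < D.line x.1 x.2

/-- `level` at a node. -/
def nodeLevel (χ : Node → ZMod 2) (u : Node) : ZMod 2 := level (fun p => χ (u.1, p)) u.2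

/-- The value of the counting function at one of the two gaps next to a node. -/
def sideLevel (e : Bool) (χ : Node → ZMod 2) (u : Node) : ZMod 2 :=
  nodeLevel χ u + bif e then χ u else 0

/-- The node at the tail of the arrow `x` at which the oriented circle arrives. -/
def Diagram.tailNode (D : Diagram) (x : Saddle) : Node :=
  if x.2 % 2 = 0 then (x.1, true, x.2) else (x.1, true, D.line x.1 x.2)

/-- The node at the head of the arrow `x` at which the oriented circle arrives. -/
def Diagram.headNode (D : Diagram) (x : Saddle) : Node :=
  if x.2 % 2 = 0 then (x.1 + 1, false, D.line x.1 x.2) else (x.1 + 1, false, x.2)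

/-- The colour of the region of the arrow `x`. -/
def Saddle.colour (x : Saddle) : Bool := decide (x.2 % 2 = 1)

namespace Diagram.IsPlanar
variable {D : Diagram} {K : ℕ} {sz : ℕ → ℕ} {τ : ℕ → Pt → Pt}

theorem lt_of_isSaddle (hD : D.IsPlanar K sz τ) {x : Saddle} (hx : D.IsSaddle K x) :
    x.2 < 2 * sz (x.1 + 1) ∧ D.line x.1 x.2 < 2 * sz (x.1 + 1) := by
  have h := hD.line x.1 (by have := hx.1; omega)
  have h1 : x.2 < 2 * sz (x.1 + 1) := by
    by_contra hc
    have := hx.2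
    rw [h.fix _ (by omega)] at this; omega
  exact ⟨h1, h.lt _ h1⟩

theorem _root_.UnifiedArc.Diagram.IsSaddle.con_left {S : Set Saddle} {x : Saddle} (hx : D.IsSaddle K x) :
    D.Con S x.1 x.2 ↔ x ∈ S := by
  rw [Con, min_eq_left hx.2.le]

theorem con_right (hD : D.IsPlanar K sz τ) {S : Set Saddle} {x : Saddle} (hx : D.IsSaddle K x) :
    D.Con S x.1 (D.line x.1 x.2) ↔ x ∈ S := by
  rw [hD.con_line S (by have := hx.1; omega), hx.con_left]

/-- Below an uncontracted arc everything is uncontracted, since contraction is nested, so the counts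
cancel along the arc. Along a vertical strand the counts on the two sides of the line agree by
`gapCount_congr`: every arc over a contracted one is itself contracted. -/
theorem level_turn (hD : D.IsPlanar K sz τ) {S : Set Saddle} (hN : D.Nested S)
    {χ : Node → ZMod 2} (hχ : ∀ u, χ (D.turn S u) = χ u) {u : Node} (hu : IsNode K sz u) :
    nodeLevel χ (D.turn S u) = nodeLevel χ u := by
  have cap (k j : ℕ) (h : ¬ D.Con S k j) : χ (k, true, D.line k j) = χ (k, true, j) := by
    simpa [turn, h] using hχ (k, true, j)
  have cup (k j : ℕ) (h : ¬ D.Con S k j) : χ (k + 1, false, D.line k j) = χ (k + 1, false, j) := by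
    simpa [turn, h] using hχ (k + 1, false, j)
  have arcs {N : ℕ} {L : ℕ → ℕ} (h : IsArcs N L) (χ : ℕ → ZMod 2) {i : ℕ} (hi : i < 2 * N)
      (hχ : ∀ p j, (p = i ∨ p = L i) → p ≤ j → j < L p → χ (L j) = χ j) :
      gapCount χ (evenGap (L i)) = gapCount χ (evenGap i) := by
    rcases lt_trichotomy i (L i) with hl | he | hl
    · exact h.gapCount_evenGap hl fun j => hχ i j (.inl rfl)
    · exact absurd he.symm (h.ne i hi)
    · have := h.gapCount_evenGap (χ := χ) (i := L i) (by rwa [h.invol]) fun j => hχ _ j (.inr rfl)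
      rw [h.invol] at this
      exact this.symm
  have unc {k i : ℕ} (hk : k < K) (hi : ¬ D.Con S k i) (p j : ℕ) (hp : p = i ∨ p = D.line k i)
      (h1 : p ≤ j) (h2 : j < D.line k p) : ¬ D.Con S k j := by
    have hp' : ¬ D.Con S k p := by
      rcases hp with rfl | rfl
      · exact hi
      · rwa [hD.con_line S hk]
    rcases h1.eq_or_lt with rfl | h1
    · exact hp'
    · exact fun hj => hp' (hN k p j h1 h2 hj)
  have vert {k i : ℕ} (hk : k < K) (hi : D.Con S k i) (hi' : i < 2 * sz (k + 1)) :
      gapCount (fun j => χ (k, true, j)) (evenGap i) =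
        gapCount (fun j => χ (k + 1, false, j)) (evenGap i) := by
    have h1 : i ≤ evenGap i ∧ evenGap i ≤ i + 1 ∧ (evenGap i ≤ 2 * sz (k + 1)) := by
      simp only [evenGap]; grind
    refine (hD.line k hk).gapCount_congr h1.2.2 (con := D.Con S k) (hD.con_line S hk)
      (fun j hj => ?_) (cap k) (cup k) (fun p hp hp' => ?_)
    · simpa [turn, hj] using (hχ (k, true, j)).symm
    · rcases (show p ≤ i by omega).eq_or_lt with rfl | hpi
      · exact hi
      rcases (show i ≤ D.line k p by omega).eq_or_lt with he | hlt
      · rw [← hD.con_line S hk, ← he]; exact hi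
      · exact hN k p i hpi hlt hi
  obtain ⟨k, b, i⟩ := u
  obtain ⟨hk, hr⟩ := hu
  simp only [InRange] at hk hr
  cases b with
  | true =>
    have hr : i < 2 * sz (k + 1) := by simpa using hr
    by_cases h : D.Con S k i
    · simp only [turn, h, if_true, nodeLevel, level]
      exact (vert hk h hr).symm
    · simp only [turn, h, if_false, nodeLevel, level]
      exact arcs (hD.line k hk) (fun j => χ (k, true, j)) hr fun p j hp h1 h2 =>
        cap k j (unc hk h p j hp h1 h2)
  | false =>
    cases k with
    | zero =>
      exact arcs hD.base (fun j => χ (0, false, j)) (by simpa using hr) fun p j _ _ _ =>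
        hχ (0, false, j)
    | succ k =>
      have hr : i < 2 * sz (k + 1) := by simpa using hr
      have hk : k < K := by omega
      by_cases h : D.Con S k i
      · simp only [turn, h, if_true, nodeLevel, level]
        exact vert hk h hr
      · simp only [turn, h, if_false, nodeLevel, level]
        exact arcs (hD.line k hk) (fun j => χ (k + 1, false, j)) hr fun p j hp h1 h2 =>
          cup k j (unc hk h p j hp h1 h2)

theorem isNode_tail (hD : D.IsPlanar K sz τ) {x : Saddle} (hx : D.IsSaddle K x) :
    IsNode K sz (x.1, true, x.2) ∧ IsNode K sz (x.1, true, D.line x.1 x.2) ∧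
    IsNode K sz (x.1 + 1, false, x.2) ∧ IsNode K sz (x.1 + 1, false, D.line x.1 x.2) := by
  have h := hD.lt_of_isSaddle hx
  have h1 := hx.1
  have h2 : x.1 < K := by omega
  refine ⟨⟨h2, ?_⟩, ⟨h2, ?_⟩, ⟨h1, ?_⟩, ⟨h1, ?_⟩⟩ <;> simp [InRange, h]

/-- The arrow of `x` stays within one region, and `e` selects the side of the circle on which this
region lies: adding `χ u` crosses the strand at `u`. Before the saddle the region is entered through
the gap to the left of the left endpoint, where the counts on the two sides of the line agree
because all arcs around `x` have been contracted. After the saddle it is the region between the two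
vertical strands, where nothing else has been contracted. -/
theorem sideLevel_saddle (hD : D.IsPlanar K sz τ) {S : Set Saddle} (hN : D.Nested S)
    {χ : Node → ZMod 2} (hχ : ∀ u, χ (D.turn S u) = χ u) {x : Saddle} (hx : D.IsSaddle K x)
    (hR : D.Ready S x) {e : Bool} (he : e = true ↔ ¬ (x ∈ S ↔ x.colour = true)) :
    sideLevel e χ (D.tailNode x) = sideLevel e χ (D.headNode x) := by
  obtain ⟨n1, n2, n3, n4⟩ := hD.isNode_tail hx
  have hk : x.1 < K := n1.1
  have harc := hD.line x.1 hk
  have hlt := hD.lt_of_isSaddle hx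
  have hpar := harc.parity hlt.1
  have turnL (u : Node) (hu : IsNode K sz u) :
      sideLevel e χ (D.turn S u) = sideLevel e χ u := by
    rw [sideLevel, sideLevel, hD.level_turn hN hχ hu, hχ]
  have hi := hx.con_left (S := S)
  have hj := hD.con_right (S := S) hx
  have cap (j : ℕ) (h : ¬ D.Con S x.1 j) : χ (x.1, true, D.line x.1 j) = χ (x.1, true, j) := by
    simpa [turn, h] using hχ (x.1, true, j)
  have cup (j : ℕ) (h : ¬ D.Con S x.1 j) :
      χ (x.1 + 1, false, D.line x.1 j) = χ (x.1 + 1, false, j) := by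
    simpa [turn, h] using hχ (x.1 + 1, false, j)
  by_cases hS : x ∈ S
  · have hhead : sideLevel e χ (x.1 + 1, false, D.line x.1 x.2) =
        sideLevel e χ (x.1, true, D.line x.1 x.2) := by
      simpa [turn, hj.mpr hS] using turnL _ n2
    have hhead' : sideLevel e χ (x.1 + 1, false, x.2) = sideLevel e χ (x.1, true, x.2) := by
      simpa [turn, hi.mpr hS] using turnL _ n1
    have hin := harc.gapCount_inner (χ := fun j => χ (x.1, true, j)) hx.2
      fun j h1 h2 => cap j (hR.2 j h1 h2)
    simp only [hS, true_iff] at he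
    by_cases hev : x.2 % 2 = 0
    · have he : e = true := he.mpr (by simp [Saddle.colour, hev])
      rw [tailNode, headNode, if_pos hev, if_pos hev, hhead]
      simp only [sideLevel, nodeLevel, level, he, cond_true, evenGap, if_pos hev,
        if_neg (show ¬ D.line x.1 x.2 % 2 = 0 by omega)]
      simp only [gapCount, Finset.sum_range_succ] at hin ⊢
      rw [hin, add_assoc, ZMod.two_add_self, add_zero]
    · have he : e = false := by
        rw [← Bool.not_eq_true, he]; simp [Saddle.colour]; omega
      rw [tailNode, headNode, if_neg hev, if_neg hev, hhead']
      simp only [sideLevel, nodeLevel, level, he, cond_false, add_zero, evenGap, if_neg hev,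
        if_pos (show D.line x.1 x.2 % 2 = 0 by omega)]
      exact hin.symm
  · have hg : gapCount (fun j => χ (x.1, true, j)) x.2 =
        gapCount (fun j => χ (x.1 + 1, false, j)) x.2 := by
      refine harc.gapCount_congr hlt.1.le (con := D.Con S x.1) (hD.con_line S hk)
        (fun j hj => ?_) cap cup (fun p hp hp' => ?_)
      · simpa [turn, hj] using (hχ (x.1, true, j)).symm
      · refine hR.1 p hp (lt_of_le_of_ne hp' fun h => ?_)
        have h1 := harc.invol p
        have h2 := hx.2
        rw [← h] at h1
        omega
    have hbase : sideLevel e χ (x.1, true, x.2) = sideLevel e χ (x.1 + 1, false, x.2) := by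
      simp only [hS, false_iff, not_not] at he
      by_cases hev : x.2 % 2 = 0
      · have he : e = false := by
          rw [← Bool.not_eq_true, he]; simp [Saddle.colour, hev]
        simp only [sideLevel, nodeLevel, level, he, cond_false, add_zero, evenGap, if_pos hev]
        exact hg
      · have he : e = true := he.mpr (by simp [Saddle.colour]; omega)
        simp only [sideLevel, nodeLevel, level, he, cond_true, evenGap, if_neg hev]
        simp only [gapCount, Finset.sum_range_succ] at hg ⊢
        rw [hg, add_assoc, add_assoc, ZMod.two_add_self, ZMod.two_add_self]
    by_cases hev : x.2 % 2 = 0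
    · rw [tailNode, headNode, if_pos hev, if_pos hev, hbase]
      simpa [turn, mt hi.mp hS] using (turnL _ n3).symm
    · rw [tailNode, headNode, if_neg hev, if_neg hev, ← hbase]
      simpa [turn, mt hi.mp hS] using turnL _ n1

theorem nodeLevel_eq_of_conn (hD : D.IsPlanar K sz τ) {S : Set Saddle} (hS : IsInner K S)
    (hN : D.Nested S) {χ : Node → ZMod 2} (hχ : ∀ u v, D.Conn S u v → χ v = χ u) {u v : Node}
    (h : D.Conn S u v) (hu : IsNode K sz u) : nodeLevel χ v = nodeLevel χ u := by
  refine (hD.eq_of_conn hS (nodeLevel χ) (fun u hu => ?_) (fun u hu => ?_) h hu).2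
  · exact hD.level_turn hN (fun u => hχ _ _ (D.conn_turn S u)) hu
  · exact (hD.planar u.1 hu.1).level (fun p => χ (u.1, p))
      (fun p => hχ _ _ (hD.conn_partner S (u := (u.1, p)) hu.1)) u.2

theorem isNode_tailNode (hD : D.IsPlanar K sz τ) {x : Saddle} (hx : D.IsSaddle K x) :
    IsNode K sz (D.tailNode x) ∧ IsNode K sz (D.headNode x) := by
  obtain ⟨n1, n2, n3, n4⟩ := hD.isNode_tail hx
  rw [tailNode, headNode]
  split
  exacts [⟨n1, n4⟩, ⟨n2, n3⟩]

/-- Two arrows in regions of different colours do not join the same two circles. -/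
theorem not_joinSame (hD : D.IsPlanar K sz τ) {S : Set Saddle} (hS : IsInner K S)
    (hN : D.Nested S) {x y : Saddle} (hx : D.IsSaddle K x) (hy : D.IsSaddle K y)
    (hRx : D.Ready S x) (hRy : D.Ready S y) {e f : Bool}
    (he : e = true ↔ ¬ (x ∈ S ↔ x.colour = true)) (hf : f = true ↔ ¬ (y ∈ S ↔ y.colour = true))
    (hef : e ≠ f) (hxx : ¬ D.Conn S (D.tailNode x) (D.headNode x))
    (hxy : (D.Conn S (D.tailNode x) (D.tailNode y) ∧ D.Conn S (D.headNode x) (D.headNode y)) ∨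
      (D.Conn S (D.tailNode x) (D.headNode y) ∧ D.Conn S (D.headNode x) (D.tailNode y))) :
    False := by
  classical
  -- With `χ` the indicator of the circle at the tail of `x`, let `p` and `q` be the constant levels
  -- along this circle and along the one at the head. The arrow `x` gives `p + e = q`, and the arrow
  -- `y`, in either direction, gives `p + f = q`. Hence `e = f`.
  let χ : Node → ZMod 2 := fun u => if D.Conn S (D.tailNode x) u then 1 else 0
  have hχ (u v : Node) (h : D.Conn S u v) : χ v = χ u := by
    have : D.Conn S (D.tailNode x) v ↔ D.Conn S (D.tailNode x) u :=
      ⟨fun h' => h'.trans _ _ _ (h.symm _ _), fun h' => h'.trans _ _ _ h⟩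
    simp only [χ, this]
  have hχ' (u : Node) : χ (D.turn S u) = χ u := hχ _ _ (D.conn_turn S u)
  have h1 : χ (D.tailNode x) = 1 := if_pos (.refl _)
  have h2 : χ (D.headNode x) = 0 := if_neg hxx
  have lx := hD.sideLevel_saddle hN hχ' hx hRx he
  have ly := hD.sideLevel_saddle hN hχ' hy hRy hf
  have nx := hD.isNode_tailNode hx
  have h10 : (1 : ZMod 2) ≠ 0 := one_ne_zero
  have key (u v : Node) (hu : D.Conn S (D.tailNode x) u) (hv : D.Conn S (D.headNode x) v)
      (h : sideLevel f χ u = sideLevel f χ v) : False := by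
    have cu := hχ _ _ hu
    have cv := hχ _ _ hv
    have lu := hD.nodeLevel_eq_of_conn hS hN hχ hu nx.1
    have lv := hD.nodeLevel_eq_of_conn hS hN hχ hv nx.2
    simp only [sideLevel, lu, lv, cu, cv, h1, h2] at lx h
    cases e <;> cases f <;> simp_all
  rcases hxy with ⟨h3, h4⟩ | ⟨h3, h4⟩
  · exact key _ _ h3 h4 ly
  · exact key _ _ h3 h4 ly.symm

end Diagram.IsPlanar

/-! ### Saddles as transpositions, and the hexagon identity -/

namespace Diagram.IsPlanar
variable {D : Diagram} {K : ℕ} {sz : ℕ → ℕ} {τ : ℕ → Pt → Pt}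

theorem con_insert (hD : D.IsPlanar K sz τ) {S : Set Saddle} {x : Saddle} (hx : D.IsSaddle K x)
    (k j : ℕ) : D.Con (insert x S) k j ↔
      (k = x.1 ∧ (j = x.2 ∨ j = D.line x.1 x.2)) ∨ D.Con S k j := by
  have h := (hD.line x.1 (by have := hx.1; omega)).invol
  have hlt := hx.2
  simp only [Con, Set.mem_insert_iff]
  refine or_congr_left ?_
  constructor
  · intro e
    have e1 : k = x.1 := congrArg Prod.fst e
    have e2 : min j (D.line k j) = x.2 := congrArg Prod.snd e
    refine ⟨e1, ?_⟩
    subst e1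
    rcases min_choice j (D.line x.1 j) with h' | h' <;> rw [h'] at e2
    · exact .inl e2
    · exact .inr (by rw [← e2, h])
  · rintro ⟨rfl, rfl | rfl⟩
    · rw [min_eq_left hlt.le]
    · rw [h, min_eq_right hlt.le]

theorem ptIn_tailNode (hD : D.IsPlanar K sz τ) {x : Saddle} (hx : D.IsSaddle K x) :
    ptIn (D.tailNode x).2 = true ∧ ptIn (D.headNode x).2 = true := by
  have hp := (hD.line x.1 (by have := hx.1; omega)).parity (hD.lt_of_isSaddle hx).1
  rw [tailNode, headNode]
  by_cases h : x.2 % 2 = 0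
  · rw [if_pos h, if_pos h]; simp [ptIn, h]; omega
  · rw [if_neg h, if_neg h]; simp [ptIn]; omega

def tailIn (hD : D.IsPlanar K sz τ) {x : Saddle} (hx : D.IsSaddle K x) : InNode K sz :=
  ⟨D.tailNode x, (hD.isNode_tailNode hx).1, (hD.ptIn_tailNode hx).1⟩

def headIn (hD : D.IsPlanar K sz τ) {x : Saddle} (hx : D.IsSaddle K x) : InNode K sz :=
  ⟨D.headNode x, (hD.isNode_tailNode hx).2, (hD.ptIn_tailNode hx).2⟩

theorem isInner_insert {S : Set Saddle} (hS : IsInner K S) {x : Saddle} (hx : D.IsSaddle K x) :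
    IsInner K (insert x S) := fun _ hs => (Set.mem_insert_iff.mp hs).elim (fun e => e ▸ hx.1) (hS _)

-- Surgery exchanges the continuations of the two oriented arcs which meet at the saddle, and it
-- does not alter the turn at any other in-node. So the permutation is multiplied on the right by
-- the transposition of the tail and the head.
open Classical in
theorem step_insert (hD : D.IsPlanar K sz τ) {S : Set Saddle} (hS : IsInner K S) {x : Saddle}
    (hx : D.IsSaddle K x) (hxS : x ∉ S) :
    hD.step (insert x S) (isInner_insert hS hx) = hD.step S hS * Equiv.swap (hD.tailIn hx) (hD.headIn hx) := by
  have hk : x.1 < K := by have := hx.1; omega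
  have h := (hD.line x.1 hk).invol
  have hp := (hD.line x.1 hk).parity (hD.lt_of_isSaddle hx).1
  have c1 : ¬ D.Con S x.1 x.2 := mt hx.con_left.mp hxS
  have c2 : ¬ D.Con S x.1 (D.line x.1 x.2) := mt (hD.con_right hx).mp hxS
  have d1 : D.Con (insert x S) x.1 x.2 := (hD.con_insert hx _ _).mpr (.inl ⟨rfl, .inl rfl⟩)
  have d2 : D.Con (insert x S) x.1 (D.line x.1 x.2) :=
    (hD.con_insert hx _ _).mpr (.inl ⟨rfl, .inr rfl⟩)
  have key (u : InNode K sz) : D.turn (insert x S) u.1 =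
      D.turn S (Equiv.swap (hD.tailIn hx) (hD.headIn hx) u).1 := by
    by_cases h1 : u = hD.tailIn hx
    · rw [h1, swap_apply_left]
      simp only [tailIn, headIn, tailNode, headNode]
      split <;> simp [turn, c1, c2, d1, d2, h]
    by_cases h2 : u = hD.headIn hx
    · rw [h2, swap_apply_right]
      simp only [tailIn, headIn, tailNode, headNode]
      split <;> simp [turn, c1, c2, d1, d2, h]
    rw [swap_apply_of_ne_of_ne h1 h2]
    obtain ⟨⟨k, b, i⟩, hn, hu⟩ := u
    have h1' : (k, b, i) ≠ D.tailNode x := fun e => h1 (Subtype.ext e)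
    have h2' : (k, b, i) ≠ D.headNode x := fun e => h2 (Subtype.ext e)
    simp only [tailNode, headNode] at h1' h2'
    simp only [ptIn] at hu
    cases b with
    | true =>
      have : D.Con (insert x S) k i ↔ D.Con S k i := by
        rw [hD.con_insert hx]
        refine or_iff_right ?_
        rintro ⟨rfl, rfl | rfl⟩
        · rw [if_pos (by simpa using hu)] at h1'; exact h1' rfl
        · have : D.line x.1 x.2 % 2 = 0 := by simpa using hu
          rw [if_neg (by omega)] at h1'; exact h1' rfl
      simp only [turn, this]
    | false =>
      cases k with
      | zero => rfl
      | succ k =>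
        have : D.Con (insert x S) k i ↔ D.Con S k i := by
          rw [hD.con_insert hx]
          refine or_iff_right ?_
          rintro ⟨rfl, rfl | rfl⟩
          · rw [if_neg (by simpa using hu)] at h2'; exact h2' rfl
          · have : D.line x.1 x.2 % 2 = 1 := by simpa using hu
            rw [if_pos (by omega)] at h2'; exact h2' rfl
        simp only [turn, this]
  refine Equiv.ext fun u => Subtype.ext ?_
  rw [Perm.mul_apply, step_val, step_val, key]

theorem conn_tail {S : Set Saddle} {x : Saddle} (hx : D.IsSaddle K x)
    (hxS : x ∉ S) : D.Conn S (x.1, true, x.2) (D.tailNode x) ∧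
      D.Conn S (x.1 + 1, false, x.2) (D.headNode x) := by
  have c1 : ¬ D.Con S x.1 x.2 := mt hx.con_left.mp hxS
  rw [tailNode, headNode]
  split
  · exact ⟨.refl _, .rel _ _ (.cup _ _ c1)⟩
  · exact ⟨.rel _ _ (.cap _ _ c1), .refl _⟩

/-- The rule for a circle split and merged again refers to the right end of the first arc. For an
odd left endpoint this right end is itself the node `D.tailNode x`; for an even one it is joined by
the new vertical strand to `D.headNode x`. -/
theorem conn_rightEnd (hD : D.IsPlanar K sz τ) {S : Set Saddle} {x : Saddle} (hx : D.IsSaddle K x)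
    (hxS : x ∈ S) : D.Conn S (x.1, true, D.line x.1 x.2)
      (bif x.colour then D.tailNode x else D.headNode x) := by
  rw [tailNode, headNode, Saddle.colour]
  by_cases h : x.2 % 2 = 0
  · rw [if_pos h, if_pos h, decide_eq_false (by omega)]
    exact .rel _ _ (.vert _ _ ((hD.con_right hx).mpr hxS))
  · rw [if_neg h, if_neg h, decide_eq_true (by omega)]
    exact .refl _

theorem conn_congr {S : Set Saddle} {u v u' v' : Node} (hu : D.Conn S u u') (hv : D.Conn S v v') :
    D.Conn S u v ↔ D.Conn S u' v' :=
  ⟨fun h => (hu.symm _ _).trans _ _ _ (h.trans _ _ _ hv),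
    fun h => hu.trans _ _ _ (h.trans _ _ _ (hv.symm _ _))⟩

theorem isMerge_iff {S : Set Saddle} {x : Saddle} (hx : D.IsSaddle K x)
    (hxS : x ∉ S) : D.IsMerge S x ↔ ¬ D.Conn S (D.tailNode x) (D.headNode x) :=
  not_congr (conn_congr (conn_tail hx hxS).1 (conn_tail hx hxS).2)

theorem swap_eq (hD : D.IsPlanar K sz τ) {S : Set Saddle} {x y : Saddle} (hx : D.IsSaddle K x)
    (hy : D.IsSaddle K y) (hxS : x ∉ S) (hyS : y ∉ S) (hxy : x ≠ y) :
    D.swap S x y = swapUnit (¬ D.Conn S (D.tailNode x) (D.headNode x))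
      (¬ D.Conn (insert x S) (D.tailNode y) (D.headNode y))
      (¬ D.Conn S (D.tailNode y) (D.headNode y))
      (D.Conn S (D.tailNode x) (D.tailNode y))
      (D.Conn (insert x S) (bif x.colour then D.tailNode x else D.headNode x) (D.tailNode y)) := by
  have hy' : y ∉ insert x S := by simp [hyS, hxy.symm]
  rw [← propext (isMerge_iff hx hxS), ← propext (isMerge_iff hy hy'),
    ← propext (isMerge_iff hy hyS), ← propext (conn_congr (conn_tail hx hxS).1 (conn_tail hy hyS).1),
    ← propext (conn_congr (hD.conn_rightEnd hx (Set.mem_insert x S)) (conn_tail hy hy').1)]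
  rfl

theorem nested_insert (hD : D.IsPlanar K sz τ) {S : Set Saddle} (hN : D.Nested S) {x : Saddle}
    (hx : D.IsSaddle K x) (hR : D.Ready S x) : D.Nested (insert x S) := by
  intro k i j hij hj hc
  rw [hD.con_insert hx] at hc ⊢
  have h := hD.line x.1 (by have := hx.1; omega)
  rcases hc with ⟨rfl, rfl | rfl⟩ | hc
  · exact .inr (hR.1 i hij hj)
  · rcases lt_trichotomy i x.2 with h1 | h1 | h1
    · refine .inr (hR.1 i h1 (hx.2.trans hj))
    · exact .inl ⟨rfl, .inl h1⟩
    · have := h.nc x.2 i h1 hij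
      omega
  · exact .inr (hN k i j hij hj hc)

theorem ready_insert (hD : D.IsPlanar K sz τ) {S : Set Saddle} {x y : Saddle}
    (hx : D.IsSaddle K x) (hR : D.Ready S y) (hxy : x.1 ≠ y.1) : D.Ready (insert x S) y := by
  refine ⟨fun p h1 h2 => (hD.con_insert hx _ _).mpr (.inr (hR.1 p h1 h2)), fun p h1 h2 hc => ?_⟩
  rw [hD.con_insert hx] at hc
  rcases hc with ⟨h, -⟩ | hc
  · exact hxy h.symm
  · exact hR.2 p h1 h2 hc

theorem ready_insert_self (hD : D.IsPlanar K sz τ) {S : Set Saddle} {x : Saddle}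
    (hx : D.IsSaddle K x) (hR : D.Ready S x) : D.Ready (insert x S) x := by
  refine ⟨fun p h1 h2 => (hD.con_insert hx _ _).mpr (.inr (hR.1 p h1 h2)), fun p h1 h2 hc => ?_⟩
  rw [hD.con_insert hx] at hc
  rcases hc with ⟨-, h | h⟩ | hc
  · omega
  · omega
  · exact hR.2 p h1 h2 hc

/-- Adjoin a saddle if a flag is set. -/
def _root_.UnifiedArc.addIf (b : Bool) (x : Saddle) (S : Set Saddle) : Set Saddle :=
  bif b then insert x S else S

theorem _root_.UnifiedArc.mem_addIf_of_ne {b : Bool} {x y : Saddle} {S : Set Saddle} (h : y ≠ x) :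
    y ∈ addIf b x S ↔ y ∈ S := by
  cases b <;> simp [addIf, h]

theorem _root_.UnifiedArc.mem_addIf_self {b : Bool} {x : Saddle} {S : Set Saddle} (h : x ∉ S) :
    x ∈ addIf b x S ↔ b = true := by
  cases b <;> simp [addIf, h]

theorem isInner_addIf {S : Set Saddle} (hS : IsInner K S) {x : Saddle} (hx : D.IsSaddle K x)
    (b : Bool) : IsInner K (addIf b x S) := by
  cases b
  exacts [hS, isInner_insert hS hx]

theorem nested_addIf (hD : D.IsPlanar K sz τ) {S : Set Saddle} (hN : D.Nested S) {x : Saddle}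
    (hx : D.IsSaddle K x) (hR : D.Ready S x) (b : Bool) : D.Nested (addIf b x S) := by
  cases b
  exacts [hN, hD.nested_insert hN hx hR]

theorem ready_addIf (hD : D.IsPlanar K sz τ) {S : Set Saddle} {x y : Saddle}
    (hx : D.IsSaddle K x) (hR : D.Ready S y) (hxy : x.1 ≠ y.1) (b : Bool) :
    D.Ready (addIf b x S) y := by
  cases b
  exacts [hR, hD.ready_insert hx hR hxy]

theorem ready_addIf_self (hD : D.IsPlanar K sz τ) {S : Set Saddle} {x : Saddle}
    (hx : D.IsSaddle K x) (hR : D.Ready S x) (b : Bool) : D.Ready (addIf b x S) x := by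
  cases b
  exacts [hR, hD.ready_insert_self hx hR]

open Classical in
theorem step_addIf (hD : D.IsPlanar K sz τ) {S : Set Saddle} (hS : IsInner K S) {x : Saddle}
    (hx : D.IsSaddle K x) (hxS : x ∉ S) (b : Bool) :
    hD.step (addIf b x S) (isInner_addIf hS hx b) =
      hD.step S hS * (bif b then Equiv.swap (hD.tailIn hx) (hD.headIn hx) else 1) := by
  cases b
  · simp [addIf]
  · exact hD.step_insert hS hx hxS

theorem tailNode_fst (x : Saddle) : (D.tailNode x).1 = x.1 ∧ (D.tailNode x).2.1 = true ∧
    (D.headNode x).1 = x.1 + 1 ∧ (D.headNode x).2.1 = false := by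
  rw [tailNode, headNode]
  split <;> simp

/-- Coherence of the commutation units of three saddles. -/
theorem hexagon (hD : D.IsPlanar K sz τ) {S : Set Saddle} (hS : IsInner K S) (hN : D.Nested S)
    {x y z : Saddle} (hx : D.IsSaddle K x) (hy : D.IsSaddle K y) (hz : D.IsSaddle K z)
    (hxy : x.1 ≠ y.1) (hxz : x.1 ≠ z.1) (hyz : y.1 ≠ z.1) (hxS : x ∉ S) (hyS : y ∉ S) (hzS : z ∉ S)
    (hRx : D.Ready S x) (hRy : D.Ready S y) (hRz : D.Ready S z) :
    D.swap S x y * D.swap (insert y S) x z * D.swap S y z =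
      D.swap (insert x S) y z * D.swap S x z * D.swap (insert z S) x y := by
  classical
  have nxy : x ≠ y := fun e => hxy (congrArg Prod.fst e)
  have nxz : x ≠ z := fun e => hxz (congrArg Prod.fst e)
  have nyz : y ≠ z := fun e => hyz (congrArg Prod.fst e)
  let pt : Fin 6 → InNode K sz := ![hD.tailIn hx, hD.headIn hx, hD.tailIn hy, hD.headIn hy,
    hD.tailIn hz, hD.headIn hz]
  have hpt : Function.Injective pt := by
    have tx := tailNode_fst (D := D) x
    have ty := tailNode_fst (D := D) y
    have tz := tailNode_fst (D := D) z
    have key (u v : Node) (h : u.1 ≠ v.1 ∨ u.2.1 ≠ v.2.1) : u ≠ v := by rintro rfl; simp at h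
    rw [← List.nodup_ofFn]
    change [hD.tailIn hx, hD.headIn hx, hD.tailIn hy, hD.headIn hy, hD.tailIn hz, hD.headIn hz].Nodup
    simp only [List.nodup_cons, List.mem_cons, List.not_mem_nil, or_false, not_or, tailIn, headIn,
      Subtype.mk.injEq]
    refine ⟨⟨key _ _ ?_, key _ _ ?_, key _ _ ?_, key _ _ ?_, key _ _ ?_⟩,
      ⟨key _ _ ?_, key _ _ ?_, key _ _ ?_, key _ _ ?_⟩, ⟨key _ _ ?_, key _ _ ?_, key _ _ ?_⟩,
      ⟨key _ _ ?_, key _ _ ?_⟩, key _ _ ?_, by simp, List.nodup_nil⟩ <;>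
      simp [tx, ty, tz, hxy, hxz, hyz]
  let T : Bool → Bool → Bool → Set Saddle := fun a b c => addIf c z (addIf b y (addIf a x S))
  let r : Bool → Bool → Bool → Fin 6 → Fin 6 → Prop := fun a b c i j =>
    D.Conn (T a b c) (pt i).1 (pt j).1
  have i1 (a : Bool) := isInner_addIf hS hx a
  have i2 (a b : Bool) := isInner_addIf (i1 a) hy b
  have i3 (a b c : Bool) := isInner_addIf (i2 a b) hz c
  have m1 (a : Bool) : y ∉ addIf a x S := by rwa [mem_addIf_of_ne nxy.symm]
  have m2 (a b : Bool) : z ∉ addIf b y (addIf a x S) := by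
    rwa [mem_addIf_of_ne nyz.symm, mem_addIf_of_ne nxz.symm]
  have hr (a b c : Bool) (i j : Fin 6) : r a b c i j ↔
      SameCycle (hD.step S hS * flips pt a b c) (pt i) (pt j) := by
    have : hD.step S hS * flips pt a b c = hD.step (T a b c) (i3 a b c) := by
      simp only [T]
      rw [hD.step_addIf (i2 a b) hz (m2 a b), hD.step_addIf (i1 a) hy (m1 a),
        hD.step_addIf hS hx hxS, mul_assoc, mul_assoc, flips, mul_assoc]
      rfl
    rw [this, ← hD.conn_iff (i3 a b c)]
  have memx (a b c : Bool) : x ∈ T a b c ↔ a = true := by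
    rw [mem_addIf_of_ne nxz, mem_addIf_of_ne nxy, mem_addIf_self hxS]
  have memy (a b c : Bool) : y ∈ T a b c ↔ b = true := by
    rw [mem_addIf_of_ne nyz, mem_addIf_self (m1 a)]
  have memz (a b c : Bool) : z ∈ T a b c ↔ c = true := mem_addIf_self (m2 a b)
  have hRy' (a : Bool) := hD.ready_addIf hx hRy hxy a
  have hRz' (a b : Bool) := hD.ready_addIf hy (hD.ready_addIf hx hRz hxz a) hyz b
  have hNT (a b c : Bool) : D.Nested (T a b c) :=
    hD.nested_addIf (hD.nested_addIf (hD.nested_addIf hN hx hRx a) hy (hRy' a) b) hz (hRz' a b) c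
  have rx (a b c : Bool) : D.Ready (T a b c) x :=
    hD.ready_addIf hz (hD.ready_addIf hy (hD.ready_addIf_self hx hRx a) hxy.symm b) hxz.symm c
  have ry (a b c : Bool) : D.Ready (T a b c) y :=
    hD.ready_addIf hz (hD.ready_addIf_self hy (hRy' a) b) hyz.symm c
  have rz (a b c : Bool) : D.Ready (T a b c) z := hD.ready_addIf_self hz (hRz' a b) c
  have col (w : Saddle) (a : Bool) (P : Prop) (h : P ↔ a = true) :
      (a ^^ w.colour) = true ↔ ¬ (P ↔ w.colour = true) := by
    rw [h]; cases a <;> cases w.colour <;> simp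
  -- In each of the eight states the contracted arcs are nested and the three saddles are ready, so
  -- the checkerboard obstruction applies. Performing a saddle moves its arrow into a region of the
  -- other colour, hence the exclusive or with the flag.
  have hJ (a b c : Bool) : ((a ^^ x.colour) ≠ (b ^^ y.colour) → ¬ JoinSame (r a b c) 0 1 2 3) ∧
      ((a ^^ x.colour) ≠ (c ^^ z.colour) → ¬ JoinSame (r a b c) 0 1 4 5) ∧
      ((b ^^ y.colour) ≠ (c ^^ z.colour) → ¬ JoinSame (r a b c) 2 3 4 5) :=
    ⟨fun hne hj => hD.not_joinSame (i3 a b c) (hNT a b c) hx hy (rx a b c) (ry a b c)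
        (col x a _ (memx a b c)) (col y b _ (memy a b c)) hne hj.1 hj.2,
      fun hne hj => hD.not_joinSame (i3 a b c) (hNT a b c) hx hz (rx a b c) (rz a b c)
        (col x a _ (memx a b c)) (col z c _ (memz a b c)) hne hj.1 hj.2,
      fun hne hj => hD.not_joinSame (i3 a b c) (hNT a b c) hy hz (ry a b c) (rz a b c)
        (col y b _ (memy a b c)) (col z c _ (memz a b c)) hne hj.1 hj.2⟩
  have key := hexagon_of_sameCycle (hD.step S hS) hpt x.colour y.colour z.colour r hr hJ
  have bifpt (c : Bool) (i j : Fin 6) : (pt (bif c then i else j)).1 =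
      bif c then (pt i).1 else (pt j).1 := by cases c <;> rfl
  have p0 : (pt 0).1 = D.tailNode x := rfl
  have p1 : (pt 1).1 = D.headNode x := rfl
  have p2 : (pt 2).1 = D.tailNode y := rfl
  have p3 : (pt 3).1 = D.headNode y := rfl
  have p4 : (pt 4).1 = D.tailNode z := rfl
  have p5 : (pt 5).1 = D.headNode z := rfl
  simp only [r, T, addIf, cond_true, cond_false, bifpt, p0, p1, p2, p3, p4, p5] at key
  have mem {u v : Saddle} (h : u ∉ S) (huv : u ≠ v) : u ∉ insert v S := by simp [h, huv]
  rw [hD.swap_eq hx hy hxS hyS nxy, hD.swap_eq hx hz (mem hxS nxy) (mem hzS nyz.symm) nxz,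
    hD.swap_eq hy hz hyS hzS nyz, hD.swap_eq hy hz (mem hyS nxy.symm) (mem hzS nxz.symm) nyz,
    hD.swap_eq hx hz hxS hzS nxz, hD.swap_eq hx hy (mem hxS nxz) (mem hyS nyz) nxy]
  rw [Set.insert_comm y x] at key
  rw [Set.insert_comm x y, Set.insert_comm x z]
  rw [Set.insert_comm y x]
  exact key

/-- Among two saddles the number of merges determines the total degree, and this number does not
depend on their order. -/
theorem saddleDeg_comm (hD : D.IsPlanar K sz τ) {S : Set Saddle} (hS : IsInner K S)
    {x y : Saddle} (hx : D.IsSaddle K x) (hy : D.IsSaddle K y) (hxy : x.1 ≠ y.1)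
    (hxS : x ∉ S) (hyS : y ∉ S) :
    D.saddleDeg S x + D.saddleDeg (insert x S) y = D.saddleDeg S y + D.saddleDeg (insert y S) x := by
  classical
  have nxy : x ≠ y := fun e => hxy (congrArg Prod.fst e)
  have nd : [hD.tailIn hx, hD.headIn hx, hD.tailIn hy, hD.headIn hy].Nodup := by
    have tx := tailNode_fst (D := D) x
    have ty := tailNode_fst (D := D) y
    have key (u v : Node) (h : u.1 ≠ v.1 ∨ u.2.1 ≠ v.2.1) : u ≠ v := by rintro rfl; simp at h
    simp only [List.nodup_cons, List.mem_cons, List.not_mem_nil, or_false, not_or, tailIn, headIn,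
      Subtype.mk.injEq]
    refine ⟨⟨key _ _ ?_, key _ _ ?_, key _ _ ?_⟩, ⟨key _ _ ?_, key _ _ ?_⟩, key _ _ ?_, by simp,
      List.nodup_nil⟩ <;> simp [tx, ty, hxy]
  have := count_merges_of_sameCycle (hD.step S hS) nd
  rw [← hD.step_insert hS hx hxS, ← hD.step_insert hS hy hyS, ← hD.conn_iff, ← hD.conn_iff,
    ← hD.conn_iff, ← hD.conn_iff] at this
  change ((if D.Conn S (D.tailNode x) (D.headNode x) then 0 else 1) +
    (if D.Conn (insert x S) (D.tailNode y) (D.headNode y) then 0 else 1) : ℕ) =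
    (if D.Conn S (D.tailNode y) (D.headNode y) then 0 else 1) +
    (if D.Conn (insert y S) (D.tailNode x) (D.headNode x) then 0 else 1) at this
  simp only [saddleDeg, isMerge_iff hx hxS, isMerge_iff hy hyS,
    isMerge_iff hy (show y ∉ insert x S by simp [hyS, nxy.symm]),
    isMerge_iff hx (show x ∉ insert y S by simp [hxS, nxy]), ite_not]
  split_ifs at this ⊢ <;> first | rfl | omega

end Diagram.IsPlanar

/-! ### Exchanging whole lines of saddles -/

/-- The saddles in the list may be performed one after the other, starting from the state `S`; they
all lie on the line `k`. -/
def Diagram.Admissible (D : Diagram) (K k : ℕ) : Set Saddle → List Saddle → Prop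
  | _, [] => True
  | S, x :: xs => D.IsSaddle K x ∧ x.1 = k ∧ x ∉ S ∧ D.Ready S x ∧ D.Admissible K k (insert x S) xs

theorem insert_union_list (S : Set Saddle) (x : Saddle) (xs : List Saddle) :
    insert x S ∪ {s | s ∈ xs} = S ∪ {s | s ∈ x :: xs} := by
  ext s; simp only [Set.mem_union, Set.mem_insert_iff, Set.mem_ofPred_eq, List.mem_cons]; tauto

theorem union_nil (S : Set Saddle) : S ∪ {s | s ∈ ([] : List Saddle)} = S := by
  ext s; simp

theorem union_list_insert (S : Set Saddle) (x : Saddle) (xs : List Saddle) :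
    insert x (S ∪ {s | s ∈ xs}) = insert x S ∪ {s | s ∈ xs} := by
  rw [Set.insert_union]

namespace Diagram.IsPlanar
variable {D : Diagram} {K : ℕ} {sz : ℕ → ℕ} {τ : ℕ → Pt → Pt}

theorem admissible_insert (hD : D.IsPlanar K sz τ) {k : ℕ} {S : Set Saddle} {ys : List Saddle}
    (h : D.Admissible K k S ys) {x : Saddle} (hx : D.IsSaddle K x) (hxk : x.1 ≠ k) :
    D.Admissible K k (insert x S) ys := by
  induction ys generalizing S with
  | nil => trivial
  | cons y ys ih =>
    obtain ⟨h1, h2, h3, h4, h5⟩ := h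
    refine ⟨h1, h2, ?_, hD.ready_insert hx h4 (h2 ▸ hxk), ?_⟩
    · rw [Set.mem_insert_iff, not_or]
      exact ⟨fun e => hxk (by rw [← e, h2]), h3⟩
    · rw [Set.insert_comm]; exact ih h5

/-- The hexagon for two fixed saddles and a whole line: the first saddle of the line is handled by
`hexagon`, and the others by induction in the state where it has been performed. -/
theorem pass_comm (hD : D.IsPlanar K sz τ) {k : ℕ} {S : Set Saddle} (hS : IsInner K S)
    (hN : D.Nested S) {x y : Saddle} (hx : D.IsSaddle K x) (hy : D.IsSaddle K y) (hxy : x.1 ≠ y.1)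
    (hxk : x.1 ≠ k) (hyk : y.1 ≠ k) (hxS : x ∉ S) (hyS : y ∉ S) (hRx : D.Ready S x)
    (hRy : D.Ready S y) {zs : List Saddle} (hzs : D.Admissible K k S zs) :
    D.swap S x y * D.pass (insert y S) x zs * D.pass S y zs =
      D.pass (insert x S) y zs * D.pass S x zs * D.swap (S ∪ {s | s ∈ zs}) x y := by
  induction zs generalizing S with
  | nil => rw [union_nil]; simp [Diagram.pass]
  | cons z zs ih =>
    obtain ⟨hz, hzk, hzS, hRz, hzs⟩ := hzs
    have hxz : x.1 ≠ z.1 := hzk ▸ hxk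
    have hyz : y.1 ≠ z.1 := hzk ▸ hyk
    have h := ih (isInner_insert hS hz) (hD.nested_insert hN hz hRz)
      (by rw [Set.mem_insert_iff, not_or]; exact ⟨fun e => hxz (congrArg Prod.fst e), hxS⟩)
      (by rw [Set.mem_insert_iff, not_or]; exact ⟨fun e => hyz (congrArg Prod.fst e), hyS⟩)
      (hD.ready_insert hz hRx hxz.symm) (hD.ready_insert hz hRy hyz.symm) hzs
    have hex := hD.hexagon hS hN hx hy hz hxy hxz hyz hxS hyS hzS hRx hRy hRz
    rw [insert_union_list S z zs] at h
    simp only [Diagram.pass]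
    rw [Set.insert_comm z y, Set.insert_comm z x]
    calc _ = (D.swap S x y * D.swap (insert y S) x z * D.swap S y z) *
          (D.pass (insert y (insert z S)) x zs * D.pass (insert z S) y zs) := by ac_rfl
      _ = D.swap (insert x S) y z * D.swap S x z * (D.swap (insert z S) x y *
          D.pass (insert y (insert z S)) x zs * D.pass (insert z S) y zs) := by rw [hex]; ac_rfl
      _ = _ := by rw [h]; ac_rfl

/-- Induction on the second line, with `pass_comm` for each of its saddles; the third line is
carried along in every step. -/
theorem passAll_comm_single (hD : D.IsPlanar K sz τ) {k l : ℕ} (hkl : l ≠ k) {S : Set Saddle}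
    (hS : IsInner K S) (hN : D.Nested S) {x : Saddle} (hx : D.IsSaddle K x) (hxk : x.1 ≠ k)
    (hxl : x.1 ≠ l) (hxS : x ∉ S) (hRx : D.Ready S x) {ys zs : List Saddle}
    (hys : D.Admissible K l S ys) (hzs : D.Admissible K k S zs) :
    D.pass S x ys * D.pass (S ∪ {s | s ∈ ys}) x zs * D.passAll S ys zs =
      D.passAll (insert x S) ys zs * D.pass S x zs * D.pass (S ∪ {s | s ∈ zs}) x ys := by
  induction ys generalizing S with
  | nil => rw [union_nil]; simp [Diagram.pass, Diagram.passAll]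
  | cons y ys ih =>
    obtain ⟨hy, hyl, hyS, hRy, hys⟩ := hys
    have hxy : x.1 ≠ y.1 := hyl ▸ hxl
    have hyk : y.1 ≠ k := hyl ▸ hkl
    have h := ih (isInner_insert hS hy) (hD.nested_insert hN hy hRy)
      (by rw [Set.mem_insert_iff, not_or]; exact ⟨fun e => hxy (congrArg Prod.fst e), hxS⟩)
      (hD.ready_insert hy hRx hxy.symm) hys (hD.admissible_insert hzs hy hyk)
    have h1 := hD.pass_comm hS hN hx hy hxy hxk hyk hxS hyS hRx hRy hzs
    rw [insert_union_list S y ys] at h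
    simp only [Diagram.pass, Diagram.passAll]
    rw [Set.insert_comm y x, union_list_insert]
    calc _ = D.swap S x y * (D.pass (insert y S) x ys * D.pass (S ∪ {s | s ∈ y :: ys}) x zs *
          D.passAll (insert y S) ys zs) * D.pass S y zs := by ac_rfl
      _ = (D.swap S x y * D.pass (insert y S) x zs * D.pass S y zs) *
          (D.passAll (insert x (insert y S)) ys zs *
            D.pass (insert y S ∪ {s | s ∈ zs}) x ys) := by rw [h]; ac_rfl
      _ = _ := by rw [h1]; ac_rfl

/-- Coherence of the commutation units for three lines of saddles. -/
theorem passAll_comm (hD : D.IsPlanar K sz τ) {j k l : ℕ} (hjl : j ≠ l) (hjk : j ≠ k) (hlk : l ≠ k)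
    {S : Set Saddle} (hS : IsInner K S) (hN : D.Nested S) {xs ys zs : List Saddle}
    (hxs : D.Admissible K j S xs) (hys : D.Admissible K l S ys) (hzs : D.Admissible K k S zs) :
    D.passAll S xs ys * D.passAll (S ∪ {s | s ∈ ys}) xs zs * D.passAll S ys zs =
      D.passAll (S ∪ {s | s ∈ xs}) ys zs * D.passAll S xs zs *
        D.passAll (S ∪ {s | s ∈ zs}) xs ys := by
  induction xs generalizing S with
  | nil => rw [union_nil]; simp [Diagram.passAll]
  | cons x xs ih =>
    obtain ⟨hx, hxj, hxS, hRx, hxs⟩ := hxs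
    have hxl : x.1 ≠ l := hxj ▸ hjl
    have hxk : x.1 ≠ k := hxj ▸ hjk
    have h := ih (isInner_insert hS hx) (hD.nested_insert hN hx hRx) hxs
      (hD.admissible_insert hys hx hxl) (hD.admissible_insert hzs hx hxk)
    have h1 := hD.passAll_comm_single hlk hS hN hx hxk hxl hxS hRx hys hzs
    rw [insert_union_list S x xs] at h
    simp only [Diagram.passAll]
    rw [union_list_insert, union_list_insert]
    calc _ = D.passAll (insert x S) xs ys * D.passAll (insert x S ∪ {s | s ∈ ys}) xs zs *
          (D.pass S x ys * D.pass (S ∪ {s | s ∈ ys}) x zs * D.passAll S ys zs) := by ac_rfl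
      _ = (D.passAll (insert x S) xs ys * D.passAll (insert x S ∪ {s | s ∈ ys}) xs zs *
          D.passAll (insert x S) ys zs) * (D.pass S x zs * D.pass (S ∪ {s | s ∈ zs}) x ys) := by
            rw [h1]; ac_rfl
      _ = _ := by rw [h]; ac_rfl

theorem saddleDeg_add_deg (hD : D.IsPlanar K sz τ) {k : ℕ} {S : Set Saddle} (hS : IsInner K S)
    {x : Saddle} (hx : D.IsSaddle K x) (hxk : x.1 ≠ k) (hxS : x ∉ S) {ys : List Saddle}
    (hys : D.Admissible K k S ys) :
    D.saddleDeg S x + D.deg (insert x S) ys = D.deg S ys + D.saddleDeg (S ∪ {s | s ∈ ys}) x := by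
  induction ys generalizing S with
  | nil => rw [union_nil]; simp [Diagram.deg]
  | cons y ys ih =>
    obtain ⟨hy, hyk, hyS, -, hys⟩ := hys
    have hxy : x.1 ≠ y.1 := hyk ▸ hxk
    have h := ih (isInner_insert hS hy)
      (by rw [Set.mem_insert_iff, not_or]; exact ⟨fun e => hxy (congrArg Prod.fst e), hxS⟩) hys
    have h1 := hD.saddleDeg_comm hS hx hy hxy hxS hyS
    rw [insert_union_list S y ys] at h
    simp only [Diagram.deg]
    rw [Set.insert_comm y x, ← add_assoc, h1, add_assoc, add_assoc, h]

/-- The total degree of two lines of saddles does not depend on their order. -/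
theorem deg_comm (hD : D.IsPlanar K sz τ) {j k : ℕ} (hjk : j ≠ k) {S : Set Saddle}
    (hS : IsInner K S) {xs ys : List Saddle} (hxs : D.Admissible K j S xs)
    (hys : D.Admissible K k S ys) :
    D.deg S xs + D.deg (S ∪ {s | s ∈ xs}) ys = D.deg S ys + D.deg (S ∪ {s | s ∈ ys}) xs := by
  induction xs generalizing S with
  | nil => rw [union_nil]; simp [Diagram.deg]
  | cons x xs ih =>
    obtain ⟨hx, hxj, hxS, hRx, hxs⟩ := hxs
    have hxk : x.1 ≠ k := hxj ▸ hjk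
    have h := ih (isInner_insert hS hx) hxs (hD.admissible_insert hys hx hxk)
    have h1 := hD.saddleDeg_add_deg hS hx hxk hxS hys
    rw [insert_union_list S x xs] at h
    simp only [Diagram.deg]
    rw [union_list_insert, add_assoc, h, ← add_assoc, h1, add_assoc]

end Diagram.IsPlanar

theorem lam_add_left (p q r : ℤ × ℤ) : lam (p + q) r = lam p r * lam q r := by
  simp only [lam, Prod.fst_add, Prod.snd_add, add_mul, zpow_add,
    show p.1 * r.2 + q.1 * r.2 - (p.2 * r.1 + q.2 * r.1) =
      (p.1 * r.2 - p.2 * r.1) + (q.1 * r.2 - q.2 * r.1) by ring]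
  ac_rfl

theorem lam_add_right (p q r : ℤ × ℤ) : lam r (p + q) = lam r p * lam r q := by
  simp only [lam, Prod.fst_add, Prod.snd_add, mul_add, zpow_add,
    show r.1 * p.2 + r.1 * q.2 - (r.2 * p.1 + r.2 * q.1) =
      (r.1 * p.2 - r.2 * p.1) + (r.1 * q.2 - r.2 * q.1) by ring]
  ac_rfl

theorem lam_zero_left (p : ℤ × ℤ) : lam 0 p = 1 := by simp [lam]

theorem lam_zero_right (p : ℤ × ℤ) : lam p 0 = 1 := by simp [lam]

/-- When `x` does not alter the type of `z`, the units `X`, `Y`, `Z` and `Z⁻¹` are the values of `λ`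
on the degrees `(-1, 0)` and `(0, -1)`. The exceptional rules for two linked saddles concern only
pairs whose types interact. -/
theorem Diagram.swap_of_unlinked {D : Diagram} {S : Set Saddle} {x z : Saddle}
    (h : D.IsMerge (insert x S) z ↔ D.IsMerge S z) :
    D.swap S x z = lam (D.saddleDeg S z) (D.saddleDeg S x) := by
  by_cases h1 : D.IsMerge S x <;> by_cases h2 : D.IsMerge S z <;>
    simp [swap, saddleDeg, h1, h2, lam, h.mpr, mt h.mp]

/-- Two lines of saddles none of which affects the type of a saddle on the other line. -/
theorem Diagram.passAll_of_unlinked {D : Diagram} {xs zs : List Saddle} (Q : Set Saddle → Prop)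
    (hQx : ∀ S, Q S → ∀ x ∈ xs, Q (insert x S)) (hQz : ∀ S, Q S → ∀ z ∈ zs, Q (insert z S))
    (h : ∀ S, Q S → ∀ x ∈ xs, ∀ z ∈ zs, (D.IsMerge (insert z S) x ↔ D.IsMerge S x) ∧
      (D.IsMerge (insert x S) z ↔ D.IsMerge S z)) {S : Set Saddle} (hS : Q S) :
    D.passAll S xs zs = lam (D.deg S zs) (D.deg S xs) := by
  have hpass (x : Saddle) (hx : x ∈ xs) (ws : List Saddle) (hws : ∀ w ∈ ws, w ∈ zs)
      (S : Set Saddle) (hS : Q S) : D.pass S x ws = lam (D.deg S ws) (D.saddleDeg S x) ∧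
        D.deg (insert x S) ws = D.deg S ws := by
    induction ws generalizing S with
    | nil => simp [Diagram.pass, Diagram.deg, lam_zero_left]
    | cons w ws ih =>
      have hw := hws w (by simp)
      have h1 := ih (fun v hv => hws v (by simp [hv])) (insert w S) (hQz S hS w hw)
      have h2 : D.saddleDeg (insert w S) x = D.saddleDeg S x := by
        rw [saddleDeg, saddleDeg, propext (h S hS x hx w hw).1]
      have h3 : D.saddleDeg (insert x S) w = D.saddleDeg S w := by
        rw [saddleDeg, saddleDeg, propext (h S hS x hx w hw).2]
      simp only [Diagram.pass, Diagram.deg]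
      rw [swap_of_unlinked (h S hS x hx w hw).2, h1.1, h2, lam_add_left, h3, Set.insert_comm, h1.2]
      exact ⟨rfl, rfl⟩
  suffices ∀ ws, (∀ w ∈ ws, w ∈ xs) → ∀ S, Q S →
      D.passAll S ws zs = lam (D.deg S zs) (D.deg S ws) from this xs (fun _ h => h) S hS
  intro ws hws
  induction ws with
  | nil => simp [Diagram.passAll, Diagram.deg, lam_zero_right]
  | cons w ws ih =>
    intro S hS
    have hw := hws w (by simp)
    have h1 := hpass w hw zs (fun _ h => h) S hS
    simp only [Diagram.passAll, Diagram.deg]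
    rw [ih (fun v hv => hws v (by simp [hv])) _ (hQx S hS w hw), h1.1, h1.2, lam_add_right,
      mul_comm]

/-! ### Connections in a stack of tangles -/

/-- The elementary connections in a stack of two strips; the first component of a point tells whether
it belongs to the upper strip. -/
inductive GlueAdj (r r' : Pt → Pt → Prop) : Bool × Pt → Bool × Pt → Prop
  | lower (p q : Pt) : r p q → GlueAdj r r' (false, p) (false, q)
  | upper (p q : Pt) : r' p q → GlueAdj r r' (true, p) (true, q)
  | mid (i : ℕ) : GlueAdj r r' (false, true, i) (true, false, i)

/-- The connections in a stack of two strips. -/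
def Glue (r r' : Pt → Pt → Prop) : Bool × Pt → Bool × Pt → Prop := Relation.EqvGen (GlueAdj r r')

theorem EqvGen.iff_of_forall {α : Type*} {r : α → α → Prop} (P : α → Prop)
    (h : ∀ x y, r x y → (P x ↔ P y)) {x y : α} (hxy : Relation.EqvGen r x y) : P x ↔ P y := by
  induction hxy with
  | rel x y h' => exact h x y h'
  | refl => rfl
  | symm _ _ _ ih => exact ih.symm
  | trans _ _ _ _ _ ih ih' => exact ih.trans ih'

theorem EqvGen.le {α : Type*} {r : α → α → Prop} {s : α → α → Prop} (hs : Equivalence s)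
    (h : ∀ x y, r x y → s x y) {x y : α} (hxy : Relation.EqvGen r x y) : s x y := by
  induction hxy with
  | rel x y h' => exact h x y h'
  | refl => exact hs.refl _
  | symm _ _ _ ih => exact hs.symm ih
  | trans _ _ _ _ _ ih ih' => exact hs.trans ih ih'

theorem Glue.equivalence (r r' : Pt → Pt → Prop) : Equivalence (Glue r r') :=
  Relation.EqvGen.is_equivalence _

/-- The points of an upper strip of vertical strands can be pushed down to its lower line; this is
the map `s`. -/
theorem glue_joined_nil {r : Pt → Pt → Prop} (hr : Equivalence r) (p q : Pt) :
    Glue r (fun p q => p.2 = q.2) (p.1, p) (q.1, q) ↔ r p q := by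
  constructor
  · intro h
    let s : Bool × Pt → Pt := fun x => if x.1 then (true, x.2.2) else x.2
    have key : r (s (p.1, p)) (s (q.1, q)) := by
      refine EqvGen.le (r := GlueAdj r fun p q => p.2 = q.2) (s := fun x y => r (s x) (s y))
        ⟨fun _ => hr.refl _, hr.symm, hr.trans⟩ (fun x y hxy => ?_) h
      cases hxy with
      | lower p q h => simpa [s] using h
      | upper p q h => simp [s, h, hr.refl]
      | mid i => simp [s, hr.refl]
    obtain ⟨b, i⟩ := p
    obtain ⟨c, j⟩ := q
    cases b <;> cases c <;> simpa [s] using key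
  · intro h
    have key (p : Pt) : Glue r (fun p q => p.2 = q.2) (p.1, p) (false, p) := by
      obtain ⟨b, i⟩ := p
      cases b
      · exact .refl _
      · exact .trans _ _ _ (.rel _ _ (.upper (true, i) (false, i) rfl)) (.symm _ _ (.rel _ _ (.mid i)))
    exact .trans _ _ _ (key p) (.trans _ _ _ (.rel _ _ (.lower p q h)) (.symm _ _ (key q)))

/-- The new position of a point after the insertion of a cup at `i`. -/
def afterCup (i : ℕ) (p : Pt) : Pt := (p.1, if p.1 = true ∧ i ≤ p.2 then p.2 + 2 else p.2)

theorem beforeCup_afterCup (i : ℕ) (p : Pt) : beforeCup i (afterCup i p) = p := by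
  obtain ⟨b, j⟩ := p; cases b <;> simp [beforeCup, afterCup]; grind

theorem not_isNew_afterCup (i : ℕ) (p : Pt) : ¬ IsNew i (afterCup i p) := by
  obtain ⟨b, j⟩ := p; cases b <;> simp [IsNew, afterCup]; grind

theorem afterCup_beforeCup {i : ℕ} {p : Pt} (h : ¬ IsNew i p) : afterCup i (beforeCup i p) = p := by
  obtain ⟨b, j⟩ := p; cases b <;> simp [IsNew, beforeCup, afterCup] at h ⊢; grind

/-- A cup at the top makes a component of its own, and otherwise only renumbers points on the top
line. Neither affects the line along which the strips are glued. -/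
theorem glue_cupRel {r r' : Pt → Pt → Prop} (i : ℕ) (p q : Pt) :
    Glue r (cupRel i r') (p.1, p) (q.1, q) ↔
      cupRel i (fun p q => Glue r r' (p.1, p) (q.1, q)) p q := by
  have hE := Glue.equivalence r r'
  have hnew (j : ℕ) : ¬ IsNew i (false, j) := by simp [IsNew]
  have hb (j : ℕ) : beforeCup i (false, j) = (false, j) := by simp [beforeCup]
  have ha (j : ℕ) : afterCup i (false, j) = (false, j) := by simp [afterCup]
  let ν : Bool × Pt → Prop := fun x => x.1 = true ∧ IsNew i x.2
  let β : Bool × Pt → Bool × Pt := fun x => (x.1, if x.1 then beforeCup i x.2 else x.2)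
  have hν (p : Pt) : ν (p.1, p) ↔ IsNew i p := by
    simp only [ν, and_iff_right_iff_imp]; exact fun h => h.1
  have hβ (p : Pt) : β (p.1, p) = ((beforeCup i p).1, beforeCup i p) := by
    obtain ⟨b, j⟩ := p; cases b <;> simp [β, beforeCup]
  constructor
  · intro h
    suffices (ν (p.1, p) ∧ ν (q.1, q)) ∨
        (¬ ν (p.1, p) ∧ ¬ ν (q.1, q) ∧ Glue r r' (β (p.1, p)) (β (q.1, q))) by
      rwa [hν, hν, hβ, hβ] at this
    refine EqvGen.le (r := GlueAdj r (cupRel i r'))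
      (s := fun x y => (ν x ∧ ν y) ∨ (¬ ν x ∧ ¬ ν y ∧ Glue r r' (β x) (β y)))
      ⟨fun x => ?_, fun h => ?_, fun h h' => ?_⟩ (fun x y hxy => ?_) h
    · by_cases hx : ν x <;> simp [hx, hE.refl]
    · rcases h with h | ⟨h1, h2, h3⟩
      · exact .inl h.symm
      · exact .inr ⟨h2, h1, hE.symm h3⟩
    · rcases h with h | ⟨h1, h2, h3⟩ <;> rcases h' with h' | ⟨h1', h2', h3'⟩
      · exact .inl ⟨h.1, h'.2⟩
      · exact absurd h.2 h1'
      · exact absurd h'.1 h2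
      · exact .inr ⟨h1, h2', hE.trans h3 h3'⟩
    · cases hxy with
      | lower p q h => exact .inr ⟨by simp [ν], by simp [ν], .rel _ _ (.lower p q h)⟩
      | upper p q h =>
        rcases h with h | ⟨h1, h2, h3⟩
        · exact .inl ⟨⟨rfl, h.1⟩, ⟨rfl, h.2⟩⟩
        · exact .inr ⟨by simp [ν, h1], by simp [ν, h2], .rel _ _ (.upper _ _ h3)⟩
      | mid j =>
        refine .inr ⟨by simp [ν], by simp [ν, hnew], ?_⟩
        simp only [β, hb]
        exact .rel _ _ (.mid j)
  · have key (x y : Bool × Pt) (h : Glue r r' x y) :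
        Glue r (cupRel i r') (x.1, if x.1 then afterCup i x.2 else x.2)
          (y.1, if y.1 then afterCup i y.2 else y.2) := by
      refine EqvGen.le (r := GlueAdj r r') (s := fun x y => Glue r (cupRel i r')
          (x.1, if x.1 then afterCup i x.2 else x.2) (y.1, if y.1 then afterCup i y.2 else y.2))
        ⟨fun _ => .refl _, fun h => .symm _ _ h, fun h h' => .trans _ _ _ h h'⟩
        (fun x y hxy => ?_) h
      cases hxy with
      | lower p q h => exact .rel _ _ (.lower p q h)
      | upper p q h =>
        refine .rel _ _ (.upper _ _ (.inr ⟨not_isNew_afterCup i p, not_isNew_afterCup i q, ?_⟩))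
        simpa [beforeCup_afterCup] using h
      | mid j =>
        simp only [ha]
        exact .rel _ _ (.mid j)
    have hα (p : Pt) (hp : ¬ IsNew i p) : ((β (p.1, p)).1, if (β (p.1, p)).1 then
        afterCup i (β (p.1, p)).2 else (β (p.1, p)).2) = (p.1, p) := by
      have := afterCup_beforeCup hp
      cases h : p.1 <;> simp [β, this]
    rintro (⟨hp, hq⟩ | ⟨hp, hq, h⟩)
    · rw [show p.1 = true from hp.1, show q.1 = true from hq.1]
      exact .rel _ _ (.upper _ _ (.inl ⟨hp, hq⟩))
    · have := key _ _ h
      rwa [← hβ, ← hβ, hα p hp, hα q hq] at this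

/-- A cap at the top joins two components, and this may be done before or after gluing the strips.
-/
theorem glue_capRel {r r' : Pt → Pt → Prop} (hr' : Equivalence r') (i : ℕ) (p q : Pt) :
    Glue r (capRel i r') (p.1, p) (q.1, q) ↔
      capRel i (fun p q => Glue r r' (p.1, p) (q.1, q)) p q := by
  have hE := Glue.equivalence r r'
  have hE' := Glue.equivalence r (capRel i r')
  have hc := capRel_equivalence i hr'
  have hb (j : ℕ) : beforeCap i (false, j) = (false, j) := by simp [beforeCap]
  let β : Bool × Pt → Bool × Pt := fun x => (x.1, if x.1 then beforeCap i x.2 else x.2)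
  have hβ (p : Pt) : β (p.1, p) = ((beforeCap i p).1, beforeCap i p) := by
    obtain ⟨b, j⟩ := p; cases b <;> simp [β, beforeCap]
  have hlift (p q : Pt) (h : r' p q) : Glue r r' (true, p) (true, q) := .rel _ _ (.upper p q h)
  constructor
  · intro h
    obtain ⟨γ, f, hf⟩ : ∃ (γ : Type), ∃ f : Bool × Pt → γ, ∀ x y, Glue r r' x y ↔ f x = f y :=
      ⟨Quotient ⟨_, hE⟩, Quotient.mk _, fun x y => (Quotient.eq (r := ⟨_, hE⟩)).symm⟩
    suffices f (β (p.1, p)) = f (β (q.1, q)) ∨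
        (f (β (p.1, p)) = f (true, true, i) ∧ f (true, true, i + 1) = f (β (q.1, q))) ∨
        (f (β (p.1, p)) = f (true, true, i + 1) ∧ f (true, true, i) = f (β (q.1, q))) by
      rw [hβ, hβ] at this
      simpa only [capRel, hf] using this
    refine EqvGen.le (r := GlueAdj r (capRel i r'))
      (s := fun x y => f (β x) = f (β y) ∨
        (f (β x) = f (true, true, i) ∧ f (true, true, i + 1) = f (β y)) ∨
        (f (β x) = f (true, true, i + 1) ∧ f (true, true, i) = f (β y)))
      ⟨fun x => ?_, fun h => ?_, fun h h' => ?_⟩ (fun x y hxy => ?_) h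
    · exact .inl rfl
    · grind
    · grind
    · cases hxy with
      | lower p q h => exact .inl ((hf _ _).mp (.rel _ _ (.lower p q h)))
      | upper p q h =>
        rcases h with h | h | h
        · exact .inl ((hf _ _).mp (hlift _ _ h))
        · exact .inr (.inl ⟨(hf _ _).mp (hlift _ _ h.1), (hf _ _).mp (hlift _ _ h.2)⟩)
        · exact .inr (.inr ⟨(hf _ _).mp (hlift _ _ h.1), (hf _ _).mp (hlift _ _ h.2)⟩)
      | mid j =>
        refine .inl ((hf _ _).mp ?_)
        simp only [β, hb]
        exact .rel _ _ (.mid j)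
  · obtain ⟨α, f, rfl⟩ := exists_eq_of_equivalence hr'
    let s : Pt → Pt → Prop := fun u v => f u = f v ∨ (f u = f (true, i) ∧ f (true, i + 1) = f v) ∨
      (f u = f (true, i + 1) ∧ f (true, i) = f v)
    have hs (u v : Pt) : s (beforeCap i u) (beforeCap i v) ↔ capRel i (fun p q => f p = f q) u v :=
      Iff.rfl
    -- The two capped points are no endpoints of the capped strip. Being connected to a point of the
    -- upper strip is therefore expressed through an endpoint `q` which remains on the same
    -- component; at points beyond the reach of such a `q` the predicate is false.
    let P : Bool × Pt → Prop := fun x => if x.1 then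
      ∃ q, s x.2 (beforeCap i q) ∧ Glue r (capRel i fun p q => f p = f q) (p.1, p) (true, q)
      else Glue r (capRel i fun p q => f p = f q) (p.1, p) x
    have hP (q : Pt) : P (true, beforeCap i q) ↔
        Glue r (capRel i fun p q => f p = f q) (p.1, p) (true, q) := by
      simp only [P, if_true]
      refine ⟨fun ⟨q', h1, h2⟩ => ?_, fun h => ⟨q, .inl rfl, h⟩⟩
      exact hE'.trans h2 (hE'.symm (.rel _ _ (.upper _ _ ((hs _ _).mp h1))))
    have hup (u v : Pt) (h : s u v) : P (true, u) ↔ P (true, v) := by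
      simp only [P, if_true]
      constructor
      · rintro ⟨w, h1, h2⟩; exact ⟨w, by simp only [s] at *; grind, h2⟩
      · rintro ⟨w, h1, h2⟩; exact ⟨w, by simp only [s] at *; grind, h2⟩
    have hinv : ∀ x y, Glue r (fun p q => f p = f q) x y → (P x ↔ P y) := by
      intro x y h
      refine EqvGen.iff_of_forall P (fun x y hxy => ?_) h
      cases hxy with
      | lower u v h =>
        simp only [P, Bool.false_eq_true, if_false]
        have h' : Glue r (capRel i fun p q => f p = f q) (false, u) (false, v) :=
          .rel _ _ (.lower _ _ h)
        exact ⟨fun h1 => hE'.trans h1 h', fun h1 => hE'.trans h1 (hE'.symm h')⟩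
      | upper u v h => exact hup u v (.inl h)
      | mid j =>
        rw [← hb j, hP]
        simp only [P, Bool.false_eq_true, if_false]
        have h' : Glue r (capRel i fun p q => f p = f q) (false, true, j) (true, false, j) :=
          .rel _ _ (.mid j)
        exact ⟨fun h1 => hE'.trans h1 h', fun h1 => hE'.trans h1 (hE'.symm h')⟩
    have hPe (q : Pt) : P ((beforeCap i q).1, beforeCap i q) ↔
        Glue r (capRel i fun p q => f p = f q) (p.1, p) (q.1, q) := by
      obtain ⟨b, j⟩ := q
      cases b
      · rw [hb]; simp [P]
      · exact hP (true, j)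
    intro h
    have ha : P (true, true, i) ↔ P (true, true, i + 1) := hup _ _ (.inr (.inl ⟨rfl, rfl⟩))
    have h0 := (hPe p).mpr (hE'.refl _)
    rw [← hPe]
    rcases h with h | ⟨h1, h2⟩ | ⟨h1, h2⟩
    · exact (hinv _ _ h).mp h0
    · exact (hinv _ _ h2).mp (ha.mp ((hinv _ _ h1).mp h0))
    · exact (hinv _ _ h2).mp (ha.mpr ((hinv _ _ h1).mp h0))

theorem Word.joined_comp {m n p : ℕ} (w : Word m n) (v : Word n p) (x y : Pt) :
    (w.comp v).Joined x y ↔ Glue w.Joined v.Joined (x.1, x) (y.1, y) := by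
  induction v generalizing x y with
  | nil =>
    simp only [Word.comp, Word.Joined]
    exact (glue_joined_nil w.joined_equivalence x y).symm
  | cup v i h ih =>
    simp only [Word.comp, Word.Joined]
    rw [glue_cupRel, show (w.comp v).Joined = fun x y => Glue w.Joined v.Joined (x.1, x) (y.1, y)
      from funext fun x => funext fun y => propext (ih x y)]
  | cap v i h ih =>
    simp only [Word.comp, Word.Joined]
    rw [glue_capRel v.joined_equivalence,
      show (w.comp v).Joined = fun x y => Glue w.Joined v.Joined (x.1, x) (y.1, y)
      from funext fun x => funext fun y => propext (ih x y)]

/-- The connections of a composition of tangles. -/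
theorem Tangle.joined_comp {m n p : ℕ} (t : Tangle m n) (s : Tangle n p) (x y : Pt) :
    (t.comp s).Joined x y ↔ Glue t.Joined s.Joined (x.1, x) (y.1, y) := by
  induction t using Quotient.inductionOn with
  | _ w => induction s using Quotient.inductionOn with
    | _ v => exact w.joined_comp v x y

theorem Word.comp_assoc {m n p q : ℕ} (u : Word m n) (v : Word n p) (w : Word p q) :
    (u.comp v).comp w = u.comp (v.comp w) := by
  induction w with
  | nil => rfl
  | cup w i h ih => simp only [Word.comp, ih]
  | cap w i h ih => simp only [Word.comp, ih]

theorem Word.nil_comp {m n : ℕ} (w : Word m n) : (Word.nil m).comp w = w := by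
  induction w with
  | nil => rfl
  | cup w i h ih => simp only [Word.comp, ih]
  | cap w i h ih => simp only [Word.comp, ih]

theorem Tangle.comp_assoc {m n p q : ℕ} (t : Tangle m n) (s : Tangle n p) (r : Tangle p q) :
    (t.comp s).comp r = t.comp (s.comp r) := by
  induction t using Quotient.inductionOn with
  | _ u => induction s using Quotient.inductionOn with
    | _ v => induction r using Quotient.inductionOn with
      | _ w => exact congrArg (Quotient.mk _) (u.comp_assoc v w)

theorem Tangle.one_comp {m n : ℕ} (t : Tangle m n) : (Tangle.one m).comp t = t := by
  induction t using Quotient.inductionOn with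
  | _ w => exact congrArg (Quotient.mk _) w.nil_comp

theorem Tangle.comp_one {m n : ℕ} (t : Tangle m n) : t.comp (Tangle.one n) = t := by
  induction t using Quotient.inductionOn with
  | _ w => rfl

/-! ### Cutting diagrams and fusing strips -/

/-- A correspondence of saddles of `D'` with saddles of `D` under which the saddles have the same
type and commute in the same way. -/
structure Diagram.Transport (D D' : Diagram) (m : Saddle → Saddle) (P : Saddle → Prop)
    (Q : Set Saddle → Set Saddle → Prop) : Prop where
  insert : ∀ {S S' x}, Q S S' → P x → Q (insert (m x) S) (insert x S')
  isMerge : ∀ {S S' x}, Q S S' → P x → (D.IsMerge S (m x) ↔ D'.IsMerge S' x)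
  tails : ∀ {S S' x y}, Q S S' → P x → P y → (D.Conn S ((m x).1, true, (m x).2)
    ((m y).1, true, (m y).2) ↔ D'.Conn S' (x.1, true, x.2) (y.1, true, y.2))
  right_tail : ∀ {S S' x y}, Q S S' → P x → P y →
    (D.Conn S ((m x).1, true, D.line (m x).1 (m x).2) ((m y).1, true, (m y).2) ↔
      D'.Conn S' (x.1, true, D'.line x.1 x.2) (y.1, true, y.2))

namespace Diagram.Transport
variable {D D' : Diagram} {m : Saddle → Saddle} {P : Saddle → Prop}
  {Q : Set Saddle → Set Saddle → Prop}

theorem of_conn (e : Node → Node) (G : Node → Prop)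
    (hQ : ∀ {S S' x}, Q S S' → P x → Q (Insert.insert (m x) S) (Insert.insert x S'))
    (hconn : ∀ {S S' u v}, Q S S' → G u → G v → (D.Conn S (e u) (e v) ↔ D'.Conn S' u v))
    (hT : ∀ {x}, P x → G (x.1, true, x.2) ∧ e (x.1, true, x.2) = ((m x).1, true, (m x).2))
    (hR : ∀ {x}, P x → G (x.1, true, D'.line x.1 x.2) ∧
      e (x.1, true, D'.line x.1 x.2) = ((m x).1, true, D.line (m x).1 (m x).2))
    (hH : ∀ {x}, P x → G (x.1 + 1, false, x.2) ∧
      e (x.1 + 1, false, x.2) = ((m x).1 + 1, false, (m x).2)) :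
    D.Transport D' m P Q where
  insert := hQ
  isMerge h hx := by
    rw [IsMerge, IsMerge, ← (hT hx).2, ← (hH hx).2, hconn h (hT hx).1 (hH hx).1]
  tails h hx hy := by rw [← (hT hx).2, ← (hT hy).2, hconn h (hT hx).1 (hT hy).1]
  right_tail h hx hy := by rw [← (hR hx).2, ← (hT hy).2, hconn h (hR hx).1 (hT hy).1]

theorem saddleDeg (h : D.Transport D' m P Q) {S S' : Set Saddle} (hS : Q S S') {x : Saddle}
    (hx : P x) : D.saddleDeg S (m x) = D'.saddleDeg S' x := by
  rw [Diagram.saddleDeg, Diagram.saddleDeg, propext (h.isMerge hS hx)]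

theorem deg (h : D.Transport D' m P Q) {S S' : Set Saddle} (hS : Q S S') {xs : List Saddle}
    (hx : ∀ x ∈ xs, P x) : D.deg S (xs.map m) = D'.deg S' xs := by
  induction xs generalizing S S' with
  | nil => rfl
  | cons x xs ih =>
    have h1 := hx x (by simp)
    simp only [List.map_cons, Diagram.deg]
    rw [h.saddleDeg hS h1, ih (h.insert hS h1) fun y hy => hx y (by simp [hy])]

theorem swap (h : D.Transport D' m P Q) {S S' : Set Saddle} (hS : Q S S') {x y : Saddle}
    (hx : P x) (hy : P y) : D.swap S (m x) (m y) = D'.swap S' x y := by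
  have hS' := h.insert hS hx
  rw [Diagram.swap, Diagram.swap, propext (h.isMerge hS hx), propext (h.isMerge hS hy),
    propext (h.isMerge hS' hy), propext (h.tails hS hx hy), propext (h.right_tail hS' hx hy)]

theorem pass (h : D.Transport D' m P Q) {S S' : Set Saddle} (hS : Q S S') {x : Saddle}
    (hx : P x) {ys : List Saddle} (hy : ∀ y ∈ ys, P y) :
    D.pass S (m x) (ys.map m) = D'.pass S' x ys := by
  induction ys generalizing S S' with
  | nil => rfl
  | cons y ys ih =>
    have h1 := hy y (by simp)
    simp only [List.map_cons, Diagram.pass]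
    rw [h.swap hS hx h1, ih (h.insert hS h1) fun z hz => hy z (by simp [hz])]

theorem passAll (h : D.Transport D' m P Q) {S S' : Set Saddle} (hS : Q S S') {xs ys : List Saddle}
    (hx : ∀ x ∈ xs, P x) (hy : ∀ y ∈ ys, P y) :
    D.passAll S (xs.map m) (ys.map m) = D'.passAll S' xs ys := by
  induction xs generalizing S S' with
  | nil => rfl
  | cons x xs ih =>
    have h1 := hx x (by simp)
    simp only [List.map_cons, Diagram.passAll]
    rw [h.pass hS h1 hy, ih (h.insert hS h1) fun z hz => hx z (by simp [hz])]

end Diagram.Transport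

namespace Diagram

/-- The part of a diagram below the line `c`, closed by the arcs on this line. -/
def take (D : Diagram) (c : ℕ) : Diagram where
  base := D.base
  strip k := if k ≤ c then D.strip k else fun _ _ => False
  line k := if k ≤ c then D.line k else id

/-- The part of a diagram above the line `c`, closed by the arcs on this line. -/
def drop (D : Diagram) (c : ℕ) : Diagram where
  base := D.line c
  strip k := D.strip (k + c + 1)
  line k := D.line (k + c + 1)

/-- The line `k` is erased, and the strips below and above it are glued. -/
def fuse (D : Diagram) (k : ℕ) : Diagram where
  base := D.base
  strip j := if j < k then D.strip j else if j = k then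
    fun p q => Glue (D.strip k) (D.strip (k + 1)) (p.1, p) (q.1, q) else D.strip (j + 1)
  line j := D.line (if j < k then j else j + 1)

/-- No saddle is performed on the line `c`, so no connection crosses it, and only the saddles below
it matter for the nodes below it. -/
theorem conn_take (D : Diagram) {c : ℕ} {S : Set Saddle} (hS : ∀ s ∈ S, s.1 ≠ c) {u v : Node}
    (hu : u.1 ≤ c) : D.Conn S u v ∧ v.1 ≤ c ↔
      v.1 ≤ c ∧ (D.take c).Conn {s | s ∈ S ∧ s.1 < c} u v := by
  constructor
  · rintro ⟨h, hv⟩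
    refine (EqvGen.iff_of_forall (fun v => v.1 ≤ c ∧ (D.take c).Conn {s | s ∈ S ∧ s.1 < c} u v)
      (fun x y hxy => ?_) h).mp ⟨hu, .refl _⟩
    have key (hc : x.1 ≤ c ↔ y.1 ≤ c)
        (h' : y.1 ≤ c → (D.take c).Conn {s | s ∈ S ∧ s.1 < c} x y) :
        x.1 ≤ c ∧ (D.take c).Conn {s | s ∈ S ∧ s.1 < c} u x ↔
          y.1 ≤ c ∧ (D.take c).Conn {s | s ∈ S ∧ s.1 < c} u y :=
      ⟨fun ⟨h1, h2⟩ => ⟨hc.mp h1, h2.trans _ _ _ (h' (hc.mp h1))⟩,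
        fun ⟨h1, h2⟩ => ⟨hc.mpr h1, h2.trans _ _ _ ((h' h1).symm _ _)⟩⟩
    cases hxy with
    | strand k p q h =>
      exact key Iff.rfl fun (hk : k ≤ c) => .rel _ _ (.strand k p q (by simpa [take, hk] using h))
    | base i => exact key Iff.rfl fun _ => .rel _ _ (.base i)
    | cap k i h =>
      refine key Iff.rfl fun (hk : k ≤ c) => ?_
      have e : (D.take c).line k = D.line k := by simp [take, hk]
      rw [← e] at h ⊢
      exact .rel _ _ (.cap k i fun h' => h h'.1)
    | cup k i h =>
      refine key Iff.rfl fun (hk : k + 1 ≤ c) => ?_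
      have e : (D.take c).line k = D.line k := by simp [take, show k ≤ c by omega]
      rw [← e] at h ⊢
      exact .rel _ _ (.cup k i fun h' => h h'.1)
    | vert k i h =>
      have hkc : k ≠ c := hS _ h
      refine key ⟨fun (hk : k ≤ c) => show k + 1 ≤ c by omega,
        fun (hk : k + 1 ≤ c) => show k ≤ c by omega⟩ fun (hk : k + 1 ≤ c) => ?_
      have e : (D.take c).line k = D.line k := by simp [take, show k ≤ c by omega]
      rw [← e] at h
      exact .rel _ _ (.vert k i ⟨h, show k < c by omega⟩)
  · rintro ⟨hv, h⟩
    refine ⟨EqvGen.le (Relation.EqvGen.is_equivalence (D.Adj S)) (fun x y hxy => ?_) h, hv⟩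
    cases hxy with
    | strand k p q h =>
      by_cases hk : k ≤ c
      · exact .rel _ _ (.strand k p q (by simpa [take, hk] using h))
      · simp [take, hk] at h
    | base i => exact .rel _ _ (.base i)
    | cap k i h =>
      by_cases hk : k ≤ c
      · have e : (D.take c).line k = D.line k := by simp [take, hk]
        rw [e] at h ⊢
        exact .rel _ _ (.cap k i fun h' => h ⟨h', lt_of_le_of_ne hk (hS _ h')⟩)
      · simp only [take, hk, if_false]
        exact .refl _
    | cup k i h =>
      by_cases hk : k ≤ c
      · have e : (D.take c).line k = D.line k := by simp [take, hk]
        rw [e] at h ⊢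
        exact .rel _ _ (.cup k i fun h' => h ⟨h', lt_of_le_of_ne hk (hS _ h')⟩)
      · simp only [take, hk, if_false]
        exact .refl _
    | vert k i h =>
      have hk : k < c := h.2
      have e : (D.take c).line k = D.line k := by simp [take, hk.le]
      rw [e] at h
      exact .rel _ _ (.vert k i h.1)

theorem transport_take (D : Diagram) (c : ℕ) : D.Transport (D.take c) id (fun x => x.1 < c)
    fun S S' => (∀ s ∈ S, s.1 ≠ c) ∧ S' = {s | s ∈ S ∧ s.1 < c} := by
  refine .of_conn id (fun u => u.1 ≤ c) (fun {S S' x} ⟨h1, h2⟩ hx => ⟨?_, ?_⟩)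
    (fun {S S' u v} ⟨h1, h2⟩ hu hv => ?_) (fun hx => ⟨hx.le, rfl⟩) (fun {x} hx => ⟨hx.le, ?_⟩)
    (fun hx => ⟨hx, rfl⟩)
  · simpa [hx.ne] using h1
  · ext s
    simp only [h2, Set.mem_insert_iff, Set.mem_ofPred_eq, id]
    constructor
    · rintro (rfl | h) <;> tauto
    · tauto
  · have := D.conn_take h1 (v := v) hu
    simp only [hv, and_true, true_and] at this
    rw [h2]; exact this
  · simp [take, hx.le]

/-- As for `conn_take`: nothing crosses the line `c`, and its arcs become the base of the upper
part. -/
theorem conn_drop (D : Diagram) {c : ℕ} {S S' : Set Saddle} (hS : ∀ s ∈ S, s.1 ≠ c)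
    (hS' : ∀ s : Saddle, s ∈ S' ↔ (s.1 + c + 1, s.2) ∈ S) (u v : Node) :
    D.Conn S (u.1 + c + 1, u.2) (v.1 + c + 1, v.2) ↔ (D.drop c).Conn S' u v := by
  constructor
  · intro h
    suffices ∀ x, D.Conn S (u.1 + c + 1, u.2) x →
        c + 1 ≤ x.1 ∧ (D.drop c).Conn S' u (x.1 - (c + 1), x.2) by
      have := (this _ h).2
      rwa [show (v.1 + c + 1, v.2).1 - (c + 1) = v.1 by simp [add_assoc]] at this
    intro x h
    refine (EqvGen.iff_of_forall
      (fun x => c + 1 ≤ x.1 ∧ (D.drop c).Conn S' u (x.1 - (c + 1), x.2)) (fun x y hxy => ?_) h).mp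
      ⟨by simp [add_assoc], ?_⟩
    swap
    · simp only [add_assoc, add_tsub_cancel_right]; exact .refl _
    have key {x y : Node} (hc : c + 1 ≤ x.1 ↔ c + 1 ≤ y.1)
        (h' : c + 1 ≤ y.1 → (D.drop c).Conn S' (x.1 - (c + 1), x.2) (y.1 - (c + 1), y.2)) :
        c + 1 ≤ x.1 ∧ (D.drop c).Conn S' u (x.1 - (c + 1), x.2) ↔
          c + 1 ≤ y.1 ∧ (D.drop c).Conn S' u (y.1 - (c + 1), y.2) :=
      ⟨fun ⟨h1, h2⟩ => ⟨hc.mp h1, h2.trans _ _ _ (h' (hc.mp h1))⟩,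
        fun ⟨h1, h2⟩ => ⟨hc.mpr h1, h2.trans _ _ _ ((h' h1).symm _ _)⟩⟩
    have hex {k : ℕ} (hk : c + 1 ≤ k) : ∃ j, k = j + c + 1 ∧ k - (c + 1) = j :=
      ⟨k - (c + 1), by omega, rfl⟩
    cases hxy with
    | strand k p q h =>
      refine key Iff.rfl fun hk => ?_
      obtain ⟨j, rfl, hj⟩ := hex hk
      simp only [hj]
      exact .rel _ _ (.strand j p q h)
    | base i => simp
    | cap k i h =>
      refine key Iff.rfl fun hk => ?_
      obtain ⟨j, rfl, hj⟩ := hex hk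
      simp only [hj]
      exact .rel _ _ (.cap j i fun h' => h ((hS' _).mp h'))
    | cup k i h =>
      refine key Iff.rfl fun (hk : c + 1 ≤ k + 1) => ?_
      rcases Nat.eq_or_lt_of_le hk with hk | hk
      · obtain rfl : c = k := by omega
        simp only [Nat.sub_self]
        exact .rel _ _ (.base i)
      · obtain ⟨j, rfl, hj⟩ := hex (Nat.le_of_lt_succ hk)
        simp only [show j + c + 1 + 1 - (c + 1) = j + 1 by omega]
        exact .rel _ _ (.cup j i fun h' => h ((hS' _).mp h'))
    | vert k i h =>
      have hkc : k ≠ c := hS _ h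
      refine key ⟨fun (hk : c + 1 ≤ k) => show c + 1 ≤ k + 1 by omega,
        fun (hk : c + 1 ≤ k + 1) => show c + 1 ≤ k by omega⟩ fun (hk : c + 1 ≤ k + 1) => ?_
      obtain ⟨j, rfl, hj⟩ := hex (show c + 1 ≤ k by omega)
      simp only [hj, show j + c + 1 + 1 - (c + 1) = j + 1 by omega]
      exact .rel _ _ (.vert j i ((hS' _).mpr h))
  · intro h
    refine EqvGen.le ((Relation.EqvGen.is_equivalence (D.Adj S)).comap
      fun u : Node => (u.1 + c + 1, u.2)) (fun x y hxy => ?_) h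
    change D.Conn S (x.1 + c + 1, x.2) (y.1 + c + 1, y.2)
    cases hxy with
    | strand k p q h => exact .rel _ _ (.strand _ p q h)
    | base i =>
      simp only [zero_add]
      exact .rel _ _ (.cup c i fun h => hS _ h rfl)
    | cap k i h => exact .rel _ _ (.cap _ i fun h' => h ((hS' _).mpr h'))
    | cup k i h =>
      simp only [show k + 1 + c + 1 = k + c + 1 + 1 by omega]
      exact .rel _ _ (.cup _ i fun h' => h ((hS' _).mpr h'))
    | vert k i h =>
      simp only [show k + 1 + c + 1 = k + c + 1 + 1 by omega]
      exact .rel _ _ (.vert _ i ((hS' _).mp h))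

theorem transport_drop (D : Diagram) (c : ℕ) :
    D.Transport (D.drop c) (fun x => (x.1 + c + 1, x.2)) (fun _ => True)
      fun S S' => (∀ s ∈ S, s.1 ≠ c) ∧ ∀ s : Saddle, s ∈ S' ↔ (s.1 + c + 1, s.2) ∈ S := by
  refine .of_conn (fun u => (u.1 + c + 1, u.2)) (fun _ => True)
    (fun {S S' x} ⟨h1, h2⟩ hx => ⟨?_, fun s => ?_⟩)
    (fun {S S' u v} ⟨h1, h2⟩ _ _ => D.conn_drop h1 h2 u v) (fun _ => ⟨trivial, rfl⟩)
    (fun _ => ⟨trivial, rfl⟩) (fun {x} _ => ⟨trivial, ?_⟩)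
  · intro s hs
    rcases hs with rfl | hs
    · show x.1 + c + 1 ≠ c; omega
    · exact h1 s hs
  · rw [Set.mem_insert_iff, Set.mem_insert_iff, h2]
    simp [Prod.ext_iff]
  · simp only [Prod.mk.injEq, and_true]; omega

end Diagram

namespace Diagram

/-- The node of `D` which corresponds to a node of `D.fuse k`. -/
def fuseNode (k : ℕ) (u : Node) : Node :=
  (if u.1 < k ∨ (u.1 = k ∧ u.2.1 = false) then u.1 else u.1 + 1, u.2)

theorem fuseNode_self (k : ℕ) (p : Pt) : fuseNode k (k, p) = (if p.1 then k + 1 else k, p) := by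
  obtain ⟨b, i⟩ := p; cases b <;> simp [fuseNode]

theorem fuseNode_of_lt {k j : ℕ} (h : j < k) (p : Pt) : fuseNode k (j, p) = (j, p) := by
  simp [fuseNode, h]

theorem fuseNode_of_gt {k j : ℕ} (h : k < j) (p : Pt) : fuseNode k (j, p) = (j + 1, p) := by
  simp [fuseNode, show ¬ j < k by omega, show j ≠ k by omega]

/-- The saddle of `D` which corresponds to a saddle of `D.fuse k`. -/
def fuseSaddle (k : ℕ) (x : Saddle) : Saddle := (if x.1 < k then x.1 else x.1 + 1, x.2)

theorem fuseNode_true (k : ℕ) (x : Saddle) :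
    fuseNode k (x.1, true, x.2) = ((fuseSaddle k x).1, true, x.2) := by
  simp [fuseNode, fuseSaddle]

theorem fuseNode_false (k : ℕ) (x : Saddle) :
    fuseNode k (x.1 + 1, false, x.2) = ((fuseSaddle k x).1 + 1, false, x.2) := by
  rcases lt_or_ge x.1 k with h | h
  · simp [fuseNode, fuseSaddle, h, show x.1 + 1 < k ∨ x.1 + 1 = k by omega]
  · simp [fuseNode, fuseSaddle, show ¬ x.1 < k by omega,
      show ¬ (x.1 + 1 < k ∨ x.1 + 1 = k) by omega]

variable {D : Diagram} {K : ℕ} {sz : ℕ → ℕ} {τ : ℕ → Pt → Pt}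

/-- When every arc of a line has been contracted, the line carries only vertical strands, and the
strips on its two sides act as the glued strip. -/
theorem IsPlanar.fuse_of_conn (hD : D.IsPlanar K sz τ) {k : ℕ} (hk : k < K) {S S' : Set Saddle}
    (hcon : ∀ i < 2 * sz (k + 1), D.Con S k i) (hS' : ∀ s, s ∈ S' ↔ fuseSaddle k s ∈ S)
    {u v : Node} (huv : D.Conn S (fuseNode k u) (fuseNode k v)) : (D.fuse k).Conn S' u v := by
  have hE := Relation.EqvGen.is_equivalence ((D.fuse k).Adj S')
  have hG := Glue.equivalence (D.strip k) (D.strip (k + 1))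
  have hglue (p q : Pt) (h : Glue (D.strip k) (D.strip (k + 1)) (p.1, p) (q.1, q)) :
      (D.fuse k).Conn S' (k, p) (k, q) := .rel _ _ (.strand k p q (by simpa [fuse] using h))
  -- The predicate must be defined at all nodes of `D`, including those on the erased line. In the
  -- two strips next to this line it refers to an outer endpoint `q` on the same component of the
  -- glued strip.
  let P : Node → Prop := fun v =>
    if v.1 < k then (D.fuse k).Conn S' u v
    else if v.1 = k ∨ v.1 = k + 1 then
      ∃ q : Pt, Glue (D.strip k) (D.strip (k + 1)) (decide (v.1 = k + 1), v.2) (q.1, q) ∧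
        (D.fuse k).Conn S' u (k, q)
    else (D.fuse k).Conn S' u (v.1 - 1, v.2)
  have hP (v : Node) : P (fuseNode k v) ↔ (D.fuse k).Conn S' u v := by
    obtain ⟨j, p⟩ := v
    rcases lt_trichotomy j k with h | rfl | h
    · simp [fuseNode_of_lt h, P, h]
    · rw [fuseNode_self]
      have h1 : P (if p.1 then j + 1 else j, p) ↔
          ∃ q : Pt, Glue (D.strip j) (D.strip (j + 1)) (p.1, p) (q.1, q) ∧
            (D.fuse j).Conn S' u (j, q) := by
        cases hp : p.1 <;> simp [P]
      rw [h1]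
      exact ⟨fun ⟨q, h2, h3⟩ => hE.trans h3 (hE.symm (hglue _ _ h2)), fun h => ⟨p, hG.refl _, h⟩⟩
    · simp [fuseNode_of_gt h, P, show ¬ j + 1 < k by omega, show j ≠ k by omega,
        show j + 1 ≠ k by omega]
  have hPg {x y : Bool × Pt} (h : Glue (D.strip k) (D.strip (k + 1)) x y) :
      P (if x.1 then k + 1 else k, x.2) ↔ P (if y.1 then k + 1 else k, y.2) := by
    have h1 (x : Bool × Pt) : P (if x.1 then k + 1 else k, x.2) ↔
        ∃ q : Pt, Glue (D.strip k) (D.strip (k + 1)) x (q.1, q) ∧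
          (D.fuse k).Conn S' u (k, q) := by
      obtain ⟨b, p⟩ := x
      cases b <;> simp [P]
    rw [h1, h1]
    exact ⟨fun ⟨q, h2, h3⟩ => ⟨q, hG.trans (hG.symm h) h2, h3⟩,
      fun ⟨q, h2, h3⟩ => ⟨q, hG.trans h h2, h3⟩⟩
  have hPe {u v : Node} (h : (D.fuse k).Conn S' u v) : P (fuseNode k u) ↔ P (fuseNode k v) := by
    rw [hP, hP]; exact ⟨fun h' => hE.trans h' h, fun h' => hE.trans h' (hE.symm h)⟩
  rw [← hP]
  refine (EqvGen.iff_of_forall P (fun x y hxy => ?_) huv).mp ((hP u).mpr (hE.refl u))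
  -- A position without a vertical strand lies beyond the end of the line, where the arc map is the
  -- identity and the connection is trivial.
  have hfix {i : ℕ} (h : (k, min i (D.line k i)) ∉ S) : D.line k i = i :=
    (hD.line k hk).fix i (by by_contra hc; exact h (hcon i (by omega)))
  cases hxy with
  | strand j p q h =>
    rcases lt_trichotomy j k with hj | rfl | hj
    · have := hPe (.rel _ _ (.strand (D := D.fuse k) (S := S') j p q (by simpa [fuse, hj] using h)))
      simpa only [fuseNode_of_lt hj] using this
    · simpa using hPg (.rel _ _ (.lower p q h))
    · rcases Nat.eq_or_lt_of_le hj with rfl | hj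
      · simpa using hPg (.rel _ _ (.upper p q h))
      · obtain ⟨j, rfl⟩ : ∃ j', j = j' + 1 := ⟨j - 1, by omega⟩
        have hj' : k < j := by omega
        have := hPe (.rel _ _ (.strand (D := D.fuse k) (S := S') j p q
          (by simpa [fuse, hj'.not_gt, hj'.ne'] using h)))
        simpa only [fuseNode_of_gt hj'] using this
  | base i =>
    have := hPe (.rel _ _ (.base (D := D.fuse k) (S := S') i))
    have e (i : ℕ) : fuseNode k (0, false, i) = (0, false, i) := by
      simp [fuseNode]; omega
    rwa [e, e] at this
  | cap j i h =>
    rcases eq_or_ne j k with rfl | hj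
    · rw [hfix h]
    · obtain ⟨j', rfl⟩ : ∃ j', j = (if j' < k then j' else j' + 1) := by
        rcases lt_or_gt_of_ne hj with hj | hj
        · exact ⟨j, by simp [hj]⟩
        · exact ⟨j - 1, by rw [if_neg (by omega)]; omega⟩
      have := hPe (.rel _ _ (.cap (D := D.fuse k) (S := S') j' i (by rw [hS']; exact h)))
      rw [fuseNode_true k (j', i), fuseNode_true k (j', (D.fuse k).line j' i)] at this
      exact this
  | cup j i h =>
    rcases eq_or_ne j k with rfl | hj
    · rw [hfix h]
    · obtain ⟨j', rfl⟩ : ∃ j', j = (if j' < k then j' else j' + 1) := by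
        rcases lt_or_gt_of_ne hj with hj | hj
        · exact ⟨j, by simp [hj]⟩
        · exact ⟨j - 1, by rw [if_neg (by omega)]; omega⟩
      have := hPe (.rel _ _ (.cup (D := D.fuse k) (S := S') j' i (by rw [hS']; exact h)))
      rw [fuseNode_false k (j', i), fuseNode_false k (j', (D.fuse k).line j' i)] at this
      exact this
  | vert j i h =>
    rcases eq_or_ne j k with rfl | hj
    · simpa using hPg (.rel _ _ (.mid i))
    · obtain ⟨j', rfl⟩ : ∃ j', j = (if j' < k then j' else j' + 1) := by
        rcases lt_or_gt_of_ne hj with hj | hj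
        · exact ⟨j, by simp [hj]⟩
        · exact ⟨j - 1, by rw [if_neg (by omega)]; omega⟩
      have := hPe (.rel _ _ (.vert (D := D.fuse k) (S := S') j' i (by rw [hS']; exact h)))
      rw [fuseNode_true k (j', i), fuseNode_false k (j', i)] at this
      exact this

/-- The converse needs an actual node to start from: `Glue` has vertical connections at all
positions, but `D` has them only within the line. The range condition `ρ` is preserved by all
connections of the glued strip, so the superfluous ones are never met. -/
theorem IsPlanar.conn_of_fuse (hD : D.IsPlanar K sz τ) {k : ℕ} (hk : k + 1 < K) {S S' : Set Saddle}
    (hcon : ∀ i < 2 * sz (k + 1), D.Con S k i) (hS' : ∀ s, s ∈ S' ↔ fuseSaddle k s ∈ S)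
    {K' : ℕ} {τ' : ℕ → Pt → Pt}
    (hD' : (D.fuse k).IsPlanar K' (fun j => if j ≤ k then sz j else sz (j + 1)) τ')
    (hin : IsInner K' S') {u v : Node}
    (hu : IsNode K' (fun j => if j ≤ k then sz j else sz (j + 1)) u)
    (h : (D.fuse k).Conn S' u v) : D.Conn S (fuseNode k u) (fuseNode k v) := by
  have hE := Relation.EqvGen.is_equivalence (D.Adj S)
  have hrange {j : ℕ} (hj : j < K) {p q : Pt} (h : D.strip j p q) :
      InRange (sz j) (sz (j + 1)) p ↔ InRange (sz j) (sz (j + 1)) q := by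
    rcases (hD.strip j hj p q).mp h with rfl | rfl
    · rfl
    · refine ⟨(hD.planar j hj).range p, fun h => ?_⟩
      have := (hD.planar j hj).range _ h
      rwa [(hD.planar j hj).invol] at this
  let ρ : Bool × Pt → Prop := fun x =>
    if x.1 then InRange (sz (k + 1)) (sz (k + 1 + 1)) x.2 else InRange (sz k) (sz (k + 1)) x.2
  let c : Node → Quotient (⟨_, hE⟩ : Setoid Node) := Quotient.mk _
  have hc {u v : Node} : c u = c v ↔ D.Conn S u v := Quotient.eq (r := ⟨_, hE⟩)
  have hglue {x y : Bool × Pt} (h : Glue (D.strip k) (D.strip (k + 1)) x y) :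
      (ρ x ↔ ρ y) ∧ (ρ x → D.Conn S (if x.1 then k + 1 else k, x.2)
        (if y.1 then k + 1 else k, y.2)) := by
    refine EqvGen.le (r := GlueAdj (D.strip k) (D.strip (k + 1)))
      (s := fun x y => (ρ x ↔ ρ y) ∧ (ρ x → D.Conn S (if x.1 then k + 1 else k, x.2)
        (if y.1 then k + 1 else k, y.2))) ⟨fun x => ⟨Iff.rfl, fun _ => hE.refl _⟩,
        fun h => ⟨h.1.symm, fun h' => hE.symm (h.2 (h.1.mpr h'))⟩,
        fun h h' => ⟨h.1.trans h'.1, fun h1 => hE.trans (h.2 h1) (h'.2 (h.1.mp h1))⟩⟩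
      (fun x y hxy => ?_) h
    cases hxy with
    | lower p q h =>
      exact ⟨by simpa [ρ] using hrange (show k < K by omega) h, fun _ => .rel _ _ (.strand k p q h)⟩
    | upper p q h =>
      exact ⟨by simpa [ρ] using hrange hk h, fun _ => .rel _ _ (.strand (k + 1) p q h)⟩
    | mid i =>
      simp only [ρ, InRange, Bool.false_eq_true, if_false, if_true, true_and]
      exact fun hi => .rel _ _ (.vert k i (hcon i hi))
  refine (hc.mp ((hD'.eq_of_conn hin (fun u => c (fuseNode k u)) (fun u hu => ?_)
    (fun u hu => ?_) h hu).2.symm))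
  · refine hc.mpr (hE.symm ?_)
    obtain ⟨j, b, i⟩ := u
    have hcf (j i : ℕ) : (D.fuse k).Con S' j i ↔
        D.Con S (fuseSaddle k (j, i)).1 i := by
      rw [Con, hS']; rfl
    cases b with
    | true =>
      by_cases h : (D.fuse k).Con S' j i
      · simp only [turn, h, if_true]
        rw [fuseNode_true k (j, i), fuseNode_false k (j, i)]
        exact .rel _ _ (.vert _ i ((hcf j i).mp h))
      · simp only [turn, h, if_false]
        rw [fuseNode_true k (j, i), fuseNode_true k (j, (D.fuse k).line j i)]
        exact .rel _ _ (.cap _ i (mt (hcf j i).mpr h))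
    | false =>
      cases j with
      | zero =>
        have e (i : ℕ) : fuseNode k (0, false, i) = (0, false, i) := by
          simp [fuseNode]; omega
        simp only [turn, e]
        exact .rel _ _ (.base i)
      | succ j =>
        by_cases h : (D.fuse k).Con S' j i
        · simp only [turn, h, if_true]
          rw [fuseNode_true k (j, i), fuseNode_false k (j, i)]
          exact .symm _ _ (.rel _ _ (.vert _ i ((hcf j i).mp h)))
        · simp only [turn, h, if_false]
          rw [fuseNode_false k (j, i), fuseNode_false k (j, (D.fuse k).line j i)]
          exact .rel _ _ (.cup _ i (mt (hcf j i).mpr h))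
  · refine hc.mpr (hE.symm ?_)
    obtain ⟨j, p⟩ := u
    have hs : (D.fuse k).strip j p (τ' j p) := (hD'.strip j hu.1 _ _).mpr (.inr rfl)
    rcases lt_trichotomy j k with hj | rfl | hj
    · simp only [fuseNode_of_lt hj]
      exact .rel _ _ (.strand _ _ _ (by simpa [fuse, hj] using hs))
    · simp only [fuseNode_self]
      refine (hglue (x := (p.1, p)) (y := ((τ' j p).1, τ' j p)) (by simpa [fuse] using hs)).2 ?_
      have := hu.2
      simp only [InRange, le_refl, if_true, show ¬ j + 1 ≤ j by omega, if_false] at this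
      cases hp : p.1 <;> simpa [ρ, hp, InRange] using this
    · simp only [fuseNode_of_gt hj]
      exact .rel _ _ (.strand _ _ _ (by simpa [fuse, hj.not_gt, hj.ne'] using hs))

theorem IsPlanar.transport_fuse (hD : D.IsPlanar K sz τ) {k : ℕ} (hk : k + 1 < K)
    {K' : ℕ} {τ' : ℕ → Pt → Pt}
    (hD' : (D.fuse k).IsPlanar K' (fun j => if j ≤ k then sz j else sz (j + 1)) τ') :
    D.Transport (D.fuse k) (fuseSaddle k) ((D.fuse k).IsSaddle K') fun S S' =>
      (∀ i < 2 * sz (k + 1), D.Con S k i) ∧ IsInner K' S' ∧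
        ∀ s, s ∈ S' ↔ fuseSaddle k s ∈ S := by
  refine .of_conn (fuseNode k) (IsNode K' fun j => if j ≤ k then sz j else sz (j + 1))
    (fun {S S' x} ⟨h1, h2, h3⟩ hx => ⟨fun i hi => .inr (h1 i hi), isInner_insert h2 hx,
      fun s => ?_⟩) (fun {S S' u v} ⟨h1, h2, h3⟩ hu hv =>
      ⟨hD.fuse_of_conn (by omega) h1 h3, hD.conn_of_fuse hk h1 h3 hD' h2 hu⟩) ?_ ?_ ?_
  · rw [Set.mem_insert_iff, Set.mem_insert_iff, h3]
    refine or_congr_left ⟨fun h => h ▸ rfl, fun h => ?_⟩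
    simp only [fuseSaddle, Prod.mk.injEq] at h
    refine Prod.ext ?_ h.2
    have := h.1
    split_ifs at this <;> omega
  · exact fun {x} hx => ⟨(hD'.isNode_tail hx).1, fuseNode_true k x⟩
  · exact fun {x} hx => ⟨(hD'.isNode_tail hx).2.1, fuseNode_true k (x.1, (D.fuse k).line x.1 x.2)⟩
  · exact fun {x} hx => ⟨(hD'.isNode_tail hx).2.2.1, fuseNode_false k x⟩

end Diagram

/-! ### Associativity of composition and the cocycle identity -/

theorem Diagram.exists_isPlanar {D : Diagram} {K : ℕ} (sz : ℕ → ℕ) (hb : IsArcs (sz 0) D.base)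
    (h : ∀ k < K, IsArcs (sz (k + 1)) (D.line k) ∧
      ∃ t : Tangle (sz k) (sz (k + 1)), D.strip k = t.Joined) : ∃ τ, D.IsPlanar K sz τ := by
  have key (k : ℕ) : ∃ τ, k < K → UnifiedArc.IsPlanar (sz k) (sz (k + 1)) τ ∧
      ∀ p q, D.strip k p q ↔ q = p ∨ q = τ p := by
    by_cases hk : k < K
    · obtain ⟨t, ht⟩ := (h k hk).2
      obtain ⟨τ, h1, h2⟩ := t.exists_isPlanar
      exact ⟨τ, fun _ => ⟨h1, by rw [ht]; exact h2⟩⟩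
    · exact ⟨fun p => p, fun h => absurd h hk⟩
  choose τ hτ using key
  exact ⟨τ, hb, fun k hk => (h k hk).1, fun k hk => (hτ k hk).1, fun k hk => (hτ k hk).2⟩

theorem saddles_eq {n : ℕ} (k : ℕ) (b : CrossMatch n) :
    saddles k b = b.arcs.map fun i : Fin (2 * n) => ((k, (i : ℕ)) : Saddle) := by
  have key (l : List (Fin (2 * n))) : (do let a ← l; pure (a : ℕ)) = l.map fun i : Fin (2 * n) => (i : ℕ) := by
    induction l with
    | nil => rfl
    | cons a l ih => simpa using ih
  rw [saddles, key, List.map_map]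
  rfl

theorem mem_saddles {n : ℕ} {k : ℕ} {b : CrossMatch n} {s : Saddle} :
    s ∈ saddles k b ↔ s.1 = k ∧ ∃ i : Fin (2 * n), (i : ℕ) = s.2 ∧ i < b.mate i := by
  obtain ⟨l, j⟩ := s
  simp only [saddles_eq, CrossMatch.arcs, List.mem_map, List.mem_filter, List.mem_reverse,
    List.mem_finRange, true_and, decide_eq_true_eq, exists_exists_and_eq_and, Prod.mk.injEq]
  constructor
  · rintro ⟨i, h, rfl, rfl⟩
    exact ⟨rfl, b.mate i, rfl, by rwa [b.mate_mate]⟩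
  · rintro ⟨rfl, i, rfl, h⟩
    exact ⟨b.mate i, by rwa [b.mate_mate], rfl, by rw [b.mate_mate]⟩

theorem con_saddles {n : ℕ} {k : ℕ} {b : CrossMatch n} {D : Diagram} (h : D.line k = b.mateN)
    {i : ℕ} (hi : i < 2 * n) : D.Con {s | s ∈ saddles k b} k i := by
  rw [Diagram.Con, h, b.mateN_of_lt hi, Set.mem_ofPred_eq, mem_saddles]
  refine ⟨rfl, ?_⟩
  have hne : (b.mate ⟨i, hi⟩ : ℕ) ≠ i := fun e => b.mate_ne ⟨i, hi⟩ (Fin.ext e)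
  rcases lt_or_gt_of_ne hne with h | h
  · exact ⟨b.mate ⟨i, hi⟩, (min_eq_right h.le).symm, by rw [b.mate_mate]; exact h⟩
  · exact ⟨⟨i, hi⟩, (min_eq_left h.le).symm, h⟩

theorem saddles_map {n : ℕ} (k l : ℕ) (b : CrossMatch n) (m : Saddle → Saddle)
    (h : ∀ i, m (k, i) = (l, i)) : (saddles k b).map m = saddles l b := by
  simp [saddles_eq, Function.comp_def, h]

theorem isInner_empty (K : ℕ) : IsInner K ∅ := fun _ h => absurd h (Set.notMem_empty _)

theorem Diagram.nested_empty (D : Diagram) : D.Nested ∅ :=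
  fun _ _ _ _ _ h => absurd h (Set.notMem_empty _)

namespace Diagram.IsPlanar
variable {D : Diagram} {K : ℕ} {sz : ℕ → ℕ} {τ : ℕ → Pt → Pt}

theorem isSaddle_saddles {n k : ℕ} {b : CrossMatch n} (h : D.line k = b.mateN)
    (hk : k + 1 < K) {s : Saddle} (hs : s ∈ saddles k b) : D.IsSaddle K s := by
  obtain ⟨rfl, i, hi, hlt⟩ := mem_saddles.mp hs
  refine ⟨hk, ?_⟩
  rw [h, ← hi, b.mateN_coe]
  exact hlt

/-- Contraction goes by decreasing right endpoint. An arc around the current one ends further to the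
right and has been contracted before; an arc below it ends further to the left and is still to come.
This makes each saddle ready when its turn comes. -/
theorem admissible_aux (hD : D.IsPlanar K sz τ) {n k : ℕ} {b : CrossMatch n}
    (h : D.line k = b.mateN) (hk : k + 1 < K) (js : List (Fin (2 * n)))
    (hjs : js.Pairwise (· > ·)) (hr : ∀ j ∈ js, b.mate j < j) {S : Set Saddle}
    (hS : ∀ i : Fin (2 * n), D.Con S k i ↔ max i (b.mate i) ∉ js)
    (hmax : ∀ j, b.mate j < j → j ∈ js ∨ ∀ j' ∈ js, j' < j) :
    D.Admissible K k S ((js.map b.mate).map fun i : Fin (2 * n) => ((k, (i : ℕ)) : Saddle)) := by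
  induction js generalizing S with
  | nil => trivial
  | cons j js ih =>
    rw [List.pairwise_cons] at hjs
    have hj := hr j (by simp)
    have hl (i : Fin (2 * n)) : D.line k i = (b.mate i : ℕ) := by rw [h, b.mateN_coe]
    have hx : D.IsSaddle K (k, (b.mate j : ℕ)) :=
      ⟨hk, by simp only [hl, b.mate_mate]; exact hj⟩
    have hbig (i : Fin (2 * n)) (h : j < max i (b.mate i)) : D.Con S k i := by
      rw [hS]
      intro hc
      rcases List.mem_cons.mp hc with e | hc
      · exact absurd h (by rw [e]; exact lt_irrefl _)
      · exact absurd (hjs.1 _ hc) (not_lt.mpr h.le)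
    have hlt : ∀ p : ℕ, p < D.line k p → p < 2 * n := fun p hp => by
      by_contra hc
      rw [h, b.isArcs.fix p (by omega)] at hp; omega
    refine ⟨hx, rfl, ?_, ⟨fun p h1 h2 => ?_, fun p h1 h2 => ?_⟩, ?_⟩
    · have h1 := mt (hS (b.mate j)).mp
        (by rw [b.mate_mate, max_eq_right hj.le]; simp)
      rwa [Diagram.Con, hl, b.mate_mate, min_eq_left (by exact_mod_cast hj.le)] at h1
    · simp only at h1 h2
      have hp := hlt p (h1.trans h2)
      refine hbig ⟨p, hp⟩ (lt_max_of_lt_right ?_)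
      have h2' : b.mate j < b.mate ⟨p, hp⟩ := by rw [← Fin.val_fin_lt, ← hl ⟨p, hp⟩]; exact h2
      have := (b.noncrossing ⟨p, hp⟩ (b.mate j) h1 h2').2
      rwa [b.mate_mate] at this
    · simp only [hl, b.mate_mate] at h1 h2
      have hp : p < 2 * n := h2.trans j.2
      have h3 := b.noncrossing (b.mate j) ⟨p, hp⟩ h1 (by rw [b.mate_mate]; exact h2)
      rw [b.mate_mate] at h3
      refine mt (hS ⟨p, hp⟩).mp (not_not.mpr ?_)
      have hm : max ⟨p, hp⟩ (b.mate ⟨p, hp⟩) < j := max_lt h2 h3.2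
      refine (hmax _ ?_).resolve_right fun h => absurd (h j (by simp)) (not_lt.mpr hm.le)
      rcases lt_or_gt_of_ne (b.mate_ne ⟨p, hp⟩) with h | h
      · rwa [max_eq_left h.le]
      · rw [max_eq_right h.le, b.mate_mate]; exact h
    · refine ih hjs.2 (fun j' h' => hr j' (by simp [h'])) (fun i => ?_) (fun j' h' => ?_)
      · rw [hD.con_insert hx, hS]
        simp only [hl, b.mate_mate, true_and, Fin.val_inj, List.mem_cons, not_or]
        have e : i = b.mate j ∨ i = j ↔ max i (b.mate i) = j := by
          constructor
          · rintro (rfl | rfl)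
            · rw [b.mate_mate, max_eq_right hj.le]
            · rw [max_eq_left hj.le]
          · intro e
            rcases max_choice i (b.mate i) with h' | h' <;> rw [h'] at e
            · exact .inr e
            · exact .inl (by rw [← e, b.mate_mate])
        rw [e]
        constructor
        · rintro (h' | h')
          · exact fun hc => absurd (hjs.1 _ hc) (by rw [h']; exact lt_irrefl _)
          · exact h'.2
        · intro h'
          by_cases h'' : max i (b.mate i) = j
          · exact .inl h''
          · exact .inr ⟨h'', h'⟩
      · rcases hmax j' h' with h1 | h1
        · rcases List.mem_cons.mp h1 with rfl | h1
          · exact .inr hjs.1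
          · exact .inl h1
        · exact .inr fun j'' h2 => h1 j'' (by simp [h2])

theorem admissible_saddles (hD : D.IsPlanar K sz τ) {n k : ℕ} {b : CrossMatch n}
    (h : D.line k = b.mateN) (hk : k + 1 < K) {S : Set Saddle} (hS : ∀ s ∈ S, s.1 ≠ k) :
    D.Admissible K k S (saddles k b) := by
  rw [saddles_eq]
  refine hD.admissible_aux h hk _ ?_ (by simp) (fun i => ?_) fun j hj => ?_
  · refine List.Pairwise.filter _ ?_
    rw [List.pairwise_reverse]
    exact List.pairwise_lt_finRange _
  · refine iff_of_false (fun hc => hS _ hc rfl) (not_not.mpr ?_)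
    simp only [List.mem_filter, List.mem_reverse, List.mem_finRange, true_and, decide_eq_true_eq]
    rcases lt_or_gt_of_ne (b.mate_ne i) with h | h
    · rwa [max_eq_left h.le]
    · rw [max_eq_right h.le, b.mate_mate]; exact h
  · exact .inl (by simpa using hj)

end Diagram.IsPlanar

/-- The closed diagram `a t₁ b̄ b t₂ c̄ c t₃ d̄ d t₄ ē`. -/
def diag₄ {k l m p q : ℕ} (a : CrossMatch k) (b : CrossMatch l) (c : CrossMatch m) (d : CrossMatch p)
    (e : CrossMatch q) (t₁ : Tangle k l) (t₂ : Tangle l m) (t₃ : Tangle m p) (t₄ : Tangle p q) :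
    Diagram where
  base := a.mateN
  strip
    | 0 => t₁.Joined
    | 1 => t₂.Joined
    | 2 => t₃.Joined
    | 3 => t₄.Joined
    | _ => fun _ _ => False
  line
    | 0 => b.mateN
    | 1 => c.mateN
    | 2 => d.mateN
    | 3 => e.mateN
    | _ => id

theorem Diagram.eq_of_forall {D D' : Diagram} (h₁ : D.base = D'.base) (h₂ : ∀ k, D.strip k = D'.strip k)
    (h₃ : ∀ k, D.line k = D'.line k) : D = D' := by
  obtain ⟨b, s, l⟩ := D
  obtain ⟨b', s', l'⟩ := D'
  obtain rfl : b = b' := h₁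
  obtain rfl : s = s' := funext h₂
  obtain rfl : l = l' := funext h₃
  rfl

/-- The sizes of the lines of a diagram. -/
def sizes (k l m p q : ℕ) : ℕ → ℕ
  | 0 => k
  | 1 => l
  | 2 => m
  | 3 => p
  | _ => q

section
variable {k l m p q : ℕ} (a : CrossMatch k) (b : CrossMatch l) (c : CrossMatch m) (d : CrossMatch p)
    (e : CrossMatch q) (t₁ : Tangle k l) (t₂ : Tangle l m) (t₃ : Tangle m p) (t₄ : Tangle p q)

theorem Tangle.joined_comp' (t : Tangle k l) (s : Tangle l m) : (t.comp s).Joined =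
    fun x y => Glue t.Joined s.Joined (x.1, x) (y.1, y) :=
  funext fun x => funext fun y => propext (t.joined_comp s x y)

theorem diag₃_isPlanar (sz : ℕ → ℕ) (h : sz = sizes k l m p q) :
    ∃ τ, (diag₃ a b c d t₁ t₂ t₃).IsPlanar 3 sz τ := by
  subst h
  refine Diagram.exists_isPlanar _ a.isArcs fun j hj => ?_
  interval_cases j
  · exact ⟨b.isArcs, t₁, rfl⟩
  · exact ⟨c.isArcs, t₂, rfl⟩
  · exact ⟨d.isArcs, t₃, rfl⟩

theorem diag₂_isPlanar (p q : ℕ) (sz : ℕ → ℕ) (h : sz = sizes k l m p q) :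
    ∃ τ, (diag₂ a b c t₁ t₂).IsPlanar 2 sz τ := by
  subst h
  refine Diagram.exists_isPlanar _ a.isArcs fun j hj => ?_
  interval_cases j
  · exact ⟨b.isArcs, t₁, rfl⟩
  · exact ⟨c.isArcs, t₂, rfl⟩

theorem diag₄_isPlanar : ∃ τ, (diag₄ a b c d e t₁ t₂ t₃ t₄).IsPlanar 4 (sizes k l m p q) τ := by
  refine Diagram.exists_isPlanar _ a.isArcs fun j hj => ?_
  interval_cases j
  · exact ⟨b.isArcs, t₁, rfl⟩
  · exact ⟨c.isArcs, t₂, rfl⟩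
  · exact ⟨d.isArcs, t₃, rfl⟩
  · exact ⟨e.isArcs, t₄, rfl⟩

theorem diag₄_take_two : (diag₄ a b c d e t₁ t₂ t₃ t₄).take 2 = diag₃ a b c d t₁ t₂ t₃ := by
  refine Diagram.eq_of_forall rfl (fun j => ?_) (fun j => ?_) <;>
    rcases j with _ | _ | _ | _ | j <;> simp [Diagram.take, diag₄, diag₃]

theorem diag₄_take_one : (diag₄ a b c d e t₁ t₂ t₃ t₄).take 1 = diag₂ a b c t₁ t₂ := by
  refine Diagram.eq_of_forall rfl (fun j => ?_) (fun j => ?_) <;>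
    rcases j with _ | _ | _ | _ | j <;> simp [Diagram.take, diag₄, diag₂]

theorem diag₃_take_one : (diag₃ a b c d t₁ t₂ t₃).take 1 = diag₂ a b c t₁ t₂ := by
  refine Diagram.eq_of_forall rfl (fun j => ?_) (fun j => ?_) <;>
    rcases j with _ | _ | _ | _ | j <;> simp [Diagram.take, diag₃, diag₂]

theorem diag₄_drop_zero : (diag₄ a b c d e t₁ t₂ t₃ t₄).drop 0 = diag₃ b c d e t₂ t₃ t₄ := by
  refine Diagram.eq_of_forall rfl (fun j => ?_) (fun j => ?_) <;> rcases j with _ | _ | _ | j <;> rfl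

theorem diag₄_drop_one : (diag₄ a b c d e t₁ t₂ t₃ t₄).drop 1 = diag₂ c d e t₃ t₄ := by
  refine Diagram.eq_of_forall rfl (fun j => ?_) (fun j => ?_) <;> rcases j with _ | _ | _ | j <;> rfl

theorem diag₃_drop_zero : (diag₃ a b c d t₁ t₂ t₃).drop 0 = diag₂ b c d t₂ t₃ := by
  refine Diagram.eq_of_forall rfl (fun j => ?_) (fun j => ?_) <;> rcases j with _ | _ | _ | j <;> rfl

theorem diag₄_fuse_zero :
    (diag₄ a b c d e t₁ t₂ t₃ t₄).fuse 0 = diag₃ a c d e (t₁.comp t₂) t₃ t₄ := by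
  refine Diagram.eq_of_forall rfl (fun j => ?_) (fun j => ?_) <;> rcases j with _ | _ | _ | j <;>
    simp [Diagram.fuse, diag₄, diag₃, Tangle.joined_comp']

theorem diag₄_fuse_one :
    (diag₄ a b c d e t₁ t₂ t₃ t₄).fuse 1 = diag₃ a b d e t₁ (t₂.comp t₃) t₄ := by
  refine Diagram.eq_of_forall rfl (fun j => ?_) (fun j => ?_) <;> rcases j with _ | _ | _ | j <;>
    simp [Diagram.fuse, diag₄, diag₃, Tangle.joined_comp']

theorem diag₄_fuse_two :
    (diag₄ a b c d e t₁ t₂ t₃ t₄).fuse 2 = diag₃ a b c e t₁ t₂ (t₃.comp t₄) := by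
  refine Diagram.eq_of_forall rfl (fun j => ?_) (fun j => ?_) <;> rcases j with _ | _ | _ | j <;>
    simp [Diagram.fuse, diag₄, diag₃, Tangle.joined_comp']

theorem diag₃_fuse_zero :
    (diag₃ a b c d t₁ t₂ t₃).fuse 0 = diag₂ a c d (t₁.comp t₂) t₃ := by
  refine Diagram.eq_of_forall rfl (fun j => ?_) (fun j => ?_) <;> rcases j with _ | _ | _ | j <;>
    simp [Diagram.fuse, diag₂, diag₃, Tangle.joined_comp']

theorem diag₃_fuse_one :
    (diag₃ a b c d t₁ t₂ t₃).fuse 1 = diag₂ a b d t₁ (t₂.comp t₃) := by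
  refine Diagram.eq_of_forall rfl (fun j => ?_) (fun j => ?_) <;> rcases j with _ | _ | _ | j <;>
    simp [Diagram.fuse, diag₂, diag₃, Tangle.joined_comp']

end

namespace Diagram
variable {D : Diagram} {K : ℕ} {sz : ℕ → ℕ} {τ : ℕ → Pt → Pt} {n n' : ℕ}

theorem deg_take (D : Diagram) {c k : ℕ} (hk : k < c) (b : CrossMatch n) :
    (D.take c).deg ∅ (saddles k b) = D.deg ∅ (saddles k b) := by
  have := (D.transport_take c).deg (S := ∅) (S' := ∅) (by simp) (xs := saddles k b)
    (fun x hx => by rw [mem_saddles] at hx; omega)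
  rw [← this, List.map_id]

theorem passAll_take (D : Diagram) {c k k' : ℕ} (hk : k < c) (hk' : k' < c) (b : CrossMatch n)
    (b' : CrossMatch n') :
    (D.take c).passAll ∅ (saddles k b) (saddles k' b') =
      D.passAll ∅ (saddles k b) (saddles k' b') := by
  have := (D.transport_take c).passAll (S := ∅) (S' := ∅) (by simp) (xs := saddles k b)
    (ys := saddles k' b') (fun x hx => by rw [mem_saddles] at hx; omega)
    (fun x hx => by rw [mem_saddles] at hx; omega)
  rw [← this, List.map_id, List.map_id]

theorem deg_drop (D : Diagram) (c k : ℕ) (b : CrossMatch n) :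
    (D.drop c).deg ∅ (saddles k b) = D.deg ∅ (saddles (k + c + 1) b) := by
  have := (D.transport_drop c).deg (S := ∅) (S' := ∅) (by simp) (xs := saddles k b)
    (fun _ _ => trivial)
  rw [← this, saddles_map k (k + c + 1) b _ fun _ => rfl]

theorem passAll_drop (D : Diagram) (c k k' : ℕ) (b : CrossMatch n) (b' : CrossMatch n') :
    (D.drop c).passAll ∅ (saddles k b) (saddles k' b') =
      D.passAll ∅ (saddles (k + c + 1) b) (saddles (k' + c + 1) b') := by
  have := (D.transport_drop c).passAll (S := ∅) (S' := ∅) (by simp) (xs := saddles k b)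
    (ys := saddles k' b') (fun _ _ => trivial) (fun _ _ => trivial)
  rw [← this, saddles_map k (k + c + 1) b _ fun _ => rfl,
    saddles_map k' (k' + c + 1) b' _ fun _ => rfl]

/-- `fuseSaddle k` takes no value on the line `k`. The state of `D` in which exactly this line is
contracted therefore corresponds to the untouched fused diagram. -/
theorem IsPlanar.fuse_start {n₀ : ℕ} {c : CrossMatch n₀} {k : ℕ}
    (hc : D.line k = c.mateN) (hsz : sz (k + 1) = n₀) (K' : ℕ) :
    (∀ i < 2 * sz (k + 1), D.Con {s | s ∈ saddles k c} k i) ∧ IsInner K' ∅ ∧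
      ∀ s, s ∈ (∅ : Set Saddle) ↔ fuseSaddle k s ∈ {s | s ∈ saddles k c} := by
  refine ⟨fun i hi => con_saddles hc (hsz ▸ hi), isInner_empty _, fun s => ?_⟩
  rw [Set.mem_ofPred_eq, mem_saddles]
  simp only [Set.mem_empty_iff_false, false_iff, not_and, fuseSaddle]
  intro h
  split_ifs at h <;> omega

theorem IsPlanar.deg_fuse (hD : D.IsPlanar K sz τ) {n₀ : ℕ} {c : CrossMatch n₀} {k : ℕ}
    (hk : k + 1 < K) (hc : D.line k = c.mateN) (hsz : sz (k + 1) = n₀) {K' : ℕ} {τ' : ℕ → Pt → Pt}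
    (hD' : (D.fuse k).IsPlanar K' (fun j => if j ≤ k then sz j else sz (j + 1)) τ')
    {j : ℕ} {b : CrossMatch n} (hj : j + 1 < K') (hb : (D.fuse k).line j = b.mateN) :
    (D.fuse k).deg ∅ (saddles j b) =
      D.deg {s | s ∈ saddles k c} (saddles (if j < k then j else j + 1) b) := by
  have := (hD.transport_fuse hk hD').deg (IsPlanar.fuse_start hc hsz K') (xs := saddles j b)
    (fun x hx => IsPlanar.isSaddle_saddles hb hj hx)
  rw [← this, saddles_map j (if j < k then j else j + 1) b _ fun _ => rfl]

theorem IsPlanar.passAll_fuse (hD : D.IsPlanar K sz τ) {n₀ : ℕ} {c : CrossMatch n₀} {k : ℕ}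
    (hk : k + 1 < K) (hc : D.line k = c.mateN) (hsz : sz (k + 1) = n₀) {K' : ℕ} {τ' : ℕ → Pt → Pt}
    (hD' : (D.fuse k).IsPlanar K' (fun j => if j ≤ k then sz j else sz (j + 1)) τ')
    {j j' : ℕ} {b : CrossMatch n} (hj : j + 1 < K') (hb : (D.fuse k).line j = b.mateN)
    {b' : CrossMatch n'} (hj' : j' + 1 < K') (hb' : (D.fuse k).line j' = b'.mateN) :
    (D.fuse k).passAll ∅ (saddles j b) (saddles j' b') =
      D.passAll {s | s ∈ saddles k c} (saddles (if j < k then j else j + 1) b)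
        (saddles (if j' < k then j' else j' + 1) b') := by
  have := (hD.transport_fuse hk hD').passAll (IsPlanar.fuse_start hc hsz K') (xs := saddles j b)
    (ys := saddles j' b') (fun x hx => IsPlanar.isSaddle_saddles hb hj hx)
    (fun x hx => IsPlanar.isSaddle_saddles hb' hj' hx)
  rw [← this, saddles_map j (if j < k then j else j + 1) b _ fun _ => rfl, saddles_map j' (if j' < k then j' else j' + 1) b' _ fun _ => rfl]

end Diagram

/-- Both sides are the total degree of contracting the two inner lines of the diagram of three
tangles, in the two orders. Contracting one line first leaves the diagram with the corresponding
strips fused. -/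
theorem cobDeg_assoc {k l m p : ℕ} (a : CrossMatch k) (b : CrossMatch l) (c : CrossMatch m)
    (d : CrossMatch p) (t₁ : Tangle k l) (t₂ : Tangle l m) (t₃ : Tangle m p) :
    cobDeg a b c t₁ t₂ + cobDeg a c d (t₁.comp t₂) t₃ =
      cobDeg b c d t₂ t₃ + cobDeg a b d t₁ (t₂.comp t₃) := by
  obtain ⟨τ, hD⟩ := diag₃_isPlanar (q := p) a b c d t₁ t₂ t₃ _ rfl
  obtain ⟨τ₀, h₀⟩ := diag₂_isPlanar a c d (t₁.comp t₂) t₃ p p _ rfl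
  obtain ⟨τ₁, h₁⟩ := diag₂_isPlanar a b d t₁ (t₂.comp t₃) p p _ rfl
  have hf0 : (diag₃ a b c d t₁ t₂ t₃).fuse 0 = _ := diag₃_fuse_zero a b c d t₁ t₂ t₃
  have hf1 : (diag₃ a b c d t₁ t₂ t₃).fuse 1 = _ := diag₃_fuse_one a b c d t₁ t₂ t₃
  have e0 : sizes k m p p p = fun j => if j ≤ 0 then sizes k l m p p j else sizes k l m p p (j + 1) := by
    funext j; rcases j with _ | _ | _ | _ | j <;> rfl
  have e1 : sizes k l p p p = fun j => if j ≤ 1 then sizes k l m p p j else sizes k l m p p (j + 1) := by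
    funext j; rcases j with _ | _ | _ | _ | j <;> simp [sizes]
  rw [e0, ← hf0] at h₀
  rw [e1, ← hf1] at h₁
  have key := hD.deg_comm (j := 0) (k := 1) (by decide) (isInner_empty _)
    (hD.admissible_saddles (b := b) rfl (by decide) (by simp))
    (hD.admissible_saddles (b := c) rfl (by decide) (by simp))
  rw [Set.empty_union, Set.empty_union] at key
  have h1 := hD.deg_fuse (c := b) (b := c) (k := 0) (j := 0) (by decide) rfl rfl h₀ (by decide)
    (by rw [hf0]; rfl)
  have h2 := hD.deg_fuse (c := c) (b := b) (k := 1) (j := 0) (by decide) rfl rfl h₁ (by decide)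
    (by rw [hf1]; rfl)
  rw [hf0] at h1
  rw [hf1] at h2
  have h3 := (diag₃ a b c d t₁ t₂ t₃).deg_take (c := 1) (k := 0) (by decide) b
  have h4 := (diag₃ a b c d t₁ t₂ t₃).deg_drop 0 0 c
  rw [diag₃_take_one] at h3
  rw [diag₃_drop_zero] at h4
  simp only [cobDeg]
  rw [h1, h2, h3, h4]
  exact key

theorem Hom.comp_assoc {a b c d : Obj} (f : Hom a b) (g : Hom b c) (h : Hom c d) :
    (f.comp g).comp h = f.comp (g.comp h) := by
  have := cobDeg_assoc a.2 b.2 c.2 d.2 f.1 g.1 h.1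
  refine Prod.ext (Tangle.comp_assoc _ _ _) ?_
  simp only [Hom.comp]
  calc _ = f.2 + g.2 + h.2 + (cobDeg a.2 b.2 c.2 f.1 g.1 + cobDeg a.2 c.2 d.2 (f.1.comp g.1) h.1) := by
        abel
    _ = _ := by rw [this]; abel

/-- The untouched line of `c` separates the saddles of `b` from those of `d`. The type of each is
decided on its own side of this line, so no saddle influences one on the other side. -/
theorem passAll_far {k l m p q : ℕ} (a : CrossMatch k) (b : CrossMatch l) (c : CrossMatch m)
    (d : CrossMatch p) (e : CrossMatch q) (t₁ : Tangle k l) (t₂ : Tangle l m) (t₃ : Tangle m p)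
    (t₄ : Tangle p q) :
    (diag₄ a b c d e t₁ t₂ t₃ t₄).passAll ∅ (saddles 0 b) (saddles 2 d) =
      lam (cobDeg c d e t₃ t₄) (cobDeg a b c t₁ t₂) := by
  set D := diag₄ a b c d e t₁ t₂ t₃ t₄ with hD
  have h1 := D.deg_take (c := 1) (k := 0) (by decide) b
  have h2 := D.deg_drop 1 0 d
  rw [hD, diag₄_take_one, ← hD] at h1
  rw [hD, diag₄_drop_one, ← hD] at h2
  rw [cobDeg, cobDeg, h1, h2]
  refine Diagram.passAll_of_unlinked (fun S => ∀ s ∈ S, s.1 ≠ 1) (fun S hS x hx s hs => ?_)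
    (fun S hS z hz s hs => ?_) (fun S hS x hx z hz => ?_) (by simp)
  · rw [mem_saddles] at hx
    rcases hs with rfl | hs
    · omega
    · exact hS s hs
  · rw [mem_saddles] at hz
    rcases hs with rfl | hs
    · omega
    · exact hS s hs
  · rw [mem_saddles] at hx hz
    have hx1 := hx.1
    have hz1 := hz.1
    have hS' (y : Saddle) (hy : y.1 ≠ 1) : ∀ s ∈ insert y S, s.1 ≠ 1 := fun s hs => by
      rcases hs with rfl | hs
      · exact hy
      · exact hS s hs
    constructor
    · have ht := D.transport_take 1
      have h1 := ht.isMerge (S := insert z S) ⟨hS' z (by omega), rfl⟩ (x := x) (by omega)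
      have h2 := ht.isMerge (S := S) ⟨hS, rfl⟩ (x := x) (by omega)
      have e : {s | s ∈ insert z S ∧ s.1 < 1} = {s | s ∈ S ∧ s.1 < 1} := by
        ext s
        simp only [Set.mem_insert_iff, Set.mem_ofPred_eq]
        constructor
        · rintro ⟨rfl | h, h'⟩
          · omega
          · exact ⟨h, h'⟩
        · exact fun h => ⟨.inr h.1, h.2⟩
      rw [e] at h1
      exact h1.trans h2.symm
    · have ht := D.transport_drop 1
      obtain ⟨w, rfl⟩ : ∃ w : Saddle, z = (w.1 + 1 + 1, w.2) :=
        ⟨(0, z.2), Prod.ext hz1 rfl⟩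
      have h1 := ht.isMerge (S := insert x S) (S' := {s | (s.1 + 1 + 1, s.2) ∈ S})
        ⟨hS' x (by omega), fun s => ?_⟩ (x := w) trivial
      · have h2 := ht.isMerge (S := S) (S' := {s | (s.1 + 1 + 1, s.2) ∈ S})
          ⟨hS, fun _ => Iff.rfl⟩ (x := w) trivial
        exact h1.trans h2.symm
      · rw [Set.mem_insert_iff]
        refine ⟨.inr, fun h => h.resolve_left fun h => ?_⟩
        have := congrArg Prod.fst h
        simp only at this
        omega

/-- The associator is a `3`-cocycle. -/
theorem assoc_pentagon {a b c d e : Obj} (f : Hom a b) (g : Hom b c) (h : Hom c d) (k : Hom d e) :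
    assoc f g h * assoc f (g.comp h) k * assoc g h k =
      assoc (f.comp g) h k * assoc f g (h.comp k) := by
  obtain ⟨na, a⟩ := a
  obtain ⟨nb, b⟩ := b
  obtain ⟨nc, c⟩ := c
  obtain ⟨nd, d⟩ := d
  obtain ⟨ne, e⟩ := e
  obtain ⟨t₁, p₁⟩ := f
  obtain ⟨t₂, p₂⟩ := g
  obtain ⟨t₃, p₃⟩ := h
  obtain ⟨t₄, p₄⟩ := k
  simp only at t₁ t₂ t₃ t₄
  obtain ⟨τ, hD⟩ := diag₄_isPlanar a b c d e t₁ t₂ t₃ t₄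
  have hf0 := diag₄_fuse_zero a b c d e t₁ t₂ t₃ t₄
  have hf1 := diag₄_fuse_one a b c d e t₁ t₂ t₃ t₄
  have hf2 := diag₄_fuse_two a b c d e t₁ t₂ t₃ t₄
  obtain ⟨τ₀, h₀⟩ := diag₃_isPlanar (q := ne) a c d e (t₁.comp t₂) t₃ t₄ _ rfl
  obtain ⟨τ₁, h₁⟩ := diag₃_isPlanar (q := ne) a b d e t₁ (t₂.comp t₃) t₄ _ rfl
  obtain ⟨τ₂, h₂⟩ := diag₃_isPlanar (q := ne) a b c e t₁ t₂ (t₃.comp t₄) _ rfl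
  have e0 : sizes na nc nd ne ne = fun j => if j ≤ 0 then sizes na nb nc nd ne j else
      sizes na nb nc nd ne (j + 1) := by
    funext j; rcases j with _ | _ | _ | _ | j <;> rfl
  have e1 : sizes na nb nd ne ne = fun j => if j ≤ 1 then sizes na nb nc nd ne j else
      sizes na nb nc nd ne (j + 1) := by
    funext j; rcases j with _ | _ | _ | _ | j <;> simp [sizes]
  have e2 : sizes na nb nc ne ne = fun j => if j ≤ 2 then sizes na nb nc nd ne j else
      sizes na nb nc nd ne (j + 1) := by
    funext j; rcases j with _ | _ | _ | _ | j <;> simp [sizes]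
  rw [e0, ← hf0] at h₀
  rw [e1, ← hf1] at h₁
  rw [e2, ← hf2] at h₂
  -- Of the six factors in this identity five are the geometric parts `α₁` of the five associators.
  -- The sixth, the exchange of the outermost inner lines while the middle one is untouched, is a
  -- value of `λ` by `passAll_far`; it accounts for the saddle degree in the composite `f.comp g`.
  have key := hD.passAll_comm (j := 0) (l := 1) (k := 2) (by decide) (by decide) (by decide)
    (isInner_empty _) (Diagram.nested_empty _)
    (hD.admissible_saddles (b := b) rfl (by decide) (by simp))
    (hD.admissible_saddles (b := c) rfl (by decide) (by simp))
    (hD.admissible_saddles (b := d) rfl (by decide) (by simp))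
  rw [Set.empty_union, Set.empty_union, Set.empty_union] at key
  have a0 := hD.passAll_fuse (c := b) (b := c) (b' := d) (k := 0) (j := 0) (j' := 1) (by decide) rfl
    rfl h₀ (by decide) (by rw [hf0]; rfl) (by decide) (by rw [hf0]; rfl)
  have a1 := hD.passAll_fuse (c := c) (b := b) (b' := d) (k := 1) (j := 0) (j' := 1) (by decide) rfl
    rfl h₁ (by decide) (by rw [hf1]; rfl) (by decide) (by rw [hf1]; rfl)
  have a2 := hD.passAll_fuse (c := d) (b := b) (b' := c) (k := 2) (j := 0) (j' := 1) (by decide) rfl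
    rfl h₂ (by decide) (by rw [hf2]; rfl) (by decide) (by rw [hf2]; rfl)
  have a3 := (diag₄ a b c d e t₁ t₂ t₃ t₄).passAll_take (c := 2) (k := 0) (k' := 1) (by decide)
    (by decide) b c
  have a4 := (diag₄ a b c d e t₁ t₂ t₃ t₄).passAll_drop 0 0 1 c d
  rw [hf0] at a0
  rw [hf1] at a1
  rw [hf2] at a2
  rw [diag₄_take_two] at a3
  rw [diag₄_drop_zero] at a4
  have a5 := passAll_far a b c d e t₁ t₂ t₃ t₄
  have a6 := cobDeg_assoc b c d e t₂ t₃ t₄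
  simp only [Nat.lt_irrefl, Nat.not_lt_zero, if_false, if_true, zero_add, Nat.reduceAdd, Nat.reduceLT]
    at a0 a1 a2 a3 a4
  simp only [assoc, Hom.comp]
  rw [a0, a1, a2, a3, a4]
  simp only [lam_add_right]
  rw [a5] at key
  -- The corrections by `λ` in the degree `p₁` agree because the total saddle degrees do.
  have a7 : lam (cobDeg b c d t₂ t₃) p₁ * lam (cobDeg b d e (t₂.comp t₃) t₄) p₁ =
      lam (cobDeg c d e t₃ t₄) p₁ * lam (cobDeg b c e t₂ (t₃.comp t₄)) p₁ := by
    rw [← lam_add_left, a6, lam_add_left]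
  generalize (diag₄ a b c d e t₁ t₂ t₃ t₄).passAll = P at *
  calc _ = P ∅ (saddles 0 b) (saddles 1 c) * P {s | s ∈ saddles 1 c} (saddles 0 b) (saddles 2 d) *
        P ∅ (saddles 1 c) (saddles 2 d) * (lam (cobDeg b c d t₂ t₃) p₁ *
          lam (cobDeg b d e (t₂.comp t₃) t₄) p₁) * lam (cobDeg c d e t₃ t₄) p₂ := by ac_rfl
    _ = _ := by rw [key, a7]; ac_rfl

/-! ### Composition with identities and the unitors -/

theorem Tangle.one_joined (n : ℕ) (p q : Pt) : (Tangle.one n).Joined p q ↔ p.2 = q.2 := by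
  change (Word.nil n).Joined p q ↔ _
  simp only [Word.Joined]

namespace Diagram
variable {D : Diagram} {S : Set Saddle} {L : ℕ → ℕ}

/-- The circle through an arc which is closed by vertical strands below it. -/
theorem conn_below (hL : ∀ i, L (L i) = i) {k : ℕ} (hb : D.base = L)
    (hl : ∀ k' ≤ k, D.line k' = L) (hs : ∀ k' ≤ k, ∀ p q, D.strip k' p q → p.2 = q.2) {j : ℕ}
    (hj : ¬ D.Con S k j) {u v : Node} (h : D.Conn S u v) :
    (u.1 ≤ k ∧ (u.2.2 = j ∨ u.2.2 = L j)) ↔ (v.1 ≤ k ∧ (v.2.2 = j ∨ v.2.2 = L j)) := by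
  have hj' : ¬ D.Con S k (L j) := by
    rw [Con, hl k le_rfl] at hj ⊢
    rwa [hL, min_comm]
  have hLL (i : ℕ) : i = j ∨ i = L j ↔ L i = j ∨ L i = L j := by
    have h1 := hL i
    have h2 := hL j
    constructor
    · rintro (rfl | rfl)
      · exact .inr rfl
      · exact .inl h2
    · rintro (h | h)
      · exact .inr (by rw [← h, h1])
      · exact .inl (by rw [← h1, h, h2])
  refine EqvGen.iff_of_forall
    (fun u : Node => u.1 ≤ k ∧ (u.2.2 = j ∨ u.2.2 = L j)) (fun x y hxy => ?_) h
  cases hxy with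
  | strand k' p q h => exact and_congr_right fun hk => by rw [hs k' hk p q h]
  | base i => rw [hb]; exact and_congr_right fun _ => hLL i
  | cap k' i h => exact and_congr_right fun hk => by rw [hl k' hk]; exact hLL i
  | cup k' i h =>
    exact and_congr_right fun hk => by rw [hl k' ((Nat.le_succ k').trans hk)]; exact hLL i
  | vert k' i h =>
    simp only
    constructor
    · rintro ⟨h1, h2⟩
      refine ⟨?_, h2⟩
      rcases Nat.lt_or_eq_of_le h1 with h1 | rfl
      · exact h1
      · rcases h2 with rfl | rfl
        · exact absurd h hj
        · exact absurd h hj'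
    · exact fun h => ⟨(Nat.le_succ k').trans h.1, h.2⟩

/-- The circle through an arc which is closed by vertical strands above it. -/
theorem conn_above (hL : ∀ i, L (L i) = i) {k : ℕ} (hl : ∀ k' ≥ k, D.line k' = L ∨ D.line k' = id)
    (hk : D.line k = L) (hs : ∀ k' > k, ∀ p q, D.strip k' p q → p.2 = q.2) {j : ℕ}
    (hj : ¬ D.Con S k j) {u v : Node} (h : D.Conn S u v) :
    (k < u.1 ∧ (u.2.2 = j ∨ u.2.2 = L j)) ↔ (k < v.1 ∧ (v.2.2 = j ∨ v.2.2 = L j)) := by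
  have hj' : ¬ D.Con S k (L j) := by
    rw [Con, hk] at hj ⊢
    rwa [hL, min_comm]
  have hLL (k' : ℕ) (hk' : k' ≥ k) (i : ℕ) :
      i = j ∨ i = L j ↔ D.line k' i = j ∨ D.line k' i = L j := by
    have h1 := hL i
    have h2 := hL j
    rcases hl k' hk' with h | h <;> rw [h]
    · constructor
      · rintro (rfl | rfl)
        · exact .inr rfl
        · exact .inl h2
      · rintro (h | h)
        · exact .inr (by rw [← h, h1])
        · exact .inl (by rw [← h1, h, h2])
    · rfl
  refine EqvGen.iff_of_forall
    (fun u : Node => k < u.1 ∧ (u.2.2 = j ∨ u.2.2 = L j)) (fun x y hxy => ?_) h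
  cases hxy with
  | strand k' p q h => exact and_congr_right fun hk => by rw [hs k' hk p q h]
  | base i => simp
  | cap k' i h => exact and_congr_right fun hk => hLL k' (le_of_lt hk) i
  | cup k' i h => exact and_congr_right fun hk => hLL k' (Nat.le_of_lt_succ hk) i
  | vert k' i h =>
    simp only
    constructor
    · exact fun h => ⟨h.1.trans (Nat.lt_succ_self k'), h.2⟩
    · rintro ⟨h1, h2⟩
      refine ⟨?_, h2⟩
      rcases Nat.lt_or_eq_of_le (Nat.le_of_lt_succ h1) with h1 | rfl
      · exact h1
      · rcases h2 with rfl | rfl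
        · exact absurd h hj
        · exact absurd h hj'

/-- An uncontracted arc over vertical strands and the same base arc bounds a circle which does not
pass through its line, so the two ends of the saddle lie on different circles. -/
theorem isMerge_below (hL : ∀ i, L (L i) = i) {x : Saddle} (hb : D.base = L)
    (hl : ∀ k' ≤ x.1, D.line k' = L) (hs : ∀ k' ≤ x.1, ∀ p q, D.strip k' p q → p.2 = q.2)
    (hx : ¬ D.Con S x.1 x.2) : D.IsMerge S x := fun h => by
  have := (conn_below hL hb hl hs hx h).mp ⟨le_rfl, .inl rfl⟩
  exact absurd this.1 (by simp)

theorem isMerge_above (hL : ∀ i, L (L i) = i) {x : Saddle}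
    (hl : ∀ k' ≥ x.1, D.line k' = L ∨ D.line k' = id) (hk : D.line x.1 = L)
    (hs : ∀ k' > x.1, ∀ p q, D.strip k' p q → p.2 = q.2)
    (hx : ¬ D.Con S x.1 x.2) : D.IsMerge S x := fun h => by
  have := (conn_above hL hl hk hs hx h).mpr ⟨Nat.lt_succ_self _, .inl rfl⟩
  exact absurd this.1 (lt_irrefl _)

theorem deg_of_isMerge {P : Saddle → Prop} (h : ∀ S x, P x → x ∉ S → D.IsMerge S x)
    {xs : List Saddle} (hx : ∀ x ∈ xs, P x) (hn : xs.Nodup) (hS : ∀ x ∈ xs, x ∉ S) :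
    D.deg S xs = (-(xs.length : ℤ), 0) := by
  induction xs generalizing S with
  | nil => rfl
  | cons x xs ih =>
    rw [List.nodup_cons] at hn
    simp only [Diagram.deg, saddleDeg]
    rw [if_pos (h S x (hx x (by simp)) (hS x (by simp))),
      ih (fun y hy => hx y (by simp [hy])) hn.2 (fun y hy => ?_)]
    · simp
    · rintro (rfl | hc)
      · exact hn.1 hy
      · exact hS y (by simp [hy]) hc

theorem pass_of_isMerge {P : Saddle → Prop} (h : ∀ S x, P x → x ∉ S → D.IsMerge S x)
    {x : Saddle} (hx : P x) (hxS : x ∉ S) {ys : List Saddle} (hy : ∀ y ∈ ys, P y) (hn : ys.Nodup)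
    (hxy : x ∉ ys) (hS : ∀ y ∈ ys, y ∉ S) : D.pass S x ys = uX ^ ys.length := by
  induction ys generalizing S with
  | nil => rfl
  | cons y ys ih =>
    rw [List.nodup_cons] at hn
    rw [List.mem_cons, not_or] at hxy
    have h1 : D.IsMerge (insert x S) y := h _ y (hy y (by simp)) (by
      rintro (hc | hc)
      · exact hxy.1 hc.symm
      · exact hS y (by simp) hc)
    simp only [Diagram.pass, Diagram.swap]
    rw [if_pos (h S x hx hxS), if_pos h1, ih (by rintro (hc | hc); exacts [hxy.1 hc, hxS hc])
      (fun z hz => hy z (by simp [hz])) hn.2 hxy.2 (fun z hz => ?_), List.length_cons, pow_succ']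
    rintro (rfl | hc)
    · exact hn.1 hz
    · exact hS z (by simp [hz]) hc

theorem passAll_of_isMerge {P : Saddle → Prop} (h : ∀ S x, P x → x ∉ S → D.IsMerge S x)
    {xs ys : List Saddle} (hx : ∀ x ∈ xs, P x) (hy : ∀ y ∈ ys, P y) (hnx : xs.Nodup) (hn : ys.Nodup)
    (hxy : ∀ x ∈ xs, x ∉ ys) (hSx : ∀ x ∈ xs, x ∉ S) (hS : ∀ y ∈ ys, y ∉ S) :
    D.passAll S xs ys = uX ^ (xs.length * ys.length) := by
  induction xs generalizing S with
  | nil => simp [Diagram.passAll]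
  | cons x xs ih =>
    rw [List.nodup_cons] at hnx
    simp only [Diagram.passAll]
    rw [pass_of_isMerge h (hx x (by simp)) (hSx x (by simp)) hy hn (hxy x (by simp)) hS,
      ih (fun z hz => hx z (by simp [hz])) hnx.2 (fun z hz => hxy z (by simp [hz]))
      (fun z hz => ?_) (fun y hy' => ?_), List.length_cons, add_mul, one_mul, pow_add]
    · rintro (rfl | hc)
      · exact hnx.1 hz
      · exact hSx z (by simp [hz]) hc
    · rintro (rfl | hc)
      · exact hxy y (by simp) hy'
      · exact hS y hy' hc

end Diagram

theorem CrossMatch.nodup_arcs {n : ℕ} (b : CrossMatch n) : b.arcs.Nodup :=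
  ((List.nodup_reverse.mpr (List.nodup_finRange _)).filter _).map
    (Function.LeftInverse.injective b.mate_mate)

theorem CrossMatch.mem_arcs {n : ℕ} (b : CrossMatch n) (i : Fin (2 * n)) :
    i ∈ b.arcs ↔ i < b.mate i := by
  simp only [arcs, List.mem_map, List.mem_filter, List.mem_reverse, List.mem_finRange, true_and,
    decide_eq_true_eq]
  constructor
  · rintro ⟨j, h, rfl⟩; rwa [b.mate_mate]
  · exact fun h => ⟨b.mate i, by rwa [b.mate_mate], b.mate_mate i⟩

theorem CrossMatch.length_arcs {n : ℕ} (b : CrossMatch n) : b.arcs.length = n := by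
  rw [← List.toFinset_card_of_nodup b.nodup_arcs]
  have e : b.arcs.toFinset = Finset.univ.filter fun i => i < b.mate i := by
    ext i; simp [b.mem_arcs]
  have h1 : (Finset.univ.filter fun i => ¬ i < b.mate i).card =
      (Finset.univ.filter fun i => i < b.mate i).card := by
    refine Finset.card_bij (fun i _ => b.mate i) (fun i hi => ?_) (fun i _ j _ h => ?_)
      (fun i hi => ⟨b.mate i, ?_, b.mate_mate i⟩)
    · simp only [Finset.mem_filter, Finset.mem_univ, true_and, b.mate_mate] at hi ⊢
      exact lt_of_le_of_ne (not_lt.mp hi) (b.mate_ne i)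
    · rw [← b.mate_mate i, h, b.mate_mate]
    · simp only [Finset.mem_filter, Finset.mem_univ, true_and, b.mate_mate] at hi ⊢
      exact not_lt.mpr hi.le
  have h2 := Finset.card_filter_add_card_filter_not (s := (Finset.univ : Finset (Fin (2 * n))))
    (fun i => i < b.mate i)
  rw [h1, Finset.card_univ, Fintype.card_fin] at h2
  rw [e]; omega

theorem nodup_saddles {n : ℕ} (k : ℕ) (b : CrossMatch n) : (saddles k b).Nodup := by
  rw [saddles_eq]
  exact b.nodup_arcs.map fun i j h => Fin.ext (congrArg Prod.snd h)

theorem length_saddles {n : ℕ} (k : ℕ) (b : CrossMatch n) : (saddles k b).length = n := by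
  rw [saddles_eq, List.length_map, b.length_arcs]

theorem Diagram.not_con {D : Diagram} {S : Set Saddle} {n : ℕ} {b : CrossMatch n} {x : Saddle}
    (hl : D.line x.1 = b.mateN) (hx : x ∈ saddles x.1 b) (hS : x ∉ S) : ¬ D.Con S x.1 x.2 := by
  obtain ⟨-, i, hi, hlt⟩ := mem_saddles.mp hx
  rw [Con, hl, ← hi, b.mateN_coe, min_eq_left (by exact_mod_cast hlt.le), hi]
  exact hS

theorem isMerge_diag₃_below {k l : ℕ} (a : CrossMatch k) (b : CrossMatch l) (t : Tangle k l)
    (S : Set Saddle) (x : Saddle) (hx : x ∈ saddles 0 a ∨ x ∈ saddles 1 a) (hS : x ∉ S) :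
    (diag₃ a a a b (Tangle.one k) (Tangle.one k) t).IsMerge S x := by
  have hx' : x ∈ saddles x.1 a ∧ x.1 ≤ 1 := by
    rcases hx with hx | hx <;> rw [(mem_saddles.mp hx).1] <;> exact ⟨hx, by decide⟩
  have hl : ∀ k' ≤ x.1, (diag₃ a a a b (Tangle.one k) (Tangle.one k) t).line k' = a.mateN := by
    intro k' hk
    have : k' ≤ 1 := hk.trans hx'.2
    interval_cases k' <;> rfl
  refine Diagram.isMerge_below a.isArcs.invol rfl hl (fun k' hk p q h => ?_)
    (Diagram.not_con (hl _ le_rfl) hx'.1 hS)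
  have : k' ≤ 1 := hk.trans hx'.2
  interval_cases k' <;> exact (Tangle.one_joined k p q).mp h

theorem isMerge_diag₃_above {k l : ℕ} (a : CrossMatch k) (b : CrossMatch l) (t : Tangle k l)
    (S : Set Saddle) (x : Saddle) (hx : x ∈ saddles 0 b ∨ x ∈ saddles 1 b) (hS : x ∉ S) :
    (diag₃ a b b b t (Tangle.one l) (Tangle.one l)).IsMerge S x := by
  have hx' : x ∈ saddles x.1 b ∧ x.1 ≤ 1 := by
    rcases hx with hx | hx <;> rw [(mem_saddles.mp hx).1] <;> exact ⟨hx, by decide⟩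
  have hl : ∀ k', (diag₃ a b b b t (Tangle.one l) (Tangle.one l)).line k' = b.mateN ∨
      (diag₃ a b b b t (Tangle.one l) (Tangle.one l)).line k' = id := by
    intro k'
    rcases k' with _ | _ | _ | k' <;> simp [diag₃]
  have hl' : (diag₃ a b b b t (Tangle.one l) (Tangle.one l)).line x.1 = b.mateN := by
    have := hx'.2
    rcases Nat.le_one_iff_eq_zero_or_eq_one.mp this with h | h <;> rw [h] <;> rfl
  refine Diagram.isMerge_above b.isArcs.invol (fun k' _ => hl k') hl' (fun k' hk p q h => ?_)
    (Diagram.not_con hl' hx'.1 hS)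
  rcases k' with _ | _ | _ | k'
  · exact absurd hk (by simp)
  · exact (Tangle.one_joined l p q).mp h
  · exact (Tangle.one_joined l p q).mp h
  · exact absurd h (by simp [diag₃])

theorem isMerge_diag₂_below {k l : ℕ} (a : CrossMatch k) (b : CrossMatch l) (t : Tangle k l)
    (S : Set Saddle) (x : Saddle) (hx : x ∈ saddles 0 a) (hS : x ∉ S) :
    (diag₂ a a b (Tangle.one k) t).IsMerge S x := by
  have hx' : x.1 = 0 := (mem_saddles.mp hx).1
  have hl : ∀ k' ≤ x.1, (diag₂ a a b (Tangle.one k) t).line k' = a.mateN := by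
    intro k' hk
    obtain rfl : k' = 0 := by omega
    rfl
  refine Diagram.isMerge_below a.isArcs.invol rfl hl (fun k' hk p q h => ?_)
    (Diagram.not_con (hl _ le_rfl) (hx' ▸ hx) hS)
  obtain rfl : k' = 0 := by omega
  exact (Tangle.one_joined k p q).mp h

theorem isMerge_diag₂_above {k l : ℕ} (a : CrossMatch k) (b : CrossMatch l) (t : Tangle k l)
    (S : Set Saddle) (x : Saddle) (hx : x ∈ saddles 0 b) (hS : x ∉ S) :
    (diag₂ a b b t (Tangle.one l)).IsMerge S x := by
  have hx' : x.1 = 0 := (mem_saddles.mp hx).1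
  have hl' : (diag₂ a b b t (Tangle.one l)).line x.1 = b.mateN := by rw [hx']; rfl
  refine Diagram.isMerge_above b.isArcs.invol (fun k' _ => ?_) hl' (fun k' hk p q h => ?_)
    (Diagram.not_con hl' (hx' ▸ hx) hS)
  · rcases k' with _ | _ | k' <;> simp [diag₂]
  · rcases k' with _ | _ | k'
    · exact absurd hk (by simp)
    · exact (Tangle.one_joined l p q).mp h
    · exact absurd h (by simp [diag₂])

theorem cobDeg_one_left {k l : ℕ} (a : CrossMatch k) (b : CrossMatch l) (t : Tangle k l) :
    cobDeg a a b (Tangle.one k) t = (-(k : ℤ), 0) := by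
  rw [cobDeg, Diagram.deg_of_isMerge (isMerge_diag₂_below a b t · ·) (fun _ h => h)
    (nodup_saddles 0 a) (by simp), length_saddles]

theorem cobDeg_one_right {k l : ℕ} (a : CrossMatch k) (b : CrossMatch l) (t : Tangle k l) :
    cobDeg a b b t (Tangle.one l) = (-(l : ℤ), 0) := by
  rw [cobDeg, Diagram.deg_of_isMerge (isMerge_diag₂_above a b t · ·) (fun _ h => h)
    (nodup_saddles 0 b) (by simp), length_saddles]

/-- All saddles are merges, and the degree `(n, 0)` of the identity compensates for their total
degree `(-n, 0)`. -/
theorem Hom.id_comp {a b : Obj} (f : Hom a b) : (Hom.id a).comp f = f := by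
  refine Prod.ext (Tangle.one_comp _) ?_
  simp only [Hom.comp, Hom.id, cobDeg_one_left]
  ext <;> simp

theorem Hom.comp_id {a b : Obj} (f : Hom a b) : f.comp (Hom.id b) = f := by
  refine Prod.ext (Tangle.comp_one _) ?_
  simp only [Hom.comp, Hom.id, cobDeg_one_right]
  ext <;> simp

/-- With `k` arcs on each of the two lines and only merges, the exchange gives `X^(k²)`. This
cancels against `λ((-k, 0), (k, 0)) = X^(-k²)`. -/
theorem assoc_id_id_left {a b : Obj} (f : Hom a b) : assoc (Hom.id a) (Hom.id a) f = 1 := by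
  simp only [assoc, Hom.id]
  rw [Diagram.passAll_of_isMerge (isMerge_diag₃_below a.2 b.2 f.1 · ·)
    (fun _ h => .inl h) (fun _ h => .inr h) (nodup_saddles _ _) (nodup_saddles _ _)
    (fun x hx hx' => ?_) (by simp) (by simp), length_saddles, length_saddles]
  · simp only [cobDeg_one_left, lam, mul_zero, zero_mul, sub_self, zpow_zero, mul_one]
    rw [← zpow_natCast, ← zpow_add]
    simp
  · rw [mem_saddles] at hx hx'; omega

theorem assoc_id_id_right {a b : Obj} (f : Hom a b) :
    assoc f (Hom.id b) (Hom.id b) = uX ^ (b.1 * b.1) * lam (-(b.1 : ℤ), 0) f.2 := by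
  simp only [assoc, Hom.id]
  rw [Diagram.passAll_of_isMerge (isMerge_diag₃_above a.2 b.2 f.1 · ·)
    (fun _ h => .inl h) (fun _ h => .inr h) (nodup_saddles _ _) (nodup_saddles _ _)
    (fun x hx hx' => ?_) (by simp) (by simp), length_saddles, length_saddles]
  · rw [cobDeg_one_right]
  · rw [mem_saddles] at hx hx'; omega

/-- The cocycle identity for `f, Id, Id, g`, in which `α(Id, Id, g) = 1` and one factor cancels. -/
theorem assoc_id_middle {a b c : Obj} (f : Hom a b) (g : Hom b c) :
    assoc f (Hom.id b) g = assoc f (Hom.id b) (Hom.id b) := by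
  have h := assoc_pentagon f (Hom.id b) (Hom.id b) g
  rw [Hom.id_comp, Hom.comp_id, Hom.id_comp, assoc_id_id_left, mul_one] at h
  exact (mul_right_cancel h).symm

end UnifiedArc

/-! ### Multiplication by the idempotents of the arc algebra -/

namespace UnifiedArc

open Contraction

section SameCircle
variable {n : ℕ} (a b : CrossMatch n)

theorem sameCircle_equivalence : Equivalence (SameCircle a b) := Relation.EqvGen.is_equivalence _

theorem sameCircle_left (i : Fin (2 * n)) : SameCircle a b i (a.mate i) := .rel _ _ (.inl rfl)

theorem sameCircle_right (i : Fin (2 * n)) : SameCircle a b i (b.mate i) := .rel _ _ (.inr rfl)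

theorem Labeling.eq_of_sameCircle {a b : CrossMatch n} (ε : Labeling a b) {i j : Fin (2 * n)}
    (h : SameCircle a b i j) : ε.1 i = ε.1 j := by
  induction h with
  | rel x y h =>
    rcases h with rfl | rfl
    · exact (ε.2 x).1.symm
    · exact (ε.2 x).2.symm
  | refl => rfl
  | symm _ _ _ ih => exact ih.symm
  | trans _ _ _ _ _ ih ih' => exact ih.trans ih'

end SameCircle

/-- One of the two halves of the diagram consists of the vertical strands over the arcs of `m`; the
other half, to which `β` points, consists of the circles of `a b̄`. -/
structure HalfTrivial {n : ℕ} (D : Diagram) (S : Set Saddle) (a b m : CrossMatch n) (β : Bool) :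
    Prop where
  big : ∀ k k', Same D S (β, k) (β, k') ↔ SameCircle a b k k'
  con : ∀ k : Fin (2 * n), D.Con S 0 k → Same D S (!β, k) (β, k)
  unc : ∀ (k : Fin (2 * n)) v, ¬ D.Con S 0 k →
    (Same D S v (!β, k) ↔ v = (!β, k) ∨ v = (!β, m.mate k))
  con_mate : ∀ k : Fin (2 * n), D.Con S 0 (m.mate k) ↔ D.Con S 0 k
  mate : ∀ k, SameCircle a b k (m.mate k)

theorem Contraction.same_equivalence {n : ℕ} (D : Diagram) (S : Set Saddle) :
    Equivalence (Same (n := n) D S) :=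
  (Relation.EqvGen.is_equivalence (D.Adj S)).comap Vert.node

section
variable {n : ℕ} {a b : CrossMatch n} {D : Diagram} {S : Set Saddle}

theorem con_mate_of_line {m : CrossMatch n} (h : D.line 0 = m.mateN) (k : Fin (2 * n)) :
    D.Con S 0 (m.mate k) ↔ D.Con S 0 k := by
  rw [Diagram.Con, Diagram.Con, h, m.mateN_coe, m.mateN_coe, m.mate_mate, min_comm]

/-- Forgetting the height maps the diagram onto `a b̄`. The exceptions are the uncontracted arcs of
the trivial half, which are circles by themselves; for this reason a vertex in a strip marked
`small` counts only if it has been contracted. -/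
theorem sameCircle_of_conn {m : CrossMatch n} (hm : D.line 0 = m.mateN) (small : ℕ → Prop)
    (hS : ∀ s ∈ S, s.1 = 0) (hstrip : ∀ k p q, D.strip k p q → p.2 = q.2)
    (hbase : D.base = a.mateN ∨ D.base = b.mateN) (hbase' : small 0 → D.base = m.mateN)
    (hline : ∀ k, D.line k = a.mateN ∨ D.line k = b.mateN ∨ D.line k = id)
    (hline' : ∀ k, small k ∨ small (k + 1) → D.line k = m.mateN ∨ D.line k = id)
    (i₀ : Fin (2 * n)) {u v : Node} (h : D.Conn S u v) :
    (∃ h : u.2.2 < 2 * n, (small u.1 → D.Con S 0 u.2.2) ∧ SameCircle a b i₀ ⟨u.2.2, h⟩) ↔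
      ∃ h : v.2.2 < 2 * n, (small v.1 → D.Con S 0 v.2.2) ∧ SameCircle a b i₀ ⟨v.2.2, h⟩ := by
  have hE := sameCircle_equivalence a b
  have key (c : CrossMatch n) (hc : ∀ i, SameCircle a b i (c.mate i)) (s : Prop)
      (hs : s → c = m) (i : ℕ) :
      (∃ h : i < 2 * n, (s → D.Con S 0 i) ∧ SameCircle a b i₀ ⟨i, h⟩) ↔
      ∃ h : c.mateN i < 2 * n, (s → D.Con S 0 (c.mateN i)) ∧
        SameCircle a b i₀ ⟨c.mateN i, h⟩ := by
    by_cases hi : i < 2 * n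
    · have e : c.mateN i = c.mate ⟨i, hi⟩ := c.mateN_of_lt hi
      have h1 : (s → D.Con S 0 (c.mate ⟨i, hi⟩)) ↔ (s → D.Con S 0 i) := by
        refine forall_congr' fun h => ?_
        have := con_mate_of_line (S := S) hm ⟨i, hi⟩
        rw [← hs h] at this
        exact this
      simp only [e, hi, (c.mate ⟨i, hi⟩).2, exists_true_left, h1]
      refine and_congr_right fun _ => ⟨fun h => hE.trans h (hc _), fun h => hE.trans h (hE.symm (hc _))⟩
    · rw [c.isArcs.fix i (by omega)]
  have mateN_inj {c c' : CrossMatch n} (h : c.mateN = c'.mateN) : c = c' := by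
    refine CrossMatch.ext (funext fun i => Fin.ext ?_)
    rw [← c.mateN_coe, h, c'.mateN_coe]
  refine EqvGen.iff_of_forall (fun u : Node => ∃ h : u.2.2 < 2 * n,
    (small u.1 → D.Con S 0 u.2.2) ∧ SameCircle a b i₀ ⟨u.2.2, h⟩) (fun x y hxy => ?_) h
  have keyl (k : ℕ) (s : Prop) (hs : s → small k ∨ small (k + 1)) (i : ℕ) :
      (∃ h : i < 2 * n, (s → D.Con S 0 i) ∧ SameCircle a b i₀ ⟨i, h⟩) ↔
      ∃ h : D.line k i < 2 * n, (s → D.Con S 0 (D.line k i)) ∧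
        SameCircle a b i₀ ⟨D.line k i, h⟩ := by
    by_cases hid : D.line k = id
    · rw [hid]; rfl
    · rcases hline k with h | h | h
      · rw [h]
        exact key a (sameCircle_left a b) _
          (fun h' => mateN_inj (h ▸ (hline' k (hs h')).resolve_right hid)) i
      · rw [h]
        exact key b (sameCircle_right a b) _
          (fun h' => mateN_inj (h ▸ (hline' k (hs h')).resolve_right hid)) i
      · exact absurd h hid
  cases hxy with
  | strand k p q h => simp only [hstrip k p q h]
  | base i =>
    rcases hbase with h | h
    · rw [h]
      exact key a (sameCircle_left a b) _ (fun h' => mateN_inj (h ▸ hbase' h')) i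
    · rw [h]
      exact key b (sameCircle_right a b) _ (fun h' => mateN_inj (h ▸ hbase' h')) i
  | cap k i h => exact keyl k _ .inl i
  | cup k i h => exact keyl k _ .inr i
  | vert k i h =>
    obtain rfl : k = 0 := hS _ h
    have h' : D.Con S 0 i := h
    simp only [h', implies_true]

/-- An uncontracted arc of `a` closes up with its base arc to a separate circle. Once contracted,
the base arc takes over the role of the erased arc of `a` in the upper half. -/
theorem halfTrivial_above (hS : ∀ s ∈ S, s.1 = 0) :
    HalfTrivial (diag₂ a a b (Tangle.one n) (Tangle.one n)) S a b a true := by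
  set D := diag₂ a a b (Tangle.one n) (Tangle.one n) with hD
  have hE := Relation.EqvGen.is_equivalence (D.Adj S)
  have hstrip : ∀ k p q, D.strip k p q → p.2 = q.2 := by
    rintro (_ | _ | k) p q h
    · exact (Tangle.one_joined n p q).mp h
    · exact (Tangle.one_joined n p q).mp h
    · exact absurd h (by simp [hD, diag₂])
  have hbase : D.base = a.mateN := rfl
  have hl0 : D.line 0 = a.mateN := rfl
  have hl1 : D.line 1 = b.mateN := rfl
  have hs0 (i : ℕ) : D.Conn S (0, false, i) (0, true, i) :=
    .rel _ _ (.strand 0 _ _ ((Tangle.one_joined n _ _).mpr rfl))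
  have hs1 (i : ℕ) : D.Conn S (1, false, i) (1, true, i) :=
    .rel _ _ (.strand 1 _ _ ((Tangle.one_joined n _ _).mpr rfl))
  have hnot (i : ℕ) : ¬ D.Con S 1 i := fun h => absurd (hS _ h) (by simp)
  refine ⟨fun k k' => ⟨fun h => ?_, fun h => ?_⟩, fun k h => ?_, fun k v h => ⟨fun h' => ?_, ?_⟩,
    con_mate_of_line hl0, sameCircle_left a b⟩
  · have := sameCircle_of_conn (a := a) (b := b) hl0 (fun j => j = 0) hS hstrip (.inl hbase)
      (fun _ => hbase) (fun j => ?_) (fun j hj => ?_) k h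
    · obtain ⟨_, _, h3⟩ := this.mp ⟨k.2, by simp [Vert.node], .refl _⟩
      exact h3
    · rcases j with _ | _ | j
      · exact .inl hl0
      · exact .inr (.inl hl1)
      · exact .inr (.inr rfl)
    · obtain rfl : j = 0 := by omega
      exact .inl hl0
  · refine EqvGen.le ((same_equivalence D S).comap fun k : Fin (2 * n) => ((true, k) : Vert n))
      (fun x y hxy => ?_) h
    change D.Conn S (1, false, (x : ℕ)) (1, false, (y : ℕ))
    rcases hxy with rfl | rfl
    · by_cases hc : D.Con S 0 x
      · have h2 : D.Con S 0 (a.mate x) := (con_mate_of_line hl0 x).mpr hc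
        have hv (i : ℕ) (h : D.Con S 0 i) : D.Conn S (0, false, i) (1, false, i) :=
          hE.trans (hs0 i) (.rel _ _ (.vert 0 i h))
        refine hE.trans (hE.symm (hv x hc)) (hE.trans ?_ (hv _ h2))
        have := Diagram.Adj.base (D := D) (S := S) x
        rw [hbase, a.mateN_coe] at this
        exact .rel _ _ this
      · have := Diagram.Adj.cup (D := D) (S := S) 0 x hc
        rw [hl0, a.mateN_coe] at this
        exact .rel _ _ this
    · refine hE.trans (hs1 _) (hE.trans ?_ (hE.symm (hs1 _)))
      have := Diagram.Adj.cap (D := D) (S := S) 1 x (hnot x)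
      rw [hl1, b.mateN_coe] at this
      exact .rel _ _ this
  · exact hE.trans (hs0 k) (.rel _ _ (.vert 0 k h))
  · have := (Diagram.conn_below (k := 0) a.isArcs.invol hbase (fun k' hk => ?_)
      (fun k' _ p q => hstrip k' p q) h h').mpr ⟨by simp [Vert.node], .inl rfl⟩
    · obtain ⟨_ | _, i⟩ := v
      · simp only [Vert.node, a.mateN_coe, Fin.val_inj] at this
        simpa using this.2
      · exact absurd this.1 (by simp [Vert.node])
    · obtain rfl : k' = 0 := by omega
      exact hl0
  · rintro (rfl | rfl)
    · exact hE.refl _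
    · have := Diagram.Adj.base (D := D) (S := S) k
      rw [hbase, a.mateN_coe] at this
      exact hE.symm (.rel _ _ this)

theorem halfTrivial_below (hS : ∀ s ∈ S, s.1 = 0) :
    HalfTrivial (diag₂ a b b (Tangle.one n) (Tangle.one n)) S a b b false := by
  set D := diag₂ a b b (Tangle.one n) (Tangle.one n) with hD
  have hE := Relation.EqvGen.is_equivalence (D.Adj S)
  have hstrip : ∀ k p q, D.strip k p q → p.2 = q.2 := by
    rintro (_ | _ | k) p q h
    · exact (Tangle.one_joined n p q).mp h
    · exact (Tangle.one_joined n p q).mp h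
    · exact absurd h (by simp [hD, diag₂])
  have hbase : D.base = a.mateN := rfl
  have hl0 : D.line 0 = b.mateN := rfl
  have hl (j : ℕ) : D.line j = b.mateN ∨ D.line j = id := by
    rcases j with _ | _ | j
    · exact .inl rfl
    · exact .inl rfl
    · exact .inr rfl
  have hs0 (i : ℕ) : D.Conn S (0, false, i) (0, true, i) :=
    .rel _ _ (.strand 0 _ _ ((Tangle.one_joined n _ _).mpr rfl))
  have hs1 (i : ℕ) : D.Conn S (1, false, i) (1, true, i) :=
    .rel _ _ (.strand 1 _ _ ((Tangle.one_joined n _ _).mpr rfl))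
  have hcap (i : Fin (2 * n)) : D.Conn S (1, true, i) (1, true, b.mate i) := by
    have := Diagram.Adj.cap (D := D) (S := S) 1 i fun h => absurd (hS _ h) (by simp)
    rw [show D.line 1 = b.mateN from rfl, b.mateN_coe] at this
    exact .rel _ _ this
  have hv (i : ℕ) (h : D.Con S 0 i) : D.Conn S (0, false, i) (1, false, i) :=
    hE.trans (hs0 i) (.rel _ _ (.vert 0 i h))
  refine ⟨fun k k' => ⟨fun h => ?_, fun h => ?_⟩, fun k h => ?_, fun k v h => ⟨fun h' => ?_, ?_⟩,
    con_mate_of_line hl0, sameCircle_right a b⟩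
  · have := sameCircle_of_conn (a := a) (b := b) hl0 (fun j => j ≠ 0) hS hstrip (.inl hbase)
      (fun h => absurd rfl h) (fun j => .inr (hl j)) (fun j _ => hl j) k h
    obtain ⟨_, _, h3⟩ := this.mp ⟨k.2, by simp [Vert.node], .refl _⟩
    exact h3
  · refine EqvGen.le ((same_equivalence D S).comap fun k : Fin (2 * n) => ((false, k) : Vert n))
      (fun x y hxy => ?_) h
    change D.Conn S (0, false, (x : ℕ)) (0, false, (y : ℕ))
    rcases hxy with rfl | rfl
    · have := Diagram.Adj.base (D := D) (S := S) x
      rw [hbase, a.mateN_coe] at this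
      exact .rel _ _ this
    · by_cases hc : D.Con S 0 x
      · have h2 : D.Con S 0 (b.mate x) := (con_mate_of_line hl0 x).mpr hc
        exact hE.trans (hv _ hc) (hE.trans (hs1 _) (hE.trans (hcap x)
          (hE.symm (hE.trans (hv _ h2) (hs1 _)))))
      · refine hE.trans (hs0 _) (hE.trans ?_ (hE.symm (hs0 _)))
        have := Diagram.Adj.cap (D := D) (S := S) 0 x hc
        rw [hl0, b.mateN_coe] at this
        exact .rel _ _ this
  · exact hE.symm (hv _ h)
  · have := (Diagram.conn_above (k := 0) b.isArcs.invol (fun k' _ => hl k') hl0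
      (fun k' _ p q => hstrip k' p q) h h').mpr ⟨by simp [Vert.node], .inl rfl⟩
    obtain ⟨_ | _, i⟩ := v
    · exact absurd this.1 (by simp [Vert.node])
    · simp only [Vert.node, b.mateN_coe, Fin.val_inj] at this
      simpa using this.2
  · rintro (rfl | rfl)
    · exact hE.refl _
    · exact hE.symm (hE.trans (hs1 _) (hE.trans (hcap k) (hE.symm (hs1 _))))

end

theorem lam_mul_swap (p q : ℤ × ℤ) : lam p q * lam q p = 1 := by
  have hx (k : ℤ) : uX ^ k * uX ^ k = 1 := by rw [← mul_zpow, uX_mul_self, one_zpow]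
  have hy (k : ℤ) : uY ^ k * uY ^ k = 1 := by rw [← mul_zpow, uY_mul_self, one_zpow]
  rw [lam, lam, mul_comm q.1, mul_comm q.2 p.2,
    show q.1 * p.2 - q.2 * p.1 = -(p.1 * q.2 - p.2 * q.1) by ring, zpow_neg]
  calc _ = (uX ^ (p.1 * q.1) * uX ^ (p.1 * q.1)) * (uY ^ (p.2 * q.2) * uY ^ (p.2 * q.2)) *
        (uZ ^ (p.1 * q.2 - p.2 * q.1) * (uZ ^ (p.1 * q.2 - p.2 * q.1))⁻¹) := by ac_rfl
    _ = 1 := by rw [hx, hy, mul_inv_cancel, mul_one, mul_one]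

theorem prod_lam_mul_swap {ι : Type*} (s : Finset ι) (f : ι → ℤ × ℤ) (p : ℤ × ℤ) :
    (∏ k ∈ s, lam p (f k)) * ∏ k ∈ s, lam (f k) p = 1 := by
  rw [← Finset.prod_mul_distrib]
  exact Finset.prod_eq_one fun k _ => lam_mul_swap _ _

theorem lam_sum_left {ι : Type*} (s : Finset ι) (f : ι → ℤ × ℤ) (p : ℤ × ℤ) :
    lam (∑ k ∈ s, f k) p = ∏ k ∈ s, lam (f k) p := by
  classical
  induction s using Finset.induction_on with
  | empty => simp [lam_zero_left]
  | insert a s ha ih => rw [Finset.sum_insert ha, Finset.prod_insert ha, lam_add_left, ih]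

theorem prod_filter_eq {n : ℕ} {M : Type*} [CommMonoid M] {p : Vert n → Prop} [DecidablePred p]
    (β : Bool) (s : Finset (Fin (2 * n))) (h : ∀ w, p w ↔ ∃ k ∈ s, w = (β, k)) (f : Vert n → M) :
    ∏ w ∈ Finset.univ.filter p, f w = ∏ k ∈ s, f (β, k) := by
  classical
  have e : Finset.univ.filter p = s.image fun k => (β, k) := by
    ext w; simp [h, eq_comm]
  rw [e, Finset.prod_image fun i _ j _ h => congrArg Prod.snd h]

open Classical in
/-- A labelling of the circles of `a b̄` as a labelling of a diagram one half of which is trivial. -/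
noncomputable def halfLabel {n : ℕ} (D : Diagram) (S : Set Saddle) (β : Bool) (ε : Fin (2 * n) → Bool) :
    Vert n → Bool :=
  fun v => if v.1 = β then ε v.2 else if D.Con S 0 v.2 then ε v.2 else true

namespace HalfTrivial
variable {n : ℕ} {D : Diagram} {S S' : Set Saddle} {a b m : CrossMatch n} {β : Bool}

theorem same_small (h : HalfTrivial D S a b m β) {k k' : Fin (2 * n)} (hk : D.Con S 0 k)
    (hk' : D.Con S 0 k') : Same D S (!β, k) (!β, k') ↔ SameCircle a b k k' := by
  have hE := same_equivalence (n := n) D S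
  rw [← h.big]
  exact ⟨fun h' => hE.trans (hE.symm (h.con k hk)) (hE.trans h' (h.con k' hk')),
    fun h' => hE.trans (h.con k hk) (hE.trans h' (hE.symm (h.con k' hk')))⟩

theorem same_small_big (h : HalfTrivial D S a b m β) {k k' : Fin (2 * n)} (hk : D.Con S 0 k) :
    Same D S (!β, k) (β, k') ↔ SameCircle a b k k' := by
  have hE := same_equivalence (n := n) D S
  rw [← h.big]
  exact ⟨fun h' => hE.trans (hE.symm (h.con k hk)) h', fun h' => hE.trans (h.con k hk) h'⟩

theorem con_of_same (h : HalfTrivial D S a b m β) {k k' : Fin (2 * n)} (hk : D.Con S 0 k)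
    (h' : Same D S (!β, k) (!β, k')) : D.Con S 0 k' := by
  by_contra hc
  rcases (h.unc k' _ hc).mp h' with e | e
  · obtain rfl : k = k' := congrArg Prod.snd e
    exact hc hk
  · obtain rfl : k = m.mate k' := congrArg Prod.snd e
    exact hc ((h.con_mate k').mp hk)

theorem not_same (h : HalfTrivial D S a b m β) {k k' : Fin (2 * n)} (hk : ¬ D.Con S 0 k) :
    ¬ Same D S (β, k') (!β, k) := by
  intro h'
  rcases (h.unc k _ hk).mp h' with e | e <;>
    exact absurd (congrArg Prod.fst e) (by simp)

theorem label_eq (h : HalfTrivial D S a b m β) (ε : Labeling a b) {v w : Vert n}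
    (hvw : Same D S v w) : halfLabel D S β ε.1 v = halfLabel D S β ε.1 w := by
  have hE := same_equivalence (n := n) D S
  have hdich (c : Bool) : c = β ∨ c = !β := by cases c <;> cases β <;> simp
  obtain ⟨c, k⟩ := v
  obtain ⟨c', k'⟩ := w
  have key {k k' : Fin (2 * n)} (h' : Same D S (β, k) (!β, k')) :
      halfLabel D S β ε.1 (β, k) = halfLabel D S β ε.1 (!β, k') := by
    by_cases hc : D.Con S 0 k'
    · have := ε.eq_of_sameCircle ((h.same_small_big hc).mp (hE.symm h'))
      simp [halfLabel, hc, this]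
    · exact absurd h' (h.not_same hc)
  rcases hdich c with rfl | rfl <;> rcases hdich c' with e | e <;> subst e
  · simpa [halfLabel] using ε.eq_of_sameCircle ((h.big k k').mp hvw)
  · exact key hvw
  · exact (key (hE.symm hvw)).symm
  · by_cases hc : D.Con S 0 k
    · have hc' := h.con_of_same hc hvw
      have := ε.eq_of_sameCircle ((h.same_small hc hc').mp hvw)
      simp [halfLabel, hc, hc', this]
    · have hc' : ¬ D.Con S 0 k' := fun hc' => hc (h.con_of_same hc' (hE.symm hvw))
      simp [halfLabel, hc, hc']

theorem put_eq (h' : HalfTrivial D S' a b m β) (ε : Labeling a b) {i : Fin (2 * n)}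
    (hi : D.Con S' 0 i) (hcon : ∀ k : Fin (2 * n), D.Con S' 0 k ↔ D.Con S 0 k ∨ k = i ∨ k = m.mate i) :
    put D S' (halfLabel D S β ε.1) (false, i) (false, i) (ε.1 i) (ε.1 i) =
      halfLabel D S' β ε.1 := by
  have hE := same_equivalence (n := n) D S'
  have hbi (c c' : Bool) : Same D S' (c, i) (c', i) := by
    have := h'.con i hi
    cases β <;> cases c <;> cases c' <;> first | exact hE.refl _ | exact this | exact hE.symm this
  have hci : halfLabel D S' β ε.1 (false, i) = ε.1 i := by
    simp [halfLabel, hi]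
  funext v
  simp only [put]
  by_cases hv : Same D S' v (false, i)
  · rw [if_pos hv, ← hci]; exact (h'.label_eq ε hv).symm
  · rw [if_neg hv, if_neg hv]
    obtain ⟨c, k⟩ := v
    simp only [halfLabel]
    by_cases hc : c = β
    · simp [hc]
    · have hc' : c = !β := by cases c <;> cases β <;> simp_all
      subst hc'
      have h1 : k ≠ i := fun e => hv (by subst e; exact hbi _ _)
      have h2 : k ≠ m.mate i := fun e => by
        subst e
        exact hv (hE.trans ((h'.same_small ((h'.con_mate i).mpr hi) hi).mpr
          ((sameCircle_equivalence a b).symm (h'.mate i))) (hbi _ _))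
      have e : D.Con S' 0 k ↔ D.Con S 0 k := by rw [hcon]; simp [h1, h2]
      by_cases h3 : D.Con S 0 k
      · simp [h3, e.mpr h3]
      · simp [h3, mt e.mp h3]

end HalfTrivial

/-- The labelling is not changed by a saddle at an arc of the trivial half, up to a unit. -/
theorem saddleBasis_halfLabel {n : ℕ} {D : Diagram} {S S' : Set Saddle} {a b m : CrossMatch n}
    {β : Bool} {i : Fin (2 * n)} (h' : HalfTrivial D S' a b m β) (hS' : S' = insert (0, (i : ℕ)) S)
    (hi : ¬ D.Con S 0 i) (hi' : D.Con S' 0 i)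
    (hcon : ∀ k : Fin (2 * n), D.Con S' 0 k ↔ D.Con S 0 k ∨ k = i ∨ k = m.mate i)
    (hm : D.IsMerge S (0, (i : ℕ))) (ε : Labeling a b) (j : Fin (2 * n)) :
    saddleBasis D S i j (halfLabel D S β ε.1) = Finsupp.single (halfLabel D S' β ε.1)
      ((front₂ D S (halfLabel D S β ε.1) (false, i) (true, i) *
        (if halfLabel D S β ε.1 (false, i) then 1 else uX * uZ) *
        (front D S' (halfLabel D S' β ε.1) (false, i))⁻¹ : Rˣ) : R) := by
  subst hS'
  have e : (halfLabel D S β ε.1 (false, i) && halfLabel D S β ε.1 (true, i)) = ε.1 i := by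
    cases β <;> simp [halfLabel, hi]
  have e' : ¬ (halfLabel D S β ε.1 (false, i) = false ∧ halfLabel D S β ε.1 (true, i) = false) := by
    cases β <;> simp [halfLabel, hi]
  simp only [saddleBasis]
  rw [if_pos hm, if_neg e', e, h'.put_eq ε hi' hcon]

theorem Vert.pos_false {n : ℕ} (k : Fin (2 * n)) : Vert.pos (false, k) = 2 * n - 1 - k := by
  simp [Vert.pos]

theorem Vert.pos_true {n : ℕ} (k : Fin (2 * n)) : Vert.pos (true, k) = 2 * n + (2 * n - 1 - k) := by
  simp [Vert.pos]

theorem Vert.pos_false_lt {n : ℕ} {k l : Fin (2 * n)} :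
    Vert.pos (false, k) < Vert.pos (false, l) ↔ l < k := by
  rw [pos_false, pos_false, Fin.lt_def]; omega

theorem Vert.pos_false_le {n : ℕ} {k l : Fin (2 * n)} :
    Vert.pos (false, k) ≤ Vert.pos (false, l) ↔ l ≤ k := by
  rw [pos_false, pos_false, Fin.le_def]; omega

theorem Vert.pos_true_lt {n : ℕ} {k l : Fin (2 * n)} :
    Vert.pos (true, k) < Vert.pos (true, l) ↔ l < k := by
  rw [pos_true, pos_true, Fin.lt_def]; omega

theorem Vert.pos_false_lt_true {n : ℕ} (k l : Fin (2 * n)) :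
    Vert.pos (false, k) < Vert.pos (true, l) := by
  rw [pos_false, pos_true]; omega

theorem Vert.eq_of_pos_lt {n : ℕ} {w : Vert n} {k : Fin (2 * n)} (h : w.pos < Vert.pos (false, k)) :
    ∃ l, w = (false, l) ∧ k < l := by
  obtain ⟨_ | _, l⟩ := w
  · exact ⟨l, rfl, Vert.pos_false_lt.mp h⟩
  · exact absurd h (Vert.pos_false_lt_true k l).not_gt

/-! ### Multiplication by an idempotent from the right -/

open Classical in
/-- The rightmost vertices of the circles of `a b̄`. -/
noncomputable def circleReps {n : ℕ} (a b : CrossMatch n) : Finset (Fin (2 * n)) :=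
  Finset.univ.filter fun i => ∀ j, SameCircle a b i j → j ≤ i

namespace HalfTrivial
variable {n : ℕ} {D : Diagram} {S S' : Set Saddle} {a b m : CrossMatch n}

/-- All circles of `a b̄` start in the lower half and precede the circle labelled `v₊` over `i`.
Moving the latter to the front gives `λ(deg ε, (1, 0))`. Passing its partner gives `X` if the
partner is labelled `v₊`, and `Z⁻¹` if it is labelled `v₋`; in the second case the merge contributes
`X Z`, so the result is `X` either way. The remaining moves cancel. -/
theorem coef_false (h : HalfTrivial D S a b m false) (h' : HalfTrivial D S' a b m false)
    {i : Fin (2 * n)} (him : i < m.mate i)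
    (hcon : ∀ k : Fin (2 * n), D.Con S 0 k ↔ m.mate i < max k (m.mate k)) (ε : Labeling a b) :
    front₂ D S (halfLabel D S false ε.1) (false, i) (true, i) *
        (if halfLabel D S false ε.1 (false, i) then 1 else uX * uZ) *
        (front D S' (halfLabel D S' false ε.1) (false, i))⁻¹ = uX * lam ε.deg (1, 0) := by
  classical
  have hE := same_equivalence (n := n) D S
  have hi : ¬ D.Con S 0 i := by rw [hcon, max_eq_right him.le]; exact lt_irrefl _
  have hu {v : Vert n} : Same D S v (true, i) ↔ v = (true, i) ∨ v = (true, m.mate i) := h.unc i v hi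
  have hfl (k : Fin (2 * n)) : halfLabel D S false ε.1 (false, k) = ε.1 k := by simp [halfLabel]
  have hfl' (k : Fin (2 * n)) : halfLabel D S' false ε.1 (false, k) = ε.1 k := by simp [halfLabel]
  have hfu : halfLabel D S false ε.1 (true, i) = true := by simp [halfLabel, hi]
  have f1 (w : Vert n) : FirstBefore D S w (true, i) ↔ ∃ k ∈ circleReps a b, w = (false, k) := by
    constructor
    · rintro ⟨h1, h2⟩
      have h3 := h2 (true, m.mate i) (hE.symm (hu.mpr (.inr rfl)))
      obtain ⟨_ | _, k⟩ := w
      · refine ⟨k, ?_, rfl⟩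
        simp only [circleReps, Finset.mem_filter, Finset.mem_univ, true_and]
        exact fun j hj => Vert.pos_false_le.mp (h1 (false, j) ((h.big k j).mpr hj))
      · have hk := (hcon k).mpr (lt_max_of_lt_left (Vert.pos_true_lt.mp h3))
        exact absurd (h1 _ (h.con k hk)) (not_le.mpr (Vert.pos_false_lt_true k k))
    · rintro ⟨k, hk, rfl⟩
      simp only [circleReps, Finset.mem_filter, Finset.mem_univ, true_and] at hk
      refine ⟨fun x hx => ?_, fun x hx => ?_⟩
      · obtain ⟨_ | _, j⟩ := x
        · exact Vert.pos_false_le.mpr (hk j ((h.big k j).mp hx))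
        · exact (Vert.pos_false_lt_true k j).le
      · rcases hu.mp (hE.symm hx) with rfl | rfl <;> exact Vert.pos_false_lt_true _ _
  have f2 {S : Set Saddle} (h : HalfTrivial D S a b m false) (w : Vert n) :
      FirstBefore D S w (false, i) ↔
        ∃ k ∈ (circleReps a b).filter (fun k => ∀ j, SameCircle a b i j → j < k), w = (false, k) := by
    simp only [circleReps, Finset.mem_filter, Finset.mem_univ, true_and]
    constructor
    · rintro ⟨h1, h2⟩
      obtain ⟨k, rfl, -⟩ := Vert.eq_of_pos_lt (h2 (false, i) ((same_equivalence D S).refl _))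
      exact ⟨k, ⟨fun j hj => Vert.pos_false_le.mp (h1 (false, j) ((h.big k j).mpr hj)),
        fun j hj => Vert.pos_false_lt.mp (h2 (false, j) ((h.big i j).mpr hj))⟩, rfl⟩
    · rintro ⟨k, ⟨h1, h2⟩, rfl⟩
      refine ⟨fun x hx => ?_, fun x hx => ?_⟩ <;> obtain ⟨_ | _, j⟩ := x
      · exact Vert.pos_false_le.mpr (h1 j ((h.big k j).mp hx))
      · exact (Vert.pos_false_lt_true k j).le
      · exact Vert.pos_false_lt.mpr (h2 j ((h.big i j).mp hx))
      · exact Vert.pos_false_lt_true k j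
  have f3 (w : Vert n) : (FirstBefore D S w (false, i) ∧ ¬ Same D S w (true, i)) ↔
      ∃ k ∈ (circleReps a b).filter (fun k => ∀ j, SameCircle a b i j → j < k), w = (false, k) := by
    rw [f2 h]
    refine ⟨fun h => h.1, fun h => ⟨h, ?_⟩⟩
    obtain ⟨k, -, rfl⟩ := h
    rw [hu]; simp
  rw [front₂, front, front, prod_filter_eq false _ f1, prod_filter_eq false _ f3,
    prod_filter_eq false _ (f2 h')]
  simp only [hfl, hfl', hfu]
  rw [Labeling.deg, lam_sum_left]
  have e : lam (labelDeg true) (labelDeg (ε.1 i)) * (if ε.1 i = true then 1 else uX * uZ) = uX := by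
    cases ε.1 i <;> simp [labelDeg, lam]
  calc _ = (lam (labelDeg true) (labelDeg (ε.1 i)) * (if ε.1 i = true then 1 else uX * uZ)) *
        (∏ k ∈ circleReps a b, lam (labelDeg (ε.1 k)) (labelDeg true)) *
        ((∏ k ∈ (circleReps a b).filter (fun k => ∀ j, SameCircle a b i j → j < k),
          lam (labelDeg (ε.1 k)) (labelDeg (ε.1 i))) *
        (∏ k ∈ (circleReps a b).filter (fun k => ∀ j, SameCircle a b i j → j < k),
          lam (labelDeg (ε.1 k)) (labelDeg (ε.1 i)))⁻¹) := by ac_rfl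
    _ = _ := by rw [e, mul_inv_cancel, mul_one]; rfl

end HalfTrivial

open Classical in
/-- The rightmost contracted vertices of the circles of `a b̄`. -/
noncomputable def conReps {n : ℕ} (D : Diagram) (S : Set Saddle) (a b : CrossMatch n) :
    Finset (Fin (2 * n)) :=
  Finset.univ.filter fun k : Fin (2 * n) =>
    D.Con S 0 k ∧ ∀ k' : Fin (2 * n), D.Con S 0 k' → SameCircle a b k k' → k' ≤ k

namespace HalfTrivial
variable {n : ℕ} {D : Diagram} {S S' : Set Saddle} {a b m : CrossMatch n}

theorem mem_conReps {k : Fin (2 * n)} : k ∈ conReps D S a b ↔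
    D.Con S 0 k ∧ ∀ k' : Fin (2 * n), D.Con S 0 k' → SameCircle a b k k' → k' ≤ k := by
  simp [conReps]

theorem eq_of_conReps {k k' : Fin (2 * n)} (hk : k ∈ conReps D S a b) (hk' : k' ∈ conReps D S a b)
    (h : SameCircle a b k k') : k = k' := by
  rw [mem_conReps] at hk hk'
  exact le_antisymm (hk'.2 k hk.1 ((sameCircle_equivalence a b).symm h)) (hk.2 k' hk'.1 h)

theorem pos_le_of_conReps (h : HalfTrivial D S a b m true) {k : Fin (2 * n)}
    (hk : k ∈ conReps D S a b) {x : Vert n} (hx : Same D S (false, k) x) :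
    Vert.pos (false, k) ≤ x.pos := by
  rw [mem_conReps] at hk
  obtain ⟨_ | _, j⟩ := x
  · have hj := h.con_of_same hk.1 hx
    exact Vert.pos_false_le.mpr (hk.2 j hj ((h.same_small hk.1 hj).mp hx))
  · exact (Vert.pos_false_lt_true k j).le

theorem mem_conReps_of_first (h : HalfTrivial D S a b m true) {k : Fin (2 * n)} (hk : D.Con S 0 k)
    (hf : ∀ x : Vert n, Same D S (false, k) x → Vert.pos (false, k) ≤ x.pos) :
    k ∈ conReps D S a b :=
  mem_conReps.mpr ⟨hk, fun k' hk' hs =>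
    Vert.pos_false_le.mp (hf (false, k') ((h.same_small hk hk').mpr hs))⟩

/-- Contraction proceeds from the right, so everything to the right of a contracted right endpoint
is contracted. The circles before the given one therefore all start at contracted vertices further
to the right. -/
theorem firstBefore_of_rep (h : HalfTrivial D S a b m true) {T : ℕ}
    (hcon : ∀ k : Fin (2 * n), D.Con S 0 k ↔ T ≤ max k (m.mate k)) {v : Vert n} {r : Fin (2 * n)}
    (hr : r ∈ conReps D S a b) (hv : Same D S v (false, r)) (w : Vert n) :
    FirstBefore D S w v ↔ ∃ k ∈ conReps D S a b, w = (false, k) ∧ r < k := by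
  have hE := same_equivalence (n := n) D S
  constructor
  · rintro ⟨h1, h2⟩
    obtain ⟨k, rfl, hk⟩ := Vert.eq_of_pos_lt (h2 _ hv)
    have hr' := mem_conReps.mp hr
    have hmr : m.mate r ≤ r := hr'.2 _ ((h.con_mate r).mpr hr'.1) (h.mate r)
    have hT := (hcon r).mp hr'.1
    rw [max_eq_left (by exact_mod_cast hmr)] at hT
    have hk' : D.Con S 0 k := (hcon k).mpr (hT.trans ((Fin.lt_def.mp hk).le.trans (le_max_left _ _)))
    exact ⟨k, h.mem_conReps_of_first hk' h1, rfl, hk⟩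
  · rintro ⟨k, hk, rfl, hrk⟩
    exact ⟨fun x hx => h.pos_le_of_conReps hk hx, fun x hx => (Vert.pos_false_lt.mpr hrk).trans_le
      (h.pos_le_of_conReps hr (hE.trans (hE.symm hv) hx))⟩

section
variable (h : HalfTrivial D S a b m true) (h' : HalfTrivial D S' a b m true) {i : Fin (2 * n)}
  (him : i < m.mate i)
  (hcon : ∀ k : Fin (2 * n), D.Con S 0 k ↔ m.mate i < max k (m.mate k))
  (hcon' : ∀ k : Fin (2 * n), D.Con S' 0 k ↔ D.Con S 0 k ∨ k = i ∨ k = m.mate i)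
include h hcon

-- The right end of the arc at `i` is the first vertex of its small circle, and whatever lies to its
-- right has already been contracted.
include him in
theorem firstBefore_arc (w : Vert n) :
    FirstBefore D S w (false, i) ↔ ∃ k ∈ conReps D S a b, w = (false, k) := by
  have hE := same_equivalence (n := n) D S
  have hi : ¬ D.Con S 0 i := by rw [hcon, max_eq_right him.le]; exact lt_irrefl _
  constructor
  · rintro ⟨h1, h2⟩
    obtain ⟨k, rfl, hk⟩ := Vert.eq_of_pos_lt
      (h2 (false, m.mate i) (hE.symm ((h.unc i _ hi).mpr (.inr rfl))))
    exact ⟨k, h.mem_conReps_of_first ((hcon k).mpr (lt_max_of_lt_left hk)) h1, rfl⟩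
  · rintro ⟨k, hk, rfl⟩
    refine ⟨fun x hx => h.pos_le_of_conReps hk hx, fun x hx => ?_⟩
    have hk' := mem_conReps.mp hk
    have hmk : m.mate k ≤ k := hk'.2 _ ((h.con_mate k).mpr hk'.1) (h.mate k)
    have hlt := (hcon k).mp hk'.1
    rw [max_eq_left hmk] at hlt
    rcases (h.unc i _ hi).mp (hE.symm hx) with rfl | rfl
    · exact Vert.pos_false_lt.mpr (him.trans hlt)
    · exact Vert.pos_false_lt.mpr hlt

/-- A circle of `a b̄` without contracted vertices lies entirely in the upper half. Hence every
circle which meets the lower half comes before it. -/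
theorem firstBefore_fresh (hf : ∀ k : Fin (2 * n), SameCircle a b i k → ¬ D.Con S 0 k) (w : Vert n) :
    FirstBefore D S w (true, i) ↔ (∃ k ∈ conReps D S a b, w = (false, k)) ∨
      ∃ k : Fin (2 * n), (¬ D.Con S 0 k ∧ m.mate k < k) ∧ w = (false, k) := by
  have hE := same_equivalence (n := n) D S
  have hbig (x : Vert n) (hx : Same D S (true, i) x) : ∃ j, x = (true, j) := by
    obtain ⟨_ | _, j⟩ := x
    · by_cases hj : D.Con S 0 j
      · exact absurd hj (hf j ((sameCircle_equivalence a b).symm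
          ((h.same_small_big hj).mp (hE.symm hx))))
      · exact absurd hx (h.not_same hj)
    · exact ⟨j, rfl⟩
  constructor
  · rintro ⟨h1, h2⟩
    have h3 := h2 (true, m.mate i) ((h.big _ _).mpr (h.mate i))
    obtain ⟨_ | _, k⟩ := w
    · by_cases hk : D.Con S 0 k
      · exact .inl ⟨k, h.mem_conReps_of_first hk h1, rfl⟩
      · refine .inr ⟨k, ⟨hk, lt_of_le_of_ne ?_ (m.mate_ne k)⟩, rfl⟩
        exact Vert.pos_false_le.mp (h1 _ (hE.symm ((h.unc k _ hk).mpr (.inr rfl))))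
    · have hk := (hcon k).mpr (lt_max_of_lt_left (Vert.pos_true_lt.mp h3))
      exact absurd (h1 _ (hE.symm (h.con k hk))) (not_le.mpr (Vert.pos_false_lt_true k k))
  · rintro (⟨k, hk, rfl⟩ | ⟨k, ⟨hk, hmk⟩, rfl⟩)
    · refine ⟨fun x hx => h.pos_le_of_conReps hk hx, fun x hx => ?_⟩
      obtain ⟨j, rfl⟩ := hbig x hx
      exact Vert.pos_false_lt_true k j
    · refine ⟨fun x hx => ?_, fun x hx => ?_⟩
      · rcases (h.unc k _ hk).mp (hE.symm hx) with rfl | rfl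
        · exact le_rfl
        · exact (Vert.pos_false_lt.mpr hmk).le
      · obtain ⟨j, rfl⟩ := hbig x hx
        exact Vert.pos_false_lt_true k j

include him h' hcon'

/-- Let `C` be the product of `λ((1, 0), label)` over the circles with contracted vertices, and `r`
the number of arcs left, the current one included. The coefficient `t` of the saddle satisfies `C^r
t = C'^(r-1)`, where `C'` is the product after the saddle, so the coefficients telescope.

If the circle of `i` already has a contracted vertex, then `C' = C`, and the circle `v₊` of the arc
passes each of these circles once, so `t = C⁻¹`. Otherwise the circle of `i` also has to pass the
`r` small circles of the remaining arcs, and one of these passages is undone. This adds `λ((1, 0),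
label)^(r-1)`, while `C'` has the same label as its new factor. -/
theorem coef_true (ε : Labeling a b) (js : Finset (Fin (2 * n)))
    (hjs : ∀ k, k ∈ js ↔ ¬ D.Con S 0 k ∧ m.mate k < k) :
    (∏ k ∈ conReps D S a b, lam (1, 0) (labelDeg (ε.1 k))) ^ js.card *
      (front₂ D S (halfLabel D S true ε.1) (false, i) (true, i) *
        (if halfLabel D S true ε.1 (false, i) then 1 else uX * uZ) *
        (front D S' (halfLabel D S' true ε.1) (false, i))⁻¹) =
      (∏ k ∈ conReps D S' a b, lam (1, 0) (labelDeg (ε.1 k))) ^ (js.card - 1) := by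
  classical
  have hE := same_equivalence (n := n) D S
  have hE' := same_equivalence (n := n) D S'
  have hC := sameCircle_equivalence a b
  have hi : ¬ D.Con S 0 i := by rw [hcon, max_eq_right him.le]; exact lt_irrefl _
  have hi' : D.Con S' 0 i := by rw [hcon']; exact .inr (.inl rfl)
  have hfb : halfLabel D S true ε.1 (true, i) = ε.1 i := by simp [halfLabel]
  have hfi : halfLabel D S true ε.1 (false, i) = true := by simp [halfLabel, hi]
  have hfi' : halfLabel D S' true ε.1 (false, i) = ε.1 i := by simp [halfLabel, hi']
  have hf (k : Fin (2 * n)) (hk : D.Con S 0 k) : halfLabel D S true ε.1 (false, k) = ε.1 k := by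
    simp [halfLabel, hk]
  have hf' (k : Fin (2 * n)) (hk : D.Con S' 0 k) : halfLabel D S' true ε.1 (false, k) = ε.1 k := by
    simp [halfLabel, hk]
  have hfn (k : Fin (2 * n)) (hk : ¬ D.Con S 0 k) : halfLabel D S true ε.1 (false, k) = true := by
    simp [halfLabel, hk]
  have hT (k : Fin (2 * n)) : D.Con S 0 k ↔
      ((m.mate i : ℕ) + 1) ≤ (max (k : ℕ) (m.mate k : ℕ)) := by
    rw [hcon, lt_max_iff, Nat.succ_le_iff, lt_max_iff, Fin.lt_def, Fin.lt_def]
  have hT' (k : Fin (2 * n)) : D.Con S' 0 k ↔ (m.mate i : ℕ) ≤ (max (k : ℕ) (m.mate k : ℕ)) := by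
    rw [hcon', hT, Nat.succ_le_iff, Nat.le_iff_lt_or_eq]
    refine or_congr_right ⟨?_, fun e => ?_⟩
    · rintro (rfl | rfl)
      · rw [max_eq_right (Fin.le_def.mp him.le)]
      · rw [m.mate_mate, max_eq_left (Fin.le_def.mp him.le)]
    · rcases max_choice (k : ℕ) (m.mate k : ℕ) with h | h <;> rw [h] at e
      · exact .inr (Fin.ext e.symm)
      · left
        rw [← m.mate_mate k, ← show m.mate i = m.mate k from Fin.ext e, m.mate_mate]
  have hbelow {k : Fin (2 * n)} (hk : k ∈ conReps D S a b) : m.mate i < k := by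
    have hk' := mem_conReps.mp hk
    have hmk : m.mate k ≤ k := hk'.2 _ ((h.con_mate k).mpr hk'.1) (h.mate k)
    have hlt := (hcon k).mp hk'.1
    rwa [max_eq_left hmk] at hlt
  have hmem : m.mate i ∈ js := (hjs _).mpr ⟨by rwa [h.con_mate], by rwa [m.mate_mate]⟩
  have hcard : 0 < js.card := Finset.card_pos.mpr ⟨_, hmem⟩
  have hswap := prod_lam_mul_swap (conReps D S a b) (fun k => labelDeg (ε.1 k)) (1, 0)
  have hpow {C C' t : Rˣ} (hCC : C * C' = 1) (e : t = C') :
      C ^ js.card * t = C ^ (js.card - 1) := by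
    conv_lhs => rw [show js.card = js.card - 1 + 1 by omega]
    rw [pow_succ, mul_assoc, e, hCC, mul_one]
  rw [front₂, front, front, hfb, hfi, hfi', if_pos rfl, mul_one]
  -- Either the upper circle at `i` already starts at a contracted vertex, whose rightmost choice is
  -- `r`, or it is still behind all small circles.
  by_cases hex : ∃ k : Fin (2 * n), D.Con S 0 k ∧ SameCircle a b i k
  · obtain ⟨r, hr, hir⟩ : ∃ r ∈ conReps D S a b, SameCircle a b i r := by
      obtain ⟨k, hk⟩ := hex
      obtain ⟨r, hr, hmax⟩ := Finset.exists_max_image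
        (Finset.univ.filter fun k : Fin (2 * n) => D.Con S 0 k ∧ SameCircle a b i k) id ⟨k, by simpa⟩
      simp only [Finset.mem_filter, Finset.mem_univ, true_and, id] at hr hmax
      exact ⟨r, mem_conReps.mpr ⟨hr.1, fun k' hk' hs => hmax k' ⟨hk', hC.trans hr.2 hs⟩⟩, hr.2⟩
    have hreps : conReps D S' a b = conReps D S a b := by
      ext k
      rw [mem_conReps, mem_conReps]
      constructor
      · rintro ⟨h1, h2⟩
        refine ⟨?_, fun k' hk' => h2 k' ((hcon' k').mpr (.inl hk'))⟩
        refine ((hcon' k).mp h1).resolve_right fun e => ?_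
        have hki : SameCircle a b k i := by
          rcases e with rfl | rfl
          · exact hC.refl _
          · exact hC.symm (h.mate i)
        have hle := h2 r ((hcon' r).mpr (.inl (mem_conReps.mp hr).1)) (hC.trans hki hir)
        have hlt := hbelow hr
        rcases e with rfl | rfl
        · exact absurd (him.trans hlt) (not_lt.mpr hle)
        · exact absurd hlt (not_lt.mpr hle)
      · rintro ⟨h1, h2⟩
        refine ⟨(hcon' k).mpr (.inl h1), fun k' hk' hs => ?_⟩
        rcases (hcon' k').mp hk' with hk' | e
        · exact h2 k' hk' hs
        · have hk := hbelow (mem_conReps.mpr ⟨h1, h2⟩)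
          rcases e with rfl | rfl
          · exact (him.trans hk).le
          · exact hk.le
    have hrc := (mem_conReps.mp hr).1
    have hfil (w : Vert n) : (∃ k ∈ conReps D S a b, w = (false, k) ∧ r < k) ↔
        ∃ k ∈ (conReps D S a b).filter (fun k => r < k), w = (false, k) := by
      simp only [Finset.mem_filter]
      exact exists_congr fun k => by tauto
    have g1 (w : Vert n) : FirstBefore D S w (true, i) ↔
        ∃ k ∈ (conReps D S a b).filter (fun k => r < k), w = (false, k) := by
      rw [h.firstBefore_of_rep hT hr (hE.symm ((h.same_small_big hrc).mpr (hC.symm hir)))]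
      exact hfil w
    have g2 (w : Vert n) : FirstBefore D S' w (false, i) ↔
        ∃ k ∈ (conReps D S a b).filter (fun k => r < k), w = (false, k) := by
      rw [h'.firstBefore_of_rep hT' (v := ((false, i) : Vert n)) (hreps ▸ hr)
        ((h'.same_small hi' ((hcon' r).mpr (.inl hrc))).mpr hir), hreps]
      exact hfil w
    have g3 (w : Vert n) : (FirstBefore D S w (false, i) ∧ ¬ Same D S w (true, i)) ↔
        ∃ k ∈ (conReps D S a b).erase r, w = (false, k) := by
      rw [h.firstBefore_arc him hcon]
      constructor
      · rintro ⟨⟨k, hk, rfl⟩, h2⟩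
        refine ⟨k, Finset.mem_erase.mpr ⟨?_, hk⟩, rfl⟩
        rintro rfl
        exact h2 ((h.same_small_big hrc).mpr (hC.symm hir))
      · rintro ⟨k, hk, rfl⟩
        rw [Finset.mem_erase] at hk
        refine ⟨⟨k, hk.2, rfl⟩, fun hs => hk.1 (eq_of_conReps hk.2 hr ?_)⟩
        exact hC.trans ((h.same_small_big (mem_conReps.mp hk.2).1).mp hs) hir
    -- Moving the upper circle to the front and moving the merged circle back to its place pass the
    -- same circles and cancel. There remain the passages of the small circle labelled `v₊`.
    rw [prod_filter_eq false _ g1, prod_filter_eq false _ g2, prod_filter_eq false _ g3, hreps]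
    refine hpow hswap ?_
    have e1 : ∏ k ∈ (conReps D S a b).filter (fun k => r < k),
        lam (labelDeg (halfLabel D S' true ε.1 (false, k))) (labelDeg (ε.1 i)) =
        ∏ k ∈ (conReps D S a b).filter (fun k => r < k),
        lam (labelDeg (halfLabel D S true ε.1 (false, k))) (labelDeg (ε.1 i)) := by
      refine Finset.prod_congr rfl fun k hk => ?_
      have hk := (mem_conReps.mp (Finset.mem_filter.mp hk).1).1
      rw [hf k hk, hf' k ((hcon' k).mpr (.inl hk))]
    have e2 : ∏ k ∈ (conReps D S a b).erase r,
        lam (labelDeg (halfLabel D S true ε.1 (false, k))) (labelDeg true) =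
        ∏ k ∈ (conReps D S a b).erase r, lam (labelDeg (ε.1 k)) (1, 0) := by
      refine Finset.prod_congr rfl fun k hk => ?_
      rw [hf k (mem_conReps.mp (Finset.mem_erase.mp hk).2).1]; rfl
    rw [e1, e2, ← Finset.mul_prod_erase _ _ hr, ← ε.eq_of_sameCircle hir]
    have e3 : lam (labelDeg (ε.1 i)) (labelDeg true) = lam (labelDeg (ε.1 i)) (1, 0) := rfl
    rw [e3]
    generalize (∏ k ∈ (conReps D S a b).filter (fun k => r < k),
        lam (labelDeg (halfLabel D S true ε.1 (false, k))) (labelDeg (ε.1 i))) = P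
    rw [mul_assoc P, mul_comm P, mul_inv_cancel_right]
  · have hfresh (k : Fin (2 * n)) (hk : SameCircle a b i k) : ¬ D.Con S 0 k :=
      fun hc => hex ⟨k, hc, hk⟩
    have hnot : m.mate i ∉ conReps D S a b := fun hc => lt_irrefl _ (hbelow hc)
    have hreps : conReps D S' a b = insert (m.mate i) (conReps D S a b) := by
      ext k
      rw [Finset.mem_insert, mem_conReps, mem_conReps]
      constructor
      · rintro ⟨h1, h2⟩
        rcases (hcon' k).mp h1 with hk | rfl | rfl
        · exact .inr ⟨hk, fun k' hk' => h2 k' ((hcon' k').mpr (.inl hk'))⟩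
        · exact absurd (h2 _ ((hcon' _).mpr (.inr (.inr rfl))) (h.mate k)) (not_le.mpr him)
        · exact .inl rfl
      · rintro (rfl | ⟨h1, h2⟩)
        · refine ⟨(hcon' _).mpr (.inr (.inr rfl)), fun k' hk' hs => ?_⟩
          rcases (hcon' k').mp hk' with hk | rfl | rfl
          · exact absurd hk (hfresh k' (hC.trans (h.mate i) hs))
          · exact him.le
          · exact le_rfl
        · refine ⟨(hcon' k).mpr (.inl h1), fun k' hk' hs => ?_⟩
          rcases (hcon' k').mp hk' with hk | rfl | rfl
          · exact h2 k' hk hs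
          · exact absurd h1 (hfresh k (hC.symm hs))
          · exact absurd h1 (hfresh k (hC.trans (h.mate i) (hC.symm hs)))
    have hdisj : Disjoint (conReps D S a b) js := by
      rw [Finset.disjoint_left]
      exact fun k hk hk' => ((hjs k).mp hk').1 (mem_conReps.mp hk).1
    have g1 (w : Vert n) : FirstBefore D S w (true, i) ↔
        ∃ k ∈ conReps D S a b ∪ js, w = (false, k) := by
      rw [h.firstBefore_fresh hcon hfresh]
      simp only [Finset.mem_union, or_and_right, exists_or, hjs]
    have g2 (w : Vert n) : FirstBefore D S' w (false, i) ↔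
        ∃ k ∈ conReps D S a b, w = (false, k) := by
      have hji : m.mate i ∈ conReps D S' a b := by rw [hreps]; exact Finset.mem_insert_self _ _
      rw [h'.firstBefore_of_rep hT' (v := ((false, i) : Vert n)) hji
        ((h'.same_small hi' (mem_conReps.mp hji).1).mpr (h.mate i)), hreps]
      constructor
      · rintro ⟨k, hk, rfl, hlt⟩
        exact ⟨k, Finset.mem_of_mem_insert_of_ne hk hlt.ne', rfl⟩
      · rintro ⟨k, hk, rfl⟩
        exact ⟨k, Finset.mem_insert_of_mem hk, rfl, hbelow hk⟩
    have g3 (w : Vert n) : (FirstBefore D S w (false, i) ∧ ¬ Same D S w (true, i)) ↔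
        ∃ k ∈ conReps D S a b, w = (false, k) := by
      rw [h.firstBefore_arc him hcon]
      refine ⟨fun h => h.1, fun hw => ⟨hw, ?_⟩⟩
      obtain ⟨k, hk, rfl⟩ := hw
      have hk := (mem_conReps.mp hk).1
      exact fun hs => hfresh k (hC.symm ((h.same_small_big hk).mp hs)) hk
    rw [prod_filter_eq false _ g1, prod_filter_eq false _ g2, prod_filter_eq false _ g3, hreps,
      Finset.prod_union hdisj, Finset.prod_insert hnot, mul_pow]
    have e1 : ∏ k ∈ conReps D S a b,
        lam (labelDeg (halfLabel D S' true ε.1 (false, k))) (labelDeg (ε.1 i)) =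
        ∏ k ∈ conReps D S a b,
        lam (labelDeg (halfLabel D S true ε.1 (false, k))) (labelDeg (ε.1 i)) := by
      refine Finset.prod_congr rfl fun k hk => ?_
      have hk := (mem_conReps.mp hk).1
      rw [hf k hk, hf' k ((hcon' k).mpr (.inl hk))]
    have e2 : ∏ k ∈ conReps D S a b,
        lam (labelDeg (halfLabel D S true ε.1 (false, k))) (labelDeg true) =
        ∏ k ∈ conReps D S a b, lam (labelDeg (ε.1 k)) (1, 0) := by
      refine Finset.prod_congr rfl fun k hk => ?_
      rw [hf k (mem_conReps.mp hk).1]; rfl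
    have e3 : ∏ k ∈ js, lam (labelDeg (halfLabel D S true ε.1 (false, k))) (labelDeg (ε.1 i)) =
        lam (1, 0) (labelDeg (ε.1 i)) ^ js.card := by
      rw [← Finset.prod_const]
      refine Finset.prod_congr rfl fun k hk => ?_
      rw [hfn k ((hjs k).mp hk).1]; rfl
    have e4 : lam (1, 0) (labelDeg (ε.1 i)) ^ js.card * lam (labelDeg (ε.1 i)) (labelDeg true) =
        lam (1, 0) (labelDeg (ε.1 i)) ^ (js.card - 1) := hpow (lam_mul_swap _ _) rfl
    rw [e1, e2, e3, ← ε.eq_of_sameCircle (h.mate i), ← hpow hswap rfl, ← e4]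
    generalize (∏ k ∈ conReps D S a b,
        lam (labelDeg (halfLabel D S true ε.1 (false, k))) (labelDeg (ε.1 i))) = P
    calc _ = (P * P⁻¹) * ((∏ k ∈ conReps D S a b, lam (1, 0) (labelDeg (ε.1 k))) ^ js.card *
        (lam (1, 0) (labelDeg (ε.1 i)) ^ js.card * lam (labelDeg (ε.1 i)) (labelDeg true) *
        ∏ k ∈ conReps D S a b, lam (labelDeg (ε.1 k)) (1, 0))) := by ac_rfl
      _ = _ := by rw [mul_inv_cancel, one_mul]; ac_rfl

end
end HalfTrivial

/-- `js` are the right endpoints of the arcs which have not been contracted yet. -/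
structure Remaining {n : ℕ} (D : Diagram) (m : CrossMatch n) (js : List (Fin (2 * n)))
    (S : Set Saddle) : Prop where
  sorted : js.Pairwise (· > ·)
  right : ∀ j ∈ js, m.mate j < j
  con : ∀ k : Fin (2 * n), D.Con S 0 k ↔ max k (m.mate k) ∉ js
  max : ∀ j, m.mate j < j → j ∈ js ∨ ∀ j' ∈ js, j' < j
  line : ∀ s ∈ S, s.1 = 0

theorem CrossMatch.mate_lt_max {n : ℕ} (m : CrossMatch n) (k : Fin (2 * n)) :
    m.mate (max k (m.mate k)) < max k (m.mate k) := by
  rcases lt_or_gt_of_ne (m.mate_ne k) with h | h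
  · rwa [max_eq_left h.le]
  · rw [max_eq_right h.le, m.mate_mate]; exact h

namespace Remaining
variable {n : ℕ} {D : Diagram} {m : CrossMatch n} {j : Fin (2 * n)} {js : List (Fin (2 * n))}
  {S : Set Saddle}

theorem con_iff (h : Remaining D m (j :: js) S) (k : Fin (2 * n)) :
    D.Con S 0 k ↔ j < Max.max k (m.mate k) := by
  rw [h.con]
  constructor
  · exact fun hk => (h.max _ (m.mate_lt_max k)).resolve_left hk j (by simp)
  · intro hlt hk
    rcases List.mem_cons.mp hk with e | hk
    · rw [e] at hlt; exact lt_irrefl _ hlt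
    · exact lt_irrefl _ (hlt.trans ((List.pairwise_cons.mp h.sorted).1 _ hk))

theorem mem_iff (h : Remaining D m js S) (k : Fin (2 * n)) :
    k ∈ js ↔ ¬ D.Con S 0 k ∧ m.mate k < k := by
  rw [h.con, not_not]
  constructor
  · exact fun hk => ⟨by rwa [max_eq_left (h.right k hk).le], h.right k hk⟩
  · rintro ⟨h1, h2⟩; rwa [max_eq_left h2.le] at h1

theorem tail (h : Remaining D m (j :: js) S) {S' : Set Saddle}
    (hS' : S' = insert (0, (m.mate j : ℕ)) S)
    (hcon : ∀ k : Fin (2 * n), D.Con S' 0 k ↔ D.Con S 0 k ∨ k = m.mate j ∨ k = j) :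
    Remaining D m js S' := by
  have hj := h.right j (by simp)
  have hs := List.pairwise_cons.mp h.sorted
  refine ⟨hs.2, fun j' h' => h.right j' (by simp [h']), fun k => ?_, fun j' h' => ?_, ?_⟩
  · have e : k = m.mate j ∨ k = j ↔ Max.max k (m.mate k) = j := by
      constructor
      · rintro (rfl | rfl)
        · rw [m.mate_mate, max_eq_right hj.le]
        · rw [max_eq_left hj.le]
      · intro e
        rcases max_choice k (m.mate k) with h' | h' <;> rw [h'] at e
        · exact .inr e
        · exact .inl (by rw [← e, m.mate_mate])
    rw [hcon, h.con, e, List.mem_cons, not_or]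
    constructor
    · rintro (h' | h')
      · exact h'.2
      · exact fun hc => absurd (hs.1 _ hc) (by rw [h']; exact lt_irrefl _)
    · intro h'
      by_cases h'' : Max.max k (m.mate k) = j
      · exact .inr h''
      · exact .inl ⟨h'', h'⟩
  · rcases h.max j' h' with h1 | h1
    · rcases List.mem_cons.mp h1 with rfl | h1
      · exact .inr hs.1
      · exact .inl h1
    · exact .inr fun j'' h2 => h1 j'' (by simp [h2])
  · rw [hS']
    rintro s (rfl | hs)
    · rfl
    · exact h.line s hs

theorem start {D : Diagram} {m : CrossMatch n} : Remaining D m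
    ((List.finRange (2 * n)).reverse.filter fun j => m.mate j < j) ∅ := by
  refine ⟨?_, by simp, fun k => ?_, fun j hj => .inl (by simpa using hj), by simp⟩
  · refine List.Pairwise.filter _ ?_
    rw [List.pairwise_reverse]
    exact List.pairwise_lt_finRange _
  · refine iff_of_false (Set.notMem_empty _) (not_not.mpr ?_)
    simpa using m.mate_lt_max k

end Remaining

section
variable {n : ℕ} {D : Diagram} {a b m : CrossMatch n} {β : Bool}

/-- The labelling of the half-contracted diagram is determined by `ε` throughout, so contraction
only multiplies a single basis element by units. The parameter `coef` is any guess for the remaining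
product of units which satisfies its recursion. -/
theorem contract_halfLabel
    (H : ∀ S : Set Saddle, (∀ s ∈ S, s.1 = 0) → HalfTrivial D S a b m β)
    (hcon : ∀ (S : Set Saddle) (i : Fin (2 * n)), i < m.mate i → ∀ k : Fin (2 * n),
      D.Con (insert (0, (i : ℕ)) S) 0 k ↔ D.Con S 0 k ∨ k = i ∨ k = m.mate i)
    (hm : ∀ (S : Set Saddle) (i : Fin (2 * n)), i < m.mate i → ¬ D.Con S 0 i →
      D.IsMerge S (0, (i : ℕ))) (ε : Labeling a b)
    (coef : List (Fin (2 * n)) → Set Saddle → Rˣ) (hnil : ∀ S, coef [] S = 1)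
    (hcons : ∀ j js S S', Remaining D m (j :: js) S → S' = insert (0, (m.mate j : ℕ)) S →
      D.Con S' 0 (m.mate j) →
      (∀ k : Fin (2 * n), D.Con S' 0 k ↔ D.Con S 0 k ∨ k = m.mate j ∨ k = m.mate (m.mate j)) →
      Remaining D m js S' →
      coef (j :: js) S = front₂ D S (halfLabel D S β ε.1) (false, m.mate j) (true, m.mate j) *
        (if halfLabel D S β ε.1 (false, m.mate j) then 1 else uX * uZ) *
        (front D S' (halfLabel D S' β ε.1) (false, m.mate j))⁻¹ * coef js S')
    (js : List (Fin (2 * n))) {S : Set Saddle} (hR : Remaining D m js S) (r : R) :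
    contract D m S (js.map m.mate) (Finsupp.single (halfLabel D S β ε.1) r) =
      Finsupp.single (fun v => ε.1 v.2) (r * (coef js S : Rˣ)) := by
  induction js generalizing S r with
  | nil =>
    have e : halfLabel D S β ε.1 = fun v => ε.1 v.2 := by
      funext v
      have h : D.Con S 0 v.2 := (hR.con v.2).mpr (by simp)
      simp [halfLabel, h]
    simp [contract, hnil, e]
  | cons j js ih =>
    have hj := hR.right j (by simp)
    have hij : m.mate j < m.mate (m.mate j) := by rwa [m.mate_mate]
    have hc := hcon S (m.mate j) hij
    have hi' : D.Con (insert (0, (m.mate j : ℕ)) S) 0 (m.mate j) := (hc _).mpr (.inr (.inl rfl))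
    have hR' := hR.tail rfl (fun k => by rw [hc, m.mate_mate])
    have hi : ¬ D.Con S 0 (m.mate j) := by
      rw [hR.con, m.mate_mate, max_eq_right hj.le]; simp
    simp only [List.map_cons, contract, LinearMap.comp_apply]
    rw [Finsupp.linearCombination_single, saddleBasis_halfLabel (H _ hR'.line) rfl hi hi' hc
      (hm S _ hij hi) ε, Finsupp.smul_single, ih hR', hcons j js S _ hR rfl hi' hc hR',
      smul_eq_mul, mul_assoc, ← Units.val_mul]

theorem con_insert_diag₂ {a b c : CrossMatch n} (S : Set Saddle) (i : Fin (2 * n))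
    (hi : i < b.mate i) (k : Fin (2 * n)) :
    (diag₂ a b c (Tangle.one n) (Tangle.one n)).Con (insert (0, (i : ℕ)) S) 0 k ↔
      (diag₂ a b c (Tangle.one n) (Tangle.one n)).Con S 0 k ∨ k = i ∨ k = b.mate i := by
  obtain ⟨τ, hD⟩ := diag₂_isPlanar a b c (Tangle.one n) (Tangle.one n) n n _ rfl
  have hx : (diag₂ a b c (Tangle.one n) (Tangle.one n)).IsSaddle 2 (0, (i : ℕ)) := by
    refine ⟨by simp, ?_⟩
    change (i : ℕ) < b.mateN i
    rw [b.mateN_coe]; exact hi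
  rw [hD.con_insert hx, or_comm]
  change _ ∨ (_ ∧ ((k : ℕ) = i ∨ (k : ℕ) = b.mateN i)) ↔ _
  simp [b.mateN_coe, Fin.val_inj]

theorem notMem_of_not_con {a b c : CrossMatch n} {S : Set Saddle} {i : Fin (2 * n)}
    (hi : i < b.mate i)
    (h : ¬ (diag₂ a b c (Tangle.one n) (Tangle.one n)).Con S 0 i) :
    ((0, (i : ℕ)) : Saddle) ∉ S := by
  have e : (diag₂ a b c (Tangle.one n) (Tangle.one n)).line 0 i = (b.mate i : ℕ) := b.mateN_coe i
  rwa [Diagram.Con, e, min_eq_left (by exact_mod_cast hi.le)] at h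

theorem contract_idem_left (a b : CrossMatch n) (ε : Labeling a b) :
    contract (diag₂ a a b (Tangle.one n) (Tangle.one n)) a ∅ a.arcs
      (Finsupp.single (fun v => if v.1 then ε.1 v.2 else true) 1) =
      Finsupp.single (fun v => ε.1 v.2) 1 := by
  -- The guess is the inverse of the telescoping quantity in `coef_true`. At the beginning no vertex
  -- is contracted, the product is empty, and the total coefficient is `1`.
  have key := contract_halfLabel (D := diag₂ a a b (Tangle.one n) (Tangle.one n)) (a := a) (b := b)
    (m := a) (β := true) (fun S hS => halfTrivial_above hS) con_insert_diag₂
    (fun S i hi hc => isMerge_diag₂_below a b _ S _ (mem_saddles.mpr ⟨rfl, i, rfl, hi⟩)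
      (notMem_of_not_con hi hc)) ε
    (fun js S => ((∏ k ∈ conReps (diag₂ a a b (Tangle.one n) (Tangle.one n)) S a b,
      lam (1, 0) (labelDeg (ε.1 k))) ^ js.length)⁻¹) (fun S => by simp) ?_ _ Remaining.start 1
  · have e1 : halfLabel (diag₂ a a b (Tangle.one n) (Tangle.one n)) ∅ true ε.1 =
        fun v => if v.1 then ε.1 v.2 else true := by
      funext v
      have : ¬ (diag₂ a a b (Tangle.one n) (Tangle.one n)).Con ∅ 0 v.2 := Set.notMem_empty _
      simp [halfLabel, this]
    have e2 : conReps (diag₂ a a b (Tangle.one n) (Tangle.one n)) ∅ a b = ∅ := by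
      refine Finset.eq_empty_of_forall_notMem fun k hk => ?_
      exact Set.notMem_empty _ (HalfTrivial.mem_conReps.mp hk).1
    rw [e1, e2] at key
    simpa [CrossMatch.arcs] using key
  · intro j js S S' hR hS' hi' hc hR'
    have hj := hR.right j (by simp)
    have hij : a.mate j < a.mate (a.mate j) := by rwa [a.mate_mate]
    have := HalfTrivial.coef_true (halfTrivial_above hR.line) (halfTrivial_above hR'.line) hij
      (fun k => by rw [hR.con_iff, a.mate_mate]) hc ε (j :: js).toFinset
      (fun k => by rw [List.mem_toFinset, hR.mem_iff])
    rw [List.toFinset_card_of_nodup (hR.sorted.imp ne_of_gt), List.length_cons,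
      Nat.add_sub_cancel] at this
    rw [List.length_cons, ← this, mul_inv, ← mul_assoc, mul_right_comm, mul_inv_cancel, one_mul]

theorem contract_idem_right (a b : CrossMatch n) (ε : Labeling a b) :
    contract (diag₂ a b b (Tangle.one n) (Tangle.one n)) b ∅ b.arcs
      (Finsupp.single (fun v => if v.1 then true else ε.1 v.2) 1) =
      Finsupp.single (fun v => ε.1 v.2) (((uX * lam ε.deg (1, 0)) ^ n : Rˣ) : R) := by
  -- By `coef_false` each arc contributes the same unit, independently of the state.
  have key := contract_halfLabel (D := diag₂ a b b (Tangle.one n) (Tangle.one n)) (a := a) (b := b)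
    (m := b) (β := false) (fun S hS => halfTrivial_below hS) con_insert_diag₂
    (fun S i hi hc => isMerge_diag₂_above a b _ S _ (mem_saddles.mpr ⟨rfl, i, rfl, hi⟩)
      (notMem_of_not_con hi hc)) ε
    (fun js S => (uX * lam ε.deg (1, 0)) ^ js.length) (fun S => by simp) ?_ _ Remaining.start 1
  · have e1 : halfLabel (diag₂ a b b (Tangle.one n) (Tangle.one n)) ∅ false ε.1 =
        fun v => if v.1 then true else ε.1 v.2 := by
      funext ⟨c, k⟩
      have : ¬ (diag₂ a b b (Tangle.one n) (Tangle.one n)).Con ∅ 0 k := Set.notMem_empty _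
      cases c <;> simp [halfLabel, this]
    have e2 := b.length_arcs
    rw [CrossMatch.arcs, List.length_map] at e2
    rw [e1, e2, one_mul] at key
    exact key
  · intro j js S S' hR hS' hi' hc hR'
    have hj := hR.right j (by simp)
    have hij : b.mate j < b.mate (b.mate j) := by rwa [b.mate_mate]
    rw [HalfTrivial.coef_false (halfTrivial_below hR.line) (halfTrivial_below hR'.line) hij
      (fun k => by rw [hR.con_iff, b.mate_mate]) ε, List.length_cons, pow_succ']

theorem sum_labeling_single (a b : CrossMatch n) (ε : Labeling a b) (r : R) :
    ∑ z : Labeling a b, Finsupp.single (⟨a, b, z⟩ : ArcBasis n)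
      ((Finsupp.single (fun v : Vert n => ε.1 v.2) r : (Vert n → Bool) →₀ R) fun v => z.1 v.2) =
      Finsupp.single ⟨a, b, ε⟩ r := by
  classical
  rw [Finset.sum_eq_single ε]
  · rw [Finsupp.single_eq_same]
  · intro z _ hz
    rw [Finsupp.single_eq_of_ne, Finsupp.single_zero]
    intro e
    refine hz (Subtype.ext (funext fun k => ?_))
    exact congrFun e (true, k)
  · simp

theorem idem_mul_single (a b : CrossMatch n) (ε : Labeling a b) (r : R) :
    mul (idem a) (Finsupp.single (⟨a, b, ε⟩ : ArcBasis n) r) =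
      Finsupp.single ⟨a, b, ε⟩ r := by
  rw [mul, idem, Finsupp.linearCombination_single, one_smul, Finsupp.linearCombination_single,
    mulBasis, if_pos rfl]
  have := contract_idem_left a b ε
  simp only at this ⊢
  rw [this, sum_labeling_single, Finsupp.smul_single, smul_eq_mul, mul_one]

theorem single_mul_idem (a b : CrossMatch n) (ε : Labeling a b) (r : R) :
    mul (Finsupp.single (⟨a, b, ε⟩ : ArcBasis n) r) (idem b) =
      (((uX * lam ε.deg (1, 0)) ^ n : Rˣ) : R) • Finsupp.single ⟨a, b, ε⟩ r := by
  rw [mul, idem, Finsupp.linearCombination_single, LinearMap.smul_apply,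
    Finsupp.linearCombination_single, one_smul, mulBasis, if_pos rfl]
  have := contract_idem_right a b ε
  simp only at this ⊢
  rw [this, sum_labeling_single, Finsupp.smul_single, Finsupp.smul_single, smul_eq_mul, smul_eq_mul,
    mul_comm]

theorem mul_single_of_ne {x y : ArcBasis n} (h : x.2.1 ≠ y.1) (r s : R) :
    mul (Finsupp.single x r) (Finsupp.single y s) = 0 := by
  rw [mul, Finsupp.linearCombination_single, LinearMap.smul_apply,
    Finsupp.linearCombination_single, mulBasis, if_neg h, smul_zero, smul_zero]

end

end UnifiedArc

namespace UnifiedArc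

/-! ### The center -/

/-- Antisymmetry turns `λ(p, (1, 0))` into `λ((-1, 0), p)`, and `X^(n²) = X^n` since `n²` and `n`
have the same parity. This identifies the scalar of right multiplication by an idempotent with the
right unitor. -/
theorem lam_right_unit_pow (n : ℕ) (p : ℤ × ℤ) :
    (uX * lam p (1, 0)) ^ n = uX ^ (n * n) * lam (-(n : ℤ), 0) p := by
  have h1 : lam p (1, 0) = lam (-1, 0) p := by
    have := lam_add_left (1, 0) (-1, 0) p
    rw [show ((1, 0) : ℤ × ℤ) + (-1, 0) = 0 by simp, lam_zero_left, ← lam_mul_swap (1, 0) p] at this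
    exact mul_left_cancel this
  have h2 (k : ℕ) : lam (-1, 0) p ^ k = lam (-(k : ℤ), 0) p := by
    induction k with
    | zero => exact (lam_zero_left p).symm
    | succ k ih =>
      rw [pow_succ, ih, ← lam_add_left]
      congr 1
      ext <;> simp
      ring
  have h3 : uX ^ (n * n) = uX ^ n := by
    have e : uX * uX = 1 := uX_mul_self
    rw [pow_mul]
    rcases Nat.even_or_odd' n with ⟨k, h | h⟩
    · have : uX ^ n = 1 := by rw [h, pow_mul, sq, e, one_pow]
      rw [this, one_pow]
    · have : uX ^ n = uX := by rw [h, pow_succ, pow_mul, sq, e, one_pow, one_mul]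
      rw [this, this]
  rw [mul_pow, h1, h2, h3]

theorem assoc_id_id_arcBasis {n : ℕ} {a b : CrossMatch n} (ε : Labeling a b) :
    assoc ((Tangle.one n, ε.deg) : Hom ⟨n, a⟩ ⟨n, b⟩) (Hom.id ⟨n, b⟩) (Hom.id ⟨n, b⟩) =
      (uX * lam ε.deg (1, 0)) ^ n := by
  rw [lam_right_unit_pow, assoc_id_id_right]

theorem sameCircle_self {n : ℕ} {a : CrossMatch n} {i j : Fin (2 * n)} :
    SameCircle a a i j ↔ j = i ∨ j = a.mate i := by
  constructor
  · intro h
    induction h with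
    | rel x y h => exact .inr (h.elim id id)
    | refl x => exact .inl rfl
    | symm x y _ ih =>
      rcases ih with rfl | rfl
      · exact .inl rfl
      · exact .inr (a.mate_mate x).symm
    | trans x y z _ _ ih ih' =>
      rcases ih with rfl | rfl
      · exact ih'
      · rcases ih' with rfl | rfl
        · exact .inr rfl
        · exact .inl (a.mate_mate x)
  · rintro (rfl | rfl)
    · exact .refl _
    · exact .rel _ _ (.inl rfl)

theorem circleReps_self {n : ℕ} (a : CrossMatch n) :
    circleReps a a = Finset.univ.filter fun i => a.mate i < i := by
  ext i
  simp only [circleReps, Finset.mem_filter, Finset.mem_univ, true_and, sameCircle_self]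
  constructor
  · exact fun h => lt_of_le_of_ne (h _ (.inr rfl)) (a.mate_ne i)
  · rintro h j (rfl | rfl)
    · exact le_rfl
    · exact h.le

theorem card_circleReps_self {n : ℕ} (a : CrossMatch n) : (circleReps a a).card = n := by
  refine Eq.trans ?_ a.length_arcs
  rw [circleReps_self, CrossMatch.arcs, List.length_map,
    ← List.toFinset_card_of_nodup ((List.nodup_reverse.mpr (List.nodup_finRange _)).filter _)]
  congr 1
  ext i
  simp

/-- The labelling by `v₊`. -/
def Labeling.plus {n : ℕ} (a b : CrossMatch n) : Labeling a b := ⟨fun _ => true, fun _ => ⟨rfl, rfl⟩⟩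

theorem Labeling.deg_plus {n : ℕ} (a : CrossMatch n) : (Labeling.plus a a).deg = ((n : ℤ), 0) := by
  change ∑ i ∈ circleReps a a, labelDeg true = _
  rw [Finset.sum_const, card_circleReps_self]
  simp [labelDeg]

/-- The second coordinates of the degrees of labels are nonpositive, and they are `0` only for `v₊`.
Their sum is `0`, so no circle is labelled `v₋`. -/
theorem Labeling.eq_plus {n : ℕ} {a : CrossMatch n} {ε : Labeling a a} (h : ε.deg = ((n : ℤ), 0)) :
    ε = Labeling.plus a a := by
  have h2 : ∑ i ∈ circleReps a a, (labelDeg (ε.1 i)).2 = 0 := by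
    have := congrArg Prod.snd h
    rwa [Labeling.deg, Prod.snd_sum] at this
  have h3 : ∀ i ∈ circleReps a a, (labelDeg (ε.1 i)).2 = 0 := by
    refine (Finset.sum_eq_zero_iff_of_nonpos fun i _ => ?_).mp h2
    cases ε.1 i <;> simp [labelDeg]
  have h4 (i : Fin (2 * n)) (hi : a.mate i < i) : ε.1 i = true := by
    have := h3 i (by rw [circleReps_self]; simpa using hi)
    revert this
    cases ε.1 i <;> simp [labelDeg]
  refine Subtype.ext (funext fun i => ?_)
  rcases lt_or_gt_of_ne (a.mate_ne i) with hi | hi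
  · exact h4 i hi
  · exact (ε.2 i).1.symm.trans (h4 _ (by rwa [a.mate_mate]))

theorem idem_eq {n : ℕ} (a : CrossMatch n) :
    idem a = Finsupp.single ⟨a, a, Labeling.plus a a⟩ 1 := rfl

theorem unit_eq_idem {n : ℕ} (a : CrossMatch n) : unit n ⟨n, a⟩ = idem a := by simp [unit]

theorem unit_eq_zero {n : ℕ} {a : Obj} (h : a.1 ≠ n) : unit n a = 0 := by simp [unit, h]

theorem single_mem_arcGr {n : ℕ} (x : ArcBasis n) (r : R) : Finsupp.single x r ∈ arcGr x.grade :=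
  Finsupp.single_mem_supported R r rfl

theorem unit_mem_arcGr (n : ℕ) (a : Obj) : unit n a ∈ arcGr (n := n) (Hom.id a).grade := by
  obtain ⟨m, a⟩ := a
  by_cases h : m = n
  · subst h
    rw [unit_eq_idem]
    have := single_mem_arcGr (⟨a, a, Labeling.plus a a⟩ : ArcBasis m) 1
    rwa [ArcBasis.grade, Labeling.deg_plus] at this
  · rw [unit_eq_zero h]; exact Submodule.zero_mem _

/-- Induction on homogeneous elements. -/
theorem arcGr_induction {n : ℕ} {g : Grade} {p : (x : Arc n) → x ∈ arcGr g → Prop}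
    (zero : p 0 (Submodule.zero_mem _))
    (add : ∀ x y hx hy, p x hx → p y hy → p (x + y) (Submodule.add_mem _ hx hy))
    (single : ∀ (x : ArcBasis n) (r : R) (hx : x.grade = g),
      p (Finsupp.single x r) (Finsupp.single_mem_supported R r hx)) {x : Arc n}
    (hx : x ∈ arcGr g) : p x hx := by
  have key : ∃ h : x ∈ arcGr g, p x h := by
    have hx' := hx
    rw [arcGr, Finsupp.mem_supported] at hx'
    rw [← Finsupp.sum_single x]
    refine Finset.sum_induction _ (fun x => ∃ h : x ∈ arcGr g, p x h)
      (fun x y hx hy => ⟨_, add x y _ _ hx.2 hy.2⟩) ⟨_, zero⟩ fun i hi => ⟨_, single i _ (hx' hi)⟩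
  exact key.2

theorem mem_arcGr_id {n : ℕ} {a : CrossMatch n} {x : Arc n}
    (hx : x ∈ arcGr (Hom.id ⟨n, a⟩).grade) : ∃ r : R, x = r • idem a := by
  induction hx using arcGr_induction with
  | zero => exact ⟨0, by simp⟩
  | add x y _ _ hx hy =>
    obtain ⟨r, rfl⟩ := hx
    obtain ⟨s, rfl⟩ := hy
    exact ⟨r + s, (add_smul _ _ _).symm⟩
  | single x r h =>
    obtain ⟨b, c, ε⟩ := x
    simp only [ArcBasis.grade, Hom.grade, Sigma.mk.injEq] at h
    obtain ⟨⟨-, h1⟩, h2⟩ := h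
    obtain rfl := eq_of_heq h1
    simp only [heq_eq_eq, Sigma.mk.injEq, true_and] at h2
    obtain ⟨h2, h3⟩ := h2
    obtain rfl := h2
    have h4 : ε.deg = ((n : ℤ), 0) := congrArg Prod.snd h3
    refine ⟨r, ?_⟩
    rw [Labeling.eq_plus h4, idem_eq, Finsupp.smul_single, smul_eq_mul, mul_one]

theorem mem_arcGr_id_of_ne {n : ℕ} {a : Obj} (h : a.1 ≠ n) {x : Arc n}
    (hx : x ∈ arcGr (Hom.id a).grade) : x = 0 := by
  induction hx using arcGr_induction with
  | zero => rfl
  | add x y _ _ hx hy => rw [hx, hy, add_zero]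
  | single x r hx => exact absurd (congrArg (fun g : Grade => g.1.1) hx).symm h

/-- Linear combinations of the idempotents. -/
noncomputable def diagonal {n : ℕ} (r : CrossMatch n → R) : Arc n := ∑ a, r a • idem a

theorem exists_eq_diagonal {n : ℕ} {z : Arc n} (hz : z ∈ ⨆ a : Obj, arcGr (Hom.id a).grade) :
    ∃ r : CrossMatch n → R, z = diagonal r := by
  classical
  induction hz using Submodule.iSup_induction' with
  | mem a x hx =>
    obtain ⟨m, a⟩ := a
    by_cases h : m = n
    · subst h
      obtain ⟨r, rfl⟩ := mem_arcGr_id hx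
      refine ⟨Pi.single a r, ?_⟩
      rw [diagonal, Finset.sum_eq_single a]
      · rw [Pi.single_eq_same]
      · intro b _ hb
        rw [Pi.single_eq_of_ne hb, zero_smul]
      · simp
    · exact ⟨0, by simp [diagonal, mem_arcGr_id_of_ne h hx]⟩
  | zero => exact ⟨0, by simp [diagonal]⟩
  | add x y _ _ hx hy =>
    obtain ⟨r, rfl⟩ := hx
    obtain ⟨s, rfl⟩ := hy
    exact ⟨r + s, by simp [diagonal, add_smul, Finset.sum_add_distrib]⟩

theorem diagonal_const {n : ℕ} (r : R) : diagonal (fun _ : CrossMatch n => r) = r • one n := by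
  rw [diagonal, one, Finset.smul_sum]

theorem diagonal_mul_single {n : ℕ} (r : CrossMatch n → R) (x : ArcBasis n) (s : R) :
    mul (diagonal r) (Finsupp.single x s) = r x.1 • Finsupp.single x s := by
  classical
  rw [diagonal, map_sum, LinearMap.sum_apply, Finset.sum_eq_single x.1]
  · rw [map_smul, LinearMap.smul_apply, idem_mul_single]
  · intro b _ hb
    rw [map_smul, LinearMap.smul_apply, idem, mul_single_of_ne hb, smul_zero]
  · simp

theorem single_mul_diagonal {n : ℕ} (r : CrossMatch n → R) (x : ArcBasis n) (s : R) :
    mul (Finsupp.single x s) (diagonal r) =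
      (r x.2.1 * (((uX * lam x.2.2.deg (1, 0)) ^ n : Rˣ) : R)) • Finsupp.single x s := by
  classical
  rw [diagonal, map_sum, Finset.sum_eq_single x.2.1]
  · rw [map_smul, single_mul_idem, smul_smul]
  · intro b _ hb
    rw [map_smul, idem, mul_single_of_ne hb.symm, smul_zero]
  · simp

theorem unit_mul {n : ℕ} {a b : Obj} {f : Hom a b} {x : Arc n} (hx : x ∈ arcGr f.grade) :
    mul (unit n a) x = x := by
  induction hx using arcGr_induction with
  | zero => rw [map_zero]
  | add x y _ _ hx hy => rw [map_add, hx, hy]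
  | single x r hx =>
    have h : (⟨n, x.1⟩ : Obj) = a := congrArg (fun g : Grade => g.1) hx
    rw [← h, unit_eq_idem, idem_mul_single]

theorem mul_unit {n : ℕ} {a b : Obj} {f : Hom a b} {x : Arc n} (hx : x ∈ arcGr f.grade) :
    mul x (unit n b) = (assoc f (Hom.id b) (Hom.id b) : R) • x := by
  induction hx using arcGr_induction with
  | zero => simp
  | add x y _ _ hx hy => rw [map_add, LinearMap.add_apply, hx, hy, smul_add]
  | single x r hx =>
    obtain ⟨c, d, ε⟩ := x
    simp only [ArcBasis.grade, Hom.grade, Sigma.mk.injEq] at hx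
    obtain ⟨rfl, hx⟩ := hx
    simp only [heq_eq_eq, Sigma.mk.injEq] at hx
    obtain ⟨rfl, hx⟩ := hx
    obtain rfl := eq_of_heq hx
    rw [unit_eq_idem, single_mul_idem, ← assoc_id_id_arcBasis]

theorem mul_one_eq {n : ℕ} {a b : Obj} {f : Hom a b} {x : Arc n} (hx : x ∈ arcGr f.grade) :
    mul x (one n) = (assoc f (Hom.id b) (Hom.id b) : R) • x := by
  induction hx using arcGr_induction with
  | zero => simp
  | add x y _ _ hx hy => rw [map_add, LinearMap.add_apply, hx, hy, smul_add]
  | single x r hx =>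
    obtain ⟨c, d, ε⟩ := x
    simp only [ArcBasis.grade, Hom.grade, Sigma.mk.injEq] at hx
    obtain ⟨rfl, hx⟩ := hx
    simp only [heq_eq_eq, Sigma.mk.injEq] at hx
    obtain ⟨rfl, hx⟩ := hx
    obtain rfl := eq_of_heq hx
    rw [← one_smul R (one n), ← diagonal_const, single_mul_diagonal, one_mul, ← assoc_id_id_arcBasis]

theorem one_mul_eq {n : ℕ} (x : Arc n) : mul (one n) x = x := by
  induction x using Finsupp.induction_linear with
  | zero => rw [map_zero]
  | add x y hx hy => rw [map_add, hx, hy]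
  | single x r => rw [← one_smul R (one n), ← diagonal_const, diagonal_mul_single, one_smul]

/-- `1` is a strict left unit, and as a right unit it acts by `α(f, Id, Id)`. Since `α(Id, Id, f) =
1`, the difference is exactly `ζ(f)`. -/
theorem one_mem_center (n : ℕ) : one n ∈ center n := by
  refine ⟨?_, fun a b f x hx => ?_⟩
  · refine Submodule.sum_mem _ fun a _ => ?_
    rw [← unit_eq_idem]
    exact Submodule.mem_iSup_of_mem (⟨n, a⟩ : Obj) (unit_mem_arcGr n _)
  · rw [mul_one_eq hx, one_mul_eq, zeta, assoc_id_id_left, one_mul]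

/-- The matching of neighbours. -/
def CrossMatch.neighbours (n : ℕ) : CrossMatch n where
  mate i := ⟨if i.1 % 2 = 0 then i + 1 else i - 1, by split_ifs <;> omega⟩
  mate_mate i := by ext; dsimp only; split_ifs <;> omega
  mate_ne i h := by
    have := congrArg Fin.val h
    dsimp only at this
    split_ifs at this <;> omega
  noncrossing i j h h' := by
    rw [Fin.lt_def] at h h'
    dsimp only at h'
    split_ifs at h' <;> omega

/-- There is a matching for every `n`, so the scalar can be read off from its idempotent. -/
theorem smul_one_injective (n : ℕ) : Function.Injective fun r : R => r • one n := by
  intro r s h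
  have key (t : R) : mul (t • one n)
      (Finsupp.single ⟨CrossMatch.neighbours n, CrossMatch.neighbours n, Labeling.plus _ _⟩ 1) =
      Finsupp.single ⟨CrossMatch.neighbours n, CrossMatch.neighbours n, Labeling.plus _ _⟩ t := by
    rw [map_smul, LinearMap.smul_apply, one_mul_eq, Finsupp.smul_single, smul_eq_mul, mul_one]
  refine Finsupp.single_injective _ ((key r).symm.trans (Eq.trans ?_ (key s)))
  simp only at h
  rw [h]

theorem diagonal_eq_smul_one {n : ℕ} {r : CrossMatch n → R} (h : ∀ a b, r a = r b) :
    diagonal r = r (CrossMatch.neighbours n) • one n := by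
  rw [← diagonal_const]
  exact congrArg diagonal (funext fun a => h _ _)

/-- A central element is diagonal by its degrees. For any `a, b` it is tested against the labelling
of `a b̄` by `v₊`: the unit from right multiplication is the one in `ζ`, so the coefficients at `a`
and `b` agree. -/
theorem eq_smul_one_of_mem_center {n : ℕ} {z : Arc n} (hz : z ∈ center n) :
    ∃ r : R, z = r • one n := by
  obtain ⟨r, rfl⟩ := exists_eq_diagonal hz.1
  refine ⟨_, diagonal_eq_smul_one fun a b => ?_⟩
  have := hz.2 _ _ _ _ (single_mem_arcGr (⟨a, b, Labeling.plus a b⟩ : ArcBasis n) 1)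
  rw [diagonal_mul_single, single_mul_diagonal, zeta, assoc_id_id_left, one_mul,
    assoc_id_id_arcBasis, smul_smul, mul_comm, Finsupp.smul_single, Finsupp.smul_single,
    smul_eq_mul, mul_one, smul_eq_mul, mul_one] at this
  exact (Units.mul_right_inj _).mp (Finsupp.single_injective _ this).symm

/-- The isomorphism of `R` onto the center. -/
noncomputable def centerEquiv (n : ℕ) : R ≃ₗ[R] center n :=
  LinearEquiv.ofBijective (LinearMap.toSpanSingleton R (center n) ⟨one n, one_mem_center n⟩)
    ⟨fun r s h => smul_one_injective n (congrArg Subtype.val h), fun z => by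
      obtain ⟨r, hr⟩ := eq_smul_one_of_mem_center z.2
      exact ⟨r, Subtype.ext hr.symm⟩⟩

theorem centerEquiv_apply (n : ℕ) (r : R) : (centerEquiv n r : Arc n) = r • one n := rfl

theorem mul_smul_one (n : ℕ) (r s : R) : mul (r • one n) (s • one n) = (r * s) • one n := by
  rw [map_smul, map_smul, LinearMap.smul_apply, one_mul_eq, smul_smul, mul_comm]

theorem mem_centerUnits_iff {n : ℕ} {z : Arc n} :
    z ∈ centerUnits n ↔ ∃ r : Rˣ, z = (r : R) • one n := by
  constructor
  · rintro ⟨hz, w, hw, h⟩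
    obtain ⟨r, rfl⟩ := eq_smul_one_of_mem_center hz
    obtain ⟨s, rfl⟩ := eq_smul_one_of_mem_center hw
    have h' : r * s = 1 := smul_one_injective n (by simp only; rw [← mul_smul_one, h, one_smul])
    exact ⟨Units.mkOfMulEqOne r s h', rfl⟩
  · rintro ⟨r, rfl⟩
    refine ⟨Submodule.smul_mem _ _ (one_mem_center n), ((r⁻¹ : Rˣ) : R) • one n,
      Submodule.smul_mem _ _ (one_mem_center n), ?_⟩
    rw [mul_smul_one, Units.mul_inv, one_smul]

theorem arcComplex_gr_zero {n : ℕ} (g : Grade) : (arcComplex n).gr 0 g = arcGr g := by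
  simp only [arcComplex, if_true]
  rfl

theorem arcComplex_gr_of_ne {n : ℕ} {k : ℤ} (hk : k ≠ 0) (g : Grade) : (arcComplex n).gr k g = ⊥ := by
  simp only [arcComplex, hk, if_false]
  rfl

/-- The grading-preserving endomorphisms of the bimodule `H^n` are scalars. -/
theorem exists_eq_smul_of_isHom {n : ℕ} {h : Arc n →ₗ[R] Arc n}
    (hh : IsHom (M := arcComplex n) (N := arcComplex n) 0 h) : ∃ r : R, h = r • LinearMap.id := by
  have hmem {g : Grade} {x : Arc n} (hx : x ∈ arcGr g) : h x ∈ arcGr g := by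
    have := hh.map_mem (k := 0) (g := g) (m := x) (by rwa [arcComplex_gr_zero])
    rwa [zero_add, arcComplex_gr_zero] at this
  have hl (x y : Arc n) : h (mul x y) = mul x (h y) := hh.map_lact x y
  have hr (x y : Arc n) : h (mul x y) = mul (h x) y := hh.map_ract x y
  -- The component of degree `Id_a` is spanned by `e_a`, so the endomorphism preserves each of these
  -- lines.
  have hid (a : CrossMatch n) : ∃ r : R, h (idem a) = r • idem a := by
    have := unit_mem_arcGr n ⟨n, a⟩
    rw [unit_eq_idem] at this
    exact mem_arcGr_id (hmem this)
  choose r hr' using hid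
  have h1 (x : ArcBasis n) (s : R) : h (Finsupp.single x s) = r x.1 • Finsupp.single x s := by
    have := hr (idem x.1) (Finsupp.single x s)
    rwa [idem_mul_single x.1 x.2.1 x.2.2, hr', map_smul, LinearMap.smul_apply,
      idem_mul_single x.1 x.2.1 x.2.2] at this
  -- Left and right linearity evaluate the endomorphism on the same element of `F(a b̄)` through
  -- `e_a` and through `e_b`.
  have h2 (a b : CrossMatch n) : r a = r b := by
    have := hl (Finsupp.single ⟨a, b, Labeling.plus a b⟩ 1) (idem b)
    rw [hr', map_smul, single_mul_idem, map_smul, h1, smul_smul, smul_smul, mul_comm,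
      Finsupp.smul_single, Finsupp.smul_single, smul_eq_mul, smul_eq_mul, mul_one, mul_one] at this
    exact (Units.mul_left_inj _).mp (Finsupp.single_injective _ this)
  refine ⟨r (CrossMatch.neighbours n), LinearMap.ext fun x => ?_⟩
  induction x using Finsupp.induction_linear with
  | zero => simp
  | add x y hx hy => rw [map_add, map_add, hx, hy]
  | single x s => rw [h1, h2 _ (CrossMatch.neighbours n)]; rfl

end UnifiedArc

namespace UnifiedArc

universe v w

/-! ### Linear maps on internal direct sums -/

section Internal
variable {S : Type*} [CommRing S] {ι κ μ : Type*} [DecidableEq ι] [DecidableEq κ] [DecidableEq μ]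
  {M N P Q : Type*} [AddCommGroup M] [Module S M] [AddCommGroup N] [Module S N]
  [AddCommGroup P] [Module S P] [AddCommGroup Q] [Module S Q]
  {A : ι → Submodule S M} {B : κ → Submodule S N} {C : μ → Submodule S P}

theorem linearMap_ext_of_isInternal (hA : DirectSum.IsInternal A) {F G : M →ₗ[S] N}
    (h : ∀ i, ∀ m ∈ A i, F m = G m) : F = G := by
  refine LinearMap.ext fun m => ?_
  have hm : m ∈ ⨆ i, A i := by rw [hA.submodule_iSup_eq_top]; trivial
  induction hm using Submodule.iSup_induction' with
  | mem i m hm => exact h i m hm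
  | zero => rw [map_zero, map_zero]
  | add x y _ _ hx hy => rw [map_add, map_add, hx, hy]

theorem exists_linearMap_of_isInternal (hA : DirectSum.IsInternal A) (F : ι → M →ₗ[S] N) :
    ∃ G : M →ₗ[S] N, ∀ i, ∀ m ∈ A i, G m = F i m := by
  let e := LinearEquiv.ofBijective (DirectSum.coeLinearMap A) hA
  refine ⟨DirectSum.toModule S ι N (fun i => F i ∘ₗ (A i).subtype) ∘ₗ e.symm.toLinearMap,
    fun i m hm => ?_⟩
  have : e.symm m = DirectSum.lof S ι (fun i => A i) i ⟨m, hm⟩ := by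
    rw [LinearEquiv.symm_apply_eq]
    exact (DirectSum.coeLinearMap_lof A i ⟨m, hm⟩).symm
  rw [LinearMap.comp_apply, LinearEquiv.coe_coe, this, DirectSum.toModule_lof]
  rfl

/-- Linearity of the operation in the map is what allows it to be iterated over several arguments,
as in `exists_trilinear_twist`. -/
theorem exists_twist (hA : DirectSum.IsInternal A) (E : ι → N →ₗ[S] N) :
    ∃ T : (M →ₗ[S] N) →ₗ[S] (M →ₗ[S] N), ∀ F i, ∀ m ∈ A i, T F m = E i (F m) := by
  choose T hT using fun F : M →ₗ[S] N => exists_linearMap_of_isInternal hA fun i => E i ∘ₗ F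
  refine ⟨⟨⟨T, fun F G => ?_⟩, fun r F => ?_⟩, hT⟩
  · refine linearMap_ext_of_isInternal hA fun i m hm => ?_
    rw [LinearMap.add_apply, hT _ i m hm, hT _ i m hm, hT _ i m hm]
    simp
  · refine linearMap_ext_of_isInternal hA fun i m hm => ?_
    simp only [RingHom.id_apply, LinearMap.smul_apply]
    rw [hT _ i m hm, hT _ i m hm]
    simp

/-- Formulas with an associator are stated for homogeneous elements, with a scalar depending on
three degrees jointly. This extends them to trilinear maps on the whole modules. -/
theorem exists_trilinear_twist (hA : DirectSum.IsInternal A) (hB : DirectSum.IsInternal B)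
    (hC : DirectSum.IsInternal C) (c : ι → κ → μ → S) (F : M →ₗ[S] N →ₗ[S] P →ₗ[S] Q) :
    ∃ G : M →ₗ[S] N →ₗ[S] P →ₗ[S] Q, ∀ i j k, ∀ m ∈ A i, ∀ n ∈ B j, ∀ p ∈ C k,
      G m n p = c i j k • F m n p := by
  choose T₁ h₁ using fun i j => exists_twist hC fun k => c i j k • (LinearMap.id : Q →ₗ[S] Q)
  choose T₂ h₂ using fun i => exists_twist hB (T₁ i)
  obtain ⟨T₃, h₃⟩ := exists_twist hA T₂
  refine ⟨T₃ F, fun i j k m hm n hn p hp => ?_⟩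
  rw [h₃ _ i m hm, h₂ i _ j n hn, h₁ i j _ k p hp]
  rfl

/-- The projection to one component kills the generators in all the others. -/
theorem le_span_of_isInternal (hA : DirectSum.IsInternal A) (X : ι → Set M)
    (hX : ∀ i, X i ⊆ A i) (h : Submodule.span S (⋃ i, X i) = ⊤) (i : ι) :
    A i ≤ Submodule.span S (X i) := by
  obtain ⟨π, hπ⟩ := exists_linearMap_of_isInternal hA
    fun j => if j = i then (LinearMap.id : M →ₗ[S] M) else 0
  intro m hm
  have key (x : M) (hx : x ∈ Submodule.span S (⋃ i, X i)) : π x ∈ Submodule.span S (X i) := by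
    induction hx using Submodule.span_induction with
    | mem x hx =>
      obtain ⟨j, hx⟩ := Set.mem_iUnion.mp hx
      rw [hπ j x (hX j hx)]
      split_ifs with hj
      · subst hj; exact Submodule.subset_span hx
      · exact Submodule.zero_mem _
    | zero => rw [map_zero]; exact Submodule.zero_mem _
    | add x y _ _ hx hy => rw [map_add]; exact Submodule.add_mem _ hx hy
    | smul r x _ hx => rw [map_smul]; exact Submodule.smul_mem _ r hx
  have := key m (by rw [h]; trivial)
  rwa [hπ i m hm, if_pos rfl] at this

end Internal

variable {n : ℕ}

theorem arc_linearMap_ext {P : Type*} [AddCommGroup P] [Module R P] {F G : Arc n →ₗ[R] P}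
    (h : ∀ (a b : Obj) (f : Hom a b), ∀ x ∈ arcGr f.grade, F x = G x) : F = G := by
  refine Finsupp.lhom_ext fun x r => ?_
  exact h _ _ _ _ (single_mem_arcGr x r)

open Classical in
theorem IsComplex.linearMap_ext {M : PreComplex.{u} n} (hM : IsComplex M) {P : Type*}
    [AddCommGroup P] [Module R P] {F G : M.carrier →ₗ[R] P}
    (h : ∀ (k : ℤ) (a b : Obj) (f : Hom a b), ∀ m ∈ M.gr k f.grade, F m = G m) : F = G :=
  linearMap_ext_of_isInternal hM.internal fun ⟨k, a, b, f⟩ m hm => h k a b f m hm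

/-! ### The associator as a function of three degrees -/

/-- A morphism with its source replaced by an equal one. -/
def Hom.castSource {a a' b : Obj} (h : a = a') (f : Hom a' b) : Hom a b := h.symm.rec f

open Classical in
/-- The associator, extended by zero to degrees which cannot be composed. -/
noncomputable def scal (f g h : Grade) : R :=
  if H : f.2.1 = g.1 ∧ g.2.1 = h.1 then
    ((assoc f.2.2 (g.2.2.castSource H.1) (h.2.2.castSource H.2) : Rˣ) : R)
  else 0

theorem scal_grade {a b c d : Obj} (f : Hom a b) (g : Hom b c) (h : Hom c d) :
    scal f.grade g.grade h.grade = assoc f g h := dif_pos ⟨rfl, rfl⟩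

theorem scal_of_ne_left {a b b' c : Obj} {f : Hom a b} {g : Hom b' c} (hb : b ≠ b') (h : Grade) :
    scal f.grade g.grade h = 0 := dif_neg fun H => hb H.1

theorem scal_of_ne_right {b c c' d : Obj} {g : Hom b c} {h : Hom c' d} (hc : c ≠ c') (f : Grade) :
    scal f g.grade h.grade = 0 := dif_neg fun H => hc H.2

/-! ### Maps from tensor products -/

namespace IsTensorVia
variable {M : PreComplex.{u} n} {N : PreComplex.{v} n} {T : PreComplex.{w} n}
  {θ : M.carrier →ₗ[R] N.carrier →ₗ[R] T.carrier}

theorem eq_zero_of_ne (hθ : IsTensorVia M N T θ) {k l : ℤ} {a b b' c : Obj} {f : Hom a b}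
    {g : Hom b' c} {m : M.carrier} {p : N.carrier} (hb : b ≠ b') (hm : m ∈ M.gr k f.grade)
    (hp : p ∈ N.gr l g.grade) : θ m p = 0 := by
  have h : m ⊗ₜ[R] p ∈ LinearMap.ker (TensorProduct.lift θ) := by
    rw [hθ.ker_eq]
    exact Submodule.subset_span (.inl ⟨k, l, a, b, b', c, f, g, m, hm, p, hp, hb, rfl⟩)
  rwa [LinearMap.mem_ker, TensorProduct.lift.tmul] at h

theorem ract_left (hθ : IsTensorVia M N T θ) {k l : ℤ} {a b c d : Obj} {f : Hom a b} {g : Hom b c}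
    {h : Hom c d} {m : M.carrier} {x : Arc n} {p : N.carrier} (hm : m ∈ M.gr k f.grade)
    (hx : x ∈ arcGr g.grade) (hp : p ∈ N.gr l h.grade) :
    θ (M.ract m x) p = (assoc f g h : R) • θ m (N.lact x p) := by
  have h' : M.ract m x ⊗ₜ[R] p - (assoc f g h : R) • (m ⊗ₜ[R] N.lact x p) ∈
      LinearMap.ker (TensorProduct.lift θ) := by
    rw [hθ.ker_eq]
    exact Submodule.subset_span
      (.inr ⟨k, l, a, b, c, d, f, g, h, m, hm, x, hx, p, hp, rfl⟩)
  rwa [LinearMap.mem_ker, map_sub, map_smul, TensorProduct.lift.tmul, TensorProduct.lift.tmul,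
    sub_eq_zero] at h'

/-- The universal property of the tensor product over `H^n`: the kernel of the structure map is
generated by the two kinds of relations, on which `G` vanishes by assumption. -/
theorem exists_lift (hθ : IsTensorVia M N T θ) {P : Type*} [AddCommGroup P] [Module R P]
    (G : M.carrier →ₗ[R] N.carrier →ₗ[R] P)
    (h₁ : ∀ (k l : ℤ) (a b b' c : Obj) (f : Hom a b) (g : Hom b' c), ∀ m ∈ M.gr k f.grade,
      ∀ p ∈ N.gr l g.grade, b ≠ b' → G m p = 0)
    (h₂ : ∀ (k l : ℤ) (a b c d : Obj) (f : Hom a b) (g : Hom b c) (h : Hom c d),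
      ∀ m ∈ M.gr k f.grade, ∀ x ∈ arcGr g.grade, ∀ p ∈ N.gr l h.grade,
        G (M.ract m x) p = (assoc f g h : R) • G m (N.lact x p)) :
    ∃ J : T.carrier →ₗ[R] P, ∀ m p, J (θ m p) = G m p := by
  have hle : LinearMap.ker (TensorProduct.lift θ) ≤ LinearMap.ker (TensorProduct.lift G) := by
    rw [hθ.ker_eq, tensorRelations, Submodule.span_le]
    rintro t (⟨k, l, a, b, b', c, f, g, m, hm, p, hp, hb, rfl⟩ |
      ⟨k, l, a, b, c, d, f, g, h, m, hm, x, hx, p, hp, rfl⟩)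
    · simpa using h₁ k l a b b' c f g m hm p hp hb
    · simpa [sub_eq_zero] using h₂ k l a b c d f g h m hm x hx p hp
  refine ⟨(LinearMap.ker (TensorProduct.lift θ)).liftQ (TensorProduct.lift G) hle ∘ₗ
    ((TensorProduct.lift θ).quotKerEquivOfSurjective hθ.surjective).symm.toLinearMap,
    fun m p => ?_⟩
  have : ((TensorProduct.lift θ).quotKerEquivOfSurjective hθ.surjective).symm (θ m p) =
      Submodule.Quotient.mk (m ⊗ₜ[R] p) := by
    rw [LinearEquiv.symm_apply_eq]; simp
  rw [LinearMap.comp_apply, LinearEquiv.coe_coe, this, Submodule.liftQ_apply,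
    TensorProduct.lift.tmul]

/-- A homogeneous component is spanned by the classes of homogeneous tensors. -/
theorem gr_le (hM : IsComplex M) (hN : IsComplex N) (hT : IsComplex T) (hθ : IsTensorVia M N T θ)
    (Q : Submodule R T.carrier) {k : ℤ} {g : Grade}
    (h : ∀ (k₁ k₂ : ℤ) (a b c : Obj) (f₁ : Hom a b) (f₂ : Hom b c), ∀ m ∈ M.gr k₁ f₁.grade,
      ∀ p ∈ N.gr k₂ f₂.grade, k₁ + k₂ = k → (f₁.comp f₂).grade = g → θ m p ∈ Q) :
    T.gr k g ≤ Q := by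
  classical
  let X (i : ℤ × Grade) : Set T.carrier := {t | ∃ (k₁ k₂ : ℤ) (a b c : Obj) (f₁ : Hom a b)
    (f₂ : Hom b c), ∃ m ∈ M.gr k₁ f₁.grade, ∃ p ∈ N.gr k₂ f₂.grade,
      (k₁ + k₂, (f₁.comp f₂).grade) = i ∧ t = θ m p}
  have hX (i) : X i ⊆ T.gr i.1 i.2 := by
    rintro t ⟨k₁, k₂, a, b, c, f₁, f₂, m, hm, p, hp, rfl, rfl⟩
    exact hθ.mem hm hp
  have hspan : Submodule.span R (⋃ i, X i) = ⊤ := by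
    have hq : (Submodule.mkQ (Submodule.span R (⋃ i, X i))) ∘ₗ TensorProduct.lift θ = 0 := by
      refine TensorProduct.ext ?_
      refine hM.linearMap_ext fun k a b f m hm => hN.linearMap_ext fun l b' c g p hp => ?_
      simp only [LinearMap.comp_apply, TensorProduct.mk_apply,
        TensorProduct.lift.tmul, LinearMap.zero_apply,
        Submodule.mkQ_apply, Submodule.Quotient.mk_eq_zero, LinearMap.compr₂ₛₗ_apply]
      by_cases hb : b = b'
      · subst hb
        exact Submodule.subset_span (Set.mem_iUnion.mpr
          ⟨_, k, l, a, b, c, f, g, m, hm, p, hp, rfl, rfl⟩)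
      · rw [hθ.eq_zero_of_ne hb hm hp]; exact Submodule.zero_mem _
    rw [eq_top_iff]
    intro t _
    obtain ⟨t, rfl⟩ := hθ.surjective t
    have := LinearMap.congr_fun hq t
    rwa [LinearMap.comp_apply, Submodule.mkQ_apply, LinearMap.zero_apply,
      Submodule.Quotient.mk_eq_zero] at this
  refine (le_span_of_isInternal hT.internal X hX hspan (k, g)).trans (Submodule.span_le.mpr ?_)
  rintro t ⟨k₁, k₂, a, b, c, f₁, f₂, m, hm, p, hp, e, rfl⟩
  exact h k₁ k₂ a b c f₁ f₂ m hm p hp (congrArg Prod.fst e) (congrArg Prod.snd e)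

theorem linearMap_ext (hM : IsComplex M) (hN : IsComplex N) (hθ : IsTensorVia M N T θ)
    {P : Type*} [AddCommGroup P] [Module R P] {F G : T.carrier →ₗ[R] P}
    (h : ∀ (k₁ k₂ : ℤ) (a b c : Obj) (f₁ : Hom a b) (f₂ : Hom b c), ∀ m ∈ M.gr k₁ f₁.grade,
      ∀ p ∈ N.gr k₂ f₂.grade, F (θ m p) = G (θ m p)) : F = G := by
  have : F ∘ₗ TensorProduct.lift θ = G ∘ₗ TensorProduct.lift θ := by
    refine TensorProduct.ext ?_
    refine hM.linearMap_ext fun k a b f m hm => hN.linearMap_ext fun l b' c g p hp => ?_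
    simp only [LinearMap.comp_apply, TensorProduct.mk_apply,
      TensorProduct.lift.tmul, LinearMap.compr₂ₛₗ_apply]
    by_cases hb : b = b'
    · subst hb; exact h k l a b c f g m hm p hp
    · rw [hθ.eq_zero_of_ne hb hm hp, map_zero, map_zero]
  refine LinearMap.ext fun t => ?_
  obtain ⟨t, rfl⟩ := hθ.surjective t
  exact LinearMap.congr_fun this t

/-- The map `f ⊗ id`. -/
theorem exists_map (hM : IsComplex M) (hN : IsComplex N) (hT : IsComplex T)
    (hθ : IsTensorVia M N T θ) {r : ℤ} {f : M.carrier →ₗ[R] M.carrier}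
    (hf : IsHom (M := M) (N := M) r f) :
    ∃ F : T.carrier →ₗ[R] T.carrier, IsHom (M := T) (N := T) r F ∧
      ∀ m p, F (θ m p) = θ (f m) p := by
  obtain ⟨F, hF⟩ := hθ.exists_lift (θ ∘ₗ f)
    (fun k l a b b' c f' g m hm p hp hb => hθ.eq_zero_of_ne hb (hf.map_mem hm) hp)
    (fun k l a b c d f' g h m hm x hx p hp => by
      rw [LinearMap.comp_apply, LinearMap.comp_apply, hf.map_ract,
        hθ.ract_left (hf.map_mem hm) hx hp])
  have hF (m p) : F (θ m p) = θ (f m) p := hF m p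
  refine ⟨F, ⟨fun {k g t} ht => ?_, fun x t => ?_, fun t x => ?_⟩, hF⟩
  · refine gr_le hM hN hT hθ ((T.gr (k + r) g).comap F) ?_ ht
    rintro k₁ k₂ a b c f₁ f₂ m hm p hp rfl rfl
    rw [Submodule.mem_comap, hF, add_right_comm]
    exact hθ.mem (hf.map_mem hm) hp
  · have : T.lact.compr₂ F = T.lact.compl₂ F := by
      refine arc_linearMap_ext fun a b g x hx => hθ.linearMap_ext hM hN ?_
      intro k₁ k₂ b' c d f₁ f₂ m hm p hp
      simp only [LinearMap.compr₂_apply, LinearMap.compl₂_apply]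
      by_cases hb : b = b'
      · subst hb
        rw [hθ.lact hx hm hp, map_smul, hF, hF, hf.map_lact, hθ.lact hx (hf.map_mem hm) hp]
      · rw [hF, hT.lact_eq_zero hb hx (hθ.mem hm hp),
          hT.lact_eq_zero hb hx (hθ.mem (hf.map_mem hm) hp), map_zero]
    exact LinearMap.congr_fun₂ this x t
  · have : T.ract.compr₂ F = T.ract ∘ₗ F := by
      refine hθ.linearMap_ext hM hN fun k₁ k₂ a b c f₁ f₂ m hm p hp => ?_
      refine arc_linearMap_ext fun c' d g x hx => ?_
      simp only [LinearMap.compr₂_apply, LinearMap.comp_apply]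
      by_cases hc : c = c'
      · subst hc
        rw [hθ.ract hm hp hx, map_smul, hF, hF, hθ.ract (hf.map_mem hm) hp hx]
      · rw [hF, hT.ract_eq_zero hc (hθ.mem hm hp) hx,
          hT.ract_eq_zero hc (hθ.mem (hf.map_mem hm) hp) hx, map_zero]
    exact LinearMap.congr_fun₂ this t x

end IsTensorVia

/-! ### Chain maps which vanish after tensoring with an invertible complex -/

/-- A map `φ : N ⊗ M → H^n` together with the tensor product `M ⊗ N`. -/
structure TensorPair (M N T T' : PreComplex.{u} n)
    (θ : N.carrier →ₗ[R] M.carrier →ₗ[R] T.carrier)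
    (θ' : M.carrier →ₗ[R] N.carrier →ₗ[R] T'.carrier) (φ : T.carrier →ₗ[R] Arc n) : Prop where
  left : IsComplex M
  right : IsComplex N
  tensor : IsComplex T
  tensor' : IsComplex T'
  via : IsTensorVia N M T θ
  via' : IsTensorVia M N T' θ'
  chainMap : IsChainMap (M := T) (N := arcComplex n) φ

namespace TensorPair
variable {M N T T' : PreComplex.{u} n} {θ : N.carrier →ₗ[R] M.carrier →ₗ[R] T.carrier}
  {θ' : M.carrier →ₗ[R] N.carrier →ₗ[R] T'.carrier} {φ : T.carrier →ₗ[R] Arc n}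

theorem apply_mem (D : TensorPair M N T T' θ θ' φ) {g : Grade} {t : T.carrier} (ht : t ∈ T.gr 0 g) :
    φ t ∈ arcGr g := by
  have := D.chainMap.map_mem ht
  rwa [zero_add, arcComplex_gr_zero] at this

theorem apply_eq_zero (D : TensorPair M N T T' θ θ' φ) {k : ℤ} (hk : k ≠ 0) {g : Grade} {t : T.carrier}
    (ht : t ∈ T.gr k g) : φ t = 0 := by
  have := D.chainMap.map_mem ht
  rw [add_zero, arcComplex_gr_of_ne hk] at this
  exact (Submodule.mem_bot R).mp this

theorem apply_d (D : TensorPair M N T T' θ θ' φ) (t : T.carrier) : φ (T.d t) = 0 := D.chainMap.map_d t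

/-- `J(m ⊗ n, m') = α(m, n, m') m φ(n ⊗ m')`. -/
def IsContraction (_ : TensorPair M N T T' θ θ' φ)
    (J : T'.carrier →ₗ[R] M.carrier →ₗ[R] M.carrier) : Prop :=
  ∀ {k l l' : ℤ} {f g h : Grade} {m : M.carrier} {p : N.carrier} {m' : M.carrier}, m ∈ M.gr k f →
    p ∈ N.gr l g → m' ∈ M.gr l' h → J (θ' m p) m' = scal f g h • M.ract m (φ (θ p m'))

/-- This is the composite `(M ⊗ N) ⊗ M ≅ M ⊗ (N ⊗ M) → M ⊗ H^n ≅ M` without the triple tensor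
product. That it respects the relations of `M ⊗ N` is the cocycle identity for the degrees of `m`,
`y`, `p` and `m'`. -/
theorem exists_isContraction (D : TensorPair M N T T' θ θ' φ) : ∃ J, D.IsContraction J := by
  classical
  let F : M.carrier →ₗ[R] N.carrier →ₗ[R] M.carrier →ₗ[R] M.carrier :=
    LinearMap.mk₂ R (fun m p => M.ract m ∘ₗ φ ∘ₗ θ p)
      (fun m m' p => by ext; simp) (fun c m p => by ext; simp)
      (fun m p p' => by ext; simp) (fun c m p => by ext; simp)
  obtain ⟨G, hG⟩ := exists_trilinear_twist D.left.internal D.right.internal D.left.internal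
    (fun i j k => scal i.2 j.2 k.2) F
  have hG {k l l' : ℤ} {f g h : Grade} {m : M.carrier} {p : N.carrier} {m' : M.carrier}
      (hm : m ∈ M.gr k f) (hp : p ∈ N.gr l g) (hm' : m' ∈ M.gr l' h) :
      G m p m' = scal f g h • M.ract m (φ (θ p m')) :=
    hG (k, f) (l, g) (l', h) m hm p hp m' hm'
  obtain ⟨J, hJ⟩ := D.via'.exists_lift G (fun k l a b b' c f g m hm p hp hb =>
    D.left.linearMap_ext fun l' c' d h m' hm' => by
      rw [hG hm hp hm', scal_of_ne_left hb, zero_smul, LinearMap.zero_apply])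
    (fun k l a b c d f x g m hm y hy p hp => D.left.linearMap_ext fun l' d' e h m' hm' => by
      rw [LinearMap.smul_apply, hG (D.left.ract_mem hm hy) hp hm',
        hG hm (D.right.lact_mem hy hp) hm']
      by_cases hd : d = d'
      · subst hd
        rw [scal_grade, scal_grade]
        have e₁ := D.via.lact hy hp hm'
        have e₂ : φ (T.lact y (θ p m')) = mul y (φ (θ p m')) := D.chainMap.map_lact _ _
        have e₃ : φ (θ (N.lact y p) m') = (assoc x g h : R) • mul y (φ (θ p m')) := by
          rw [← e₂, e₁, map_smul, smul_smul, Units.mul_inv, one_smul]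
        rw [e₃, map_smul]
        have e₄ : M.ract (M.ract m y) (φ (θ p m')) =
            (assoc f x (g.comp h) : R) • M.ract m (mul y (φ (θ p m'))) := by
          -- `H^n` is concentrated in homological degree `0`, so `φ` vanishes in all other degrees.
          -- In degree `0` its value is homogeneous, and associativity of the right action applies.
          have hmem := D.via.mem hp hm'
          by_cases hl : l + l' = 0
          · rw [hl] at hmem
            exact D.left.ract_ract hm hy (D.apply_mem hmem)
          · rw [D.apply_eq_zero hl hmem]; simp
        rw [e₄, smul_smul, smul_smul, smul_smul, ← Units.val_mul, ← Units.val_mul, ← Units.val_mul,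
          assoc_pentagon]
      · rw [scal_of_ne_right hd, scal_of_ne_right hd]; simp)
  exact ⟨J, fun hm hp hm' => by rw [hJ, hG hm hp hm']⟩

variable {D : TensorPair M N T T' θ θ' φ} {J : T'.carrier →ₗ[R] M.carrier →ₗ[R] M.carrier}

namespace IsContraction

theorem apply_grade (hJ : D.IsContraction J) {k l l' : ℤ} {a b c d : Obj} {f : Hom a b} {g : Hom b c}
    {h : Hom c d} {m : M.carrier} {p : N.carrier} {m' : M.carrier} (hm : m ∈ M.gr k f.grade)
    (hp : p ∈ N.gr l g.grade) (hm' : m' ∈ M.gr l' h.grade) :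
    J (θ' m p) m' = (assoc f g h : R) • M.ract m (φ (θ p m')) := by
  rw [hJ hm hp hm', scal_grade]

/-- As for the other properties of `J`, it suffices to take for `t` the class of a homogeneous
tensor, by `IsTensorVia.gr_le`. -/
theorem mem (hJ : D.IsContraction J) {k l : ℤ} {a b c : Obj} {f : Hom a b} {g : Hom b c}
    {t : T'.carrier} {m : M.carrier} (ht : t ∈ T'.gr k f.grade) (hm : m ∈ M.gr l g.grade) :
    J t m ∈ M.gr (k + l) (f.comp g).grade := by
  refine D.via'.gr_le D.left D.right D.tensor'
    ((M.gr (k + l) (f.comp g).grade).comap (J.flip m)) ?_ ht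
  intro k₁ k₂ a' b' c' f₁ f₂ m' hm' p hp hk e
  subst hk
  cases e
  rw [Submodule.mem_comap, LinearMap.flip_apply, hJ.apply_grade hm' hp hm, Hom.comp_assoc]
  refine Submodule.smul_mem _ _ ?_
  have hmem := D.via.mem hp hm
  by_cases hl : k₂ + l = 0
  · rw [hl] at hmem
    rw [add_assoc, hl, add_zero]
    exact D.left.ract_mem hm' (D.apply_mem hmem)
  · rw [D.apply_eq_zero hl hmem, map_zero]; exact Submodule.zero_mem _

theorem lact (hJ : D.IsContraction J) {k l : ℤ} {a b c d : Obj} {f : Hom a b} {g : Hom b c}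
    {h : Hom c d} {x : Arc n} {t : T'.carrier} {m : M.carrier} (hx : x ∈ arcGr f.grade)
    (ht : t ∈ T'.gr k g.grade) (hm : m ∈ M.gr l h.grade) :
    J (T'.lact x t) m = (assoc f g h : R) • M.lact x (J t m) := by
  refine D.via'.gr_le D.left D.right D.tensor' (LinearMap.eqLocus (J.flip m ∘ₗ T'.lact x)
    ((assoc f g h : R) • M.lact x ∘ₗ J.flip m)) ?_ ht
  intro k₁ k₂ a' b' c' f₁ f₂ m' hm' p hp hk e
  subst hk
  cases e
  simp only [LinearMap.mem_eqLocus, LinearMap.comp_apply, LinearMap.flip_apply, LinearMap.smul_apply]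
  rw [D.via'.lact hx hm' hp, map_smul, LinearMap.smul_apply,
    hJ.apply_grade (D.left.lact_mem hx hm') hp hm, hJ.apply_grade hm' hp hm, map_smul]
  have e : M.ract (M.lact x m') (φ (θ p m)) =
      (assoc f f₁ (f₂.comp h) : R) • M.lact x (M.ract m' (φ (θ p m))) := by
    have hmem := D.via.mem hp hm
    by_cases hl : k₂ + l = 0
    · rw [hl] at hmem
      exact D.left.ract_lact hx hm' (D.apply_mem hmem)
    · rw [D.apply_eq_zero hl hmem]; simp
  rw [e]
  simp only [smul_smul, ← Units.val_mul]
  have P := assoc_pentagon f f₁ f₂ h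
  rw [← P, mul_assoc, inv_mul_cancel_left]

theorem middle (hJ : D.IsContraction J) {k l : ℤ} {a b c d : Obj} {f : Hom a b} {g : Hom b c}
    {h : Hom c d} {t : T'.carrier} {x : Arc n} {m : M.carrier} (ht : t ∈ T'.gr k f.grade)
    (hx : x ∈ arcGr g.grade) (hm : m ∈ M.gr l h.grade) :
    J (T'.ract t x) m = (assoc f g h : R) • J t (M.lact x m) := by
  refine D.via'.gr_le D.left D.right D.tensor' (LinearMap.eqLocus (J.flip m ∘ₗ T'.ract.flip x)
    ((assoc f g h : R) • J.flip (M.lact x m))) ?_ ht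
  intro k₁ k₂ a' b' c' f₁ f₂ m' hm' p hp hk e
  subst hk
  cases e
  simp only [LinearMap.mem_eqLocus, LinearMap.comp_apply, LinearMap.flip_apply, LinearMap.smul_apply]
  rw [D.via'.ract hm' hp hx, map_smul, LinearMap.smul_apply,
    hJ.apply_grade hm' (D.right.ract_mem hp hx) hm, hJ.apply_grade hm' hp (D.left.lact_mem hx hm),
    D.via.ract_left hp hx hm, map_smul, map_smul]
  simp only [smul_smul, ← Units.val_mul]
  rw [← mul_assoc, assoc_pentagon]

theorem ract (hJ : D.IsContraction J) {k l : ℤ} {a b c d : Obj} {f : Hom a b} {g : Hom b c}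
    {h : Hom c d} {t : T'.carrier} {m : M.carrier} {x : Arc n} (ht : t ∈ T'.gr k f.grade)
    (hm : m ∈ M.gr l g.grade) (hx : x ∈ arcGr h.grade) :
    M.ract (J t m) x = (assoc f g h : R) • J t (M.ract m x) := by
  refine D.via'.gr_le D.left D.right D.tensor' (LinearMap.eqLocus (M.ract.flip x ∘ₗ J.flip m)
    ((assoc f g h : R) • J.flip (M.ract m x))) ?_ ht
  intro k₁ k₂ a' b' c' f₁ f₂ m' hm' p hp hk e
  subst hk
  cases e
  simp only [LinearMap.mem_eqLocus, LinearMap.comp_apply, LinearMap.flip_apply, LinearMap.smul_apply]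
  rw [hJ.apply_grade hm' hp hm, hJ.apply_grade hm' hp (D.left.ract_mem hm hx), map_smul,
    LinearMap.smul_apply]
  have e₂ : φ (T.ract (θ p m) x) = mul (φ (θ p m)) x := D.chainMap.map_ract _ _
  rw [D.via.ract hp hm hx, map_smul] at e₂
  have e : M.ract (M.ract m' (φ (θ p m))) x =
      (assoc f₁ (f₂.comp g) h : R) • M.ract m' (mul (φ (θ p m)) x) := by
    have hmem := D.via.mem hp hm
    by_cases hl : k₂ + l = 0
    · rw [hl] at hmem
      exact D.left.ract_ract hm' (D.apply_mem hmem) hx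
    · rw [D.apply_eq_zero hl hmem]; simp
  rw [e, ← e₂, map_smul]
  simp only [smul_smul, ← Units.val_mul]
  rw [← mul_assoc, assoc_pentagon]

/-- `φ` is a chain map to a complex with zero differential, so it kills boundaries. The two terms in
which the differential falls on `p` or on `m` therefore cancel after applying `φ`. -/
theorem d (hJ : D.IsContraction J) {k l : ℤ} {f g : Grade} {t : T'.carrier} {m : M.carrier}
    (ht : t ∈ T'.gr k f) (hm : m ∈ M.gr l g) :
    M.d (J t m) = J (T'.d t) m + ((k.negOnePow : ℤˣ) : ℤ) • J t (M.d m) := by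
  refine D.via'.gr_le D.left D.right D.tensor' (LinearMap.eqLocus (M.d ∘ₗ J.flip m)
    (J.flip m ∘ₗ T'.d + ((k.negOnePow : ℤˣ) : ℤ) • J.flip (M.d m))) ?_ ht
  rintro k₁ k₂ a' b' c' f₁ f₂ m' hm' p hp rfl -
  simp only [LinearMap.mem_eqLocus, LinearMap.comp_apply, LinearMap.flip_apply, LinearMap.smul_apply,
    LinearMap.add_apply]
  have e₁ := D.apply_d (θ p m)
  rw [D.via.d hp hm, map_add, map_zsmul] at e₁
  rw [D.via'.d hm' hp, map_add, map_zsmul, LinearMap.add_apply, LinearMap.smul_apply,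
    hJ hm' hp hm, hJ (D.left.d_mem hm') hp hm, hJ hm' (D.right.d_mem hp) hm,
    hJ hm' hp (D.left.d_mem hm), map_smul, D.left.d_ract, add_assoc, Int.negOnePow_add,
    Units.val_mul, mul_smul, ← smul_add, ← smul_comm (scal _ _ _), ← smul_add, ← map_zsmul,
    ← map_add, e₁]
  simp

end IsContraction
end TensorPair

namespace TensorPair
variable {M N T T' : PreComplex.{u} n} {θ : N.carrier →ₗ[R] M.carrier →ₗ[R] T.carrier}
  {θ' : M.carrier →ₗ[R] N.carrier →ₗ[R] T'.carrier} {φ : T.carrier →ₗ[R] Arc n}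
  {J : T'.carrier →ₗ[R] M.carrier →ₗ[R] M.carrier} {K : T'.carrier →ₗ[R] T'.carrier}
  {W : T.carrier →ₗ[R] M.carrier →ₗ[R] M.carrier}

/-- The cocycle identity solved for the quotients of associators which occur in the properties of
the twisted contraction. -/
theorem pentagon_solve {G : Type*} [Group G] {a b c d e : G} (h : a * b * c = d * e) :
    d⁻¹ * (a * b) = e * c⁻¹ ∧ d⁻¹ * a = e * (c⁻¹ * b⁻¹) ∧ a⁻¹ * d = b * (c * e⁻¹) ∧
      b⁻¹ * (a⁻¹ * d) = c * e⁻¹ := by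
  obtain rfl : e = d⁻¹ * (a * b * c) := by rw [h, inv_mul_cancel_left]
  refine ⟨?_, ?_, ?_, ?_⟩ <;> group

theorem ringInverse_scal {a b c d : Obj} (f : Hom a b) (g : Hom b c) (h : Hom c d) :
    Ring.inverse (scal f.grade g.grade h.grade) = (((assoc f g h)⁻¹ : Rˣ) : R) := by
  rw [scal_grade, Ring.inverse_unit]

/-- `W(n ⊗ m', m) = α(m, n, m')⁻¹ J(K(m ⊗ n), m')`. -/
def IsTwisted (_ : TensorPair M N T T' θ θ' φ) (J : T'.carrier →ₗ[R] M.carrier →ₗ[R] M.carrier)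
    (K : T'.carrier →ₗ[R] T'.carrier) (W : T.carrier →ₗ[R] M.carrier →ₗ[R] M.carrier) : Prop :=
  ∀ {k l l' : ℤ} {f g h : Grade} {m : M.carrier} {p : N.carrier} {m' : M.carrier}, m ∈ M.gr k f →
    p ∈ N.gr l g → m' ∈ M.gr l' h →
      W (θ p m') m = Ring.inverse (scal f g h) • J (K (θ' m p)) m'

/-- This is `K ⊗ id` followed by the contraction, rebracketed so that its argument is an element of
`N ⊗ M`. Then `ψ` can be inserted there. The relations of `N ⊗ M` are respected because `K` is right
linear and `J` is balanced. -/
theorem exists_isTwisted (D : TensorPair M N T T' θ θ' φ)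
    (hJ : D.IsContraction J) (hK : IsHom (M := T') (N := T') 1 K) : ∃ W, D.IsTwisted J K W := by
  classical
  let F : N.carrier →ₗ[R] M.carrier →ₗ[R] M.carrier →ₗ[R] M.carrier :=
    LinearMap.mk₂ R (fun p m' => J.flip m' ∘ₗ K ∘ₗ θ'.flip p)
      (fun m m' p => by ext; simp) (fun c m p => by ext; simp)
      (fun m p p' => by ext; simp) (fun c m p => by ext; simp)
  obtain ⟨G, hG⟩ := exists_trilinear_twist D.right.internal D.left.internal D.left.internal
    (fun j k i => Ring.inverse (scal i.2 j.2 k.2)) F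
  have hG {k l l' : ℤ} {f g h : Grade} {m : M.carrier} {p : N.carrier} {m' : M.carrier}
      (hm : m ∈ M.gr k f) (hp : p ∈ N.gr l g) (hm' : m' ∈ M.gr l' h) :
      G p m' m = Ring.inverse (scal f g h) • J (K (θ' m p)) m' :=
    hG (l, g) (l', h) (k, f) p hp m' hm' m hm
  obtain ⟨W, hW⟩ := D.via.exists_lift G (fun k l a b b' c f g p hp m' hm' hb =>
    D.left.linearMap_ext fun l' c' d h m hm => by
      -- On degrees that cannot be composed `scal` is `0`, and so is its `Ring.inverse`, as required
      -- by the relation for non-composable tensors.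
      rw [hG hm hp hm', scal_of_ne_right hb, Ring.inverse_zero, zero_smul, LinearMap.zero_apply])
    (fun k l a b c d f x h p hp y hy m' hm' => D.left.linearMap_ext fun l' e a' g m hm => by
      rw [LinearMap.smul_apply, hG hm (D.right.ract_mem hp hy) hm',
        hG hm hp (D.left.lact_mem hy hm')]
      by_cases ha : a' = a
      · subst ha
        rw [ringInverse_scal, ringInverse_scal]
        have e₁ := D.via'.ract hm hp hy
        have hmem := hK.map_mem (D.via'.mem hm hp)
        have e₃ := hJ.middle hmem hy hm'
        rw [← hK.map_ract, e₁, map_smul, map_smul, LinearMap.smul_apply] at e₃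
        have e₄ : J (K (θ' m (N.ract p y))) m' =
            (((assoc g f x)⁻¹ * assoc (g.comp f) x h : Rˣ) : R) • J (K (θ' m p)) (M.lact y m') := by
          rw [Units.val_mul, mul_smul, ← e₃, smul_smul, Units.inv_mul, one_smul]
        rw [e₄, smul_smul, smul_smul, ← Units.val_mul, ← Units.val_mul]
        rw [(pentagon_solve (assoc_pentagon g f x h)).2.2.2]
      · rw [scal_of_ne_left ha, scal_of_ne_left ha]; simp)
  exact ⟨W, fun hm hp hm' => by rw [hW, hG hm hp hm']⟩

variable {D : TensorPair M N T T' θ θ' φ}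

namespace IsTwisted

theorem apply_grade (hW : D.IsTwisted J K W) {k l l' : ℤ} {a b c d : Obj} {f : Hom a b} {g : Hom b c}
    {h : Hom c d} {m : M.carrier} {p : N.carrier} {m' : M.carrier} (hm : m ∈ M.gr k f.grade)
    (hp : p ∈ N.gr l g.grade) (hm' : m' ∈ M.gr l' h.grade) :
    W (θ p m') m = (((assoc f g h)⁻¹ : Rˣ) : R) • J (K (θ' m p)) m' := by
  rw [hW hm hp hm', ringInverse_scal]

theorem mem (hW : D.IsTwisted J K W) (hJ : D.IsContraction J) (hK : IsHom (M := T') (N := T') 1 K)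
    {k l : ℤ} {a b c : Obj} {f : Hom a b} {g : Hom b c} {m : M.carrier} {t : T.carrier}
    (hm : m ∈ M.gr k f.grade) (ht : t ∈ T.gr l g.grade) :
    W t m ∈ M.gr (k + l + 1) (f.comp g).grade := by
  refine D.via.gr_le D.right D.left D.tensor
    ((M.gr (k + l + 1) (f.comp g).grade).comap (W.flip m)) ?_ ht
  intro k₁ k₂ a' b' c' f₁ f₂ p hp m' hm' hk e
  subst hk
  cases e
  rw [Submodule.mem_comap, LinearMap.flip_apply, hW.apply_grade hm hp hm', ← Hom.comp_assoc]
  refine Submodule.smul_mem _ _ ?_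
  have := hJ.mem (hK.map_mem (D.via'.mem hm hp)) hm'
  rwa [show k + k₁ + 1 + k₂ = k + (k₁ + k₂) + 1 by ring] at this

theorem lact (hW : D.IsTwisted J K W) (hJ : D.IsContraction J) (hK : IsHom (M := T') (N := T') 1 K)
    {k l : ℤ} {a b c d : Obj} {f : Hom a b} {g : Hom b c} {h : Hom c d} {x : Arc n} {m : M.carrier}
    {t : T.carrier} (hx : x ∈ arcGr f.grade) (hm : m ∈ M.gr k g.grade) (ht : t ∈ T.gr l h.grade) :
    W t (M.lact x m) = (assoc f g h : R) • M.lact x (W t m) := by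
  refine D.via.gr_le D.right D.left D.tensor (LinearMap.eqLocus (W.flip (M.lact x m))
    ((assoc f g h : R) • M.lact x ∘ₗ W.flip m)) ?_ ht
  intro k₁ k₂ a' b' c' f₁ f₂ p hp m' hm' hk e
  subst hk
  cases e
  simp only [LinearMap.mem_eqLocus, LinearMap.comp_apply, LinearMap.flip_apply, LinearMap.smul_apply]
  have e₁ : θ' (M.lact x m) p = (assoc f g f₁ : R) • T'.lact x (θ' m p) := by
    rw [D.via'.lact hx hm hp, smul_smul, Units.mul_inv, one_smul]
  rw [hW.apply_grade (D.left.lact_mem hx hm) hp hm', hW.apply_grade hm hp hm', e₁, map_smul,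
    hK.map_lact, map_smul, LinearMap.smul_apply,
    hJ.lact hx (hK.map_mem (D.via'.mem hm hp)) hm', map_smul]
  simp only [smul_smul, ← Units.val_mul]
  rw [(pentagon_solve (assoc_pentagon f g f₁ f₂)).1]

theorem middle (hW : D.IsTwisted J K W) {k l : ℤ} {a b c d : Obj} {f : Hom a b} {g : Hom b c}
    {h : Hom c d} {m : M.carrier} {x : Arc n} {t : T.carrier} (hm : m ∈ M.gr k f.grade)
    (hx : x ∈ arcGr g.grade) (ht : t ∈ T.gr l h.grade) :
    W t (M.ract m x) = (assoc f g h : R) • W (T.lact x t) m := by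
  refine D.via.gr_le D.right D.left D.tensor (LinearMap.eqLocus (W.flip (M.ract m x))
    ((assoc f g h : R) • W.flip m ∘ₗ T.lact x)) ?_ ht
  intro k₁ k₂ a' b' c' f₁ f₂ p hp m' hm' hk e
  subst hk
  cases e
  simp only [LinearMap.mem_eqLocus, LinearMap.comp_apply, LinearMap.flip_apply, LinearMap.smul_apply]
  rw [hW.apply_grade (D.left.ract_mem hm hx) hp hm', D.via'.ract_left hm hx hp, D.via.lact hx hp hm',
    map_smul, map_smul, map_smul, LinearMap.smul_apply, LinearMap.smul_apply,
    hW.apply_grade hm (D.right.lact_mem hx hp) hm']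
  simp only [smul_smul, ← Units.val_mul]
  rw [(pentagon_solve (assoc_pentagon f g f₁ f₂)).2.1]

theorem ract (hW : D.IsTwisted J K W) (hJ : D.IsContraction J) (hK : IsHom (M := T') (N := T') 1 K)
    {k l : ℤ} {a b c d : Obj} {f : Hom a b} {g : Hom b c} {h : Hom c d} {m : M.carrier}
    {t : T.carrier} {x : Arc n} (hm : m ∈ M.gr k f.grade) (ht : t ∈ T.gr l g.grade)
    (hx : x ∈ arcGr h.grade) :
    M.ract (W t m) x = (assoc f g h : R) • W (T.ract t x) m := by
  refine D.via.gr_le D.right D.left D.tensor (LinearMap.eqLocus (M.ract.flip x ∘ₗ W.flip m)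
    ((assoc f g h : R) • W.flip m ∘ₗ T.ract.flip x)) ?_ ht
  intro k₁ k₂ a' b' c' f₁ f₂ p hp m' hm' hk e
  subst hk
  cases e
  simp only [LinearMap.mem_eqLocus, LinearMap.comp_apply, LinearMap.flip_apply, LinearMap.smul_apply]
  rw [hW.apply_grade hm hp hm', D.via.ract hp hm' hx, map_smul, map_smul, LinearMap.smul_apply,
    LinearMap.smul_apply, hW.apply_grade hm hp (D.left.ract_mem hm' hx),
    hJ.ract (hK.map_mem (D.via'.mem hm hp)) hm' hx]
  simp only [smul_smul, ← Units.val_mul]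
  rw [(pentagon_solve (assoc_pentagon f f₁ f₂ h)).2.2.1]

/-- The Leibniz rule for `J` and the homotopy formula for `h ⊗ id` combine: applied to `θ' m p` and
`m'`, the homotopy `K` bounds the contraction of `h m ⊗ p` with `m'`, which is `h m` acted on by `φ
(θ p m')` up to the associator. -/
theorem d (hW : D.IsTwisted J K W) (hJ : D.IsContraction J) (hK : IsHom (M := T') (N := T') 1 K)
    {h : M.carrier →ₗ[R] M.carrier} (hh : IsHom (M := M) (N := M) 0 h)
    (hd : ∀ m p, θ' (h m) p = T'.d (K (θ' m p)) + K (T'.d (θ' m p)))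
    {k l : ℤ} {a b c : Obj} {f : Hom a b} {g : Hom b c} {m : M.carrier}
    {t : T.carrier} (hm : m ∈ M.gr k f.grade) (ht : t ∈ T.gr l g.grade) :
    M.d (W t m) + W t (M.d m) + ((k.negOnePow : ℤˣ) : ℤ) • W (T.d t) m = M.ract (h m) (φ t) := by
  refine D.via.gr_le D.right D.left D.tensor (LinearMap.eqLocus
    (M.d ∘ₗ W.flip m + W.flip (M.d m) + ((k.negOnePow : ℤˣ) : ℤ) • W.flip m ∘ₗ T.d)
    (M.ract (h m) ∘ₗ φ)) ?_ ht
  intro k₁ k₂ a' b' c' f₁ f₂ p hp m' hm' hk e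
  subst hk
  cases e
  simp only [LinearMap.mem_eqLocus, LinearMap.comp_apply, LinearMap.flip_apply, LinearMap.smul_apply,
    LinearMap.add_apply]
  have hmem := hK.map_mem (D.via'.mem hm hp)
  have e₁ := hJ.apply_grade (hh.map_mem hm) hp hm'
  rw [hd, map_add, LinearMap.add_apply, D.via'.d hm hp, map_add, map_zsmul, map_add,
    map_zsmul, LinearMap.add_apply, LinearMap.smul_apply] at e₁
  have e₂ : M.ract (h m) (φ (θ p m')) = (((assoc f f₁ f₂)⁻¹ : Rˣ) : R) •
      ((assoc f f₁ f₂ : R) • M.ract (h m) (φ (θ p m'))) := by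
    rw [smul_smul, Units.inv_mul, one_smul]
  rw [e₂, ← e₁, D.via.d hp hm', map_add, map_zsmul, LinearMap.add_apply, LinearMap.smul_apply,
    hW.apply_grade hm hp hm', hW.apply_grade (D.left.d_mem hm) hp hm',
    hW.apply_grade hm (D.right.d_mem hp) hm', hW.apply_grade hm hp (D.left.d_mem hm'),
    map_smul, hJ.d hmem hm']
  simp only [smul_add, smul_comm _ (((assoc f f₁ f₂)⁻¹ : Rˣ) : R), Int.negOnePow_add,
    Int.negOnePow_one, Units.val_mul, mul_smul]
  simp
  abel

end IsTwisted
end TensorPair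

namespace TensorPair
variable {M N T T' : PreComplex.{u} n} {θ : N.carrier →ₗ[R] M.carrier →ₗ[R] T.carrier}
  {θ' : M.carrier →ₗ[R] N.carrier →ₗ[R] T'.carrier} {φ : T.carrier →ₗ[R] Arc n}

/-- A chain map `h` is null-homotopic if `h ⊗ id` is null-homotopic on `M ⊗ N`. -/
theorem homotopic_zero (D : TensorPair M N T T' θ θ' φ) {ψ : Arc n →ₗ[R] T.carrier}
    (hψ : IsChainMap (M := arcComplex n) (N := T) ψ) (hφψ : ∀ x, φ (ψ x) = x)
    {h : M.carrier →ₗ[R] M.carrier} (hh : IsHom (M := M) (N := M) 0 h)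
    {K : T'.carrier →ₗ[R] T'.carrier} (hK : IsHom (M := T') (N := T') 1 K)
    (hd : ∀ m p, θ' (h m) p = T'.d (K (θ' m p)) + K (T'.d (θ' m p))) :
    Homotopic (M := M) (N := M) h 0 := by
  classical
  obtain ⟨J, hJ⟩ := D.exists_isContraction
  obtain ⟨W, hW⟩ := D.exists_isTwisted hJ hK
  -- The homotopy on `M` sends `m` to `m ⊗ ψ(1_b)` in `M ⊗ (N ⊗ M)` and applies the twisted
  -- contraction. Dividing by the right unitor makes it linear over `H^n`.
  obtain ⟨Q, hQ⟩ := exists_linearMap_of_isInternal D.left.internal fun i =>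
    (((rightUnitor i.2.2.2)⁻¹ : Rˣ) : R) • W (ψ (unit n i.2.2.1))
  have hQ {k : ℤ} {a b : Obj} {f : Hom a b} {m : M.carrier} (hm : m ∈ M.gr k f.grade) :
      Q m = (((rightUnitor f)⁻¹ : Rˣ) : R) • W (ψ (unit n b)) m := hQ (k, f.grade) m hm
  have hψmem {g : Grade} {x : Arc n} (hx : x ∈ arcGr g) : ψ x ∈ T.gr 0 g := by
    have := hψ.map_mem (k := 0) (g := g) (m := x) (by rwa [arcComplex_gr_zero])
    rwa [zero_add] at this
  have hu (b : Obj) := hψmem (unit_mem_arcGr n b)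
  have hψd (x : Arc n) : T.d (ψ x) = 0 := (hψ.map_d x).symm.trans (map_zero ψ)
  have hQmem {k : ℤ} {a b : Obj} {f : Hom a b} {m : M.carrier} (hm : m ∈ M.gr k f.grade) :
      Q m ∈ M.gr (k + 1) f.grade := by
    have := hW.mem hJ hK hm (hu b)
    rw [add_zero, Hom.comp_id] at this
    rw [hQ hm]
    exact Submodule.smul_mem _ _ this
  refine ⟨Q, ⟨fun {k g m} hm => hQmem (f := g.2.2) hm, fun x m => ?_, fun m x => ?_⟩, fun m => ?_⟩
  · have : M.lact.compr₂ Q = M.lact.compl₂ Q := by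
      refine arc_linearMap_ext fun a b f x hx => D.left.linearMap_ext fun k b' c g m hm => ?_
      simp only [LinearMap.compr₂_apply, LinearMap.compl₂_apply]
      by_cases hb : b = b'
      · subst hb
        rw [hQ (D.left.lact_mem hx hm), hQ hm, hW.lact hJ hK hx hm (hu c), map_smul, smul_smul,
          ← Units.val_mul]
        -- The cocycle identity reduces here to `α(f, g, Id) α(g, Id, Id) = α(g ∘ f, Id, Id)`, so
        -- the right unitors absorb the associator.
        have P := assoc_pentagon f g (Hom.id c) (Hom.id c)
        rw [Hom.comp_id, Hom.id_comp, mul_right_comm, mul_left_inj] at P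
        rw [rightUnitor, rightUnitor, ← P, mul_inv_rev, inv_mul_cancel_right]
      · rw [D.left.lact_eq_zero hb hx hm, D.left.lact_eq_zero hb hx (hQmem hm), map_zero]
    exact LinearMap.congr_fun₂ this x m
  · have : M.ract.compr₂ Q = M.ract ∘ₗ Q := by
      refine D.left.linearMap_ext fun k a b f m hm => arc_linearMap_ext fun b' c g x hx => ?_
      simp only [LinearMap.compr₂_apply, LinearMap.comp_apply]
      by_cases hb : b = b'
      · subst hb
        have e₁ : T.lact x (ψ (unit n c)) = (assoc g (Hom.id c) (Hom.id c) : R) • ψ x := by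
          rw [← map_smul, ← mul_unit hx]; exact (hψ.map_lact _ _).symm
        have e₂ : T.ract (ψ (unit n b)) x = ψ x := by
          refine (hψ.map_ract _ _).symm.trans (congrArg ψ (unit_mul hx))
        rw [hQ (D.left.ract_mem hm hx), hQ hm, hW.middle hm hx (hu c), e₁, map_smul,
          LinearMap.smul_apply, map_smul, LinearMap.smul_apply, hW.ract hJ hK hm (hu b) hx, e₂]
        simp only [smul_smul, ← Units.val_mul]
        have P := assoc_pentagon f g (Hom.id c) (Hom.id c)
        -- In the same way for the right action, with `assoc_id_middle` for the identity in the
        -- middle, where `ψ(1_b)` has been inserted.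
        rw [Hom.comp_id, Hom.id_comp, mul_right_comm, mul_left_inj] at P
        rw [assoc_id_middle f g, rightUnitor, rightUnitor, ← P, inv_mul_cancel]
        simp
      · rw [D.left.ract_eq_zero hb hm hx, D.left.ract_eq_zero hb (hQmem hm) hx, map_zero]
    exact LinearMap.congr_fun₂ this m x
  · rw [LinearMap.zero_apply, sub_zero]
    have : h = M.d ∘ₗ Q + Q ∘ₗ M.d := by
      refine D.left.linearMap_ext fun k a b f m hm => ?_
      -- For `t = ψ(1_b)` one has `T.d t = 0` and `φ t = 1_b`. The formula leaves `h m` acted on by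
      -- `1_b`, which is `h m` times the right unitor.
      have e := hW.d hJ hK hh hd hm (hu b)
      have hhm := hh.map_mem hm
      rw [hψd, map_zero, LinearMap.zero_apply, smul_zero, add_zero, hφψ, D.left.ract_unit hhm] at e
      rw [LinearMap.add_apply, LinearMap.comp_apply, LinearMap.comp_apply, hQ hm,
        hQ (D.left.d_mem hm), map_smul, ← smul_add, e, smul_smul, Units.inv_mul, one_smul]
    exact LinearMap.congr_fun this m

end TensorPair

/-! ### The homotopy category -/

section Homotopy
variable {L M N P : PreComplex.{u} n}

theorem IsHom.comp {M : PreComplex.{u} n} {N : PreComplex.{v} n} {P : PreComplex.{w} n} {r s t : ℤ}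
    {f : M.carrier →ₗ[R] N.carrier} {g : N.carrier →ₗ[R] P.carrier}
    (hg : IsHom (M := N) (N := P) s g) (hf : IsHom (M := M) (N := N) r f) (h : r + s = t) :
    IsHom (M := M) (N := P) t (g ∘ₗ f) where
  map_mem hm := by rw [← h, ← add_assoc]; exact hg.map_mem (hf.map_mem hm)
  map_lact x m := by rw [LinearMap.comp_apply, hf.map_lact, hg.map_lact]; rfl
  map_ract m x := by rw [LinearMap.comp_apply, hf.map_ract, hg.map_ract]; rfl

theorem IsHom.add {M : PreComplex.{u} n} {N : PreComplex.{v} n} {r : ℤ}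
    {f g : M.carrier →ₗ[R] N.carrier} (hf : IsHom (M := M) (N := N) r f)
    (hg : IsHom (M := M) (N := N) r g) : IsHom (M := M) (N := N) r (f + g) where
  map_mem hm := Submodule.add_mem _ (hf.map_mem hm) (hg.map_mem hm)
  map_lact x m := by simp [hf.map_lact, hg.map_lact]
  map_ract m x := by simp [hf.map_ract, hg.map_ract]

theorem IsHom.smul {M : PreComplex.{u} n} {N : PreComplex.{v} n} {r : ℤ} (c : R)
    {f : M.carrier →ₗ[R] N.carrier} (hf : IsHom (M := M) (N := N) r f) :
    IsHom (M := M) (N := N) r (c • f) where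
  map_mem hm := Submodule.smul_mem _ c (hf.map_mem hm)
  map_lact x m := by simp [hf.map_lact]
  map_ract m x := by simp [hf.map_ract]

theorem IsChainMap.comp {M : PreComplex.{u} n} {N : PreComplex.{v} n} {P : PreComplex.{w} n}
    {f : M.carrier →ₗ[R] N.carrier} {g : N.carrier →ₗ[R] P.carrier}
    (hg : IsChainMap (M := N) (N := P) g) (hf : IsChainMap (M := M) (N := N) f) :
    IsChainMap (M := M) (N := P) (g ∘ₗ f) where
  toIsHom := hg.toIsHom.comp hf.toIsHom (add_zero 0)
  map_d m := by rw [LinearMap.comp_apply, hf.map_d, hg.map_d]; rfl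

theorem IsChainMap.smul {M : PreComplex.{u} n} {N : PreComplex.{v} n} (c : R)
    {f : M.carrier →ₗ[R] N.carrier} (hf : IsChainMap (M := M) (N := N) f) :
    IsChainMap (M := M) (N := N) (c • f) where
  toIsHom := hf.toIsHom.smul c
  map_d m := by simp [hf.map_d]

theorem IsChainMap.id (M : PreComplex.{u} n) :
    IsChainMap (M := M) (N := M) (LinearMap.id : M.carrier →ₗ[R] M.carrier) where
  map_mem hm := by rwa [add_zero]
  map_lact _ _ := rfl
  map_ract _ _ := rfl
  map_d _ := rfl

namespace Homotopic
variable {f g h : M.carrier →ₗ[R] N.carrier}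

theorem trans (h₁ : Homotopic (M := M) (N := N) f g) (h₂ : Homotopic (M := M) (N := N) g h) :
    Homotopic (M := M) (N := N) f h := by
  obtain ⟨p, hp, hp'⟩ := h₁
  obtain ⟨q, hq, hq'⟩ := h₂
  refine ⟨p + q, hp.add hq, fun m => ?_⟩
  rw [← sub_add_sub_cancel, hp', hq', LinearMap.add_apply, LinearMap.add_apply, map_add]
  abel

theorem smul (c : R) (h₁ : Homotopic (M := M) (N := N) f g) :
    Homotopic (M := M) (N := N) (c • f) (c • g) := by
  obtain ⟨p, hp, hp'⟩ := h₁
  refine ⟨c • p, hp.smul c, fun m => ?_⟩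
  simp only [LinearMap.smul_apply, ← smul_sub, hp', map_smul, smul_add]

theorem symm (h₁ : Homotopic (M := M) (N := N) f g) : Homotopic (M := M) (N := N) g f := by
  obtain ⟨p, hp, hp'⟩ := h₁
  refine ⟨(-1 : R) • p, hp.smul _, fun m => ?_⟩
  have e : g m - f m = (-1 : R) • (f m - g m) := by simp
  rw [e, hp', smul_add, LinearMap.smul_apply, LinearMap.smul_apply, map_smul]

theorem comp_left {k : N.carrier →ₗ[R] P.carrier} (hk : IsChainMap (M := N) (N := P) k)
    (h₁ : Homotopic (M := M) (N := N) f g) :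
    Homotopic (M := M) (N := P) (k ∘ₗ f) (k ∘ₗ g) := by
  obtain ⟨p, hp, hp'⟩ := h₁
  refine ⟨k ∘ₗ p, hk.toIsHom.comp hp (add_zero 1), fun m => ?_⟩
  simp only [LinearMap.comp_apply, ← map_sub, hp', map_add, hk.map_d]

theorem comp_right {k : L.carrier →ₗ[R] M.carrier} (hk : IsChainMap (M := L) (N := M) k)
    (h₁ : Homotopic (M := M) (N := N) f g) :
    Homotopic (M := L) (N := N) (f ∘ₗ k) (g ∘ₗ k) := by
  obtain ⟨p, hp, hp'⟩ := h₁
  refine ⟨p ∘ₗ k, hp.comp hk.toIsHom (zero_add 1), fun m => ?_⟩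
  simp only [LinearMap.comp_apply, hp', hk.map_d]

end Homotopic
end Homotopy

namespace IsTensorVia
variable {M N T : PreComplex.{u} n} {θ : M.carrier →ₗ[R] N.carrier →ₗ[R] T.carrier}

theorem exists_chainMap (hM : IsComplex M) (hN : IsComplex N) (hT : IsComplex T)
    (hθ : IsTensorVia M N T θ) {f : M.carrier →ₗ[R] M.carrier}
    (hf : IsChainMap (M := M) (N := M) f) :
    ∃ F : T.carrier →ₗ[R] T.carrier, IsChainMap (M := T) (N := T) F ∧
      ∀ m p, F (θ m p) = θ (f m) p := by
  obtain ⟨F, hF, h⟩ := hθ.exists_map hM hN hT hf.toIsHom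
  refine ⟨F, ⟨hF, fun t => ?_⟩, h⟩
  have : F ∘ₗ T.d = T.d ∘ₗ F := by
    refine hθ.linearMap_ext hM hN fun k₁ k₂ a b c f₁ f₂ m hm p hp => ?_
    have hfm := hf.map_mem hm
    rw [add_zero] at hfm
    rw [LinearMap.comp_apply, LinearMap.comp_apply, h, hθ.d hm hp, hθ.d hfm hp, map_add, map_zsmul,
      h, h, hf.map_d]
  exact LinearMap.congr_fun this t

theorem exists_homotopy (hM : IsComplex M) (hN : IsComplex N) (hT : IsComplex T)
    (hθ : IsTensorVia M N T θ) {r s : R}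
    (h : Homotopic (M := M) (N := M) (r • LinearMap.id) (s • LinearMap.id)) :
    Homotopic (M := T) (N := T) (r • LinearMap.id) (s • LinearMap.id) := by
  obtain ⟨k, hk, hk'⟩ := h
  obtain ⟨K, hK, hK'⟩ := hθ.exists_map hM hN hT hk
  refine ⟨K, hK, fun t => ?_⟩
  have : r • LinearMap.id - s • LinearMap.id = T.d ∘ₗ K + K ∘ₗ T.d := by
    refine hθ.linearMap_ext hM hN fun k₁ k₂ a b c f₁ f₂ m hm p hp => ?_
    have e := hk' m
    simp only [LinearMap.smul_apply, LinearMap.id_apply] at e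
    simp only [LinearMap.sub_apply, LinearMap.add_apply, LinearMap.comp_apply, LinearMap.smul_apply,
      LinearMap.id_apply]
    -- The homotopy raises the homological degree by one. The two terms with the differential on `p`
    -- thus have opposite signs and cancel.
    rw [hK', hθ.d hm hp, hθ.d (hk.map_mem hm) hp, map_add, map_zsmul, hK', hK', Int.negOnePow_succ,
      Units.val_neg, neg_smul]
    have e₂ : r • θ m p - s • θ m p = θ (r • m - s • m) p := by simp
    rw [e₂, e, map_add, LinearMap.add_apply]
    abel
  exact LinearMap.congr_fun this t

end IsTensorVia

/-! ### Endomorphisms of invertible complexes -/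

section Invertible
variable {M N : PreComplex.{u} n}

/-- Through `M ⊗ N ≃ H^n` the map `f ⊗ id` becomes an endomorphism of `H^n`, which is a scalar `r`.
So `(f - r) ⊗ id` is null-homotopic, and `TensorPair.homotopic_zero` removes the factor `N`. -/
theorem exists_homotopic_smul (hM : IsComplex M) (hM' : IsInvertibleComplex M)
    {f : M.carrier →ₗ[R] M.carrier} (hf : IsChainMap (M := M) (N := M) f) :
    ∃ r : R, Homotopic (M := M) (N := M) f (r • LinearMap.id) := by
  obtain ⟨N, T, T', hN, ⟨hT, θ, hθ⟩, ⟨hT', θ', hθ'⟩, ⟨φ, hφ, ψ, hψ, -, hφψ⟩,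
    ⟨φ', hφ', ψ', hψ', hψφ', -⟩⟩ := hM'
  have D : TensorPair M N T T' θ θ' φ := ⟨hM, hN, hT, hT', hθ, hθ', hφ⟩
  -- The differential of `H^n` is zero, so homotopic endomorphisms of it are equal.
  have hφψ (x : Arc n) : φ (ψ x) = x := by
    obtain ⟨k, -, hk⟩ := hφψ
    have := (hk x).trans (add_eq_zero_iff_eq_neg.mpr ?_)
    · exact sub_eq_zero.mp this
    · exact (neg_eq_zero.mpr (map_zero k)).symm
  obtain ⟨F, hF, hF'⟩ := hθ'.exists_chainMap hM hN hT' hf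
  obtain ⟨r, hr⟩ := exists_eq_smul_of_isHom (hφ'.comp (hF.comp hψ')).toIsHom
  -- `F ≃ (ψ' φ') F (ψ' φ') = r ψ' φ' ≃ r`.
  have hF₁ : Homotopic (M := T') (N := T') F (r • LinearMap.id) := by
    have h₁ := hψφ'.comp_right (L := T') hF
    have h₂ := (hψφ'.comp_left (P := T') hF).comp_left (P := T') (hψ'.comp hφ')
    have e : (ψ' ∘ₗ φ') ∘ₗ F ∘ₗ (ψ' ∘ₗ φ') = r • (ψ' ∘ₗ φ') := by
      have : (ψ' ∘ₗ φ') ∘ₗ F ∘ₗ (ψ' ∘ₗ φ') = ψ' ∘ₗ (φ' ∘ₗ F ∘ₗ ψ') ∘ₗ φ' := rfl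
      rw [this, hr]
      exact LinearMap.ext fun t => map_smul ψ' r (φ' t)
    rw [e] at h₂
    exact (h₁.symm.trans h₂.symm).trans (hψφ'.smul r)
  obtain ⟨K, hK, hK'⟩ := hF₁
  refine ⟨r, ?_⟩
  have key := D.homotopic_zero hψ hφψ (h := f + (-r) • LinearMap.id)
    (hf.toIsHom.add ((IsChainMap.id M).toIsHom.smul _)) hK (fun m p => by
      rw [← hK', hF']; simp [sub_eq_add_neg])
  obtain ⟨k, hk, hk'⟩ := key
  exact ⟨k, hk, fun m => by rw [← hk']; simp [sub_eq_add_neg]⟩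

/-- The homotopy is carried over to `M ⊗ N ≃ H^n`, where homotopic scalars are equal and `r` is
recovered from `r • 1`. -/
theorem eq_of_homotopic_smul (hM : IsComplex M) (hM' : IsInvertibleComplex M) {r s : R}
    (h : Homotopic (M := M) (N := M) (r • LinearMap.id) (s • LinearMap.id)) : r = s := by
  obtain ⟨N, T, T', hN, -, ⟨hT', θ', hθ'⟩, -, ⟨φ, hφ, ψ, hψ, -, hφψ⟩⟩ := hM'
  obtain ⟨K, hK, hK'⟩ := hθ'.exists_homotopy hM hN hT' h
  have hφψ (x : Arc n) : φ (ψ x) = x := by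
    obtain ⟨k, -, hk⟩ := hφψ
    have := (hk x).trans (add_eq_zero_iff_eq_neg.mpr ?_)
    · exact sub_eq_zero.mp this
    · exact (neg_eq_zero.mpr (map_zero k)).symm
  refine smul_one_injective n ?_
  have e := congrArg φ (hK' (ψ (one n)))
  have e₁ : T'.d (ψ (one n)) = 0 := (hψ.map_d _).symm.trans (map_zero ψ)
  have e₂ (t) : φ (T'.d t) = 0 := hφ.map_d t
  rw [e₁, map_zero, add_zero, e₂] at e
  simp only [LinearMap.smul_apply, LinearMap.id_apply, map_sub, map_smul, hφψ] at e
  exact sub_eq_zero.mp e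

/-- An endomorphism and its homotopy inverse are both homotopic to scalars. The product of these
scalars is homotopic to the identity, hence equal to `1`. -/
theorem isHomotopyIso_iff (hM : IsComplex M) (hM' : IsInvertibleComplex M)
    {f : M.carrier →ₗ[R] M.carrier} (hf : IsChainMap (M := M) (N := M) f) :
    IsHomotopyIso (M := M) (N := M) f ↔
      ∃ r : Rˣ, Homotopic (M := M) (N := M) f ((r : R) • LinearMap.id) := by
  constructor
  · rintro ⟨-, g, hg, hgf, -⟩
    obtain ⟨r, hr⟩ := exists_homotopic_smul hM hM' hf
    obtain ⟨s, hs⟩ := exists_homotopic_smul hM hM' hg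
    have h₁ : Homotopic (M := M) (N := M) (g ∘ₗ f) ((s * r) • LinearMap.id) := by
      have h₂ := hr.comp_left (P := M) hg
      rw [LinearMap.comp_smul, LinearMap.comp_id] at h₂
      have h₃ := hs.smul r
      rw [smul_smul, mul_comm] at h₃
      exact h₂.trans h₃
    have h₂ := eq_of_homotopic_smul hM hM' (r := s * r) (s := 1)
      (h₁.symm.trans (by rwa [one_smul]))
    exact ⟨Units.mkOfMulEqOne r s (by rw [mul_comm, h₂]), hr⟩
  · rintro ⟨r, hr⟩
    refine ⟨hf, ((r⁻¹ : Rˣ) : R) • LinearMap.id, (IsChainMap.id M).smul _, ?_, ?_⟩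
    all_goals
      have := hr.smul ((r⁻¹ : Rˣ) : R)
      rw [smul_smul, Units.inv_mul, one_smul] at this
    · exact this
    · rwa [LinearMap.comp_smul, LinearMap.comp_id]

/-- If `f'` is inverse to `f`, then `f' ∘ g` is an automorphism of `M` and so is homotopic to a unit
`r`. Hence `g ≃ f ∘ f' ∘ g ≃ r f`. -/
theorem exists_homotopic_unit_smul (hM : IsComplex M) (hM' : IsInvertibleComplex M)
    {f g : M.carrier →ₗ[R] N.carrier} (hf : IsHomotopyIso (M := M) (N := N) f)
    (hg : IsHomotopyIso (M := M) (N := N) g) :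
    ∃ r : Rˣ, Homotopic (M := M) (N := N) g ((r : R) • f) := by
  obtain ⟨hf, f', hf', hff, hff'⟩ := hf
  obtain ⟨hg, g', hg', hgg, hgg'⟩ := hg
  have hiso : IsHomotopyIso (M := M) (N := M) (f' ∘ₗ g) := by
    refine ⟨hf'.comp hg, g' ∘ₗ f, hg'.comp hf, ?_, ?_⟩
    · exact ((hff'.comp_right (L := M) hg).comp_left (P := M) hg').trans hgg
    · exact ((hgg'.comp_right (L := M) hf).comp_left (P := M) hf').trans hff
  obtain ⟨r, hr⟩ := (isHomotopyIso_iff hM hM' hiso.1).mp hiso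
  refine ⟨r, (hff'.comp_right (L := M) hg).symm.trans ?_⟩
  have := hr.comp_left (P := N) hf
  rwa [LinearMap.comp_smul, LinearMap.comp_id] at this

end Invertible

end UnifiedArc

theorem mainTheorem6 (n : ℕ) (hn : 1 ≤ n) :
    (∃ Φ : R ≃ₗ[R] center n,
      (∀ r : R, (Φ r : Arc n) = r • one n) ∧
      (∀ r s : R, mul (Φ r : Arc n) (Φ s : Arc n) = (Φ (r * s) : Arc n)) ∧
      (∀ z : Arc n, z ∈ centerUnits n ↔ ∃ r : Rˣ, z = (Φ (r : R) : Arc n))) ∧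
    (∀ M : PreComplex.{u} n, IsComplex M → IsInvertibleComplex M →
      ∀ f : M.carrier →ₗ[R] M.carrier, IsChainMap f →
        (IsHomotopyIso f ↔ ∃ r : Rˣ, Homotopic f ((r : R) • LinearMap.id))) ∧
    (∀ M N : PreComplex.{u} n, IsComplex M → IsComplex N →
      IsInvertibleComplex M → IsInvertibleComplex N →
      ∀ f g : M.carrier →ₗ[R] N.carrier, IsHomotopyIso f → IsHomotopyIso g →
        ∃ r : Rˣ, Homotopic g ((r : R) • f)) :=
  ⟨⟨centerEquiv n, centerEquiv_apply n, mul_smul_one n, fun _ => mem_centerUnits_iff⟩,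
    fun _ hM hM' _ hf => isHomotopyIso_iff hM hM' hf,
    fun _ _ hM _ hM' _ _ _ hf hg => exists_homotopic_unit_smul hM hM' hf hg⟩
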